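/- Let $D>0$ be a non-square discriminant ($D\equiv 0,1 \bmod 4$), $K=\mathbb{Q}(\sqrt D)\subset\mathbb{R}$ with Galois conjugation $\sigma$, $\mathcal{O}_D=\mathbb{Z}\oplus\mathbb{Z}\tfrac{D+\sqrt D}{2}$, and let $d\ge 1$ be an integer relatively prime to the conductor $[\mathcal{O}_K:\mathcal{O}_D]$. Let $X_{D,d}^{(3)}$ be the set of isomorphism classes of quadruples $(A,H,S,\rho)$, where $(A,H)$ is a principally polarized complex abelian threefold, $S\subset A$ is a two-dimensional abelian subvariety on which $H$ induces a polarization of type $(1,d)$, and $\rho:\mathcal{O}_D\hookrightarrow \mathrm{End}(S)$ is real multiplication, i.e. an injective ring homomorphism, self-adjoint with respect to $H|_S$, that does not extend to a larger order of $K$. Isomorphisms are isomorphisms of polarized abelian varieties which map subvariety onto subvariety and commute with the actions of $\mathcal{O}_D$. The set $X_{D,d}^{(3)}$ carries the natural complex analytic structure: the finest topology for which the classifying maps of holomorphic families are continuous, the holomorphic functions being those whose pull-backs to all holomorphic families are holomorphic. For an ideal $\mathfrak a\subseteq\mathcal{O}_D$ let $X_{\mathfrak a}^{(3)}$ be the locus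 of the classes for which $(S,H|_S,\rho)$ is isomorphic, for some $(z_1,z_2)\in\mathbb{H}^2$, to the surface $\mathbb{C}^2/\{(x+yz_1,x^\sigma+y^\sigma z_2): x\in\mathcal{O}_D,\ y\in\tfrac1{\sqrt D}\mathfrak a\}$ with the polarization induced by $\langle (x,y),(\tilde x,\tilde y)\rangle=\mathrm{tr}(\tilde x y-x\tilde y)$ and with $k\in\mathcal{O}_D$ acting by $\mathrm{diag}(k,k^\sigma)$. We say that $d$ satisfies the prime factor condition if no prime divisor of $d$ is inert in $K$ and every prime divisor of $d$ ramified in $K$ divides $d$ exactly once. Then $X_{D,d}^{(3)}$ is non-empty if and only if $d$ satisfies the prime factor condition. In this case $X_{D,d}^{(3)}$ is the disjoint union of its irreducible components; there are exactly $2^s$ of them, where $s$ is the number of prime divisors of $d$ that split in $K$, and $\mathfrak a\mapsto X_{\mathfrak a}^{(3)}$ is a bijection from the primitive ideals of $\mathcal{O}_D$ of norm $d$ onto the set of irreducible components. Moreover, every primitive ideal $\mathfrak a$ of norm $d$ has a smart basis $(\eta_2^\sigma,d\eta_1^\sigma)$, that is, there is a $\mathbb{Z}$-basis $(\eta_1,\eta_2)$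 of $\mathcal{O}_D$ with $\eta_1\eta_2^\sigma-\eta_1^\sigma\eta_2=-\sqrt D$ such that $(\eta_2^\sigma,d\eta_1^\sigma)$ is a $\mathbb{Z}$-basis of $\mathfrak a$. For every smart basis, put \[ M=\begin{pmatrix}\tfrac{d}{\eta_2}\mathcal{O}_D&\tfrac{\sqrt D}{\eta_1^\sigma}\mathcal{O}_D\\ \tfrac{d}{\sqrt D\eta_2}\mathfrak a&\tfrac1{\eta_1^\sigma}\mathfrak a\end{pmatrix},\qquad T=\begin{pmatrix}0&\tfrac{\sqrt D}{d}\tfrac{\eta_2}{\eta_1^\sigma}\\1&0\end{pmatrix}. \] Then \[ \Gamma_{D,d}(\eta_1,\eta_2)=\left\{(A,B)\in \mathrm{SL}\begin{pmatrix}\mathcal{O}_D&(\tfrac1{\sqrt D}\mathfrak a)^{-1}\\ \tfrac1{\sqrt D}\mathfrak a&\mathcal{O}_D\end{pmatrix}\times\mathrm{SL}_2(\mathbb{Z}) : A-TBT^{-1}\in M\right\} \] is a group. It acts on $\mathbb{H}^3$ by $(A,B).(z_1,z_2,z_3)=(Az_1,A^\sigma z_2,Bz_3)$. For $z\in\mathbb{H}^3$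 let \[ \Pi_z=\begin{pmatrix}\eta_1&\eta_2&0&\tfrac1{\sqrt D}\eta_2^\sigma z_1&\tfrac{-1}{\sqrt D}\eta_1^\sigma z_1&\tfrac1d\eta_2\\ \eta_1^\sigma&\eta_2^\sigma&0&\tfrac{-1}{\sqrt D}\eta_2z_2&\tfrac1{\sqrt D}\eta_1z_2&\tfrac1d\eta_2^\sigma\\0&0&1&0&\tfrac1d&-\tfrac1dz_3\end{pmatrix}, \] $A_z=\mathbb{C}^3/\Pi_z\mathbb{Z}^6$, let $H_z$ be the polarization for which the columns of $\Pi_z$ form a symplectic basis, $S_z$ the subvariety with tangent space $\mathbb{C}^2\times\{0\}$, and $\rho_z(k)(c_1,c_2,0)=(kc_1,k^\sigma c_2,0)$. Then $(A_z,H_z,S_z,\rho_z)$ is a quadruple as above, and $[z]\mapsto[(A_z,H_z,S_z,\rho_z)]$ is a well-defined isomorphism of complex analytic spaces \[ \Gamma_{D,d}(\eta_1,\eta_2)\backslash\mathbb{H}^3\;\cong\; X_{\mathfrak a}^{(3)}. \] -/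

import Mathlib

open scoped Pointwise MatrixGroups

noncomputable section

namespace RMModuli

/-! ### The real quadratic field `K = ℚ(√D)` and the order of discriminant `D` -/

/-- The algebra `ℚ(√D) = ℚ ⊕ ℚ √D`; its element `⟨a, b⟩` is `a + b √D`. It is a field as soon as
`D` is not a square, and `star` is the Galois conjugation `x ↦ x^σ`. -/
abbrev K (D : ℕ) : Type := QuadraticAlgebra ℚ (D : ℚ) 0

instance factNonsquare (D : ℕ) [h : Fact (¬ IsSquare D)] :
    Fact (∀ r : ℚ, r ^ 2 ≠ (D : ℚ) + 0 * r) := by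
  refine ⟨fun r hr => h.out ?_⟩
  have h1 : IsSquare ((D : ℕ) : ℚ) := ⟨r, by rw [← sq, hr]; ring⟩
  exact Rat.isSquare_natCast_iff.mp h1

/-- The element `√D` of `K`. -/
def sqrtD (D : ℕ) : K D := ⟨0, 1⟩

/-- The real embedding of `K` with `√D ↦ +√D`. -/
def toReal (D : ℕ) : K D →+* ℝ :=
  (QuadraticAlgebra.lift (R := ℚ) (a := (D : ℚ)) (b := 0) (A := ℝ)
    ⟨Real.sqrt D, by
      rw [Real.mul_self_sqrt (Nat.cast_nonneg D)]
      simp [Algebra.smul_def]⟩ : K D →ₐ[ℚ] ℝ).toRingHom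

/-- The real embedding of `K` with `√D ↦ -√D`, that is `x ↦ x^σ` followed by `toReal`. -/
def toRealConj (D : ℕ) : K D →+* ℝ := (toReal D).comp (starRingEnd (K D))

/-- `K ⊂ ℝ ⊂ ℂ`. -/
def toC {D : ℕ} (x : K D) : ℂ := ((toReal D x : ℝ) : ℂ)

/-- `γ_D = (D + √D) / 2`. -/
def gamma (D : ℕ) : K D := ⟨(D : ℚ) / 2, 1 / 2⟩

/-- The quadratic order `𝒪_D = ℤ[γ_D]` of discriminant `D`
(equal to `ℤ ⊕ ℤ γ_D` when `D ≡ 0, 1 mod 4`). -/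
def order (D : ℕ) : Subring (K D) := Subring.closure {gamma D}

/-- `𝒪_D` as a lattice in `K`. -/
def orderLattice (D : ℕ) : Submodule ℤ (K D) :=
  AddSubgroup.toIntSubmodule (order D).toAddSubgroup

/-- An ideal of `𝒪_D` as a lattice in `K`. -/
def idealLattice {D : ℕ} (𝔞 : Ideal (order D)) : Submodule ℤ (K D) :=
  (𝔞.restrictScalars ℤ).map (order D).subtype.toAddMonoidHom.toIntLinearMap

/-- The conductor of `𝒪_D`: its index in the maximal order of `K`. -/
def conductor (D : ℕ) : ℕ :=
  (order D).toAddSubgroup.relIndex (integralClosure ℤ (K D)).toSubring.toAddSubgroup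

/-- A subring of `K` is an order if it is a finitely generated abelian group spanning `K`
over `ℚ`. -/
def IsQuadraticOrder {D : ℕ} (R : Subring (K D)) : Prop :=
  R.toAddSubgroup.FG ∧ Submodule.span ℚ (R : Set (K D)) = ⊤

/-- The norm `[𝒪_D : 𝔞]` of an ideal. -/
def idealNorm {D : ℕ} (𝔞 : Ideal (order D)) : ℕ := Nat.card (order D ⧸ 𝔞)

/-- An ideal is primitive if it is contained in `m 𝒪_D`, `m ∈ ℤ`, only for `m = ±1`. -/
def IsPrimitiveIdeal {D : ℕ} (𝔞 : Ideal (order D)) : Prop :=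
  ∀ m : ℤ, 𝔞 ≤ Ideal.span {(m : order D)} → IsUnit m

/-- The primitive ideals of `𝒪_D` of norm `d`. -/
def primitiveIdeals (D d : ℕ) : Set (Ideal (order D)) :=
  {𝔞 | IsPrimitiveIdeal 𝔞 ∧ idealNorm 𝔞 = d}

section Primes
variable (D : ℕ) [Fact (¬ IsSquare D)]

/-- `p` is inert in `K`: it generates a prime ideal of the maximal order. -/
def IsInert (p : ℕ) : Prop :=
  (Ideal.span {(p : NumberField.RingOfIntegers (K D))}).IsPrime

/-- `p` is ramified in `K`: it generates the square of a prime ideal of the maximal order. -/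
def IsRamified (p : ℕ) : Prop :=
  ∃ P : Ideal (NumberField.RingOfIntegers (K D)), P.IsPrime ∧
    Ideal.span {(p : NumberField.RingOfIntegers (K D))} = P ^ 2

/-- `p` splits in `K`: it generates the product of two distinct prime ideals. -/
def IsSplit (p : ℕ) : Prop :=
  ∃ P Q : Ideal (NumberField.RingOfIntegers (K D)), P.IsPrime ∧ Q.IsPrime ∧ P ≠ Q ∧
    Ideal.span {(p : NumberField.RingOfIntegers (K D))} = P * Q

/-- The prime factor condition: no prime divisor of `d` is inert, and ramified prime divisors
occur with exponent one. -/
def PrimeFactorCondition (d : ℕ) : Prop :=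
  ∀ p : ℕ, p.Prime → p ∣ d → ¬ IsInert D p ∧ (IsRamified D p → d.factorization p = 1)

/-- The number of prime divisors of `d` that split in `K`. -/
def numSplit (d : ℕ) : ℕ := {p : ℕ | p.Prime ∧ p ∣ d ∧ IsSplit D p}.ncard

end Primes

/-! ### Polarized abelian threefolds with real multiplication on a subsurface -/

/-- `ℂ³`. -/
abbrev C3 : Type := Fin 3 → ℂ

/-- Sesquilinear forms on `ℂ³`, linear in the first variable. -/
abbrev SesqForm : Type := C3 →ₗ[ℂ] C3 →ₗ⋆[ℂ] ℂ

/-- `H` is a polarization of the torus `ℂ³ / Λ`: a positive definite Hermitian form whose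
imaginary part is integral on `Λ`. -/
structure IsPolarization (Λ : Submodule ℤ C3) (H : SesqForm) : Prop where
  hermitian : ∀ v w, H w v = (starRingEnd ℂ) (H v w)
  pos : ∀ v, v ≠ 0 → 0 < (H v v).re
  integral : ∀ v ∈ Λ, ∀ w ∈ Λ, ∃ n : ℤ, (H v w).im = n

/-- The alternating form `Im H` has type `(t₁, …, t_g)` on the lattice `Λ`: there is a symplectic
`ℤ`-basis `(λ₁, …, λ_g, μ₁, …, μ_g)` with `E(λᵢ, λⱼ) = E(μᵢ, μⱼ) = 0`, `E(λᵢ, μⱼ) = tᵢ δᵢⱼ`. -/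
def HasType {g : ℕ} (Λ : Submodule ℤ C3) (H : SesqForm) (t : Fin g → ℕ) : Prop :=
  ∃ b : Module.Basis (Fin g ⊕ Fin g) ℤ Λ, ∀ i j : Fin g,
    (H (b (Sum.inl i)) (b (Sum.inl j))).im = 0 ∧
    (H (b (Sum.inr i)) (b (Sum.inr j))).im = 0 ∧
    (H (b (Sum.inl i)) (b (Sum.inr j))).im = if i = j then (t i : ℝ) else 0

/-- The endomorphism ring of the subtorus `V / (V ∩ Λ)` of `ℂ³ / Λ`, an endomorphism being given by
its analytic representation: a `ℂ`-linear map of `V` preserving `V ∩ Λ`. -/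
def endRing (Λ : Submodule ℤ C3) (V : Submodule ℂ C3) : Subring (Module.End ℂ V) where
  carrier := {f | ∀ v : V, (v : C3) ∈ Λ → (f v : C3) ∈ Λ}
  mul_mem' := fun hf hg v hv => hf _ (hg v hv)
  one_mem' := fun _ hv => hv
  add_mem' := fun hf hg v hv => by
    simpa using Λ.add_mem (hf v hv) (hg v hv)
  zero_mem' := fun _ _ => by simp
  neg_mem' := fun hf v hv => by
    simpa using Λ.neg_mem (hf v hv)

/-- A principally polarized abelian threefold `(A, H)`, `A = ℂ³ / Λ`, together with a
two-dimensional abelian subvariety `S = V / (V ∩ Λ)` on which `H` induces a polarization of type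
`(1, d)`, and a choice `ρ` of real multiplication by `𝒪_D` on `(S, H|_S)`. -/
structure RMThreefold (D d : ℕ) where
  /-- the lattice `Λ` -/
  Λ : Submodule ℤ C3
  discrete : DiscreteTopology Λ
  span_Λ : Submodule.span ℝ (Λ : Set C3) = ⊤
  /-- the polarization -/
  H : SesqForm
  isPolarization : IsPolarization Λ H
  principal : HasType Λ H (fun _ : Fin 3 => 1)
  /-- the tangent space `V` of the subvariety `S` -/
  V : Submodule ℂ C3
  finrank_V : Module.finrank ℂ V = 2
  span_V : Submodule.span ℝ ((Λ : Set C3) ∩ V) = V.restrictScalars ℝ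
  type_S : HasType (Λ ⊓ V.restrictScalars ℤ) H ![1, d]
  /-- the real multiplication on `S` -/
  ρ : order D →+* endRing Λ V
  injective_ρ : Function.Injective ρ
  selfAdjoint : ∀ (k : order D) (v w : V),
    H ((ρ k : Module.End ℂ V) v) w = H v ((ρ k : Module.End ℂ V) w)
  /-- `ρ` does not extend to a larger order of `K`. -/
  proper : ∀ (R : Subring (K D)) (hR : order D < R), IsQuadraticOrder R →
    ¬ ∃ ρ' : R →+* endRing Λ V, Function.Injective ρ' ∧
      ∀ k : order D, ρ' (Subring.inclusion hR.le k) = ρ k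

namespace RMThreefold
variable {D d : ℕ}

/-- The action of `k ∈ 𝒪_D` on the tangent space of `S`. -/
def act (P : RMThreefold D d) (k : order D) (v : P.V) : C3 := ((P.ρ k : Module.End ℂ P.V) v : P.V)

/-- An isomorphism `(A, H, S, ρ) ≅ (A', H', S', ρ')`: an isomorphism of polarized abelian varieties
mapping `S` onto `S'` and commuting with the actions of `𝒪_D` on `S` and `S'`. -/
def IsIsom (P Q : RMThreefold D d) (F : C3 ≃ₗ[ℂ] C3) : Prop :=
  (∀ v, F v ∈ Q.Λ ↔ v ∈ P.Λ) ∧ (∀ v w, Q.H (F v) (F w) = P.H v w) ∧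
  (∀ v, F v ∈ Q.V ↔ v ∈ P.V) ∧
  ∀ (k : order D) (v : P.V) (w : Q.V), F v = w → F (P.act k v) = Q.act k w

instance setoid (D d : ℕ) : Setoid (RMThreefold D d) where
  r P Q := ∃ F : C3 ≃ₗ[ℂ] C3, IsIsom P Q F
  iseqv :=
    { refl := fun P => ⟨LinearEquiv.refl ℂ C3, fun _ => Iff.rfl, fun _ _ => rfl, fun _ => Iff.rfl,
        fun k v w h => by
          have h' : v = w := Subtype.ext h
          subst h'; rfl⟩
      symm := by
        rintro P Q ⟨F, h1, h2, h3, h4⟩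
        refine ⟨F.symm, fun v => ?_, fun v w => ?_, fun v => ?_, fun k v w h => ?_⟩
        · rw [← h1, F.apply_symm_apply]
        · rw [← h2, F.apply_symm_apply, F.apply_symm_apply]
        · rw [← h3, F.apply_symm_apply]
        · rw [LinearEquiv.symm_apply_eq] at h ⊢
          exact (h4 k w v h.symm).symm
      trans := by
        rintro P Q R ⟨F, h1, h2, h3, h4⟩ ⟨G, g1, g2, g3, g4⟩
        refine ⟨F.trans G, fun v => ?_, fun v w => ?_, fun v => ?_, fun k v w h => ?_⟩
        · rw [LinearEquiv.trans_apply, g1, h1]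
        · rw [LinearEquiv.trans_apply, LinearEquiv.trans_apply, g2, h2]
        · rw [LinearEquiv.trans_apply, g3, h3]
        · have hv : F v ∈ Q.V := (h3 v).2 v.2
          rw [LinearEquiv.trans_apply, h4 k v ⟨F v, hv⟩ rfl]
          exact g4 k ⟨F v, hv⟩ w h }

/-- The symplectic form on `𝒪_D ⊕ (1/√D) 𝔞` (a lattice in `K²`) given by the trace pairing
`⟨(x, y), (x', y')⟩ = tr (x' y - x y')`, `tr z = z + z^σ`. -/
def tracePairing (p q : K D × K D) : ℝ :=
  toReal D ((q.1 * p.2 - p.1 * q.2) + star (q.1 * p.2 - p.1 * q.2))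

/-- `φ_z (x, y) = (x + y z₁, x^σ + y^σ z₂)`. -/
def phi (z₁ z₂ : UpperHalfPlane) (p : K D × K D) : Fin 2 → ℂ :=
  ![toC p.1 + toC p.2 * (z₁ : ℂ), toC (star p.1) + toC (star p.2) * (z₂ : ℂ)]

/-- The lattice `𝒪_D ⊕ (1/√D) 𝔞`, where `(1/√D) 𝔞 = {y ∈ K : √D y ∈ 𝔞}`. -/
def pairLattice (𝔞 : Ideal (order D)) : Set (K D × K D) :=
  {p | p.1 ∈ orderLattice D ∧ sqrtD D * p.2 ∈ idealLattice 𝔞}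

/-- `(A, H, S, ρ)` is of type `𝔞`: for some `(z₁, z₂) ∈ ℍ²` the polarized abelian surface with real
multiplication `(S, H|_S, ρ)` is isomorphic to the surface `ℂ² / φ_z (𝒪_D ⊕ (1/√D) 𝔞)`, with the
polarization induced by the trace pairing and with `k ∈ 𝒪_D` acting by `diag (k, k^σ)`. -/
def IsOfType (P : RMThreefold D d) (𝔞 : Ideal (order D)) : Prop :=
  ∃ (z₁ z₂ : UpperHalfPlane) (F : P.V ≃ₗ[ℂ] (Fin 2 → ℂ)),
    (∀ v : P.V, (v : C3) ∈ P.Λ ↔ F v ∈ phi z₁ z₂ '' pairLattice 𝔞) ∧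
    (∀ p ∈ pairLattice 𝔞, ∀ q ∈ pairLattice 𝔞, ∀ v w : P.V, F v = phi z₁ z₂ p →
      F w = phi z₁ z₂ q → (P.H v w).im = tracePairing p q) ∧
    ∀ (k : order D) (v : P.V), F ((P.ρ k : Module.End ℂ P.V) v) =
      ![toC (k : K D) * F v 0, toC (star (k : K D)) * F v 1]

end RMThreefold

/-! ### The moduli space and its complex analytic structure -/

/-- The moduli space `X_{D,d}^{(3)}`: the set of isomorphism classes `[(A, H, S, ρ)]`. -/
def ModuliSpace (D d : ℕ) : Type := Quotient (RMThreefold.setoid D d)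

/-- The class `[(A, H, S, ρ)]`. -/
def cls {D d : ℕ} (P : RMThreefold D d) : ModuliSpace D d := Quotient.mk _ P

/-- The locus `X_𝔞^{(3)}` of the classes of type `𝔞`. -/
def component {D : ℕ} (d : ℕ) (𝔞 : Ideal (order D)) : Set (ModuliSpace D d) :=
  {x | ∃ P : RMThreefold D d, cls P = x ∧ P.IsOfType 𝔞}

/-- `t ↦ P t` is a holomorphic family over `T ⊆ ℂⁿ` with trivialized homology: the lattices have a
basis `b₁(t), …, b₆(t)` depending holomorphically on `t`, and in terms of this basis the polarization
form, the sublattice belonging to `S` and the action of `𝒪_D` on this sublattice are constant. (Every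
holomorphic family is locally of this kind.) -/
def IsHolFamily {D d n : ℕ} (T : Set (Fin n → ℂ)) (P : (Fin n → ℂ) → RMThreefold D d) : Prop :=
  ∃ b : Fin 6 → (Fin n → ℂ) → C3,
    (∀ i, DifferentiableOn ℂ (b i) T) ∧
    (∀ t ∈ T, LinearIndependent ℤ (fun i => b i t) ∧
      Submodule.span ℤ (Set.range fun i => b i t) = (P t).Λ) ∧
    ∀ s ∈ T, ∀ t ∈ T,
      (∀ i j, ((P s).H (b i s) (b j s)).im = ((P t).H (b i t) (b j t)).im) ∧
      (∀ c : Fin 6 → ℤ, (∑ i, c i • b i s) ∈ (P s).V ↔ (∑ i, c i • b i t) ∈ (P t).V) ∧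
      ∀ (c c' : Fin 6 → ℤ) (hs : (∑ i, c i • b i s) ∈ (P s).V)
        (ht : (∑ i, c i • b i t) ∈ (P t).V) (k : order D),
        (P s).act k ⟨_, hs⟩ = ∑ i, c' i • b i s ↔ (P t).act k ⟨_, ht⟩ = ∑ i, c' i • b i t

/-- The topology of the moduli space: the finest one for which the classifying maps of all
holomorphic families over open subsets of all `ℂⁿ` are continuous. -/
instance (D d : ℕ) : TopologicalSpace (ModuliSpace D d) where
  IsOpen U := ∀ (n : ℕ) (T : Set (Fin n → ℂ)) (P : (Fin n → ℂ) → RMThreefold D d),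
    IsOpen T → IsHolFamily T P → IsOpen {t | t ∈ T ∧ cls (P t) ∈ U}
  isOpen_univ := fun n T P hT _ => by simpa using hT
  isOpen_inter := fun U V hU hV n T P hT hP => by
    have h := (hU n T P hT hP).inter (hV n T P hT hP)
    convert h using 1
    ext t
    simp only [Set.mem_ofPred_eq, Set.mem_inter_iff]
    tauto
  isOpen_sUnion := fun 𝒰 h𝒰 n T P hT hP => by
    have h : {t | t ∈ T ∧ cls (P t) ∈ ⋃₀ 𝒰} = ⋃ U ∈ 𝒰, {t | t ∈ T ∧ cls (P t) ∈ U} := by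
      ext t
      simp only [Set.mem_ofPred_eq, Set.mem_sUnion, Set.mem_iUnion, exists_prop]
      tauto
    rw [h]
    exact isOpen_biUnion fun U hU => h𝒰 U hU n T P hT hP

/-- Holomorphic functions on an open subset `U` of the moduli space: those whose pull-back under the
classifying map of every holomorphic family is holomorphic. -/
def HolOn {D d : ℕ} (f : ModuliSpace D d → ℂ) (U : Set (ModuliSpace D d)) : Prop :=
  ∀ (n : ℕ) (T : Set (Fin n → ℂ)) (P : (Fin n → ℂ) → RMThreefold D d),
    IsOpen T → IsHolFamily T P →
      DifferentiableOn ℂ (fun t => f (cls (P t))) {t | t ∈ T ∧ cls (P t) ∈ U}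

/-- Analytic subsets of the moduli space: locally the common zero locus of finitely many holomorphic
functions. -/
def IsAnalyticSubset {D d : ℕ} (Z : Set (ModuliSpace D d)) : Prop :=
  ∀ x, ∃ U : Set (ModuliSpace D d), IsOpen U ∧ x ∈ U ∧
    ∃ (m : ℕ) (f : Fin m → ModuliSpace D d → ℂ), (∀ i, HolOn (f i) U) ∧
      ∀ y ∈ U, y ∈ Z ↔ ∀ i, f i y = 0

/-- A nonempty analytic subset is irreducible if it is not the union of two proper analytic
subsets. -/
def IsIrreducibleAnalytic {D d : ℕ} (Z : Set (ModuliSpace D d)) : Prop :=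
  IsAnalyticSubset Z ∧ Z.Nonempty ∧
    ∀ Z₁ Z₂ : Set (ModuliSpace D d), IsAnalyticSubset Z₁ → IsAnalyticSubset Z₂ →
      Z = Z₁ ∪ Z₂ → Z = Z₁ ∨ Z = Z₂

/-- The irreducible components of the moduli space: the maximal irreducible analytic subsets. -/
def irreducibleComponents (D d : ℕ) : Set (Set (ModuliSpace D d)) :=
  {Z | Maximal IsIrreducibleAnalytic Z}

/-! ### The Hilbert modular varieties `Γ \ ℍ³` -/

/-- `ℍ³`. -/
abbrev H3 : Type := UpperHalfPlane × UpperHalfPlane × UpperHalfPlane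

section Group
variable (D : ℕ) [Fact (¬ IsSquare D)]

/-- The group `SL₂(K) × SL₂(ℤ)`. -/
abbrev BigGroup : Type := SL(2, K D) × SL(2, ℤ)

/-- The action `(A, B) (z₁, z₂, z₃) = (A z₁, A^σ z₂, B z₃)` by Möbius transformations. -/
instance : MulAction (BigGroup D) H3 where
  smul g z := (Matrix.SpecialLinearGroup.map (toReal D) g.1 • z.1,
    Matrix.SpecialLinearGroup.map (toRealConj D) g.1 • z.2.1, g.2 • z.2.2)
  one_smul z := by
    change ((_, _, _) : H3) = z
    simp
  mul_smul g h z := by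
    change ((_, _, _) : H3) = (_, _, _)
    simp only [Prod.fst_mul, Prod.snd_mul, map_mul, mul_smul]
    rfl

variable {D}

/-- `(x, y)` is a `ℤ`-basis of the lattice `L ⊂ K`. -/
def IsZBasis (x y : K D) (L : Submodule ℤ (K D)) : Prop :=
  LinearIndependent ℤ ![x, y] ∧ Submodule.span ℤ {x, y} = L

/-- `(η₂^σ, d η₁^σ)` is a smart basis for `𝔞`: `(η₁, η₂)` is a `ℤ`-basis of `𝒪_D` with
`η₁ η₂^σ - η₁^σ η₂ = -√D`, and `(η₂^σ, d η₁^σ)` is a `ℤ`-basis of `𝔞`. -/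
def IsSmartBasis (d : ℕ) (𝔞 : Ideal (order D)) (η₁ η₂ : K D) : Prop :=
  IsZBasis η₁ η₂ (orderLattice D) ∧ η₁ * star η₂ - star η₁ * η₂ = - sqrtD D ∧
    IsZBasis (star η₂) ((d : K D) * star η₁) (idealLattice 𝔞)

/-- `SL₂(𝒪_D ⊕ (1/√D) 𝔞)`, the matrices of determinant one with entries in
`(𝒪_D, ((1/√D) 𝔞)⁻¹; (1/√D) 𝔞, 𝒪_D)`, where `I⁻¹ = {x ∈ K : x I ⊆ 𝒪_D}`. -/
def slLattice (𝔞 : Ideal (order D)) : Set SL(2, K D) :=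
  {A | A 0 0 ∈ orderLattice D ∧
    (∀ y ∈ (sqrtD D)⁻¹ • idealLattice 𝔞, A 0 1 * y ∈ orderLattice D) ∧
    A 1 0 ∈ (sqrtD D)⁻¹ • idealLattice 𝔞 ∧ A 1 1 ∈ orderLattice D}

/-- The matrix `S = (0, (√D / d) (η₂ / η₁^σ); 1, 0)`. -/
def matS (d : ℕ) (η₁ η₂ : K D) : Matrix (Fin 2) (Fin 2) (K D) :=
  !![0, sqrtD D / d * (η₂ / star η₁); 1, 0]

/-- The lattice of matrices `M_{D,d}(η₁, η₂)`, with entries in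
`((d/η₂) 𝒪_D, (√D/η₁^σ) 𝒪_D; (d/(√D η₂)) 𝔞, (1/η₁^σ) 𝔞)`. -/
def matM (d : ℕ) (𝔞 : Ideal (order D)) (η₁ η₂ : K D) : Set (Matrix (Fin 2) (Fin 2) (K D)) :=
  {M | M 0 0 ∈ ((d : K D) / η₂) • orderLattice D ∧
    M 0 1 ∈ (sqrtD D / star η₁) • orderLattice D ∧
    M 1 0 ∈ ((d : K D) / (sqrtD D * η₂)) • idealLattice 𝔞 ∧
    M 1 1 ∈ (1 / star η₁) • idealLattice 𝔞}

/-- The set `Γ_{D,d}(η₁, η₂)` of the `(A, B) ∈ SL₂(𝒪_D ⊕ (1/√D) 𝔞) × SL₂(ℤ)` with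
`A - S B S⁻¹ ∈ M_{D,d}(η₁, η₂)`. -/
def gammaSet (d : ℕ) (𝔞 : Ideal (order D)) (η₁ η₂ : K D) : Set (BigGroup D) :=
  {g | g.1 ∈ slLattice 𝔞 ∧
    (g.1 : Matrix (Fin 2) (Fin 2) (K D)) -
      matS d η₁ η₂ * (g.2 : Matrix (Fin 2) (Fin 2) ℤ).map (Int.cast : ℤ → K D) *
        (matS d η₁ η₂)⁻¹ ∈ matM d 𝔞 η₁ η₂}

/-- The quotient `Γ \ ℍ³`, with the quotient topology. -/
abbrev HilbertVariety (Γ : Subgroup (BigGroup D)) : Type := MulAction.orbitRel.Quotient Γ H3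

/-- The class of `z` in `Γ \ ℍ³`. -/
def orbitCls (Γ : Subgroup (BigGroup D)) (z : H3) : HilbertVariety Γ := Quotient.mk _ z

/-- The point of `ℍ³` with coordinates `w`, if all of them have positive imaginary part. -/
def toH3 (w : Fin 3 → ℂ) : H3 :=
  (UpperHalfPlane.ofComplex (w 0), UpperHalfPlane.ofComplex (w 1), UpperHalfPlane.ofComplex (w 2))

/-- Holomorphic functions on an open subset `U` of `Γ \ ℍ³`: those whose pull-back to the preimage
of `U` in `ℍ³ ⊂ ℂ³` is holomorphic. -/
def HilbertHolOn (Γ : Subgroup (BigGroup D)) (g : HilbertVariety Γ → ℂ)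
    (U : Set (HilbertVariety Γ)) : Prop :=
  DifferentiableOn ℂ (fun w : Fin 3 → ℂ => g (orbitCls Γ (toH3 w)))
    {w | (∀ i, 0 < (w i).im) ∧ orbitCls Γ (toH3 w) ∈ U}

/-- The period matrix `Π_z`. -/
def periodMatrix (d : ℕ) (η₁ η₂ : K D) (z : H3) : Matrix (Fin 3) (Fin 6) ℂ :=
  !![toC η₁, toC η₂, 0,
      toC (1 / sqrtD D * star η₂) * (z.1 : ℂ), toC (-1 / sqrtD D * star η₁) * (z.1 : ℂ),
      1 / (d : ℂ) * toC η₂;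
    toC (star η₁), toC (star η₂), 0,
      toC (-1 / sqrtD D * η₂) * (z.2.1 : ℂ), toC (1 / sqrtD D * η₁) * (z.2.1 : ℂ),
      1 / (d : ℂ) * toC (star η₂);
    0, 0, 1, 0, 1 / (d : ℂ), - (1 / (d : ℂ)) * (z.2.2 : ℂ)]

/-- `P` is the quadruple `(A_z, H_z, S_z, ρ_z)`: its lattice is `Π_z ℤ⁶`, the columns
`(λ₁, λ₂, λ₃, μ₁, μ₂, μ₃)` of `Π_z` are a symplectic basis for the polarization, the subvariety comes
from `ℂ² × {0}`, and `ρ_z(k) (c₁, c₂, 0) = (k c₁, k^σ c₂, 0)`. -/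
def IsPeriodModel {d : ℕ} (η₁ η₂ : K D) (z : H3) (P : RMThreefold D d) : Prop :=
  let col : Fin 6 → C3 := fun j i => periodMatrix d η₁ η₂ z i j
  let lam : Fin 3 → C3 := fun i => col (Fin.castAdd 3 i)
  let mu : Fin 3 → C3 := fun i => col (Fin.natAdd 3 i)
  P.Λ = Submodule.span ℤ (Set.range col) ∧
  (∀ i j : Fin 3, (P.H (lam i) (lam j)).im = 0 ∧ (P.H (mu i) (mu j)).im = 0 ∧
    (P.H (lam i) (mu j)).im = if i = j then 1 else 0) ∧
  (∀ v : C3, v ∈ P.V ↔ v 2 = 0) ∧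
  ∀ (k : order D) (v : P.V),
    P.act k v = ![toC (k : K D) * (v : C3) 0, toC (star (k : K D)) * (v : C3) 1, 0]

end Group

end RMModuli

end

/-!
The arithmetic of `𝒪_D = ℤ ⊕ ℤ γ`, `γ = (D + √D) / 2`, enters through the primitive ideals of norm
`d`: they are the ideals `ℤ d ⊕ ℤ (γ + n)` with `d ∣ N(γ + n)`, and so correspond to the roots
modulo `d` of the polynomial `n² + D n + (D² - D) / 4` of discriminant `D`. For `d` prime to the
conductor, the number of roots modulo `p` tells whether `p ∣ d` is inert, ramified or split. By the
Chinese remainder theorem and Hensel's lemma there are `2 ^ s` roots under the prime factor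
condition (`ncard_primitiveIdeals_eq`), and none otherwise (`primitiveIdeals_nonempty_iff`).

The heart of the geometric part is the structure of the lattice `L` of the surface `S`, an
`𝒪_D`-module of rank two with a self-adjoint alternating form `E` of type `(1, d)`. Properness of
the real multiplication means that `γ` is not a scalar modulo any prime. This yields a vector `e`
for which `ℤ e + ℤ γ e` is saturated. This sublattice is the kernel of the `𝒪_D`-linear map
`w ↦ E(w, γ e) - D E(w, e) + E(w, e) γ` from `L` to `𝒪_D`, whose image is `ℤ d ⊕ ℤ (γ + n)`
(`IsRMLattice.exists_decomposition`). Splitting this map identifies `L` with `𝒪_D ⊕ (1/√D) 𝔞`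
carrying the trace pairing, for a primitive ideal `𝔞` of norm `d` (`exists_isSurfaceMarking`), and
`𝔞` is unique (`IsSurfaceMarking.ideal_eq`). Hence the loci of type `𝔞` partition the moduli space.

Let `(η₁, η₂)` give a smart basis of `𝔞`. The lattice of `S` is saturated in the unimodular lattice
`Λ` of `A`, so its symplectic basis of type `(1, d)` extends to the glueing of `S` with an elliptic
curve that the period matrix describes (`IsSurfaceMarking.exists_isMarking`). Such a marking
consists of eigenvectors `e`, `f` in the tangent space of `S` and of vectors `u`, `w` in its
orthogonal complement, with `f = (z₁ e₀, z₂ e₁)`, `w = z₃ u`. Its period `z ∈ ℍ³` determines the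
isomorphism class of the threefold (`exists_isIsom_of_period`). Two markings of one threefold differ
by a pair of matrices in `SL₂(K) × SL₂(ℤ)` (`IsMarking.exists_act`), and the lattice is preserved
exactly by the pairs in `Γ` (`IsMarking.mem_gammaSet`, `IsMarking.act_inv`). This shows that `Γ` is
a group, and that `z` and `z'` define isomorphic threefolds if and only if they lie in one orbit
(`equiv_iff_of_period`).

For the analytic structure, a holomorphic family with trivialized homology carries the marking of
one fibre to all the others, so it is induced by a holomorphic map to `ℍ³`
(`IsHolFamily.exists_transport`, `IsHolFamily.exists_period`, `IsHolFamily.exists_lift`).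
Conversely, `z ↦ A_z` is itself a holomorphic family (`isHolFamily_std`). Therefore open sets and
holomorphic functions on the locus of type `𝔞` are those of `Γ \ ℍ³` (`moduliHomeomorph`,
`holOn_iff`). The type is constant in families, so the loci are clopen (`isClopen_component`). They
are irreducible because `ℍ³` is: of two analytic subsets covering `ℍ³` one has an interior point,
and it is all of `ℍ³` by the identity theorem (`IsLocallyZeroLocus.subset`).
-/

open scoped Pointwise MatrixGroups

noncomputable section

namespace RMModuli

/-! ### Arithmetic of the order of discriminant `D` -/

/-- The norm `(D² - D) / 4` of `γ_D`. -/
def gammaNorm (D : ℕ) : ℤ := ((D : ℤ) ^ 2 - D) / 4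

/-- The norm `n² + D n + (D² - D) / 4` of `γ_D + n`. Its roots modulo `d` parametrize the primitive
ideals of norm `d`. -/
def normPoly (D : ℕ) (n : ℤ) : ℤ := n ^ 2 + D * n + gammaNorm D

lemma four_mul_gammaNorm {D : ℕ} (hD : D % 4 = 0 ∨ D % 4 = 1) :
    4 * gammaNorm D = (D : ℤ) ^ 2 - D := by
  unfold gammaNorm
  have : (4 : ℤ) ∣ (D : ℤ) ^ 2 - D := by
    have h : (D : ℤ) % 4 = 0 ∨ (D : ℤ) % 4 = 1 := by omega
    have h2 : ((D : ℤ) ^ 2 - D) % 4 = 0 := by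
      rcases h with h | h <;> simp [Int.sub_emod, pow_two, Int.mul_emod, h]
    exact Int.dvd_of_emod_eq_zero h2
  omega

lemma gammaNorm_cast {D : ℕ} (hD : D % 4 = 0 ∨ D % 4 = 1) :
    (gammaNorm D : ℚ) = ((D : ℚ) ^ 2 - D) / 4 := by
  have := four_mul_gammaNorm hD
  have h : (4 : ℚ) * (gammaNorm D : ℚ) = (D : ℚ) ^ 2 - D := by exact_mod_cast this
  linarith

open QuadraticAlgebra in
lemma gamma_mul_gamma {D : ℕ} (hD : D % 4 = 0 ∨ D % 4 = 1) :
    gamma D * gamma D = (D : K D) * gamma D - (gammaNorm D : K D) := by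
  ext <;> simp [gamma, gammaNorm_cast hD] <;> ring

open QuadraticAlgebra in
lemma star_gamma (D : ℕ) : star (gamma D) = (D : K D) - gamma D := by
  ext <;> simp [gamma]
  ring

open QuadraticAlgebra in
lemma sqrtD_eq (D : ℕ) : sqrtD D = 2 * gamma D - D := by
  ext <;> simp [gamma, sqrtD]
  ring

open QuadraticAlgebra in
lemma star_sqrtD (D : ℕ) : star (sqrtD D) = - sqrtD D := by
  ext <;> simp [sqrtD]

open QuadraticAlgebra in
lemma sqrtD_mul_sqrtD (D : ℕ) : sqrtD D * sqrtD D = D := by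
  ext <;> simp [sqrtD]

open QuadraticAlgebra in
lemma star_intCast (D : ℕ) (n : ℤ) : star (n : K D) = n := by
  ext <;> simp

open QuadraticAlgebra in
lemma star_natCast' (D : ℕ) (n : ℕ) : star (n : K D) = n := by
  ext <;> simp

open QuadraticAlgebra in
lemma order_coords_inj {D : ℕ} {a b a' b' : ℤ}
    (h : (a : K D) + b * gamma D = a' + b' * gamma D) : a = a' ∧ b = b' := by
  have h1 := congrArg QuadraticAlgebra.im h
  have h2 := congrArg QuadraticAlgebra.re h
  simp [gamma] at h1 h2
  subst h1
  exact ⟨by exact_mod_cast add_right_cancel h2, rfl⟩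

lemma mem_order_iff {D : ℕ} (hD : D % 4 = 0 ∨ D % 4 = 1) {x : K D} :
    x ∈ order D ↔ ∃ a b : ℤ, x = a + b * gamma D := by
  constructor
  · intro hx
    induction hx using Subring.closure_induction with
    | mem y hy =>
      rw [Set.mem_singleton_iff] at hy
      exact ⟨0, 1, by simp [hy]⟩
    | zero => exact ⟨0, 0, by simp⟩
    | one => exact ⟨1, 0, by simp⟩
    | add y z _ _ hy hz =>
      obtain ⟨a, b, rfl⟩ := hy
      obtain ⟨a', b', rfl⟩ := hz
      exact ⟨a + a', b + b', by push_cast; ring⟩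
    | neg y _ hy =>
      obtain ⟨a, b, rfl⟩ := hy
      exact ⟨-a, -b, by push_cast; ring⟩
    | mul y z _ _ hy hz =>
      obtain ⟨a, b, rfl⟩ := hy
      obtain ⟨a', b', rfl⟩ := hz
      refine ⟨a * a' - b * b' * gammaNorm D, a * b' + b * a' + b * b' * D, ?_⟩
      push_cast
      linear_combination (b * b' : K D) * gamma_mul_gamma hD
  · rintro ⟨a, b, rfl⟩
    exact add_mem (intCast_mem _ a) (mul_mem (intCast_mem _ b) (Subring.subset_closure rfl))

lemma gamma_mem_order (D : ℕ) : gamma D ∈ order D := Subring.subset_closure rfl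

lemma sqrtD_mem_order (D : ℕ) : sqrtD D ∈ order D := by
  rw [sqrtD_eq]
  exact sub_mem (mul_mem (ofNat_mem _ 2) (gamma_mem_order D)) (natCast_mem _ D)

lemma mem_orderLattice {D : ℕ} {x : K D} : x ∈ orderLattice D ↔ x ∈ order D := Iff.rfl

lemma mem_idealLattice {D : ℕ} {𝔞 : Ideal (order D)} {x : K D} :
    x ∈ idealLattice 𝔞 ↔ ∃ y ∈ 𝔞, (y : K D) = x := Iff.rfl

lemma idealLattice_injective (D : ℕ) :
    Function.Injective (idealLattice : Ideal (order D) → Submodule ℤ (K D)) := by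
  have key : ∀ 𝔞 𝔟 : Ideal (order D), idealLattice 𝔞 = idealLattice 𝔟 → 𝔞 ≤ 𝔟 := by
    intro 𝔞 𝔟 h x hx
    have : (x : K D) ∈ idealLattice 𝔟 := h ▸ mem_idealLattice.2 ⟨x, hx, rfl⟩
    obtain ⟨y, hy, hyx⟩ := mem_idealLattice.1 this
    rwa [← Subtype.ext hyx]
  exact fun 𝔞 𝔟 h => le_antisymm (key _ _ h) (key _ _ h.symm)

lemma mul_mem_idealLattice {D : ℕ} {𝔞 : Ideal (order D)} {k x : K D} (hk : k ∈ order D)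
    (hx : x ∈ idealLattice 𝔞) : k * x ∈ idealLattice 𝔞 := by
  obtain ⟨y, hy, rfl⟩ := mem_idealLattice.1 hx
  exact mem_idealLattice.2 ⟨⟨k, hk⟩ * y, 𝔞.mul_mem_left _ hy, rfl⟩

/-! ### The real embeddings -/

lemma toReal_apply {D : ℕ} (x : K D) : toReal D x = x.re + x.im * Real.sqrt D := by
  simp [toReal, QuadraticAlgebra.lift, Algebra.smul_def]

lemma toReal_star {D : ℕ} (x : K D) : toReal D (star x) = x.re - x.im * Real.sqrt D := by
  rw [toReal_apply]; simp; ring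

lemma toReal_sqrtD (D : ℕ) : toReal D (sqrtD D) = Real.sqrt D := by
  simp [toReal_apply, sqrtD]

lemma D_pos {D : ℕ} [hns : Fact (¬ IsSquare D)] : 0 < D := by
  rcases Nat.eq_zero_or_pos D with h | h
  · exact absurd (h ▸ ⟨0, rfl⟩ : IsSquare D) hns.out
  · exact h

lemma sqrt_D_pos {D : ℕ} [Fact (¬ IsSquare D)] : 0 < Real.sqrt D :=
  Real.sqrt_pos.2 (by exact_mod_cast D_pos)

lemma sqrtD_ne_zero {D : ℕ} : sqrtD D ≠ 0 := by
  intro h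
  have := congrArg QuadraticAlgebra.im h
  simp [sqrtD] at this

lemma intCast_injective_K {D : ℕ} : Function.Injective (Int.cast : ℤ → K D) := by
  intro a b h
  have := congrArg QuadraticAlgebra.re h
  simpa using this

lemma natCast_ne_zero_K {D d : ℕ} (hd : 0 < d) : (d : K D) ≠ 0 := by
  have := intCast_injective_K (D := D).ne (show (d : ℤ) ≠ 0 by exact_mod_cast hd.ne')
  simpa using this

/-- A nonzero element of the order has nonzero norm. -/
lemma norm_form_eq_zero {D : ℕ} [Fact (¬ IsSquare D)] (hD : D % 4 = 0 ∨ D % 4 = 1) {a b : ℤ}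
    (h : a ^ 2 + D * (a * b) + gammaNorm D * b ^ 2 = 0) : a = 0 ∧ b = 0 := by
  have h1 : ((a : K D) + b * gamma D) * star ((a : K D) + b * gamma D) = 0 := by
    rw [star_add, star_mul, star_gamma, star_intCast, star_intCast]
    have : ((a ^ 2 + D * (a * b) + gammaNorm D * b ^ 2 : ℤ) : K D) = 0 := by rw [h]; simp
    push_cast at this
    linear_combination this - (b : K D) ^ 2 * gamma_mul_gamma hD
  have h2 : (a : K D) + b * gamma D = ((0 : ℤ) : K D) + (0 : ℤ) * gamma D := by
    rcases mul_eq_zero.1 h1 with h | h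
    · simpa using h
    · simpa using star_eq_zero.1 h
  exact order_coords_inj h2

/-! ### Ideals in normal form -/

/-- Normal form of a subgroup of `𝒪_D = ℤ ⊕ ℤ γ`, written in coordinates, that is stable under
multiplication by `γ`: it is `c (ℤ m ⊕ ℤ (γ + n))` with `m` dividing the norm of `γ + n`. -/
lemma exists_normal_form (D N : ℤ) (I : AddSubgroup (ℤ × ℤ))
    (hI : ∀ a b : ℤ, (a, b) ∈ I → (-N * b, a + D * b) ∈ I) {k : ℤ} (hk : k ≠ 0)
    (hkI : (k, 0) ∈ I) :
    ∃ c m n : ℤ, 0 < c ∧ 0 < m ∧ m ∣ n ^ 2 + D * n + N ∧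
      ∀ a b : ℤ, (a, b) ∈ I ↔ ∃ u v : ℤ, a = c * (m * u + n * v) ∧ b = c * v := by
  -- `c` generates the second coordinates, `M` the intersection with `ℤ × 0`
  obtain ⟨c, hc⟩ := Int.subgroup_cyclic (I.map (AddMonoidHom.snd ℤ ℤ))
  obtain ⟨M, hM⟩ := Int.subgroup_cyclic (I.comap (AddMonoidHom.inl ℤ ℤ))
  wlog hc0 : 0 ≤ c generalizing c
  · exact this (-c) (by rw [hc]; simp [AddSubgroup.closure_singleton_neg]) (by omega)
  wlog hM0 : 0 ≤ M generalizing M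
  · exact this (-M) (by rw [hM]; simp [AddSubgroup.closure_singleton_neg]) (by omega)
  have memc : ∀ b, (∃ a, (a, b) ∈ I) ↔ c ∣ b := by
    intro b
    have : b ∈ I.map (AddMonoidHom.snd ℤ ℤ) ↔ b ∈ AddSubgroup.closure {c} := by rw [hc]
    rw [AddSubgroup.mem_closure_singleton] at this
    constructor
    · rintro ⟨a, ha⟩
      obtain ⟨z, hz⟩ := this.1 ⟨(a, b), ha, rfl⟩
      exact ⟨z, by rw [← hz]; simp [mul_comm]⟩
    · rintro ⟨z, hz⟩
      obtain ⟨⟨a, b'⟩, ha, rfl⟩ := this.2 ⟨z, by rw [hz]; simp [mul_comm]⟩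
      exact ⟨a, ha⟩
  have memM : ∀ a, (a, 0) ∈ I ↔ M ∣ a := by
    intro a
    have : a ∈ I.comap (AddMonoidHom.inl ℤ ℤ) ↔ a ∈ AddSubgroup.closure {M} := by rw [hM]
    rw [AddSubgroup.mem_closure_singleton] at this
    constructor
    · intro ha
      obtain ⟨z, hz⟩ := this.1 ha
      exact ⟨z, by rw [← hz]; simp [mul_comm]⟩
    · rintro ⟨z, hz⟩
      exact this.2 ⟨z, by rw [hz]; simp [mul_comm]⟩
  have hMne : M ≠ 0 := by
    rintro rfl
    exact hk (zero_dvd_iff.1 ((memM k).1 hkI))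
  have hcM : c ∣ M := by
    refine (memc M).1 ⟨-N * 0, ?_⟩
    have := hI M 0 ((memM M).2 dvd_rfl)
    simpa using this
  have hcne : c ≠ 0 := by
    rintro rfl
    exact hMne (zero_dvd_iff.1 hcM)
  obtain ⟨m, rfl⟩ := hcM
  obtain ⟨a, ha⟩ := (memc c).2 dvd_rfl
  have hca : c ∣ a := by
    -- the second coordinate of `γ (a + c γ)` is `a + D c`
    have h1 := (memc _).1 ⟨_, hI a c ha⟩
    exact (Int.dvd_add_left (Dvd.intro_left D rfl)).1 h1
  obtain ⟨n, rfl⟩ := hca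
  have hcpos : 0 < c := by omega
  have hmpos : 0 < m := by
    by_contra h
    have : c * m ≤ 0 := mul_nonpos_of_nonneg_of_nonpos hc0 (by omega)
    omega
  refine ⟨c, m, n, hcpos, hmpos, ?_, ?_⟩
  -- `(γ - n - D) (n + γ) = -N(γ + n)` lies in `ℤ`
  · have h1 := I.sub_mem (hI _ _ ha) (I.zsmul_mem ha (n + D))
    have h2 : ((-N * c, c * n + D * c) : ℤ × ℤ) - (n + D) • ((c * n, c) : ℤ × ℤ)
        = (c * -(n ^ 2 + D * n + N), 0) := by
      ext <;> simp <;> ring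
    rw [h2] at h1
    have h3 := Int.dvd_of_mul_dvd_mul_left hcne ((memM _).1 h1)
    exact (dvd_neg).1 h3
  · intro a b
    constructor
    · intro hab
      obtain ⟨v, rfl⟩ := (memc b).1 ⟨a, hab⟩
      have h1 := I.sub_mem hab (I.zsmul_mem ha v)
      have h2 : ((a, c * v) : ℤ × ℤ) - v • ((c * n, c) : ℤ × ℤ) = (a - v * (c * n), 0) := by
        ext
        · simp
        · simp; ring
      rw [h2] at h1
      obtain ⟨u, hu⟩ := (memM _).1 h1
      exact ⟨u, v, by linarith, rfl⟩
    · rintro ⟨u, v, rfl, rfl⟩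
      have h1 := I.add_mem (I.zsmul_mem ((memM _).2 dvd_rfl) u) (I.zsmul_mem ha v)
      convert h1 using 1
      ext <;> simp <;> ring

/-! ### Primitive ideals of norm `d` and roots modulo `d` -/

/-- The coordinates `(a, b) ↦ a + b γ` on the order of discriminant `D`. -/
def orderEquiv {D : ℕ} (hD : D % 4 = 0 ∨ D % 4 = 1) : ℤ × ℤ ≃+ order D :=
  AddEquiv.ofBijective
    (AddMonoidHom.mk' (fun p => (⟨p.1 + p.2 * gamma D, (mem_order_iff hD).2 ⟨p.1, p.2, rfl⟩⟩ : order D))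
      (fun p q => Subtype.ext (by simp; ring)))
    ⟨fun p q h => by
      have h1 := congrArg Subtype.val h
      obtain ⟨h2, h3⟩ := order_coords_inj h1
      exact Prod.ext h2 h3,
    fun x => by
      obtain ⟨a, b, h⟩ := (mem_order_iff hD).1 x.2
      exact ⟨(a, b), Subtype.ext h.symm⟩⟩

lemma coe_orderEquiv {D : ℕ} (hD : D % 4 = 0 ∨ D % 4 = 1) (p : ℤ × ℤ) :
    (orderEquiv hD p : K D) = p.1 + p.2 * gamma D := rfl

/-- The ideal `ℤ d ⊕ ℤ (γ + n)`, for `d` dividing the norm of `γ + n`. -/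
def idealOf {D : ℕ} (hD : D % 4 = 0 ∨ D % 4 = 1) (d n : ℤ) (h : d ∣ normPoly D n) :
    Ideal (order D) where
  carrier := {x | ∃ u v : ℤ, (x : K D) = d * u + (gamma D + n) * v}
  zero_mem' := ⟨0, 0, by simp⟩
  add_mem' := by
    rintro x y ⟨u, v, h⟩ ⟨u', v', h'⟩
    exact ⟨u + u', v + v', by rw [Subring.coe_add, h, h']; push_cast; ring⟩
  smul_mem' := by
    rintro k x ⟨u, v, hx⟩
    obtain ⟨a, b, hk⟩ := (mem_order_iff hD).1 k.2
    obtain ⟨l, hl⟩ := h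
    refine ⟨a * u - b * n * u - b * v * l, b * d * u + a * v + b * v * (D + n), ?_⟩
    rw [smul_eq_mul, Subring.coe_mul, hx, hk]
    have h2 : (normPoly D n : K D) = (d : K D) * l := by rw [hl]; push_cast; ring
    rw [normPoly] at h2
    push_cast at h2 ⊢
    linear_combination (b * v : K D) * gamma_mul_gamma hD - (b * v : K D) * h2

lemma mem_idealOf {D : ℕ} (hD : D % 4 = 0 ∨ D % 4 = 1) {d n : ℤ} (h : d ∣ normPoly D n)
    {x : order D} : x ∈ idealOf hD d n h ↔ ∃ u v : ℤ, (x : K D) = d * u + (gamma D + n) * v :=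
  Iff.rfl

lemma orderEquiv_mem_idealOf {D : ℕ} (hD : D % 4 = 0 ∨ D % 4 = 1) {d n : ℤ}
    (h : d ∣ normPoly D n) (a b : ℤ) : orderEquiv hD (a, b) ∈ idealOf hD d n h ↔ d ∣ a - n * b := by
  rw [mem_idealOf, coe_orderEquiv]
  constructor
  · rintro ⟨u, v, huv⟩
    have : ((a : ℤ) : K D) + (b : ℤ) * gamma D = ((d * u + n * v : ℤ) : K D) + (v : ℤ) * gamma D := by
      push_cast; linear_combination huv
    obtain ⟨rfl, rfl⟩ := order_coords_inj this
    exact ⟨u, by ring⟩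
  · rintro ⟨u, hu⟩
    refine ⟨u, b, ?_⟩
    have : ((a : ℤ) : K D) = ((d * u + n * b : ℤ) : K D) := by congr 1; linarith
    simp only [this]
    push_cast; ring

lemma idealNorm_idealOf {D : ℕ} (hD : D % 4 = 0 ∨ D % 4 = 1) (d : ℕ) (n : ℤ)
    (h : (d : ℤ) ∣ normPoly D n) : idealNorm (idealOf hD d n h) = d := by
  let φ : order D →+ ZMod d :=
    ((Int.castAddHom (ZMod d)).comp (AddMonoidHom.fst ℤ ℤ -
      (AddMonoidHom.mulLeft n).comp (AddMonoidHom.snd ℤ ℤ))).comp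
      (orderEquiv hD).symm.toAddMonoidHom
  have hφ : ∀ a b : ℤ, φ (orderEquiv hD (a, b)) = ((a - n * b : ℤ) : ZMod d) := by
    intro a b
    simp [φ]
  have hsurj : Function.Surjective φ := by
    intro r
    obtain ⟨a, rfl⟩ := ZMod.intCast_surjective r
    exact ⟨orderEquiv hD (a, 0), by rw [hφ]; simp⟩
  have hker : φ.ker = (idealOf hD d n h).toAddSubgroup := by
    ext x
    obtain ⟨⟨a, b⟩, rfl⟩ := (orderEquiv hD).surjective x
    rw [AddMonoidHom.mem_ker, hφ, ZMod.intCast_zmod_eq_zero_iff_dvd]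
    exact (orderEquiv_mem_idealOf hD h a b).symm
  have h1 : Nat.card (order D ⧸ φ.ker) = d := by
    rw [Nat.card_congr (QuotientAddGroup.quotientKerEquivOfSurjective φ hsurj).toEquiv,
      Nat.card_zmod]
  change Nat.card (order D ⧸ (idealOf hD d n h).toAddSubgroup) = d
  refine Eq.trans ?_ h1
  exact Nat.card_congr (QuotientAddGroup.quotientAddEquivOfEq hker.symm).toEquiv

lemma isPrimitiveIdeal_idealOf {D : ℕ} (hD : D % 4 = 0 ∨ D % 4 = 1) (d : ℤ) (n : ℤ)
    (h : d ∣ normPoly D n) : IsPrimitiveIdeal (idealOf hD d n h) := by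
  intro m hm
  have h1 : orderEquiv hD (n, 1) ∈ idealOf hD d n h := by
    rw [orderEquiv_mem_idealOf]; simp
  obtain ⟨⟨y, hy⟩, hy2⟩ := Ideal.mem_span_singleton'.1 (hm h1)
  obtain ⟨a, b, rfl⟩ := (mem_order_iff hD).1 hy
  have h2 := congrArg Subtype.val hy2
  rw [coe_orderEquiv] at h2
  have h3 : ((a * m : ℤ) : K D) + (b * m : ℤ) * gamma D = (n : ℤ) + (1 : ℤ) * gamma D := by
    rw [← h2]; push_cast; ring
  obtain ⟨-, h4⟩ := order_coords_inj h3
  exact IsUnit.of_mul_eq_one_right _ h4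

lemma idealOf_eq_iff {D : ℕ} (hD : D % 4 = 0 ∨ D % 4 = 1) {d n n' : ℤ}
    (h : d ∣ normPoly D n) (h' : d ∣ normPoly D n') :
    idealOf hD d n h = idealOf hD d n' h' ↔ d ∣ n - n' := by
  constructor
  · intro heq
    have h1 : orderEquiv hD (n, 1) ∈ idealOf hD d n h := by
      rw [orderEquiv_mem_idealOf]; simp
    rw [heq, orderEquiv_mem_idealOf] at h1
    simpa using h1
  · intro hdvd
    ext x
    obtain ⟨⟨a, b⟩, rfl⟩ := (orderEquiv hD).surjective x
    rw [orderEquiv_mem_idealOf, orderEquiv_mem_idealOf]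
    have h2 : a - n' * b = (a - n * b) + (n - n') * b := by ring
    rw [h2, Int.dvd_add_left (Dvd.dvd.mul_right hdvd b)]

lemma exists_eq_idealOf {D : ℕ} (hD : D % 4 = 0 ∨ D % 4 = 1) {d : ℕ} (hd : 0 < d)
    {𝔞 : Ideal (order D)} (h𝔞 : 𝔞 ∈ primitiveIdeals D d) :
    ∃ (n : ℤ) (h : (d : ℤ) ∣ normPoly D n), 𝔞 = idealOf hD d n h := by
  obtain ⟨hprim, hnorm⟩ := h𝔞
  let I : AddSubgroup (ℤ × ℤ) := 𝔞.toAddSubgroup.comap (orderEquiv hD).toAddMonoidHom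
  have memI : ∀ p, p ∈ I ↔ orderEquiv hD p ∈ 𝔞 := fun p => Iff.rfl
  have hI : ∀ a b : ℤ, (a, b) ∈ I → (-gammaNorm D * b, a + D * b) ∈ I := by
    intro a b hab
    have h1 := 𝔞.mul_mem_left ⟨gamma D, gamma_mem_order D⟩ ((memI _).1 hab)
    rw [memI]
    convert h1 using 1
    apply Subtype.ext
    rw [Subring.coe_mul, coe_orderEquiv, coe_orderEquiv]
    push_cast
    linear_combination - (b : K D) * gamma_mul_gamma hD
  have hkI : ((d : ℤ), (0 : ℤ)) ∈ I := by
    rw [memI]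
    have : orderEquiv hD ((d : ℤ), (0 : ℤ)) = d • (1 : order D) := by
      apply Subtype.ext; rw [coe_orderEquiv]; simp
    rw [this, ← hnorm]
    have h2 : (Nat.card (order D ⧸ 𝔞)) • (1 : order D ⧸ 𝔞) = 0 := card_nsmul_eq_zero'
    rw [← Ideal.Quotient.eq_zero_iff_mem, map_nsmul, map_one]
    exact h2
  obtain ⟨c, m, n, hc, hm, hmn, hmem⟩ :=
    exists_normal_form D (gammaNorm D) I hI (by positivity : (d : ℤ) ≠ 0) hkI
  replace hmn : m ∣ normPoly D n := hmn
  have hc1 : c = 1 := by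
    have := hprim c (by
      intro x hx
      obtain ⟨⟨a, b⟩, rfl⟩ := (orderEquiv hD).surjective x
      obtain ⟨u, v, rfl, rfl⟩ := (hmem a b).1 hx
      refine Ideal.mem_span_singleton'.2 ⟨orderEquiv hD (m * u + n * v, v), ?_⟩
      apply Subtype.ext
      rw [Subring.coe_mul, coe_orderEquiv, coe_orderEquiv]
      push_cast; ring)
    rcases Int.isUnit_iff.1 this with h | h <;> omega
  subst hc1
  have h𝔞 : 𝔞 = idealOf hD m n hmn := by
    ext x
    obtain ⟨⟨a, b⟩, rfl⟩ := (orderEquiv hD).surjective x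
    rw [orderEquiv_mem_idealOf, ← memI, hmem]
    constructor
    · rintro ⟨u, v, rfl, rfl⟩
      exact ⟨u, by ring⟩
    · rintro ⟨u, hu⟩
      exact ⟨u, b, by linarith, by ring⟩
  lift m to ℕ using hm.le
  have hmd : m = d := by
    rw [← idealNorm_idealOf hD m n hmn, ← h𝔞, hnorm]
  subst hmd
  exact ⟨n, hmn, h𝔞⟩

lemma idealOf_mem_primitiveIdeals {D : ℕ} (hD : D % 4 = 0 ∨ D % 4 = 1) (d : ℕ) (n : ℤ)
    (h : (d : ℤ) ∣ normPoly D n) : idealOf hD d n h ∈ primitiveIdeals D d :=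
  ⟨isPrimitiveIdeal_idealOf hD d n h, idealNorm_idealOf hD d n h⟩

/-- The roots modulo `d` of the norm polynomial of `γ`. -/
def RootMod (D d : ℕ) : Type :=
  {r : ZMod d // r ^ 2 + (D : ZMod d) * r + (gammaNorm D : ZMod d) = 0}

lemma root_intCast_iff (D d : ℕ) (n : ℤ) :
    (n : ZMod d) ^ 2 + (D : ZMod d) * n + (gammaNorm D : ZMod d) = 0 ↔ (d : ℤ) ∣ normPoly D n := by
  rw [← ZMod.intCast_zmod_eq_zero_iff_dvd, normPoly]
  push_cast
  rfl

lemma ncard_primitiveIdeals {D : ℕ} (hD : D % 4 = 0 ∨ D % 4 = 1) {d : ℕ} (hd : 0 < d) :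
    (primitiveIdeals D d).ncard = Nat.card (RootMod D d) := by
  symm
  have : NeZero d := ⟨hd.ne'⟩
  have hr : ∀ r : RootMod D d, (d : ℤ) ∣ normPoly D (r.1.val : ℤ) := fun r => by
    rw [← root_intCast_iff]
    have := r.2
    rw [Int.cast_natCast, ZMod.natCast_zmod_val]
    exact this
  rw [← Nat.card_coe_set_eq]
  refine Nat.card_congr (Equiv.ofBijective (fun r => ⟨idealOf hD d (r.1.val : ℤ) (hr r),
    idealOf_mem_primitiveIdeals hD d _ (hr r)⟩) ⟨?_, ?_⟩)
  · intro r s hrs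
    have h1 := (idealOf_eq_iff hD (hr r) (hr s)).1 (congrArg Subtype.val hrs)
    apply Subtype.ext
    rw [← ZMod.intCast_zmod_eq_zero_iff_dvd] at h1
    push_cast at h1
    rw [ZMod.natCast_zmod_val, ZMod.natCast_zmod_val] at h1
    exact sub_eq_zero.1 h1
  · rintro ⟨𝔞, h𝔞⟩
    obtain ⟨n, hn, rfl⟩ := exists_eq_idealOf hD hd h𝔞
    refine ⟨⟨(n : ZMod d), (root_intCast_iff D d n).2 hn⟩, Subtype.ext ?_⟩
    rw [idealOf_eq_iff]
    rw [← ZMod.intCast_zmod_eq_zero_iff_dvd]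
    push_cast
    rw [ZMod.natCast_zmod_val, sub_self]

/-- The Chinese remainder theorem for roots of the norm polynomial. -/
lemma card_rootMod_mul (D : ℕ) {m n : ℕ} (h : m.Coprime n) :
    Nat.card (RootMod D (m * n)) = Nat.card (RootMod D m) * Nat.card (RootMod D n) := by
  rw [← Nat.card_prod]
  refine Nat.card_congr (Equiv.trans (β := {p : ZMod m × ZMod n //
      (p.1 ^ 2 + (D : ZMod m) * p.1 + (gammaNorm D : ZMod m) = 0) ∧
      (p.2 ^ 2 + (D : ZMod n) * p.2 + (gammaNorm D : ZMod n) = 0)})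
    (Equiv.subtypeEquiv (ZMod.chineseRemainder h).toEquiv ?_)
    (Equiv.subtypeProdEquivProd
      (p := fun r : ZMod m => r ^ 2 + (D : ZMod m) * r + (gammaNorm D : ZMod m) = 0)
      (q := fun r : ZMod n => r ^ 2 + (D : ZMod n) * r + (gammaNorm D : ZMod n) = 0)))
  intro a
  rw [← (ZMod.chineseRemainder h).injective.eq_iff, map_zero]
  simp [Prod.ext_iff]

/-! ### Splitting of primes -/

lemma dvd_two_mul_add {D : ℕ} (hD : D % 4 = 0 ∨ D % 4 = 1) {p : ℕ} (hp : p.Prime) {n : ℤ}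
    (hpD : p ∣ D) (h : (p : ℤ) ∣ normPoly D n) : (p : ℤ) ∣ D + 2 * n := by
  have h4 : 4 * normPoly D n = (D + 2 * n) ^ 2 - D := by
    rw [normPoly]; linear_combination four_mul_gammaNorm hD
  have : (p : ℤ) ∣ (D + 2 * n) ^ 2 := by
    have h5 : ((D : ℤ) + 2 * n) ^ 2 = 4 * normPoly D n + D := by rw [h4]; ring
    rw [h5]
    exact dvd_add (Dvd.dvd.mul_left h 4) (by exact_mod_cast hpD)
  exact (Nat.prime_iff_prime_int.1 hp).dvd_of_dvd_pow this

/-- This holds because `D = (D + 2 n)² - 4 N(γ + n)`. -/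
lemma dvd_D_of_dvd {D : ℕ} (hD : D % 4 = 0 ∨ D % 4 = 1) {p : ℕ} {n : ℤ}
    (h : (p : ℤ) ∣ normPoly D n) (h2 : (p : ℤ) ∣ D + 2 * n) : p ∣ D := by
  have h4 : (D : ℤ) = (D + 2 * n) ^ 2 - 4 * normPoly D n := by
    rw [normPoly]; linear_combination four_mul_gammaNorm hD
  have : (p : ℤ) ∣ D := by
    rw [h4]
    exact dvd_sub (Dvd.dvd.pow h2 two_ne_zero) (Dvd.dvd.mul_left h 4)
  exact_mod_cast this

lemma exists_root_of_dvd {D : ℕ} (hD : D % 4 = 0 ∨ D % 4 = 1) {p : ℕ} (hp : p.Prime)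
    (hpD : p ∣ D) : ∃ n : ℤ, (p : ℤ) ∣ normPoly D n := by
  have h4 := four_mul_gammaNorm hD
  rcases hp.eq_two_or_odd' with rfl | hodd
  · refine ⟨gammaNorm D, ?_⟩
    have h2 : (2 : ℤ) ∣ D := by exact_mod_cast hpD
    rw [normPoly]
    have : (2 : ℤ) ∣ gammaNorm D ^ 2 + gammaNorm D := by
      rw [show gammaNorm D ^ 2 + gammaNorm D = gammaNorm D * (gammaNorm D + 1) by ring]
      exact (Int.even_mul_succ_self _).two_dvd
    have h3 : (2 : ℤ) ∣ D * gammaNorm D := Dvd.dvd.mul_right h2 _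
    push_cast
    omega
  · refine ⟨0, ?_⟩
    rw [normPoly]
    have hpD' : (p : ℤ) ∣ D := by exact_mod_cast hpD
    have h1 : (p : ℤ) ∣ 4 * gammaNorm D := by
      rw [h4]; exact dvd_sub (Dvd.dvd.pow hpD' two_ne_zero) hpD'
    have h2 : IsCoprime (p : ℤ) 4 := by
      refine (Nat.isCoprime_iff_coprime (m := p) (n := 4)).2 ?_
      have : p.Coprime (2 ^ 2) := Nat.Coprime.pow_right 2 (Nat.coprime_two_right.2 hodd)
      simpa using this
    have := h2.dvd_of_dvd_mul_left h1
    simpa using this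

lemma isIntegral_gamma {D : ℕ} (hD : D % 4 = 0 ∨ D % 4 = 1) : IsIntegral ℤ (gamma D) := by
  refine ⟨Polynomial.X ^ 2 - Polynomial.C (D : ℤ) * Polynomial.X + Polynomial.C (gammaNorm D),
    by monicity!, ?_⟩
  simp only [Polynomial.eval₂_add, Polynomial.eval₂_sub, Polynomial.eval₂_mul, Polynomial.eval₂_pow,
    Polynomial.eval₂_X, Polynomial.eval₂_C]
  simp only [eq_intCast, Int.cast_natCast]
  linear_combination gamma_mul_gamma hD

/-- Away from the conductor the order is `p`-maximal. -/
lemma mem_order_of_prime_mul_mem {D p : ℕ} (hp : p.Prime) (hpc : ¬ p ∣ conductor D) {x : K D}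
    (hx : IsIntegral ℤ x) (hpx : (p : K D) * x ∈ order D) : x ∈ order D := by
  by_contra hxo
  apply hpc
  let G := (integralClosure ℤ (K D)).toSubring.toAddSubgroup
  let H : AddSubgroup G := (order D).toAddSubgroup.addSubgroupOf G
  let y : G := ⟨x, hx⟩
  have h1 : p • (QuotientAddGroup.mk y : G ⧸ H) = 0 := by
    rw [← QuotientAddGroup.mk_nsmul, QuotientAddGroup.eq_zero_iff]
    change ((p • y : G) : K D) ∈ order D
    rw [AddSubgroup.coe_nsmul, nsmul_eq_mul]
    exact hpx
  have h2 : (QuotientAddGroup.mk y : G ⧸ H) ≠ 0 := by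
    rw [Ne, QuotientAddGroup.eq_zero_iff]
    exact hxo
  have : Fact p.Prime := ⟨hp⟩
  have h3 := addOrderOf_eq_prime h1 h2
  rw [← h3]
  exact addOrderOf_dvd_natCard _

/-- The conductor annihilates `𝒪_K / 𝒪_D`, being the order of this group. -/
lemma conductor_mul_mem {D : ℕ} {x : K D} (hx : IsIntegral ℤ x) :
    (conductor D : K D) * x ∈ order D := by
  let G := (integralClosure ℤ (K D)).toSubring.toAddSubgroup
  let H : AddSubgroup G := (order D).toAddSubgroup.addSubgroupOf G
  have := AddSubgroup.nsmul_index_mem H ⟨x, hx⟩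
  change ((H.index • (⟨x, hx⟩ : G) : G) : K D) ∈ order D at this
  rwa [AddSubgroup.coe_nsmul, nsmul_eq_mul] at this

/-- A prime dividing both the trace and, to second order, the norm of `γ + n` divides the
conductor. -/
lemma not_sq_dvd_normPoly {D p : ℕ} (hD : D % 4 = 0 ∨ D % 4 = 1) (hp : p.Prime)
    (hpc : ¬ p ∣ conductor D) {n : ℤ} (h1 : (p : ℤ) ∣ D + 2 * n) (h2 : (p : ℤ) ^ 2 ∣ normPoly D n) :
    False := by
  obtain ⟨t, ht⟩ := h1
  obtain ⟨l, hl⟩ := h2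
  have hp0 : (p : ℚ) ≠ 0 := by exact_mod_cast hp.ne_zero
  -- `(γ + n) / p` would be integral without lying in the order
  let x : K D := (p : ℚ)⁻¹ • (gamma D + n)
  have hpx : (p : K D) * x = gamma D + n := by
    change (p : K D) * ((p : ℚ)⁻¹ • (gamma D + n)) = _
    ext <;> simp <;> field_simp
  have hp0' : (p : K D) ≠ 0 := by
    intro h
    have := congrArg QuadraticAlgebra.re h
    simp at this
    exact hp.ne_zero this
  have hx : IsIntegral ℤ x := by
    refine ⟨Polynomial.X ^ 2 - Polynomial.C t * Polynomial.X + Polynomial.C l, by monicity!, ?_⟩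
    simp only [Polynomial.eval₂_add, Polynomial.eval₂_sub, Polynomial.eval₂_mul, Polynomial.eval₂_pow,
      Polynomial.eval₂_X, Polynomial.eval₂_C]
    simp only [eq_intCast]
    have h3 : (p : K D) ^ 2 * (x ^ 2 - t * x + l) = 0 := by
      have h4 : (p : K D) * t = D + 2 * n := by exact_mod_cast congrArg (Int.cast : ℤ → K D) ht.symm
      have h5 : (p : K D) ^ 2 * l = (normPoly D n : K D) := by rw [hl]; push_cast; ring
      rw [normPoly] at h5
      push_cast at h5
      linear_combination (p * x + gamma D + n - p * t) * hpx + gamma_mul_gamma hD + h5 -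
        (gamma D + n) * h4
    have h6 : (p : ℚ) ^ 2 • (x ^ 2 - t * x + l) = 0 := by
      rw [← h3]
      ext
      · simp [pow_two]; ring
      · simp [pow_two]
    exact (smul_eq_zero.1 h6).resolve_left (pow_ne_zero 2 hp0)
  have h7 := mem_order_of_prime_mul_mem hp hpc hx (by
    rw [hpx]; exact add_mem (gamma_mem_order D) (intCast_mem _ n))
  obtain ⟨a, b, hab⟩ := (mem_order_iff hD).1 h7
  have h8 : ((p * a : ℤ) : K D) + (p * b : ℤ) * gamma D = (n : ℤ) + (1 : ℤ) * gamma D := by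
    rw [hab] at hpx
    push_cast
    linear_combination hpx
  have h9 := (order_coords_inj h8).2
  exact hp.one_lt.ne' (by
    have := Int.isUnit_iff.1 (IsUnit.of_mul_eq_one (b := b) h9)
    omega)

/-- If the norm polynomial has no root modulo `p`, the norm form `a² + D a b + N b²` of `𝒪_D` is
anisotropic modulo `p`. -/
lemma dvd_coords_of_no_root {D p : ℕ} (hp : p.Prime)
    (hroot : ∀ n : ℤ, ¬ (p : ℤ) ∣ normPoly D n) {a b : ℤ}
    (h : (p : ℤ) ∣ a ^ 2 + D * (a * b) + gammaNorm D * b ^ 2) : (p : ℤ) ∣ a ∧ (p : ℤ) ∣ b := by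
  have hp' := Nat.prime_iff_prime_int.1 hp
  have hb : (p : ℤ) ∣ b := by
    by_contra hb
    obtain ⟨u, v, huv⟩ := (hp'.coprime_iff_not_dvd).2 hb
    apply hroot (v * a)
    have h2 : normPoly D (v * a) = v ^ 2 * (a ^ 2 + D * (a * b) + gammaNorm D * b ^ 2)
        + p * (u * (gammaNorm D * (1 + v * b) + D * v * a)) := by
      rw [normPoly]
      linear_combination - (gammaNorm D * (1 + v * b) + D * v * a) * huv
    rw [h2]
    exact dvd_add (Dvd.dvd.mul_left h _) (Dvd.intro _ rfl)
  refine ⟨?_, hb⟩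
  have h3 : (p : ℤ) ∣ a ^ 2 := by
    obtain ⟨k, rfl⟩ := hb
    have h4 : a ^ 2 = (a ^ 2 + D * (a * (p * k)) + gammaNorm D * (p * k) ^ 2) -
      p * (k * (D * a + gammaNorm D * (p * k))) := by ring
    rw [h4]
    exact dvd_sub h (Dvd.intro _ rfl)
  exact hp'.dvd_of_dvd_pow h3

section Split
variable {D : ℕ} [Fact (¬ IsSquare D)]

instance : NumberField (K D) where
  to_charZero := inferInstance
  to_finiteDimensional := by
    convert (inferInstance : Module.Finite ℚ (QuadraticAlgebra ℚ (D : ℚ) 0))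

local notation "𝒪" => NumberField.RingOfIntegers (K D)

/-- `γ` as an algebraic integer. -/
def gammaInt (hD : D % 4 = 0 ∨ D % 4 = 1) : 𝒪 := ⟨gamma D, isIntegral_gamma hD⟩

lemma coe_gammaInt (hD : D % 4 = 0 ∨ D % 4 = 1) : ((gammaInt hD : 𝒪) : K D) = gamma D := rfl

/-- Away from the conductor, divisibility by `p` in the maximal order can be read off from the
coordinates in `𝒪_D`. -/
lemma natCast_dvd_coords (hD : D % 4 = 0 ∨ D % 4 = 1) {p : ℕ} (hp : p.Prime)
    (hpc : ¬ p ∣ conductor D) {a b : ℤ} (h : (p : 𝒪) ∣ a + b * gammaInt hD) :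
    (p : ℤ) ∣ a ∧ (p : ℤ) ∣ b := by
  obtain ⟨y, hy⟩ := h
  have h1 : (a : K D) + b * gamma D = p * (y : K D) := by
    have := congrArg (algebraMap 𝒪 (K D)) hy
    simpa [coe_gammaInt] using this
  have h2 : (y : K D) ∈ order D := mem_order_of_prime_mul_mem hp hpc y.2
    (h1 ▸ (mem_order_iff hD).2 ⟨a, b, rfl⟩)
  obtain ⟨u, v, huv⟩ := (mem_order_iff hD).1 h2
  rw [huv] at h1
  have h3 : (a : K D) + b * gamma D = ((p * u : ℤ) : K D) + (p * v : ℤ) * gamma D := by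
    rw [h1]; push_cast; ring
  obtain ⟨rfl, rfl⟩ := order_coords_inj h3
  exact ⟨⟨u, rfl⟩, ⟨v, rfl⟩⟩

lemma exists_conductor_coords (hD : D % 4 = 0 ∨ D % 4 = 1) (x : 𝒪) :
    ∃ a b : ℤ, (conductor D : 𝒪) * x = a + b * gammaInt hD := by
  obtain ⟨a, b, h⟩ := (mem_order_iff hD).1 (conductor_mul_mem (D := D) x.2)
  refine ⟨a, b, ?_⟩
  apply NumberField.RingOfIntegers.ext
  have h' : (conductor D : K D) * algebraMap 𝒪 (K D) x = a + b * gamma D := h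
  simpa [coe_gammaInt] using h'

lemma gammaInt_mul (hD : D % 4 = 0 ∨ D % 4 = 1) :
    gammaInt hD * gammaInt hD = (D : 𝒪) * gammaInt hD - (gammaNorm D : 𝒪) := by
  apply NumberField.RingOfIntegers.ext
  simpa [coe_gammaInt] using gamma_mul_gamma hD

lemma natCast_dvd_of_conductor {p : ℕ} (hp : p.Prime) (hpc : ¬ p ∣ conductor D) {x : 𝒪}
    (h : (p : 𝒪) ∣ (conductor D : 𝒪) * x) : (p : 𝒪) ∣ x := by
  have h1 : IsCoprime (p : ℤ) (conductor D : ℤ) :=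
    Nat.isCoprime_iff_coprime.2 ((Nat.Prime.coprime_iff_not_dvd hp).2 hpc)
  obtain ⟨u, v, huv⟩ := h1
  have h2 : x = (p : 𝒪) * (u * x) + v * ((conductor D : 𝒪) * x) := by
    have := congrArg (Int.cast : ℤ → 𝒪) huv
    push_cast at this
    linear_combination - x * this
  rw [h2]
  exact dvd_add (Dvd.intro _ rfl) (Dvd.dvd.mul_left h _)

lemma natCast_not_dvd_one (hD : D % 4 = 0 ∨ D % 4 = 1) {p : ℕ} (hp : p.Prime)
    (hpc : ¬ p ∣ conductor D) : ¬ (p : 𝒪) ∣ 1 := by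
  intro h
  have h1 := (natCast_dvd_coords hD hp hpc (a := 1) (b := 0) (by simpa using h)).1
  have := Int.isUnit_iff.1 (isUnit_of_dvd_one h1)
  have := hp.one_lt
  omega

/-- The anisotropy of the norm form modulo `p` makes `p` a prime element of the maximal order. -/
lemma isInert_of_no_root (hD : D % 4 = 0 ∨ D % 4 = 1) {p : ℕ} (hp : p.Prime)
    (hpc : ¬ p ∣ conductor D) (hroot : ∀ n : ℤ, ¬ (p : ℤ) ∣ normPoly D n) : IsInert D p := by
  have hp' := Nat.prime_iff_prime_int.1 hp
  have hp0 : (p : 𝒪) ≠ 0 := by exact_mod_cast hp.ne_zero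
  rw [IsInert, Ideal.span_singleton_prime hp0]
  refine ⟨hp0, fun h => natCast_not_dvd_one hD hp hpc h.dvd, fun x y hxy => ?_⟩
  -- a product divisible by `p` has norm divisible by `p`, and only multiples of `p` have such a
  -- norm; after multiplication by the conductor this can be checked on coordinates in the order
  obtain ⟨a, b, hx⟩ := exists_conductor_coords hD x
  obtain ⟨a', b', hy⟩ := exists_conductor_coords hD y
  have h1 : (p : 𝒪) ∣ (a * a' - b * b' * gammaNorm D : ℤ) +
      (a * b' + b * a' + D * (b * b') : ℤ) * gammaInt hD := by
    have : ((a * a' - b * b' * gammaNorm D : ℤ) : 𝒪) +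
      (a * b' + b * a' + D * (b * b') : ℤ) * gammaInt hD =
      ((conductor D : 𝒪) * conductor D) * (x * y) := by
      rw [show ((conductor D : 𝒪) * conductor D) * (x * y) =
        ((conductor D : 𝒪) * x) * ((conductor D : 𝒪) * y) by ring, hx, hy]
      push_cast
      linear_combination - (b * b' : 𝒪) * gammaInt_mul hD
    rw [this]
    exact Dvd.dvd.mul_left hxy _
  obtain ⟨h2, h3⟩ := natCast_dvd_coords hD hp hpc h1
  have h4 : (p : ℤ) ∣ (a ^ 2 + D * (a * b) + gammaNorm D * b ^ 2) *
      (a' ^ 2 + D * (a' * b') + gammaNorm D * b' ^ 2) := by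
    have : (a ^ 2 + D * (a * b) + gammaNorm D * b ^ 2) *
      (a' ^ 2 + D * (a' * b') + gammaNorm D * b' ^ 2) =
      (a * a' - b * b' * gammaNorm D) * (a * a' - b * b' * gammaNorm D +
        D * (a * b' + b * a' + D * (b * b'))) +
      gammaNorm D * (a * b' + b * a' + D * (b * b')) * (a * b' + b * a' + D * (b * b')) := by
      ring
    rw [this]
    exact dvd_add (Dvd.dvd.mul_right h2 _) (Dvd.dvd.mul_left h3 _)
  have fin : ∀ {z : 𝒪} {u v : ℤ}, (conductor D : 𝒪) * z = u + v * gammaInt hD →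
      (p : ℤ) ∣ u ^ 2 + D * (u * v) + gammaNorm D * v ^ 2 → (p : 𝒪) ∣ z := by
    intro z u v hz h
    obtain ⟨⟨s, rfl⟩, ⟨t, rfl⟩⟩ := dvd_coords_of_no_root hp hroot h
    apply natCast_dvd_of_conductor hp hpc
    rw [hz]
    exact ⟨s + t * gammaInt hD, by push_cast; ring⟩
  exact (hp'.dvd_or_dvd h4).imp (fin hx) (fin hy)

lemma not_dvd_gammaInt_add (hD : D % 4 = 0 ∨ D % 4 = 1) {p : ℕ} (hp : p.Prime)
    (hpc : ¬ p ∣ conductor D) (r : ℤ) : ¬ (p : 𝒪) ∣ gammaInt hD + r := by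
  intro h
  have h1 := (natCast_dvd_coords hD hp hpc (a := r) (b := 1) (by
    rw [Int.cast_one, one_mul, add_comm]; exact h)).2
  have := Int.isUnit_iff.1 (isUnit_of_dvd_one h1)
  have := hp.one_lt
  omega

lemma gammaInt_add_mul (hD : D % 4 = 0 ∨ D % 4 = 1) (r : ℤ) :
    (gammaInt hD + r) * (gammaInt hD + ((-D - r : ℤ) : 𝒪)) = -(normPoly D r : 𝒪) := by
  rw [normPoly]
  push_cast
  linear_combination gammaInt_mul hD

lemma not_isInert_of_root (hD : D % 4 = 0 ∨ D % 4 = 1) {p : ℕ} (hp : p.Prime)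
    (hpc : ¬ p ∣ conductor D) {r : ℤ} (hr : (p : ℤ) ∣ normPoly D r) : ¬ IsInert D p := by
  have hp0 : (p : 𝒪) ≠ 0 := by exact_mod_cast hp.ne_zero
  rw [IsInert, Ideal.span_singleton_prime hp0]
  intro h
  have h1 : (p : 𝒪) ∣ (gammaInt hD + r) * (gammaInt hD + ((-D - r : ℤ) : 𝒪)) := by
    rw [gammaInt_add_mul, dvd_neg]
    exact_mod_cast map_dvd (Int.castRingHom 𝒪) hr
  rcases h.dvd_or_dvd h1 with h2 | h2
  · exact not_dvd_gammaInt_add hD hp hpc _ h2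
  · exact not_dvd_gammaInt_add hD hp hpc _ h2

/-- The ideal `(p, γ + r)` of the maximal order. -/
def primeAbove (hD : D % 4 = 0 ∨ D % 4 = 1) (p : ℕ) (r : ℤ) : Ideal 𝒪 :=
  Ideal.span {(p : 𝒪), gammaInt hD + r}

/-- The maximality is elementary: every element outside the ideal is, after multiplication by the
conductor, congruent to an integer prime to `p`. -/
lemma isMaximal_primeAbove (hD : D % 4 = 0 ∨ D % 4 = 1) {p : ℕ} (hp : p.Prime)
    (hpc : ¬ p ∣ conductor D) {r : ℤ} (hr : (p : ℤ) ∣ normPoly D r) :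
    (primeAbove hD p r).IsMaximal := by
  have hp' := Nat.prime_iff_prime_int.1 hp
  have hpm : (p : 𝒪) ∈ primeAbove hD p r := Ideal.subset_span (by simp)
  have hgm : gammaInt hD + (r : 𝒪) ∈ primeAbove hD p r := Ideal.subset_span (by simp)
  refine Ideal.isMaximal_iff.2 ⟨fun h1 => ?_, fun J y hJ hy hyJ => ?_⟩
  · obtain ⟨u, v, huv⟩ := Ideal.mem_span_pair.1 h1
    -- otherwise `p` divides the conjugate of `γ + r`
    apply not_dvd_gammaInt_add hD hp hpc (-D - r)
    obtain ⟨l, hl⟩ := hr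
    have h2 := gammaInt_add_mul hD r
    rw [hl] at h2
    refine ⟨u * (gammaInt hD + ((-D - r : ℤ) : 𝒪)) - v * l, ?_⟩
    push_cast at h2 ⊢
    linear_combination - (gammaInt hD - D - r) * huv + v * h2
  · obtain ⟨a, b, hab⟩ := exists_conductor_coords hD y
    have hint : (conductor D : 𝒪) * y = (a - b * r : ℤ) + b * (gammaInt hD + r) := by
      rw [hab]; push_cast; ring
    have hnd : ¬ (p : ℤ) ∣ a - b * r := by
      rintro ⟨l, hl⟩
      apply hy
      have h1 : IsCoprime (p : ℤ) (conductor D : ℤ) :=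
        Nat.isCoprime_iff_coprime.2 ((Nat.Prime.coprime_iff_not_dvd hp).2 hpc)
      obtain ⟨u, v, huv⟩ := h1
      rw [hl] at hint
      have h2 : y = (u * y + v * l) * (p : 𝒪) + v * b * (gammaInt hD + r) := by
        have := congrArg (Int.cast : ℤ → 𝒪) huv
        push_cast at this hint
        linear_combination - y * this + v * hint
      rw [h2]
      exact add_mem (Ideal.mul_mem_left _ _ hpm) (Ideal.mul_mem_left _ _ hgm)
    -- modulo the ideal, the conductor times `y` is the integer `a - b r`, a unit modulo `p`
    obtain ⟨u, v, huv⟩ := (hp'.coprime_iff_not_dvd).2 hnd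
    have h1 : (1 : 𝒪) = u * p + (v * conductor D) * y - (v * b) * (gammaInt hD + r) := by
      have := congrArg (Int.cast : ℤ → 𝒪) huv
      push_cast at this hint
      linear_combination - this - v * hint
    rw [h1]
    exact sub_mem (add_mem (J.mul_mem_left _ (hJ hpm)) (J.mul_mem_left _ hyJ))
      (J.mul_mem_left _ (hJ hgm))

/-- The conjugate of `γ + r` is `-(γ + (-D - r))`, so the second factor is the conjugate of the
first one. -/
lemma span_eq_primeAbove_mul (hD : D % 4 = 0 ∨ D % 4 = 1) {p : ℕ} (hp : p.Prime)
    (hpc : ¬ p ∣ conductor D) {r : ℤ} (hr : (p : ℤ) ∣ normPoly D r) :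
    Ideal.span {(p : 𝒪)} = primeAbove hD p r * primeAbove hD p (-D - r) := by
  have hr' : (p : ℤ) ∣ normPoly D (-D - r) := by
    rwa [show normPoly D (-D - r) = normPoly D r by rw [normPoly, normPoly]; ring]
  have hm := isMaximal_primeAbove hD hp hpc hr
  have hm' := isMaximal_primeAbove hD hp hpc hr'
  have hp0 : (p : 𝒪) ≠ 0 := by exact_mod_cast hp.ne_zero
  have hle : Ideal.span {(p : 𝒪)} ≤ primeAbove hD p r :=
    Ideal.span_mono (by simp)
  obtain ⟨Q, hQ⟩ := Ideal.dvd_iff_le.2 hle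
  have hne : primeAbove hD p r ≠ 0 := by
    rintro h
    rw [h, zero_mul, Ideal.zero_eq_bot, Ideal.span_singleton_eq_bot] at hQ
    exact hp0 hQ
  have hprod : primeAbove hD p r * primeAbove hD p (-D - r) ≤ Ideal.span {(p : 𝒪)} := by
    rw [primeAbove, primeAbove, Ideal.span_mul_span', Ideal.span_le]
    rintro _ ⟨x, hx, y, hy, rfl⟩
    simp only [SetLike.mem_coe, Ideal.mem_span_singleton]
    rcases hx with rfl | hx
    · exact Dvd.intro _ rfl
    rcases hy with rfl | hy
    · exact Dvd.intro_left _ rfl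
    rw [Set.mem_singleton_iff] at hx hy
    subst hx hy
    change _ ∣ (gammaInt hD + r) * (gammaInt hD + ((-D - r : ℤ) : 𝒪))
    rw [gammaInt_add_mul, dvd_neg]
    exact_mod_cast map_dvd (Int.castRingHom 𝒪) hr
  rw [hQ] at hprod ⊢
  have hle2 : primeAbove hD p (-D - r) ≤ Q := by
    rw [← Ideal.dvd_iff_le] at hprod ⊢
    exact (mul_dvd_mul_iff_left hne).1 hprod
  -- `(p) = 𝔭 Q` with `𝔭' ⊆ Q`, and `Q` is proper because `p` is not inert
  rcases eq_or_ne Q ⊤ with h | h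
  · exfalso
    apply not_isInert_of_root hD hp hpc hr
    rw [h, Ideal.mul_top] at hQ
    rw [IsInert, hQ]
    exact hm.isPrime
  · rw [hm'.eq_of_le h hle2]

lemma isRamified_of_dvd (hD : D % 4 = 0 ∨ D % 4 = 1) {p : ℕ} (hp : p.Prime)
    (hpc : ¬ p ∣ conductor D) (hpD : p ∣ D) : IsRamified D p := by
  obtain ⟨r, hr⟩ := exists_root_of_dvd hD hp hpD
  refine ⟨primeAbove hD p r, (isMaximal_primeAbove hD hp hpc hr).isPrime, ?_⟩
  rw [span_eq_primeAbove_mul hD hp hpc hr, pow_two]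
  congr 1
  obtain ⟨t, ht⟩ := dvd_two_mul_add hD hp hpD hr
  symm
  refine (isMaximal_primeAbove hD hp hpc hr).eq_of_le
    (isMaximal_primeAbove hD hp hpc ?_).ne_top ?_
  · rwa [show normPoly D (-D - r) = normPoly D r by rw [normPoly, normPoly]; ring]
  · rw [primeAbove, Ideal.span_le]
    rintro x (rfl | hx)
    · exact Ideal.subset_span (by simp)
    · rw [Set.mem_singleton_iff] at hx
      have h2 : x = (t : 𝒪) * p + (gammaInt hD + ((-D - r : ℤ) : 𝒪)) := by
        have h3 := congrArg (Int.cast : ℤ → 𝒪) ht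
        push_cast at h3 ⊢
        rw [hx]
        linear_combination h3
      rw [h2]
      exact add_mem (Ideal.mul_mem_left _ _ (Ideal.subset_span (by simp)))
        (Ideal.subset_span (by simp))

lemma isSplit_of_root (hD : D % 4 = 0 ∨ D % 4 = 1) {p : ℕ} (hp : p.Prime)
    (hpc : ¬ p ∣ conductor D) {r : ℤ} (hr : (p : ℤ) ∣ normPoly D r) (hpD : ¬ p ∣ D) :
    IsSplit D p := by
  have hp' := Nat.prime_iff_prime_int.1 hp
  have hr' : (p : ℤ) ∣ normPoly D (-D - r) := by
    rwa [show normPoly D (-D - r) = normPoly D r by rw [normPoly, normPoly]; ring]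
  refine ⟨primeAbove hD p r, primeAbove hD p (-D - r), (isMaximal_primeAbove hD hp hpc hr).isPrime,
    (isMaximal_primeAbove hD hp hpc hr').isPrime, fun heq => ?_,
    span_eq_primeAbove_mul hD hp hpc hr⟩
  apply (isMaximal_primeAbove hD hp hpc hr).ne_top
  rw [Ideal.eq_top_iff_one]
  have h1 : gammaInt hD + (r : 𝒪) ∈ primeAbove hD p r := Ideal.subset_span (by simp)
  have h2 : gammaInt hD + ((-D - r : ℤ) : 𝒪) ∈ primeAbove hD p r := by
    rw [heq]; exact Ideal.subset_span (by simp)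
  have h3 : (p : 𝒪) ∈ primeAbove hD p r := Ideal.subset_span (by simp)
  obtain ⟨u, v, huv⟩ := (hp'.coprime_iff_not_dvd).2 (fun h => hpD (dvd_D_of_dvd hD hr h))
  have h4 : (1 : 𝒪) = u * p + v * ((gammaInt hD + (r : 𝒪)) - (gammaInt hD + ((-D - r : ℤ) : 𝒪))) := by
    have := congrArg (Int.cast : ℤ → 𝒪) huv
    push_cast at this ⊢
    linear_combination - this
  rw [h4]
  exact add_mem (Ideal.mul_mem_left _ _ h3) (Ideal.mul_mem_left _ _ (sub_mem h1 h2))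

lemma not_isSplit_of_isRamified {p : ℕ} (hp : p.Prime) (h : IsRamified D p) : ¬ IsSplit D p := by
  rintro ⟨P, Q, hP, hQ, hne, hPQ⟩
  obtain ⟨R, hR, hRR⟩ := h
  have hp0 : Ideal.span {(p : 𝒪)} ≠ ⊥ := by
    rw [Ne, Ideal.span_singleton_eq_bot]; exact_mod_cast hp.ne_zero
  have hP0 : P ≠ ⊥ := by rintro rfl; rw [Ideal.bot_mul] at hPQ; exact hp0 hPQ
  have hQ0 : Q ≠ ⊥ := by rintro rfl; rw [Ideal.mul_bot] at hPQ; exact hp0 hPQ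
  have key : ∀ S : Ideal 𝒪, S.IsPrime → S ≠ ⊥ → Ideal.span {(p : 𝒪)} ≤ S → R = S := by
    intro S hS hS0 hle
    rw [hRR] at hle
    exact (hR.isMaximal (by
      rintro rfl; rw [Ideal.bot_pow two_ne_zero] at hRR; exact hp0 hRR)).eq_of_le hS.ne_top
      (hS.le_of_pow_le hle)
  exact hne ((key P hP hP0 (hPQ ▸ Ideal.mul_le_left)).symm.trans
    (key Q hQ hQ0 (hPQ ▸ Ideal.mul_le_right)))

lemma not_isInert_of_isRamified {p : ℕ} (hp : p.Prime) (h : IsRamified D p) : ¬ IsInert D p := by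
  obtain ⟨R, hR, hRR⟩ := h
  intro hin
  rw [IsInert] at hin
  have hp0 : Ideal.span {(p : 𝒪)} ≠ ⊥ := by
    rw [Ne, Ideal.span_singleton_eq_bot]; exact_mod_cast hp.ne_zero
  rw [hRR] at hin hp0
  have h1 : R ≤ R ^ 2 := hin.le_of_pow_le le_rfl
  have h2 : R ^ 2 ∣ R ^ 1 := Ideal.dvd_iff_le.2 (by simpa using h1)
  have hR0 : R ≠ 0 := by rintro rfl; exact hp0 (by simp)
  have hRu : ¬ IsUnit R := by rw [Ideal.isUnit_iff]; exact hR.ne_top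
  exact absurd ((pow_dvd_pow_iff hR0 hRu).1 h2) (by norm_num)

end Split

/-- Away from the conductor, the prime factor condition is a condition on roots modulo primes. -/
lemma primeFactorCondition_iff {D : ℕ} [Fact (¬ IsSquare D)] (hD : D % 4 = 0 ∨ D % 4 = 1) {d : ℕ}
    (hcop : Nat.Coprime d (conductor D)) :
    PrimeFactorCondition D d ↔ ∀ p : ℕ, p.Prime → p ∣ d →
      (∃ n : ℤ, (p : ℤ) ∣ normPoly D n) ∧ (p ∣ D → d.factorization p = 1) := by
  refine forall₃_congr fun p hp hpd => ?_
  have hpc : ¬ p ∣ conductor D := fun h => hp.one_lt.ne' (Nat.eq_one_of_dvd_coprimes hcop hpd h)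
  have h1 : ¬ IsInert D p ↔ ∃ n : ℤ, (p : ℤ) ∣ normPoly D n := by
    refine ⟨fun h => ?_, fun ⟨r, hr⟩ => not_isInert_of_root hD hp hpc hr⟩
    by_contra! h2
    exact h (isInert_of_no_root hD hp hpc h2)
  have h2 : IsRamified D p ↔ p ∣ D := by
    refine ⟨fun h => ?_, isRamified_of_dvd hD hp hpc⟩
    by_contra h3
    obtain ⟨r, hr⟩ := h1.1 (not_isInert_of_isRamified hp h)
    exact not_isSplit_of_isRamified hp h (isSplit_of_root hD hp hpc hr h3)
  rw [h1, h2]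

/-- If `d` satisfies the prime factor condition, the prime divisors of `d` that split are those not
dividing `D`. -/
lemma numSplit_eq {D : ℕ} [Fact (¬ IsSquare D)] (hD : D % 4 = 0 ∨ D % 4 = 1) {d : ℕ} (hd : 0 < d)
    (hcop : Nat.Coprime d (conductor D)) (h : PrimeFactorCondition D d) :
    numSplit D d = (d.primeFactors.filter (fun p => ¬ p ∣ D)).card := by
  rw [numSplit, ← Set.ncard_coe_finset]
  congr 1
  ext p
  simp only [Set.mem_ofPred_eq, Finset.coe_filter, Nat.mem_primeFactors]
  constructor
  · rintro ⟨hp, hpd, hs⟩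
    have hpc : ¬ p ∣ conductor D := fun h => hp.one_lt.ne' (Nat.eq_one_of_dvd_coprimes hcop hpd h)
    exact ⟨⟨hp, hpd, hd.ne'⟩, fun hpD =>
      not_isSplit_of_isRamified hp (isRamified_of_dvd hD hp hpc hpD) hs⟩
  · rintro ⟨⟨hp, hpd, -⟩, hpD⟩
    have hpc : ¬ p ∣ conductor D := fun h => hp.one_lt.ne' (Nat.eq_one_of_dvd_coprimes hcop hpd h)
    obtain ⟨⟨r, hr⟩, -⟩ := (primeFactorCondition_iff hD hcop).1 h p hp hpd
    exact ⟨hp, hpd, isSplit_of_root hD hp hpc hr hpD⟩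

/-! ### Counting primitive ideals -/

/-- Hensel lifting of a simple root. -/
lemma exists_root_prime_pow {D : ℕ} (hD : D % 4 = 0 ∨ D % 4 = 1) {p : ℕ} (hp : p.Prime)
    (hpD : ¬ p ∣ D) {r : ℤ} (hr : (p : ℤ) ∣ normPoly D r) (k : ℕ) :
    ∃ n : ℤ, ((p ^ (k + 1) : ℕ) : ℤ) ∣ normPoly D n := by
  have hp' := Nat.prime_iff_prime_int.1 hp
  induction k with
  | zero => exact ⟨r, by simpa using hr⟩
  | succ k ih =>
    obtain ⟨n, l, hl⟩ := ih
    have hn : (p : ℤ) ∣ normPoly D n := by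
      rw [hl]; push_cast; exact Dvd.dvd.mul_right (dvd_pow_self _ (by omega)) _
    obtain ⟨u, v, huv⟩ := (hp'.coprime_iff_not_dvd).2 (fun h => hpD (dvd_D_of_dvd hD hn h))
    refine ⟨n + p ^ (k + 1) * (-l * v), u * l + p ^ k * (l * v) ^ 2, ?_⟩
    have h1 : normPoly D (n + p ^ (k + 1) * (-l * v)) = normPoly D n +
      p ^ (k + 1) * ((-l * v) * (D + 2 * n)) + p ^ (k + 1) * p ^ (k + 1) * (l * v) ^ 2 := by
      rw [normPoly, normPoly]; ring
    rw [h1, hl]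
    push_cast
    linear_combination - (p : ℤ) ^ (k + 1) * l * huv

/-- The derivative `D + 2 r` of the norm polynomial at a root `r` is prime to `p`, so each of the
two roots modulo `p`, namely `r` and `-D - r`, lifts uniquely to `ℤ / p ^ k`. -/
lemma card_rootMod_split {D : ℕ} (hD : D % 4 = 0 ∨ D % 4 = 1) {p : ℕ} (hp : p.Prime)
    (hpD : ¬ p ∣ D) {r : ℤ} (hr : (p : ℤ) ∣ normPoly D r) {k : ℕ} (hk : 0 < k) :
    Nat.card (RootMod D (p ^ k)) = 2 := by
  have hp' := Nat.prime_iff_prime_int.1 hp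
  obtain ⟨k, rfl⟩ := Nat.exists_eq_succ_of_ne_zero hk.ne'
  obtain ⟨n, hn⟩ := exists_root_prime_pow hD hp hpD hr k
  have hpk : (p : ℤ) ∣ ((p ^ (k + 1) : ℕ) : ℤ) := by
    push_cast; exact dvd_pow_self _ (by omega)
  have hnd : ¬ (p : ℤ) ∣ D + 2 * n := fun h => hpD (dvd_D_of_dvd hD (hpk.trans hn) h)
  have hset : {x : ZMod (p ^ (k + 1)) | x ^ 2 + (D : ZMod (p ^ (k + 1))) * x +
      (gammaNorm D : ZMod (p ^ (k + 1))) = 0} = {(n : ZMod _), ((-D - n : ℤ) : ZMod _)} := by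
    ext x
    obtain ⟨a, rfl⟩ := ZMod.intCast_surjective x
    simp only [Set.mem_ofPred_eq, Set.mem_insert_iff, Set.mem_singleton_iff]
    rw [root_intCast_iff, ZMod.intCast_eq_intCast_iff_dvd_sub,
      ZMod.intCast_eq_intCast_iff_dvd_sub, dvd_sub_comm, dvd_sub_comm (b := -(D : ℤ) - n)]
    have h1 : normPoly D a = (a - n) * (a - (-D - n)) + normPoly D n := by
      rw [normPoly, normPoly]; ring
    rw [h1, Int.dvd_add_left hn]
    constructor
    · intro h
      have hcase : ¬ (p : ℤ) ∣ a - n ∨ ¬ (p : ℤ) ∣ a - (-D - n) := by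
        by_contra! h2
        apply hnd
        have := dvd_sub h2.2 h2.1
        rwa [show a - (-D - n) - (a - n) = (D : ℤ) + 2 * n by ring] at this
      push_cast at h ⊢
      rcases hcase with h2 | h2
      · right
        exact (IsCoprime.pow_left ((hp'.coprime_iff_not_dvd).2 h2)).dvd_of_dvd_mul_left h
      · left
        exact (IsCoprime.pow_left ((hp'.coprime_iff_not_dvd).2 h2)).dvd_of_dvd_mul_right h
    · rintro (h | h)
      · exact Dvd.dvd.mul_right h _
      · exact Dvd.dvd.mul_left h _
  have hc : Nat.card (RootMod D (p ^ (k + 1))) = Set.ncard {x : ZMod (p ^ (k + 1)) |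
      x ^ 2 + (D : ZMod (p ^ (k + 1))) * x + (gammaNorm D : ZMod (p ^ (k + 1))) = 0} := rfl
  rw [hc, hset, Set.ncard_pair]
  rw [Ne, ZMod.intCast_eq_intCast_iff_dvd_sub]
  intro h
  apply hnd
  have := hpk.trans h
  rw [← dvd_neg]
  rwa [show -((D : ℤ) + 2 * n) = -D - n - n by ring]

/-- Modulo a prime divisor of `D`, the norm polynomial has a double root. -/
lemma card_rootMod_ramified {D : ℕ} (hD : D % 4 = 0 ∨ D % 4 = 1) {p : ℕ} (hp : p.Prime)
    (hpD : p ∣ D) : Nat.card (RootMod D p) = 1 := by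
  have hp' := Nat.prime_iff_prime_int.1 hp
  obtain ⟨n, hn⟩ := exists_root_of_dvd hD hp hpD
  have hset : {x : ZMod p | x ^ 2 + (D : ZMod p) * x + (gammaNorm D : ZMod p) = 0}
      = {(n : ZMod _)} := by
    ext x
    obtain ⟨a, rfl⟩ := ZMod.intCast_surjective x
    simp only [Set.mem_ofPred_eq, Set.mem_singleton_iff]
    rw [root_intCast_iff, ZMod.intCast_eq_intCast_iff_dvd_sub, dvd_sub_comm]
    obtain ⟨t, ht⟩ := dvd_two_mul_add hD hp hpD hn
    have h1 : normPoly D a = (a - n) ^ 2 + p * (t * (a - n)) + normPoly D n := by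
      rw [normPoly, normPoly]; linear_combination (a - n) * ht
    rw [h1, Int.dvd_add_left hn, Int.dvd_add_left (Dvd.intro _ rfl)]
    exact ⟨hp'.dvd_of_dvd_pow, fun h => Dvd.dvd.pow h two_ne_zero⟩
  have hc : Nat.card (RootMod D p) = Set.ncard {x : ZMod p |
      x ^ 2 + (D : ZMod p) * x + (gammaNorm D : ZMod p) = 0} := rfl
  rw [hc, hset, Set.ncard_singleton]

lemma card_rootMod {D : ℕ} (hD : D % 4 = 0 ∨ D % 4 = 1) (d : ℕ) (hd : 0 < d)
    (h : ∀ p : ℕ, p.Prime → p ∣ d →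
      (∃ n : ℤ, (p : ℤ) ∣ normPoly D n) ∧ (p ∣ D → d.factorization p = 1)) :
    Nat.card (RootMod D d) = 2 ^ (d.primeFactors.filter (fun p => ¬ p ∣ D)).card := by
  induction d using Nat.recOnPosPrimePosCoprime with
  | zero => omega
  | one =>
    have : Unique (RootMod D 1) :=
      { default := ⟨0, Subsingleton.elim (α := ZMod 1) _ _⟩
        uniq := fun x => Subtype.ext (Subsingleton.elim (α := ZMod 1) _ _) }
    rw [Nat.card_unique]
    simp
  | prime_pow p k hp hk =>
    obtain ⟨⟨r, hr⟩, h2⟩ := h p hp (dvd_pow_self p hk.ne')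
    rw [Nat.primeFactors_prime_pow hk.ne' hp]
    by_cases hpD : p ∣ D
    · have := h2 hpD
      rw [Nat.Prime.factorization_pow hp, Finsupp.single_eq_same] at this
      subst this
      rw [pow_one, card_rootMod_ramified hD hp hpD, Finset.filter_singleton]
      simp [hpD]
    · rw [card_rootMod_split hD hp hpD hr hk, Finset.filter_singleton]
      simp [hpD]
  | coprime a b ha hb hab iha ihb =>
    have hfac : ∀ p, (a * b).factorization p = a.factorization p + b.factorization p := by
      intro p; rw [Nat.factorization_mul (by omega) (by omega)]; rfl
    rw [card_rootMod_mul D hab, iha (by omega) ?_, ihb (by omega) ?_, ← pow_add,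
      Nat.Coprime.primeFactors_mul hab, Finset.filter_union, Finset.card_union_of_disjoint]
    · exact Finset.disjoint_filter_filter hab.disjoint_primeFactors
    · intro p hp hpb
      obtain ⟨h1, h2⟩ := h p hp (Dvd.dvd.mul_left hpb a)
      refine ⟨h1, fun hpD => ?_⟩
      have h3 := h2 hpD
      rw [hfac, Nat.factorization_eq_zero_of_not_dvd (n := a)
        (fun hpa => hp.one_lt.ne' (Nat.eq_one_of_dvd_coprimes hab hpa hpb))] at h3
      omega
    · intro p hp hpa
      obtain ⟨h1, h2⟩ := h p hp (Dvd.dvd.mul_right hpa b)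
      refine ⟨h1, fun hpD => ?_⟩
      have h3 := h2 hpD
      rw [hfac, Nat.factorization_eq_zero_of_not_dvd (n := b)
        (fun hpb => hp.one_lt.ne' (Nat.eq_one_of_dvd_coprimes hab hpa hpb))] at h3
      omega

/-- The number of primitive ideals of norm `d`. -/
lemma ncard_primitiveIdeals_eq {D : ℕ} [Fact (¬ IsSquare D)] (hD : D % 4 = 0 ∨ D % 4 = 1) {d : ℕ}
    (hd : 0 < d) (hcop : Nat.Coprime d (conductor D)) (h : PrimeFactorCondition D d) :
    (primitiveIdeals D d).ncard = 2 ^ numSplit D d := by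
  rw [ncard_primitiveIdeals hD hd, numSplit_eq hD hd hcop h,
    card_rootMod hD d hd ((primeFactorCondition_iff hD hcop).1 h)]

/-- A root modulo every prime power dividing `d` is what the prime factor condition provides: there
is none modulo an inert prime, and none modulo the square of a ramified one. -/
lemma primitiveIdeals_nonempty_iff {D : ℕ} [Fact (¬ IsSquare D)] (hD : D % 4 = 0 ∨ D % 4 = 1)
    {d : ℕ} (hd : 0 < d) (hcop : Nat.Coprime d (conductor D)) :
    (primitiveIdeals D d).Nonempty ↔ PrimeFactorCondition D d := by
  constructor
  · rintro ⟨𝔞, h𝔞⟩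
    obtain ⟨n, hn, -⟩ := exists_eq_idealOf hD hd h𝔞
    rw [primeFactorCondition_iff hD hcop]
    intro p hp hpd
    have hpd' : (p : ℤ) ∣ d := by exact_mod_cast hpd
    refine ⟨⟨n, hpd'.trans hn⟩, fun hpD => ?_⟩
    have hpc : ¬ p ∣ conductor D := fun h => hp.one_lt.ne' (Nat.eq_one_of_dvd_coprimes hcop hpd h)
    have h1 : 0 < d.factorization p := hp.factorization_pos_of_dvd hd.ne' hpd
    by_contra h2
    have h3 : p ^ 2 ∣ d := (hp.pow_dvd_iff_le_factorization hd.ne').2 (by omega)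
    have h4 : (p : ℤ) ^ 2 ∣ d := by exact_mod_cast h3
    exact not_sq_dvd_normPoly hD hp hpc (dvd_two_mul_add hD hp hpD (hpd'.trans hn)) (h4.trans hn)
  · intro h
    apply Set.nonempty_of_ncard_ne_zero
    rw [ncard_primitiveIdeals_eq hD hd hcop h]
    positivity

/-! ### Symplectic lattices with real multiplication -/

/-- The Chinese remainder theorem in an abelian group. -/
lemma exists_crt {M : Type*} [AddCommGroup M] (S : Finset ℕ) (hS : ∀ p ∈ S, p.Prime) (v : ℕ → M) :
    ∃ y : M, ∀ p ∈ S, ∃ w : M, y = v p + (p : ℤ) • w := by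
  induction S using Finset.induction_on with
  | empty => exact ⟨0, by simp⟩
  | insert q S hq ih =>
    obtain ⟨y, hy⟩ := ih (fun p hp => hS p (Finset.mem_insert_of_mem hp))
    have hq' := hS q (Finset.mem_insert_self q S)
    have hcop : IsCoprime (q : ℤ) ((∏ p ∈ S, p : ℕ) : ℤ) := by
      refine Nat.isCoprime_iff_coprime.2 (Nat.Coprime.prod_right fun p hp => ?_)
      refine (Nat.coprime_primes hq' (hS p (Finset.mem_insert_of_mem hp))).2 ?_
      rintro rfl
      exact hq hp
    obtain ⟨a, b, hab⟩ := hcop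
    refine ⟨y + (b * (∏ p ∈ S, p : ℕ) : ℤ) • (v q - y), fun p hp => ?_⟩
    rcases Finset.mem_insert.1 hp with rfl | hp
    · refine ⟨a • (y - v p), ?_⟩
      have h1 : (b * (∏ p ∈ S, p : ℕ) : ℤ) = 1 - a * p := by linarith
      rw [h1]
      module
    · obtain ⟨w, hw⟩ := hy p hp
      obtain ⟨k, hk⟩ := Finset.dvd_prod_of_mem (fun p : ℕ => p) hp
      refine ⟨w + (b * k) • (v q - y), ?_⟩
      rw [hk, hw]
      push_cast
      module

/-- Linearly independent vectors `u` of a lattice, as many as its rank, stay independent modulo all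
primes not dividing the index `Δ` of their span. -/
lemma exists_index {ι L : Type*} [Fintype ι] [DecidableEq ι] [AddCommGroup L]
    (b : Module.Basis ι ℤ L) (u : ι → L)
    (hu : ∀ x : ι → ℤ, ∑ i, x i • u i = 0 → x = 0) :
    ∃ Δ : ℤ, Δ ≠ 0 ∧ (∀ v, ∃ x : ι → ℤ, Δ • v = ∑ i, x i • u i) ∧
      ∀ p : ℕ, p.Prime → ¬ (p : ℤ) ∣ Δ → ∀ (x : ι → ℤ) (w : L),
        ∑ i, x i • u i = (p : ℤ) • w → ∀ i, (p : ℤ) ∣ x i := by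
  let A : Matrix ι ι ℤ := Matrix.of fun i j => b.repr (u j) i
  have hA : ∀ x : ι → ℤ, ∀ i, b.repr (∑ j, x j • u j) i = A.mulVec x i := by
    intro x i
    simp [A, Matrix.mulVec, dotProduct, mul_comm]
  refine ⟨A.det, fun h0 => ?_, fun v => ?_, fun p hp hpd x w hx i => ?_⟩
  · obtain ⟨x, hx0, hx⟩ := Matrix.exists_mulVec_eq_zero_iff.2 h0
    apply hx0
    apply hu
    apply b.repr.injective
    ext i
    rw [hA, hx]
    simp
  · refine ⟨A.adjugate.mulVec (b.repr v), ?_⟩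
    apply b.repr.injective
    ext i
    rw [hA, Matrix.mulVec_mulVec, Matrix.mul_adjugate]
    simp
  · have h1 : A.mulVec x = (p : ℤ) • (b.repr w : ι → ℤ) := by
      ext j
      rw [← hA, hx]
      simp
    have h2 := congrArg (A.adjugate.mulVec) h1
    rw [Matrix.mulVec_mulVec, Matrix.adjugate_mul, Matrix.mulVec_smul] at h2
    have h3 := congrFun h2 i
    simp at h3
    exact ((Nat.prime_iff_prime_int.1 hp).dvd_or_dvd (Dvd.intro _ h3.symm)).resolve_left hpd

/-- A functional on a pure sublattice extends to the lattice. -/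
lemma exists_extension {L : Type*} [AddCommGroup L] [Module.Free ℤ L] [Module.Finite ℤ L]
    (N : Submodule ℤ L) (hN : ∀ (n : ℤ) (w : L), n ≠ 0 → n • w ∈ N → w ∈ N) (φ : N →ₗ[ℤ] ℤ) :
    ∃ ψ : L →ₗ[ℤ] ℤ, ∀ v : N, ψ v = φ v := by
  have : Module.IsTorsionFree ℤ (L ⧸ N) := by
    refine Module.IsTorsionFree.of_smul_eq_zero fun r m h => ?_
    obtain ⟨w, rfl⟩ := N.mkQ_surjective m
    by_contra! h1
    rw [← map_smul, Submodule.mkQ_apply, Submodule.Quotient.mk_eq_zero] at h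
    apply h1.2
    rw [Submodule.mkQ_apply, Submodule.Quotient.mk_eq_zero]
    exact hN r w h1.1 h
  have : Module.Free ℤ (L ⧸ N) := inferInstance
  obtain ⟨s, hs⟩ := Module.projective_lifting_property N.mkQ LinearMap.id N.mkQ_surjective
  have hmem : ∀ v, v - s (N.mkQ v) ∈ N := by
    intro v
    rw [← Submodule.Quotient.mk_eq_zero, ← Submodule.mkQ_apply, map_sub]
    have := LinearMap.congr_fun hs (N.mkQ v)
    rw [LinearMap.comp_apply, LinearMap.id_apply] at this
    rw [this, sub_self]
  refine ⟨φ ∘ₗ LinearMap.codRestrict N (LinearMap.id - s ∘ₗ N.mkQ) hmem, fun v => ?_⟩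
  rw [LinearMap.comp_apply]
  congr 1
  apply Subtype.ext
  simp [(Submodule.Quotient.mk_eq_zero N).2 v.2]

section RMLattice
variable {L : Type*} [AddCommGroup L]

lemma zsmul_injective_of_basis {ι : Type*} (b : Module.Basis ι ℤ L) {n : ℤ} (hn : n ≠ 0) {v w : L}
    (hvw : n • v = n • w) : v = w := by
  apply b.repr.injective
  ext i
  have := congrArg (fun v => b.repr v i) hvw
  simp at this
  exact this.resolve_right hn

/-- `e` and `g e` are linearly independent modulo `p`. -/
def IsGoodAt (g : L →ₗ[ℤ] L) (p : ℕ) (e : L) : Prop :=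
  ∀ (a b : ℤ) (w : L), a • e + b • g e = (p : ℤ) • w → (p : ℤ) ∣ a ∧ (p : ℤ) ∣ b

lemma IsGoodAt.congr {g : L →ₗ[ℤ] L} {p : ℕ} {e e' w : L} (h : IsGoodAt g p e)
    (he : e' = e + (p : ℤ) • w) : IsGoodAt g p e' := by
  intro a b v hv
  apply h a b (v - a • w - b • g w)
  rw [he, map_add, map_smul] at hv
  rw [smul_sub, smul_sub, ← hv]
  module

/-- A vector that is not good at `p` is an eigenvector of `g` modulo `p`; for `e` divisible by `p`
this holds trivially. -/
lemma exists_eigen_of_not_isGoodAt {g : L →ₗ[ℤ] L} {p : ℕ} (hp : p.Prime) {e : L}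
    (h : ¬ IsGoodAt g p e) : ∃ (c : ℤ) (w : L), g e = c • e + (p : ℤ) • w := by
  have hp' := Nat.prime_iff_prime_int.1 hp
  unfold IsGoodAt at h
  push Not at h
  obtain ⟨a, b, w, hw, hab⟩ := h
  by_cases hb : (p : ℤ) ∣ b
  · have ha : ¬ (p : ℤ) ∣ a := fun ha => hab ha hb
    obtain ⟨k, rfl⟩ := hb
    obtain ⟨u, v, huv⟩ := (hp'.coprime_iff_not_dvd).2 ha
    have h1 : e = (p : ℤ) • (u • e + v • w - (v * k) • g e) := by
      have h2 : e = (u * p + v * a) • e := by rw [huv, one_smul]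
      have h3 : a • e = (p : ℤ) • w - (p * k) • g e := by rw [← hw]; module
      calc e = (u * p) • e + v • (a • e) := by rw [smul_smul, ← add_smul, ← h2]
        _ = _ := by rw [h3]; module
    refine ⟨0, g (u • e + v • w - (v * k) • g e), ?_⟩
    rw [zero_smul, zero_add, ← map_smul, ← h1]
  · obtain ⟨u, v, huv⟩ := (hp'.coprime_iff_not_dvd).2 hb
    refine ⟨-(v * a), u • g e + v • w, ?_⟩
    have h2 : g e = (u * p + v * b) • g e := by rw [huv, one_smul]
    have h3 : b • g e = (p : ℤ) • w - a • e := by rw [← hw]; module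
    calc g e = (u * p) • g e + v • (b • g e) := by rw [smul_smul, ← add_smul, ← h2]
      _ = _ := by rw [h3]; module

/-- Modulo `p`, any vector `e` becomes good after adding an element of the `g`-stable plane of a
good vector `f`. -/
lemma IsGoodAt.exists_add {g : L →ₗ[ℤ] L} {p : ℕ} (hp : p.Prime) {f : L} (hf : IsGoodAt g p f)
    (e : L) :
    ∃ s t : ℤ, IsGoodAt g p (e + (s • f + t • g f)) := by
  have hp' := Nat.prime_iff_prime_int.1 hp
  by_cases he : IsGoodAt g p e
  · exact ⟨0, 0, by simpa using he⟩
  obtain ⟨c, w, hw⟩ := exists_eigen_of_not_isGoodAt hp he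
  by_cases hspan : ∃ (s t : ℤ) (v : L), e = s • f + t • g f + (p : ℤ) • v
  · obtain ⟨s, t, v, rfl⟩ := hspan
    refine ⟨1 - s, -t, hf.congr (w := v) ?_⟩
    module
  · refine ⟨1, 0, fun a c' v hv => ?_⟩
    have h1 : (a + c' * c) • e + (a • f + c' • g f) = (p : ℤ) • (v - c' • w) := by
      rw [smul_sub, ← hv]
      simp only [one_smul, zero_smul, add_zero, map_add, hw]
      module
    by_cases hac : (p : ℤ) ∣ a + c' * c
    · obtain ⟨k, hk⟩ := hac
      apply hf a c' (v - c' • w - k • e)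
      rw [smul_sub, ← h1, hk]
      module
    · exfalso
      apply hspan
      obtain ⟨x, y, hxy⟩ := (hp'.coprime_iff_not_dvd).2 hac
      refine ⟨-(y * a), -(y * c'), x • e + y • (v - c' • w), ?_⟩
      have h2 : (a + c' * c) • e = (p : ℤ) • (v - c' • w) - (a • f + c' • g f) := by
        rw [← h1]; module
      calc e = (x * p + y * (a + c' * c)) • e := by rw [hxy, one_smul]
        _ = (x * p) • e + y • ((a + c' * c) • e) := by module
        _ = _ := by rw [h2]; module

/-- If all vectors are eigenvectors modulo `p`, then `g` is a scalar modulo `p`. -/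
lemma exists_isGoodAt {ι : Type*} [Finite ι] (b : Module.Basis ι ℤ L) (g : L →ₗ[ℤ] L) {p : ℕ}
    (hp : p.Prime) (hns : ¬ ∃ c : ℤ, ∀ v, ∃ w, g v = c • v + (p : ℤ) • w) :
    ∃ e, IsGoodAt g p e := by
  classical
  have := Fintype.ofFinite ι
  by_contra! hbad
  apply hns
  have hev := fun v => exists_eigen_of_not_isGoodAt hp (hbad v)
  choose c w hcw using fun i => hev (b i)
  rcases isEmpty_or_nonempty ι with hι | ⟨⟨i₀⟩⟩
  · refine ⟨0, fun v => ⟨0, ?_⟩⟩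
    rw [b.ext_elem_iff]
    exact fun i => hι.elim i
  have hc : ∀ i, (p : ℤ) ∣ c i - c i₀ := by
    intro i
    rcases eq_or_ne i i₀ with rfl | hne
    · simp
    obtain ⟨c', w', h'⟩ := hev (b i + b i₀)
    rw [map_add, hcw, hcw] at h'
    have h1 : (c i - c') • b i + (c i₀ - c') • b i₀ = (p : ℤ) • (w' - w i - w i₀) := by
      rw [smul_sub, smul_sub]
      linear_combination (norm := module) h'
    have h2 := congrArg (fun v => b.repr v i) h1
    have h3 := congrArg (fun v => b.repr v i₀) h1
    simp [hne, hne.symm] at h2 h3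
    have h4 : c i - c i₀ = (c i - c') - (c i₀ - c') := by ring
    rw [h4, h2, h3]
    exact dvd_sub (Dvd.intro _ rfl) (Dvd.intro _ rfl)
  choose k hk using hc
  refine ⟨c i₀, fun v => ⟨∑ i, b.repr v i • (w i + k i • b i), ?_⟩⟩
  conv_lhs => rw [← b.sum_repr v]
  conv_rhs => enter [1, 2]; rw [← b.sum_repr v]
  rw [map_sum, Finset.smul_sum, Finset.smul_sum, ← Finset.sum_add_distrib]
  refine Finset.sum_congr rfl fun i _ => ?_
  rw [map_smul, hcw]
  have h1 : c i = c i₀ + p * k i := by linarith [hk i]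
  rw [h1]
  module

/-- The data of a lattice of rank `4` with an alternating form of type `(1, d)` and a self-adjoint
endomorphism `g`, not a scalar modulo any prime, with characteristic equation `g² = D g - N`. -/
structure IsRMLattice (D N d : ℤ) (b : Module.Basis (Fin 2 ⊕ Fin 2) ℤ L)
    (E : L →ₗ[ℤ] L →ₗ[ℤ] ℤ) (g : L →ₗ[ℤ] L) : Prop where
  alt : ∀ v w, E v w = - E w v
  inl_inl : ∀ i j, E (b (Sum.inl i)) (b (Sum.inl j)) = 0
  inr_inr : ∀ i j, E (b (Sum.inr i)) (b (Sum.inr j)) = 0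
  inl_inr : ∀ i j, E (b (Sum.inl i)) (b (Sum.inr j)) = if i = j then (![1, d] i) else 0
  sq : ∀ v, g (g v) = D • g v - N • v
  selfAdjoint : ∀ v w, E (g v) w = E v (g w)
  irr : ∀ x y : ℤ, x ^ 2 + D * (x * y) + N * y ^ 2 = 0 → x = 0 ∧ y = 0
  nonscalar : ∀ p : ℕ, p.Prime → ¬ ∃ c : ℤ, ∀ v, ∃ w, g v = c • v + (p : ℤ) • w

namespace IsRMLattice
variable {D N d : ℤ} {b : Module.Basis (Fin 2 ⊕ Fin 2) ℤ L} {E : L →ₗ[ℤ] L →ₗ[ℤ] ℤ}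
  {g : L →ₗ[ℤ] L} (h : IsRMLattice D N d b E g)
include h

/-- Vectors `f`, `x` on different `K`-lines are independent together with their images. -/
lemma independent {f x : L} (hf : f ≠ 0)
    (hx : ∀ n s t : ℤ, n • x = s • f + t • g f → n = 0) {s t s' t' : ℤ}
    (h0 : s • f + t • g f + (s' • x + t' • g x) = 0) : s = 0 ∧ t = 0 ∧ s' = 0 ∧ t' = 0 := by
  have hconj : ∀ (v : L) (a c : ℤ), (a + D * c) • (a • v + c • g v) - c • g (a • v + c • g v) =
      (a ^ 2 + D * (a * c) + N * c ^ 2) • v := by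
    intro v a c
    rw [map_add, map_smul, map_smul, h.sq]
    module
  have h1 := hconj x s' t'
  have h2 : s' • x + t' • g x = -(s • f + t • g f) := by
    rw [eq_neg_iff_add_eq_zero, add_comm]; exact h0
  rw [h2] at h1
  have h3 : (s' ^ 2 + D * (s' * t') + N * t' ^ 2) • x =
      (-(s' + D * t') * s - t' * N * t) • f + (-(s' + D * t') * t + t' * s + t' * D * t) • g f := by
    rw [← h1, map_neg, map_add, map_smul, map_smul, h.sq]
    module
  obtain ⟨rfl, rfl⟩ := h.irr _ _ (hx _ _ _ h3)
  have h4 : s • f + t • g f = 0 := by simpa using h0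
  have h5 := hconj f s t
  rw [h4] at h5
  have h6 : s ^ 2 + D * (s * t) + N * t ^ 2 = 0 := by
    by_contra hne
    apply hf
    apply zsmul_injective_of_basis b hne
    rw [← h5]; simp
  obtain ⟨rfl, rfl⟩ := h.irr _ _ h6
  exact ⟨rfl, rfl, rfl, rfl⟩

/-- If `x` is not in the `K`-line of `f`, the four vectors `f, g f, x, g x` span a sublattice of
finite index. Some nonzero `Δ` maps the lattice into this sublattice, and the four vectors stay
independent modulo every prime not dividing `Δ`. -/
lemma exists_index_pair {f x : L} (hf : f ≠ 0)
    (hx : ∀ n s t : ℤ, n • x = s • f + t • g f → n = 0) :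
    ∃ Δ : ℤ, Δ ≠ 0 ∧
      (∀ v, ∃ s t s' t' : ℤ, Δ • v = s • f + t • g f + (s' • x + t' • g x)) ∧
      ∀ p : ℕ, p.Prime → ¬ (p : ℤ) ∣ Δ → ∀ (s t s' t' : ℤ) (w : L),
        s • f + t • g f + (s' • x + t' • g x) = (p : ℤ) • w →
        (p : ℤ) ∣ s ∧ (p : ℤ) ∣ t ∧ (p : ℤ) ∣ s' ∧ (p : ℤ) ∣ t' := by
  obtain ⟨Δ, h1, h2, h3⟩ := exists_index b (Sum.elim ![f, g f] ![x, g x]) (by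
    intro y hy
    simp [Fin.sum_univ_two] at hy
    obtain ⟨e1, e2, e3, e4⟩ := h.independent hf hx hy
    ext i
    rcases i with i | i <;> fin_cases i <;> assumption)
  refine ⟨Δ, h1, fun v => ?_, fun p hp hpd s t s' t' w hw => ?_⟩
  · obtain ⟨y, hy⟩ := h2 v
    simp [Fin.sum_univ_two] at hy
    exact ⟨_, _, _, _, hy⟩
  · have := h3 p hp hpd (Sum.elim ![s, t] ![s', t']) w (by simpa [Fin.sum_univ_two] using hw)
    exact ⟨this (Sum.inl 0), this (Sum.inl 1), this (Sum.inr 0), this (Sum.inr 1)⟩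

/-- There is `e` such that `ℤ e ⊕ ℤ g e` is a pure sublattice. First a vector `f` is fixed, then `e`
is made good at the finitely many primes where `f` is not good; this leaves finitely many primes, where
`e` is corrected by an element of the `K`-line of `f`. -/
lemma exists_isGoodAt_forall : ∃ e, ∀ p : ℕ, p.Prime → IsGoodAt g p e := by
  let f := b (Sum.inl 0)
  let x₀ := b (Sum.inr 0)
  have hE1 : E f x₀ = 1 := by simp [f, x₀, h.inl_inr]
  have hf : f ≠ 0 := b.ne_zero _
  have hfgf : E f (g f) = 0 := by
    have h1 := h.alt f (g f)
    rw [h.selfAdjoint] at h1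
    omega
  have hff : E f f = 0 := h.inl_inl 0 0
  have hx₀ : ∀ n s t : ℤ, n • x₀ = s • f + t • g f → n = 0 := by
    intro n s t hn
    have := congrArg (E f) hn
    simpa [hE1, hff, hfgf] using this
  -- `f` is good outside the finite set `B` of primes dividing `Δ₀`
  obtain ⟨Δ₀, hΔ₀, -, hgood₀⟩ := h.exists_index_pair hf hx₀
  let B := Δ₀.natAbs.primeFactors
  have memB : ∀ p : ℕ, p.Prime → (p ∈ B ↔ (p : ℤ) ∣ Δ₀) := by
    intro p hp
    rw [Nat.mem_primeFactors, Int.natCast_dvd]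
    exact ⟨fun h => h.2.1, fun h => ⟨hp, h, Int.natAbs_ne_zero.2 hΔ₀⟩⟩
  have hBprime : ∀ p ∈ B, p.Prime := fun p hp => Nat.prime_of_mem_primeFactors hp
  have hfgood : ∀ p : ℕ, p.Prime → p ∉ B → IsGoodAt g p f := by
    intro p hp hpB s t w hw
    have := hgood₀ p hp (fun hd => hpB ((memB p hp).2 hd)) s t 0 0 w (by simpa using hw)
    exact ⟨this.1, this.2.1⟩
  -- `e₁` is good at the primes in `B`
  choose! good hgood using fun (p : ℕ) (hp : p.Prime) => exists_isGoodAt b g hp (h.nonscalar p hp)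
  obtain ⟨e₁, he₁⟩ := exists_crt B hBprime good
  have he₁' : ∀ p ∈ B, IsGoodAt g p e₁ := by
    intro p hp
    obtain ⟨w, hw⟩ := he₁ p hp
    exact (hgood p (hBprime p hp)).congr hw
  -- `e₂` is moreover not on the `K`-line of `f`
  obtain ⟨e₂, he₂, he₂'⟩ : ∃ e₂, (∀ p ∈ B, IsGoodAt g p e₂) ∧
      ∀ n s t : ℤ, n • e₂ = s • f + t • g f → n = 0 := by
    by_cases hin : ∀ n s t : ℤ, n • e₁ = s • f + t • g f → n = 0
    · exact ⟨e₁, he₁', hin⟩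
    push Not at hin
    obtain ⟨n, s, t, hn, hn0⟩ := hin
    have hP : ((∏ p ∈ B, p : ℕ) : ℤ) ≠ 0 := by
      rw [Int.natCast_ne_zero, Finset.prod_ne_zero_iff]
      exact fun p hp => (hBprime p hp).ne_zero
    refine ⟨e₁ + ((∏ p ∈ B, p : ℕ) : ℤ) • x₀, fun p hp => ?_, fun n' s' t' hn' => ?_⟩
    · obtain ⟨k, hk⟩ := Finset.dvd_prod_of_mem (fun p : ℕ => p) hp
      refine (he₁' p hp).congr (w := (k : ℤ) • x₀) ?_
      rw [hk, smul_smul]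
      push_cast
      rfl
    · have h1 := hx₀ (n * n' * ((∏ p ∈ B, p : ℕ) : ℤ)) (n * s' - n' * s) (n * t' - n' * t) (by
        have h2 : (n * n' * ((∏ p ∈ B, p : ℕ) : ℤ)) • x₀ =
          n • (n' • (e₁ + ((∏ p ∈ B, p : ℕ) : ℤ) • x₀)) - n' • (n • e₁) := by module
        rw [h2, hn, hn']
        module)
      rcases mul_eq_zero.1 h1 with h3 | h3
      · exact (mul_eq_zero.1 h3).resolve_left hn0
      · exact absurd h3 hP
  -- `e₂`, and every `e₂ + k f` with `k` in the order, is good outside the primes dividing `Δ`; at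
  -- these primes `k` is chosen by the Chinese remainder theorem
  obtain ⟨Δ, hΔ, -, hgood₂⟩ := h.exists_index_pair hf he₂'
  have hst : ∀ p : ℕ, ∃ st : ℤ × ℤ, p.Prime →
      IsGoodAt g p (e₂ + (st.1 • f + st.2 • g f)) := by
    intro p
    by_cases hp : p.Prime
    · by_cases hpB : p ∈ B
      · exact ⟨(0, 0), fun _ => by simpa using he₂ p hpB⟩
      · obtain ⟨s, t, hst⟩ := (hfgood p hp hpB).exists_add hp e₂
        exact ⟨(s, t), fun _ => hst⟩
    · exact ⟨0, fun hp' => absurd hp' hp⟩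
  choose st hst using hst
  obtain ⟨y, hy⟩ := exists_crt Δ.natAbs.primeFactors
    (fun p hp => Nat.prime_of_mem_primeFactors hp) st
  refine ⟨e₂ + (y.1 • f + y.2 • g f), fun p hp => ?_⟩
  by_cases hpΔ : (p : ℤ) ∣ Δ
  · obtain ⟨w, hw⟩ := hy p (Nat.mem_primeFactors.2
      ⟨hp, Int.natCast_dvd.1 hpΔ, Int.natAbs_ne_zero.2 hΔ⟩)
    refine (hst p hp).congr (w := w.1 • f + w.2 • g f) ?_
    rw [hw]
    simp only [Prod.fst_add, Prod.snd_add, Prod.smul_fst, Prod.smul_snd, smul_eq_mul]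
    module
  · intro a c w hw
    have := hgood₂ p hp hpΔ (a * y.1 - c * N * y.2) (a * y.2 + c * y.1 + c * D * y.2) a c w (by
      rw [← hw]
      simp only [map_add, map_smul, h.sq]
      module)
    exact ⟨this.2.2.1, this.2.2.2⟩

/-- There is a vector `e` such that `ℤ e + ℤ g e` is a saturated sublattice of rank two (saturation
is `n ≠ 0`, the rank is `n = 0`). -/
lemma exists_pure : ∃ e, ∀ (n a c : ℤ) (w : L), a • e + c • g e = n • w → n ∣ a ∧ n ∣ c := by
  obtain ⟨e, he⟩ := h.exists_isGoodAt_forall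
  have key : ∀ (n : ℕ) (a c : ℤ) (w : L), a • e + c • g e = (n : ℤ) • w →
      (n : ℤ) ∣ a ∧ (n : ℤ) ∣ c := by
    intro n
    induction n using induction_on_primes with
    | zero =>
      intro a c w hw
      have hall : ∀ p : ℕ, p.Prime → (p : ℤ) ∣ a ∧ (p : ℤ) ∣ c := fun p hp =>
        he p hp a c 0 (by simpa using hw)
      obtain ⟨p, hp, hprime⟩ := Nat.exists_infinite_primes (a.natAbs + c.natAbs + 1)
      obtain ⟨h1, h2⟩ := hall p hprime
      rw [Int.eq_zero_of_dvd_of_natAbs_lt_natAbs h1 (by simp; omega),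
        Int.eq_zero_of_dvd_of_natAbs_lt_natAbs h2 (by simp; omega)]
      simp
    | one => simp
    | prime_mul p m hp ih =>
      intro a c w hw
      push_cast at hw ⊢
      obtain ⟨⟨a', rfl⟩, ⟨c', rfl⟩⟩ := he p hp a c ((m : ℤ) • w) (by rw [hw, smul_smul])
      have h1 : a' • e + c' • g e = (m : ℤ) • w := by
        apply zsmul_injective_of_basis b (n := (p : ℤ)) (by exact_mod_cast hp.ne_zero)
        rw [smul_smul, ← hw]
        module
      obtain ⟨h2, h3⟩ := ih a' c' w h1
      exact ⟨mul_dvd_mul_left _ h2, mul_dvd_mul_left _ h3⟩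
  refine ⟨e, fun n a c w hw => ?_⟩
  rcases Int.natAbs_eq n with hn | hn
  · rw [hn] at hw ⊢; exact key _ a c w hw
  · rw [hn] at hw ⊢
    obtain ⟨h1, h2⟩ := key n.natAbs a c (-w) (by rw [hw]; module)
    exact ⟨(neg_dvd).2 h1, (neg_dvd).2 h2⟩

/-- `d` times a functional is represented by the form. -/
lemma exists_represent (φ : L →ₗ[ℤ] ℤ) : ∃ w, ∀ v, E w v = d * φ v := by
  refine ⟨(d * φ (b (Sum.inr 0))) • b (Sum.inl 0) - (d * φ (b (Sum.inl 0))) • b (Sum.inr 0) +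
    φ (b (Sum.inr 1)) • b (Sum.inl 1) - φ (b (Sum.inl 1)) • b (Sum.inr 1), fun v => ?_⟩
  have : E ((d * φ (b (Sum.inr 0))) • b (Sum.inl 0) - (d * φ (b (Sum.inl 0))) • b (Sum.inr 0) +
    φ (b (Sum.inr 1)) • b (Sum.inl 1) - φ (b (Sum.inl 1)) • b (Sum.inr 1)) = d • φ := by
    have hinr : ∀ i j, E (b (Sum.inr i)) (b (Sum.inl j)) = if j = i then -(![1, d] j) else 0 := by
      intro i j
      rw [h.alt, h.inl_inr]
      split_ifs <;> simp
    refine b.ext fun i => ?_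
    rcases i with i | i <;> fin_cases i <;>
      simp [h.inl_inl, h.inr_inr, h.inl_inr, hinr, mul_comm]
  rw [this]
  rfl

/-- The structure theorem: the lattice is the symplectic module `𝒪 ⊕ 𝔞` for the ideal
`𝔞 = ℤ d ⊕ ℤ (γ + n)`, spelled out on a basis `e, γ e, u₁, u₂`. -/
theorem exists_decomposition (hd : 0 < d) :
    ∃ (e u₁ u₂ : L) (n : ℤ), d ∣ n ^ 2 + D * n + N ∧ g u₁ + n • u₁ = d • u₂ ∧
      E u₁ e = 0 ∧ E u₁ (g e) = d ∧
      ∀ v, ∃ s t s' t' : ℤ, v = s • e + t • g e + (s' • u₁ + t' • u₂) := by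
  obtain ⟨e, he⟩ := h.exists_pure
  have hself : ∀ v, E v (g v) = 0 := by
    intro v
    have h1 := h.alt v (g v)
    rw [h.selfAdjoint] at h1
    omega
  have halt : ∀ v, E v v = 0 := fun v => by have := h.alt v v; omega
  have hgeg : E (g e) (g e) = 0 := halt _
  have heg' : E (g e) e = 0 := by rw [h.selfAdjoint, hself]
  have hzero : ∀ a c : ℤ, a • e + c • g e = 0 → a = 0 ∧ c = 0 := by
    intro a c hac
    obtain ⟨h1, h2⟩ := he 0 a c 0 (by simpa using hac)
    exact ⟨zero_dvd_iff.1 h1, zero_dvd_iff.1 h2⟩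
  have he0 : e ≠ 0 := by
    rintro rfl
    have := (hzero 1 0 (by simp)).1
    omega
  -- a functional with `φ(e) = 0`, `φ(g e) = 1`, by purity
  obtain ⟨w₀, hw₀, hw₀'⟩ : ∃ w₀, E w₀ e = 0 ∧ E w₀ (g e) = d := by
    have hli : LinearIndependent ℤ ![e, g e] := by
      rw [LinearIndependent.pair_iff]; exact hzero
    let B := Module.Basis.span hli
    have : Module.Free ℤ L := Module.Free.of_basis b
    have : Module.Finite ℤ L := Module.Finite.of_basis b
    obtain ⟨ψ, hψ⟩ := exists_extension (Submodule.span ℤ (Set.range ![e, g e])) (by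
      intro n w hn hw
      rw [Matrix.range_cons_cons_empty, Submodule.mem_span_pair] at hw ⊢
      obtain ⟨a, c, hac⟩ := hw
      obtain ⟨⟨a', rfl⟩, ⟨c', rfl⟩⟩ := he n a c w hac
      refine ⟨a', c', zsmul_injective_of_basis b hn ?_⟩
      rw [← hac]
      module) (B.coord 1)
    obtain ⟨w, hw⟩ := h.exists_represent ψ
    have hB0 : ((B 0 : Submodule.span ℤ (Set.range ![e, g e])) : L) = e := by
      simp [B, Module.Basis.span_apply]
    have hB1 : ((B 1 : Submodule.span ℤ (Set.range ![e, g e])) : L) = g e := by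
      simp [B, Module.Basis.span_apply]
    have h1 := hψ (B 0)
    have h2 := hψ (B 1)
    rw [hB0] at h1
    rw [hB1] at h2
    refine ⟨w, ?_, ?_⟩
    · rw [hw, h1]; simp
    · rw [hw, h2]; simp
  -- `κ` is `𝒪`-linear: `w ↦ (E(w, g e) - D E(w, e)) + E(w, e) γ` in coordinates. Its kernel is
  -- `ℤ e + ℤ g e`, and its image is an ideal in normal form
  let κ : L →+ ℤ × ℤ := AddMonoidHom.mk' (fun w => (E w (g e) - D * E w e, E w e)) (by
    intro v w
    ext <;> simp; ring)
  have hκ : ∀ w, κ w = (E w (g e) - D * E w e, E w e) := fun _ => rfl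
  have hκg : ∀ w a c, κ w = (a, c) → κ (g w) = (-N * c, a + D * c) := by
    intro w a c hw
    rw [hκ] at hw ⊢
    obtain ⟨rfl, rfl⟩ := Prod.mk.inj hw
    rw [h.selfAdjoint, h.selfAdjoint, h.sq]
    ext <;> simp
  have hker : ∀ w, κ w = 0 → ∃ s t : ℤ, w = s • e + t • g e := by
    intro w hw
    rw [hκ] at hw
    obtain ⟨h1, h2⟩ := Prod.mk.inj hw
    rw [h2, mul_zero, sub_zero] at h1
    by_contra hne
    have hx : ∀ n s t : ℤ, n • w = s • e + t • g e → n = 0 := by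
      intro n s t hn
      by_contra hn0
      obtain ⟨⟨a', rfl⟩, ⟨c', rfl⟩⟩ := he n s t w hn.symm
      exact hne ⟨a', c', zsmul_injective_of_basis b hn0 (by rw [hn]; module)⟩
    obtain ⟨Δ, hΔ, hspan, -⟩ := h.exists_index_pair he0 hx
    obtain ⟨s, t, s', t', hst⟩ := hspan w₀
    have h3 := congrArg (fun v => E v (g e)) hst
    have h4 : E (g w) (g e) = 0 := by
      rw [h.selfAdjoint, h.sq]
      simp [h1, h2]
    simp [hw₀', hself, hgeg, h1, h4] at h3
    rcases h3 with h3 | h3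
    · exact hΔ h3
    · exact hd.ne' h3
  have hκ0 : κ w₀ = (d, 0) := by rw [hκ, hw₀, hw₀']; simp
  obtain ⟨c, m, n, hc, hm, hmn, hmem⟩ := exists_normal_form D N κ.range (by
    rintro a c ⟨w, hw⟩
    exact ⟨g w, hκg w a c hw⟩) hd.ne' ⟨w₀, hκ0⟩
  obtain ⟨u, v, huv, hcv⟩ := (hmem d 0).1 ⟨w₀, hκ0⟩
  have hv0 : v = 0 := by
    rcases mul_eq_zero.1 hcv.symm with h1 | h1
    · omega
    · exact h1
  subst hv0
  obtain ⟨w₁, hw₁⟩ := (hmem (c * m) 0).2 ⟨1, 0, by ring, by ring⟩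
  obtain ⟨w₂, hw₂⟩ := (hmem (c * n) c).2 ⟨0, 1, by ring, by ring⟩
  obtain ⟨s, t, hst⟩ := hker (g w₁ + n • w₁ - m • w₂) (by
    rw [map_sub, map_add, map_zsmul, map_zsmul, hκg w₁ _ _ hw₁, hw₁, hw₂]
    ext <;> simp <;> ring)
  -- multiplying `(γ + n) w₁ - m w₂ = (s + t γ) e` by the conjugate of `γ + n`
  obtain ⟨l, hl⟩ := hmn
  obtain ⟨-, ⟨r, hr⟩⟩ := he m ((D + n) * s + t * N) (n * t - s)
    (l • w₁ - (D • w₂ - g w₂ + n • w₂)) (by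
      have h1 : (D + n) • (s • e + t • g e) - g (s • e + t • g e) =
        ((D + n) * s + t * N) • e + (n * t - s) • g e := by
        rw [map_add, map_smul, map_smul, h.sq]
        module
      rw [← h1, ← hst]
      simp only [map_add, map_sub, map_smul, h.sq]
      have h2 : (n ^ 2 + D * n + N) • w₁ = (m * l) • w₁ := by rw [hl]
      linear_combination (norm := module) h2)
  -- so `s + t γ = t (γ + n) - m r`, and `w₁`, `w₂` can be corrected
  obtain ⟨u₁, hu₁⟩ : ∃ u₁, u₁ = w₁ - t • e := ⟨_, rfl⟩
  obtain ⟨u₂, hu₂⟩ : ∃ u₂, u₂ = w₂ - r • e := ⟨_, rfl⟩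
  have hκe : κ e = 0 := by rw [hκ, hself, halt]; simp
  have hκu₁ : κ u₁ = (c * m, 0) := by rw [hu₁, map_sub, map_zsmul, hκe, hw₁]; simp
  have hκu₂ : κ u₂ = (c * n, c) := by rw [hu₂, map_sub, map_zsmul, hκe, hw₂]; simp
  have hrel : g u₁ + n • u₁ = m • u₂ := by
    rw [hu₁, hu₂, map_sub, map_smul]
    have h2 : (n * t - s) • e = (m * r) • e := by rw [hr]
    linear_combination (norm := module) hst - h2
  obtain ⟨hu₁g, hu₁e⟩ := Prod.mk.inj ((hκ u₁).symm.trans hκu₁)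
  obtain ⟨hu₂g, hu₂e⟩ := Prod.mk.inj ((hκ u₂).symm.trans hκu₂)
  rw [hu₁e, mul_zero, sub_zero] at hu₁g
  rw [hu₂e] at hu₂g
  replace hu₂g : E u₂ (g e) = c * (D + n) := by linarith
  have hu₁₂ : E u₁ u₂ = 0 := by
    have h1 := congrArg (E u₁) hrel
    simp [hself, halt] at h1
    rcases h1 with h1 | h1
    · omega
    · exact h1
  have hspan : ∀ v, ∃ s t s' t' : ℤ, v = s • e + t • g e + (s' • u₁ + t' • u₂) := by
    intro v
    obtain ⟨s', t', h1, h2⟩ := (hmem (κ v).1 (κ v).2).1 ⟨v, rfl⟩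
    obtain ⟨s, t, h3⟩ := hker (v - (s' • u₁ + t' • u₂)) (by
      rw [map_sub, map_add, map_zsmul, map_zsmul, hκu₁, hκu₂]
      ext <;> simp [h1, h2] <;> ring)
    exact ⟨s, t, s', t', by rw [← h3]; module⟩
  have hanti := fun x y => h.alt x y
  -- `c` divides all values of the form, one of which is `1`
  have hc1 : c = 1 := by
    have hdvd : ∀ v w, c ∣ E v w := by
      intro v w
      obtain ⟨s, t, s', t', rfl⟩ := hspan v
      obtain ⟨q, q₁, q₂, q₃, rfl⟩ := hspan w
      simp only [map_add, map_smul, LinearMap.add_apply, LinearMap.smul_apply, smul_eq_mul, halt,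
        hself, heg', hanti e u₁, hanti e u₂, hanti (g e) u₁, hanti (g e) u₂, hanti u₂ u₁,
        hu₁e, hu₁g, hu₂e, hu₂g, hu₁₂]
      refine ⟨s * -q₃ + t * (-m * q₂ - (D + n) * q₃) + s' * (m * q₁) + t' * (q + (D + n) * q₁), ?_⟩
      ring
    have h1 := hdvd (b (Sum.inl 0)) (b (Sum.inr 0))
    rw [h.inl_inr] at h1
    have := Int.isUnit_iff.1 (isUnit_of_dvd_one (by simpa using h1))
    omega
  subst hc1
  -- `m ∣ d` because `κ w₀ = (d, 0)`; conversely, `d` divides `E(·, b)` for the last basis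
  -- vector `b`, which forces `m b ∈ d L`
  have hmd : m = d := by
    apply Int.dvd_antisymm hm.le hd.le
    · exact ⟨u, by linarith⟩
    · obtain ⟨s, t, s', t', hv⟩ := hspan (b (Sum.inr 1))
      have hall : ∀ w, d ∣ E w (b (Sum.inr 1)) := by
        intro w
        have h1 : E w (b (Sum.inr 1)) = d * b.repr w (Sum.inl 1) := by
          have h2 : E.flip (b (Sum.inr 1)) = d • b.coord (Sum.inl 1) := by
            refine b.ext fun i => ?_
            rcases i with i | i <;> fin_cases i <;> simp [h.inr_inr, h.inl_inr]
          have h3 := LinearMap.congr_fun h2 w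
          simpa using h3
        rw [h1]
        exact Dvd.intro _ rfl
      have h1 := hall u₁
      have h2 := hall u₂
      have h3 := hall e
      have h4 := hall (g e)
      rw [hv] at h1 h2 h3 h4
      simp only [map_add, map_smul, smul_eq_mul, halt, hself, heg', hanti e u₁, hanti e u₂,
        hanti (g e) u₁, hanti (g e) u₂, hanti u₂ u₁, hu₁e, hu₁g, hu₂e, hu₂g, hu₁₂] at h1 h2 h3 h4
      obtain ⟨k1, h1⟩ := h1
      obtain ⟨k2, h2⟩ := h2
      obtain ⟨k3, h3⟩ := h3
      obtain ⟨k4, h4⟩ := h4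
      have h5 : m • b (Sum.inr 1) = d • ((m * k2 - (D + n) * k1) • e + k1 • g e +
          ((-k4 + (D + n) * k3) • u₁ + (-m * k3) • u₂)) := by
        rw [hv]
        have e1 : m * s = d * (m * k2 - (D + n) * k1) := by
          linear_combination m * h2 - (D + n) * h1
        have e2 : m * t = d * k1 := by linear_combination h1
        have e3 : m * s' = d * (-k4 + (D + n) * k3) := by
          linear_combination - h4 + (D + n) * h3
        have e4 : m * t' = d * (-m * k3) := by linear_combination - m * h3
        simp only [smul_add, smul_smul, e1, e2, e3, e4]
      have h6 := congrArg (fun v => b.repr v (Sum.inr 1)) h5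
      simp only [map_smul, Finsupp.smul_apply, Module.Basis.repr_self, Finsupp.single_eq_same,
        smul_eq_mul, mul_one] at h6
      exact ⟨_, h6⟩
  subst hmd
  exact ⟨e, u₁, u₂, n, ⟨l, hl⟩, hrel, hu₁e, by simpa using hu₁g, hspan⟩

end IsRMLattice
end RMLattice

/-! ### Hermitian forms and their imaginary parts -/

/-- The real alternating form `Im H`. -/
def imForm (H : SesqForm) : C3 →ₗ[ℝ] C3 →ₗ[ℝ] ℝ :=
  LinearMap.mk₂ ℝ (fun v w => (H v w).im)
    (fun v v' w => by simp)
    (fun r v w => by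
      rw [← Complex.coe_smul, map_smul]; simp)
    (fun v w w' => by simp)
    (fun r v w => by
      rw [← Complex.coe_smul, map_smulₛₗ]; simp)

lemma imForm_apply (H : SesqForm) (v w : C3) : imForm H v w = (H v w).im := rfl

lemma re_eq_imForm (H : SesqForm) (v w : C3) : (H v w).re = imForm H (Complex.I • v) w := by
  rw [imForm_apply, map_smul]; simp

namespace IsPolarization
variable {Λ : Submodule ℤ C3} {H : SesqForm} (h : IsPolarization Λ H)
include h

lemma alt (v w : C3) : imForm H v w = - imForm H w v := by
  rw [imForm_apply, imForm_apply, h.hermitian v w, Complex.conj_im, neg_neg]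

lemma self_im (v : C3) : (H v v).im = 0 := by
  have := h.alt v v
  rw [imForm_apply] at this
  linarith

lemma eq_zero_of_forall {v : C3} (hv : ∀ w, imForm H v w = 0) : v = 0 := by
  by_contra hne
  have h1 := hv (Complex.I • v)
  rw [h.alt, ← re_eq_imForm] at h1
  have := h.pos v hne
  linarith

/-- Nonzero vectors that are orthogonal in pairs are linearly independent. -/
lemma linearIndependent {ι : Type*} (v : ι → C3) (h0 : ∀ i, v i ≠ 0)
    (ho : ∀ i j, i ≠ j → H (v i) (v j) = 0) : LinearIndependent ℂ v := by
  rw [linearIndependent_iff']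
  intro s c hc i hi
  have h1 : H (∑ j ∈ s, c j • v j) (v i) = c i * H (v i) (v i) := by
    rw [map_sum, LinearMap.sum_apply, Finset.sum_eq_single_of_mem i hi]
    · simp
    · intro j _ hj
      simp [ho j i hj]
  rw [hc] at h1
  have h2 : H (v i) (v i) ≠ 0 := by
    intro h3
    have := h.pos (v i) (h0 i)
    rw [h3] at this
    simp at this
  simpa [h2] using h1.symm

end IsPolarization

/-- An integral form restricted to a lattice. -/
lemma exists_intForm {H : SesqForm} (L : Submodule ℤ C3)
    (hint : ∀ v ∈ L, ∀ w ∈ L, ∃ n : ℤ, (H v w).im = n) :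
    ∃ E : L →ₗ[ℤ] L →ₗ[ℤ] ℤ, ∀ v w : L, (E v w : ℝ) = imForm H v w := by
  choose E hE using fun (v w : L) => hint v v.2 w w.2
  have hE' : ∀ v w : L, (E v w : ℝ) = imForm H v w := fun v w => (hE v w).symm
  refine ⟨LinearMap.mk₂ ℤ E (fun v v' w => ?_) (fun n v w => ?_) (fun v w w' => ?_)
    (fun n v w => ?_), hE'⟩ <;> apply Int.cast_injective (α := ℝ)
  · push_cast; simp [hE']
  · rw [hE', smul_eq_mul]; push_cast; rw [hE', map_zsmul]
    simp
  · push_cast; simp [hE']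
  · rw [hE', smul_eq_mul]; push_cast; rw [hE', map_zsmul]
    simp

/-! ### Frames -/

/-- The two real embeddings of `K`. -/
def emb (D : ℕ) : Fin 2 → K D →+* ℝ := ![toReal D, toRealConj D]

lemma emb_zero {D : ℕ} (x : K D) : emb D 0 x = toReal D x := rfl
lemma emb_one {D : ℕ} (x : K D) : emb D 1 x = toReal D (star x) := rfl

lemma emb_zero_star {D : ℕ} (x : K D) : emb D 0 (star x) = emb D 1 x := rfl
lemma emb_one_star {D : ℕ} (x : K D) : emb D 1 (star x) = emb D 0 x := by
  rw [emb_one, star_star, emb_zero]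

lemma emb_zero_sqrtD {D : ℕ} : emb D 0 (sqrtD D) = Real.sqrt D := toReal_sqrtD D
lemma emb_one_sqrtD {D : ℕ} : emb D 1 (sqrtD D) = - Real.sqrt D := by
  rw [emb_one, star_sqrtD, map_neg, toReal_sqrtD]

lemma emb_injective {D : ℕ} [Fact (¬ IsSquare D)] (i : Fin 2) : Function.Injective (emb D i) :=
  (emb D i).injective

section combo
variable {D : ℕ} {M : Type*} [AddCommGroup M] [Module ℝ M]

/-- The vector `x e₀ + x^σ e₁` attached to `x ∈ K`. -/
def combo (x : K D) (e : Fin 2 → M) : M := emb D 0 x • e 0 + emb D 1 x • e 1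

lemma combo_add (x y : K D) (e : Fin 2 → M) : combo (x + y) e = combo x e + combo y e := by
  simp only [combo, map_add]; module

lemma combo_zero (e : Fin 2 → M) : combo (0 : K D) e = 0 := by
  simp [combo]

lemma combo_one (e : Fin 2 → M) : combo (1 : K D) e = e 0 + e 1 := by
  simp [combo]

lemma combo_intCast_mul (n : ℤ) (x : K D) (e : Fin 2 → M) :
    combo ((n : K D) * x) e = n • combo x e := by
  simp only [combo, map_mul, map_intCast, smul_add, ← Int.cast_smul_eq_zsmul ℝ, smul_smul]

lemma combo_zsmul (n : ℤ) (x : K D) (e : Fin 2 → M) :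
    combo (n • x) e = n • combo x e := by
  rw [← combo_intCast_mul, zsmul_eq_mul]

/-- The vector `x e₀ + x^σ e₁ + y f₀ + y^σ f₁ + p w + q u`. -/
def vec (e f : Fin 2 → M) (u w : M) (x y : K D) (p q : ℝ) : M :=
  combo x e + combo y f + (p • w + q • u)

lemma map_combo {N F : Type*} [AddCommGroup N] [Module ℝ N] [FunLike F M N]
    [LinearMapClass F ℝ M N] (φ : F) (x : K D) (e : Fin 2 → M) :
    φ (combo x e) = combo x (fun i => φ (e i)) := by
  simp only [combo, map_add, map_smul]

end combo

namespace RMThreefold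
variable {D d : ℕ} (P : RMThreefold D d)

/-- The analytic representation of the real multiplication. -/
def actHom : order D →+* Module.End ℂ P.V := (endRing P.Λ P.V).subtype.comp P.ρ

lemma act_eq (k : order D) (v : P.V) : P.act k v = P.actHom k v := rfl

lemma actHom_mem (k : order D) (v : P.V) (hv : (v : C3) ∈ P.Λ) : (P.actHom k v : C3) ∈ P.Λ :=
  (P.ρ k).2 v hv

lemma actHom_selfAdjoint (k : order D) (v w : P.V) :
    P.H (P.actHom k v) w = P.H v (P.actHom k w) := P.selfAdjoint k v w

variable {P} in
/-- Vectors of the tangent space of `S` as vectors of the tangent space of `A`. -/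
def coeV (e : Fin 2 → P.V) : Fin 2 → C3 := fun i => e i

/-- A frame of the tangent space of `S`: vectors `eᵢ`, `fᵢ` that are symplectic for `Im H` and on
which `k ∈ 𝒪_D` acts through the `i`-th real embedding. -/
structure IsRMFrame (e f : Fin 2 → P.V) : Prop where
  ee : imForm P.H (e 0) (e 1) = 0
  ff : imForm P.H (f 0) (f 1) = 0
  fe : ∀ i j, imForm P.H (f i) (e j) = if i = j then 1 else 0
  act_e : ∀ k i, P.actHom k (e i) = emb D i k • e i
  act_f : ∀ k i, P.actHom k (f i) = emb D i k • f i

/-- A frame identifying the lattice of `S` with `𝒪_D ⊕ (1/√D) 𝔞`. -/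
structure IsSurfaceMarking (𝔞 : Ideal (order D)) (e f : Fin 2 → P.V) : Prop where
  frame : P.IsRMFrame e f
  lattice : ∀ v : P.V, (v : C3) ∈ P.Λ ↔ ∃ p ∈ pairLattice 𝔞, v = combo p.1 e + combo p.2 f

end RMThreefold

/-- The columns of the period matrix with respect to an arbitrary frame: the `j`-th column is the
vector with `K`-coordinates `x`, `y` along `e`, `f` and real coordinates `p`, `q` along `w`, `u`,
listed in this order. -/
def frameCol {D : ℕ} [Fact (¬ IsSquare D)] (d : ℕ) (η₁ η₂ : K D) (e f : Fin 2 → C3) (u w : C3)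
    (j : Fin 6) : C3 :=
  vec e f u w ((![η₁, η₂, 0, 0, 0, η₂ / (d : K D)] : Fin 6 → K D) j)
    ((![0, 0, 0, star η₂ / sqrtD D, -(star η₁ / sqrtD D), 0] : Fin 6 → K D) j)
    ((![0, 0, 0, 0, 0, -(1 / (d : ℝ))] : Fin 6 → ℝ) j)
    ((![0, 0, 1, 0, 1 / (d : ℝ), 0] : Fin 6 → ℝ) j)

namespace RMThreefold
variable {D d : ℕ} [Fact (¬ IsSquare D)] (P : RMThreefold D d)

/-- The two eigenspaces of the real multiplication are orthogonal because it is self-adjoint. -/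
lemma H_eq_zero_of_eigen {v w : P.V} {i j : Fin 2} (hij : i ≠ j)
    (hv : ∀ k, P.actHom k v = emb D i k • v) (hw : ∀ k, P.actHom k w = emb D j k • w) :
    P.H v w = 0 := by
  have h1 := P.actHom_selfAdjoint ⟨sqrtD D, sqrtD_mem_order D⟩ v w
  rw [hv, hw] at h1
  simp only [Submodule.coe_smul_of_tower] at h1
  rw [← Complex.coe_smul, ← Complex.coe_smul, map_smul, map_smulₛₗ] at h1
  have hs := sqrt_D_pos (D := D)
  simp only [LinearMap.smul_apply, smul_eq_mul, Complex.conj_ofReal, mul_eq_mul_right_iff,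
    Complex.ofReal_inj] at h1
  refine h1.resolve_left ?_
  fin_cases i <;> fin_cases j <;> simp [emb_zero_sqrtD, emb_one_sqrtD] at hij ⊢ <;> linarith

/-- A frame of the tangent space of `A` that is adapted to `V` and its orthogonal complement. -/
structure IsFrame (e f : Fin 2 → P.V) (u w : C3) : Prop where
  frame : P.IsRMFrame e f
  eu : ∀ i, imForm P.H (e i) u = 0
  ew : ∀ i, imForm P.H (e i) w = 0
  fu : ∀ i, imForm P.H (f i) u = 0
  fw : ∀ i, imForm P.H (f i) w = 0
  wu : imForm P.H w u = d

/-- A frame of the tangent space of `A` in which the lattice is given by the columns of the period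
matrix. -/
structure IsMarking (η₁ η₂ : K D) (e f : Fin 2 → P.V) (u w : C3) : Prop where
  frame : P.IsFrame e f u w
  lattice : P.Λ = Submodule.span ℤ (Set.range (frameCol d η₁ η₂ (coeV e) (coeV f) u w))

namespace IsRMFrame
variable {P} {e f : Fin 2 → P.V} (h : P.IsRMFrame e f)
include h

omit [Fact (¬ IsSquare D)] in
lemma e_ne_zero (i : Fin 2) : (e i : C3) ≠ 0 := by
  intro h0
  have := h.fe i i
  rw [h0] at this
  simp at this

lemma H_e {i j : Fin 2} (hij : i ≠ j) : P.H (e i) (e j) = 0 :=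
  P.H_eq_zero_of_eigen hij (fun k => h.act_e k i) (fun k => h.act_e k j)

lemma linearIndependent_e : LinearIndependent ℂ e := by
  have := P.isPolarization.linearIndependent (fun i => (e i : C3)) h.e_ne_zero
    (fun i j hij => h.H_e hij)
  exact LinearIndependent.of_comp P.V.subtype this

lemma exists_coords (v : P.V) : ∃ c : Fin 2 → ℂ, v = c 0 • e 0 + c 1 • e 1 := by
  have hspan := h.linearIndependent_e.span_eq_top_of_card_eq_finrank' (by
    rw [P.finrank_V, Fintype.card_fin])
  have hv : v ∈ Submodule.span ℂ (Set.range e) := by rw [hspan]; trivial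
  obtain ⟨c, hc⟩ := (Submodule.mem_span_range_iff_exists_fun ℂ).1 hv
  exact ⟨c, by rw [← hc, Fin.sum_univ_two]⟩

/-- The vectors `eᵢ` and `fᵢ` span the same eigenline; their quotient lies in the upper half plane
because `H` is positive definite. -/
lemma exists_uniformize : ∃ z : Fin 2 → UpperHalfPlane,
    (∀ i, f i = (z i : ℂ) • e i) ∧ ∀ i, P.H (e i) (e i) = ((1 / (z i).im : ℝ) : ℂ) := by
  have key : ∀ i, ∃ z : UpperHalfPlane, f i = (z : ℂ) • e i ∧
      P.H (e i) (e i) = ((1 / z.im : ℝ) : ℂ) := by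
    intro i
    have hpos := P.isPolarization.pos _ (h.e_ne_zero i)
    have him := P.isPolarization.self_im (e i)
    obtain ⟨c, hc⟩ := h.exists_coords (f i)
    have hfi : ∃ z : ℂ, f i = z • e i := by
      have h0 : ∀ j, j ≠ i → c j = 0 := by
        intro j hj
        have h1 : P.H (f i) (e j) = c j * P.H (e j) (e j) := by
          rw [hc]
          have h01 := h.H_e (i := 0) (j := 1) (by decide)
          have h10 := h.H_e (i := 1) (j := 0) (by decide)
          fin_cases j <;> simp [h01, h10]
        rw [P.H_eq_zero_of_eigen hj.symm (fun k => h.act_f k i) (fun k => h.act_e k j)] at h1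
        refine (mul_eq_zero.1 h1.symm).resolve_right fun h2 => ?_
        have := P.isPolarization.pos _ (h.e_ne_zero j)
        rw [h2] at this
        simp at this
      refine ⟨c i, ?_⟩
      rw [hc]
      fin_cases i
      · simp [h0 1 (by decide)]
      · simp [h0 0 (by decide)]
    obtain ⟨z, hz⟩ := hfi
    have h1 := h.fe i i
    rw [hz, if_pos rfl, imForm_apply, Submodule.coe_smul, map_smul, LinearMap.smul_apply,
      smul_eq_mul, Complex.mul_im, him, mul_zero, zero_add] at h1
    have hzim : 0 < z.im := by
      by_contra hneg
      have : z.im * (P.H (e i) (e i)).re ≤ 0 :=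
        mul_nonpos_of_nonpos_of_nonneg (not_lt.1 hneg) hpos.le
      linarith
    refine ⟨⟨z, hzim⟩, hz, ?_⟩
    apply Complex.ext
    · rw [Complex.ofReal_re]
      change _ = 1 / z.im
      field_simp
      linarith
    · rw [him, Complex.ofReal_im]
  choose z hz using key
  exact ⟨z, fun i => (hz i).1, fun i => (hz i).2⟩

/-- On the frame, `Im H` is the trace pairing. -/
lemma imForm_combo (x y x' y' : K D) :
    imForm P.H (combo x e + combo y f : P.V) (combo x' e + combo y' f : P.V) =
      emb D 0 (x' * y - x * y') + emb D 1 (x' * y - x * y') := by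
  have a1 := h.ee
  have a2 := h.ff
  have a3 := P.isPolarization.alt (e 1) (e 0)
  have a4 := P.isPolarization.alt (f 1) (f 0)
  have a5 := fun i j => P.isPolarization.alt (e i) (f j)
  have a6 := h.fe
  have a7 := fun v => P.isPolarization.self_im v
  simp only [← imForm_apply] at a7
  simp only [combo, Submodule.coe_add, Submodule.coe_smul_of_tower, map_add, map_smul,
    LinearMap.add_apply, LinearMap.smul_apply, smul_eq_mul, a1, a2, a3, a4, a5, a6, a7, map_mul,
    map_sub]
  simp
  ring

end IsRMFrame

end RMThreefold

namespace RMThreefold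

/-! ### The lattice of the subsurface -/

section
variable {D d : ℕ} (P : RMThreefold D d)

lemma real_smul_eq (r : ℝ) (v : P.V) : r • v = (r : ℂ) • v :=
  Subtype.ext (funext fun i => by simp)

/-- The action of `√D`. -/
def sqrtEnd : Module.End ℂ P.V := P.actHom ⟨sqrtD D, sqrtD_mem_order D⟩

lemma sqrtEnd_sqrtEnd (v : P.V) : P.sqrtEnd (P.sqrtEnd v) = (D : ℝ) • v := by
  have h1 : (⟨sqrtD D, sqrtD_mem_order D⟩ : order D) * ⟨sqrtD D, sqrtD_mem_order D⟩ = (D : order D) :=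
    Subtype.ext (sqrtD_mul_sqrtD D)
  have h2 := congrArg P.actHom h1
  rw [map_mul, map_natCast] at h2
  have h3 := LinearMap.congr_fun h2 v
  rw [Module.End.natCast_apply, ← Nat.cast_smul_eq_nsmul ℝ] at h3
  exact h3

lemma actHom_apply (hD : D % 4 = 0 ∨ D % 4 = 1) (k : order D) (v : P.V) :
    P.actHom k v = ((k : K D).re : ℝ) • v + ((k : K D).im : ℝ) • P.sqrtEnd v := by
  obtain ⟨a, b, hab⟩ := (mem_order_iff hD).1 k.2
  have h1 : (2 : ℤ) * k = ((2 * a + b * D : ℤ) : order D) +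
      (b : order D) * ⟨sqrtD D, sqrtD_mem_order D⟩ := by
    apply Subtype.ext
    change ((2 : ℤ) : K D) * (k : K D) = ((2 * a + b * D : ℤ) : K D) + (b : K D) * sqrtD D
    rw [hab, sqrtD_eq]
    push_cast
    ring
  have h2 := congrArg P.actHom h1
  rw [map_mul, map_intCast, map_add, map_mul, map_intCast, map_intCast] at h2
  have h3 := LinearMap.congr_fun h2 v
  simp only [Module.End.mul_apply, LinearMap.add_apply, Module.End.intCast_apply] at h3
  simp only [← Int.cast_smul_eq_zsmul ℝ] at h3
  have h4 : P.actHom k v = (1 / 2 : ℝ) • (((2 : ℤ) : ℝ) • P.actHom k v) := by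
    rw [smul_smul]; norm_num
  rw [h4, h3, hab]
  simp only [sqrtEnd, gamma, QuadraticAlgebra.re_add, QuadraticAlgebra.im_add,
    QuadraticAlgebra.re_mul, QuadraticAlgebra.im_mul, QuadraticAlgebra.re_intCast,
    QuadraticAlgebra.im_intCast]
  push_cast
  module

/-- The components of `v` in the eigenspaces of `√D`. -/
def eigenParts (v : P.V) : Fin 2 → P.V :=
  ![(1 / 2 : ℝ) • (v + (1 / Real.sqrt D) • P.sqrtEnd v),
    (1 / 2 : ℝ) • (v - (1 / Real.sqrt D) • P.sqrtEnd v)]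

lemma combo_eigenParts [Fact (¬ IsSquare D)] (y : K D) (v : P.V) :
    combo y (P.eigenParts v) = (y.re : ℝ) • v + (y.im : ℝ) • P.sqrtEnd v := by
  have hs := (sqrt_D_pos (D := D)).ne'
  simp only [combo, emb_zero, emb_one, toReal_apply, eigenParts]
  simp
  match_scalars
  · ring
  · field_simp; ring

lemma act_eigenParts [Fact (¬ IsSquare D)] (hD : D % 4 = 0 ∨ D % 4 = 1) (v : P.V) (k : order D)
    (i : Fin 2) : P.actHom k (P.eigenParts v i) = emb D i k • P.eigenParts v i := by
  have hs := (sqrt_D_pos (D := D)).ne'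
  have hss : Real.sqrt D * Real.sqrt D = D := Real.mul_self_sqrt (Nat.cast_nonneg D)
  have hDne : (D : ℝ) ≠ 0 := by rw [← hss]; exact mul_ne_zero hs hs
  rw [P.actHom_apply hD]
  fin_cases i
  · simp [eigenParts, emb_zero, toReal_apply, LinearMap.map_smul_of_tower, sqrtEnd_sqrtEnd]
    match_scalars
    · field_simp
      linear_combination (-((k : K D).im : ℝ)) * hss
    · field_simp
  · simp [eigenParts, emb_one, toReal_star, LinearMap.map_smul_of_tower, sqrtEnd_sqrtEnd]
    match_scalars
    · field_simp
      linear_combination (((k : K D).im : ℝ)) * hss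
    · field_simp
      ring

variable [Fact (¬ IsSquare D)]

/-- The action of `K` on the tangent space of `S`. -/
def fieldAct : K D →+* Module.End ℂ P.V where
  toFun y := ((y.re : ℝ) : ℂ) • 1 + ((y.im : ℝ) : ℂ) • P.sqrtEnd
  map_one' := by ext v; simp [QuadraticAlgebra.re_one, QuadraticAlgebra.im_one]
  map_zero' := by ext v; simp
  map_add' x y := by
    ext v; simp [add_smul]; ring
  map_mul' x y := by
    refine LinearMap.ext fun v => ?_
    simp only [LinearMap.add_apply, LinearMap.smul_apply, Module.End.one_apply,
      Module.End.mul_apply, map_add, map_smul, sqrtEnd_sqrtEnd, QuadraticAlgebra.re_mul,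
      QuadraticAlgebra.im_mul]
    rw [P.real_smul_eq]
    push_cast
    module

omit [Fact (¬ IsSquare D)] in
lemma fieldAct_apply (y : K D) (v : P.V) :
    P.fieldAct y v = (y.re : ℝ) • v + (y.im : ℝ) • P.sqrtEnd v := by
  rw [P.real_smul_eq, P.real_smul_eq]; rfl

omit [Fact (¬ IsSquare D)] in
lemma fieldAct_coe (hD : D % 4 = 0 ∨ D % 4 = 1) (k : order D) : P.fieldAct k = P.actHom k := by
  refine LinearMap.ext fun v => ?_
  rw [fieldAct_apply, actHom_apply P hD]

/-- The lattice of the subsurface `S`. -/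
abbrev surfaceLattice : Submodule ℤ C3 := P.Λ ⊓ P.V.restrictScalars ℤ

/-- The inclusion of the lattice of `S` into the tangent space of `S`. -/
def toV : P.surfaceLattice →ₗ[ℤ] P.V where
  toFun v := ⟨v, v.2.2⟩
  map_add' _ _ := rfl
  map_smul' _ _ := rfl

omit [Fact (¬ IsSquare D)] in
lemma toV_injective : Function.Injective P.toV := fun v w h => by
  apply Subtype.ext
  exact congrArg (fun x : P.V => (x : C3)) h

/-- The multiplier ring of the lattice of `S` is `𝒪_D`, since the real multiplication is proper. -/
lemma mem_order_of_fieldAct (hD : D % 4 = 0 ∨ D % 4 = 1) {x : K D}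
    (hx : ∀ v : P.V, (v : C3) ∈ P.Λ → (P.fieldAct x v : C3) ∈ P.Λ) : x ∈ order D := by
  let R : Subring (K D) := (endRing P.Λ P.V).comap P.fieldAct
  have hR : order D ≤ R := by
    intro k hk v hv
    rw [show P.fieldAct k = P.actHom ⟨k, hk⟩ from P.fieldAct_coe hD ⟨k, hk⟩]
    exact P.actHom_mem _ v hv
  by_contra hxo
  have hlt : order D < R := lt_of_le_of_ne hR (fun h => hxo (by rw [h]; exact hx))
  have hnt : Nontrivial P.V := by
    apply Module.nontrivial_of_finrank_pos (R := ℂ); rw [P.finrank_V]; norm_num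
  have hinj : Function.Injective P.fieldAct := P.fieldAct.injective
  obtain ⟨b, -⟩ := P.type_S
  have : Module.Finite ℤ P.surfaceLattice := Module.Finite.of_basis b
  refine P.proper R hlt ⟨?_, ?_⟩ ⟨(P.fieldAct.comp R.subtype).codRestrict _ fun y => y.2, ?_, ?_⟩
  · let e := b (Sum.inl 0)
    have he : P.toV e ≠ 0 := by
      intro h0
      exact b.ne_zero (Sum.inl 0) (P.toV_injective (by rw [h0, map_zero]))
    let φ : R →ₗ[ℤ] P.surfaceLattice :=
      { toFun := fun y => ⟨P.fieldAct y (P.toV e), y.2 _ e.2.1, (P.fieldAct y (P.toV e)).2⟩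
        map_add' := fun y y' => by
          apply Subtype.ext
          simp
        map_smul' := fun n y => by
          apply Subtype.ext
          simp }
    have hφ : Function.Injective φ := by
      rw [← LinearMap.ker_eq_bot, LinearMap.ker_eq_bot']
      intro y hy
      have h1 : P.fieldAct y (P.toV e) = 0 := Subtype.ext (congrArg (fun w : P.surfaceLattice => (w : C3)) hy)
      by_contra hy0
      have hy0' : (y : K D) ≠ 0 := fun h => hy0 (Subtype.ext h)
      have h2 : P.fieldAct ((y : K D)⁻¹ * y) (P.toV e) = 0 := by
        rw [map_mul, Module.End.mul_apply, h1, map_zero]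
      rw [inv_mul_cancel₀ hy0', map_one] at h2
      exact he h2
    have : Module.Finite ℤ R := Module.Finite.of_injective φ hφ
    have h3 := (Module.Finite.iff_addGroup_fg (G := R)).1 this
    exact (AddGroup.fg_iff_addSubgroup_fg R.toAddSubgroup).1 h3
  · rw [eq_top_iff]
    intro y _
    have h1 : (1 : K D) ∈ Submodule.span ℚ (R : Set (K D)) := Submodule.subset_span R.one_mem
    have h2 : sqrtD D ∈ Submodule.span ℚ (R : Set (K D)) :=
      Submodule.subset_span (hR (sqrtD_mem_order D))
    have h3 : y = y.re • (1 : K D) + y.im • sqrtD D := by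
      ext <;> simp [sqrtD]
    rw [h3]
    exact add_mem (Submodule.smul_mem _ _ h1) (Submodule.smul_mem _ _ h2)
  · intro y y' hyy
    exact Subtype.ext (hinj (congrArg Subtype.val hyy))
  · intro k
    apply Subtype.ext
    exact P.fieldAct_coe hD k

/-- Every lattice of a subsurface with real multiplication is `𝒪_D ⊕ (1/√D) 𝔞`. -/
theorem exists_isSurfaceMarking (hD : D % 4 = 0 ∨ D % 4 = 1) (hd : 0 < d) :
    ∃ (n : ℤ) (h : (d : ℤ) ∣ normPoly D n) (e f : Fin 2 → P.V),
      P.IsSurfaceMarking (idealOf hD d n h) e f := by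
  obtain ⟨b, hb⟩ := P.type_S
  obtain ⟨E, hE⟩ := exists_intForm (H := P.H) P.surfaceLattice
    (fun v hv w hw => P.isPolarization.integral v hv.1 w hw.1)
  let γ : order D := ⟨gamma D, gamma_mem_order D⟩
  let g : P.surfaceLattice →ₗ[ℤ] P.surfaceLattice :=
    { toFun := fun v => ⟨P.actHom γ (P.toV v), P.actHom_mem γ _ v.2.1, (P.actHom γ (P.toV v)).2⟩
      map_add' := fun v w => by apply Subtype.ext; simp
      map_smul' := fun n v => by apply Subtype.ext; simp }
  have hg : ∀ v, P.toV (g v) = P.actHom γ (P.toV v) := fun v => rfl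
  have hcoe : ∀ v, (P.toV v : C3) = v := fun v => rfl
  have hγ : (gamma D).re = (D : ℚ) / 2 ∧ (gamma D).im = 1 / 2 := ⟨rfl, rfl⟩
  have hRM : IsRMLattice (D : ℤ) (gammaNorm D) d b E g := by
    refine ⟨fun v w => ?_, fun i j => ?_, fun i j => ?_, fun i j => ?_, fun v => ?_, fun v w => ?_,
      fun x y => norm_form_eq_zero hD, fun p hp => ?_⟩
    · apply Int.cast_injective (α := ℝ)
      push_cast
      rw [hE, hE, P.isPolarization.alt]
    · apply Int.cast_injective (α := ℝ)
      rw [hE, imForm_apply, (hb i j).1]; simp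
    · apply Int.cast_injective (α := ℝ)
      rw [hE, imForm_apply, (hb i j).2.1]; simp
    · apply Int.cast_injective (α := ℝ)
      rw [hE, imForm_apply, (hb i j).2.2]
      fin_cases i <;> fin_cases j <;> simp
    · apply P.toV_injective
      rw [hg, hg, map_sub, map_zsmul, map_zsmul, hg, ← Module.End.mul_apply, ← map_mul]
      have h1 : γ * γ = ((D : ℤ) : order D) * γ - ((gammaNorm D : ℤ) : order D) := by
        apply Subtype.ext
        push_cast
        exact gamma_mul_gamma hD
      rw [h1, map_sub, map_mul, map_intCast, map_intCast]
      simp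
    · apply Int.cast_injective (α := ℝ)
      rw [hE, hE, imForm_apply, imForm_apply]
      exact congrArg Complex.im (P.actHom_selfAdjoint γ (P.toV v) (P.toV w))
    · rintro ⟨c, hc⟩
      -- if `γ` were the scalar `c` modulo `p`, then `(γ - c) / p` would act on the lattice
      let x : K D := (p : K D)⁻¹ * (gamma D - c)
      have hp0 : (p : K D) ≠ 0 := by
        have := intCast_injective_K (D := D).ne (show (p : ℤ) ≠ 0 by exact_mod_cast hp.ne_zero)
        simpa using this
      have hx : x ∈ order D := by
        apply P.mem_order_of_fieldAct hD
        intro v hv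
        obtain ⟨w, hw⟩ := hc ⟨v, hv, v.2⟩
        have h1 : P.fieldAct x v = P.toV w := by
          have h2 := congrArg P.toV hw
          rw [hg, map_add, map_zsmul, map_zsmul] at h2
          have h3 : P.toV ⟨v, hv, v.2⟩ = v := rfl
          rw [h3, ← P.fieldAct_coe hD] at h2
          have h4 : P.fieldAct (gamma D - c) v = P.fieldAct (p : K D) (P.toV w) := by
            rw [map_sub, LinearMap.sub_apply, h2, map_intCast, map_natCast,
              Module.End.intCast_apply, Module.End.natCast_apply]
            simp
          rw [map_mul, Module.End.mul_apply, h4, ← Module.End.mul_apply, ← map_mul,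
            inv_mul_cancel₀ hp0, map_one, Module.End.one_apply]
        rw [h1]
        exact w.2.1
      obtain ⟨a, b, hab⟩ := (mem_order_iff hD).1 hx
      have h4 : ((p * a + c : ℤ) : K D) + ((p * b : ℤ) : K D) * gamma D
          = (0 : ℤ) + (1 : ℤ) * gamma D := by
        have h5 : (p : K D) * x = gamma D - c := by
          simp only [x]; rw [mul_inv_cancel_left₀ hp0]
        rw [hab] at h5
        push_cast
        linear_combination h5
      have h6 := (order_coords_inj h4).2
      have := Int.isUnit_iff.1 (IsUnit.of_mul_eq_one (b := b) h6)
      have := hp.one_lt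
      omega
  obtain ⟨e, u₁, u₂, n, hn, hrel, hu₁e, hu₁g, hspan⟩ :=
    hRM.exists_decomposition (by exact_mod_cast hd)
  have hd0 : (d : ℝ) ≠ 0 := by exact_mod_cast hd.ne'
  have hs := (sqrt_D_pos (D := D)).ne'
  have hss : Real.sqrt D * Real.sqrt D = D := Real.mul_self_sqrt (Nat.cast_nonneg D)
  have hDne : (D : ℝ) ≠ 0 := by rw [← hss]; exact mul_ne_zero hs hs
  have hDneQ : (D : ℚ) ≠ 0 := by exact_mod_cast hDne
  -- `F` is the vector with `u₁ = (d/√D) F`, `u₂ = ((γ + n)/√D) F`, as `√D` acts with square `D`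
  let F : P.V := (1 / d : ℝ) • P.sqrtEnd (P.toV u₁)
  have hge : P.toV (g e) = (D / 2 : ℝ) • P.toV e + (1 / 2 : ℝ) • P.sqrtEnd (P.toV e) := by
    rw [hg, P.actHom_apply hD, hγ.1, hγ.2]; push_cast; rfl
  have hgu : P.toV (g u₁) = (D / 2 : ℝ) • P.toV u₁ + (1 / 2 : ℝ) • P.sqrtEnd (P.toV u₁) := by
    rw [hg, P.actHom_apply hD, hγ.1, hγ.2]; push_cast; rfl
  -- the basis `e, γ e, u₁, u₂` in terms of the eigenspaces of `√D`
  have ce : combo (1 : K D) (P.eigenParts (P.toV e)) = P.toV e := by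
    rw [combo_eigenParts]; simp [QuadraticAlgebra.re_one, QuadraticAlgebra.im_one]
  have cge : combo (gamma D) (P.eigenParts (P.toV e)) = P.toV (g e) := by
    rw [combo_eigenParts, hge, hγ.1, hγ.2]; push_cast; rfl
  have cu₁ : combo ((sqrtD D)⁻¹ * (d : K D)) (P.eigenParts F) = P.toV u₁ := by
    have h1 : (sqrtD D)⁻¹ * (d : K D) = ⟨0, d / D⟩ := by
      rw [inv_mul_eq_iff_eq_mul₀ sqrtD_ne_zero]
      ext <;> simp [sqrtD]
      field_simp
    rw [h1, combo_eigenParts]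
    simp only [F, LinearMap.map_smul_of_tower, sqrtEnd_sqrtEnd]
    push_cast
    match_scalars
    · simp
    · field_simp
  have cu₂ : combo ((sqrtD D)⁻¹ * (gamma D + (n : K D))) (P.eigenParts F) = P.toV u₂ := by
    have h1 : (sqrtD D)⁻¹ * (gamma D + (n : K D)) = ⟨1 / 2, (D / 2 + n) / D⟩ := by
      rw [inv_mul_eq_iff_eq_mul₀ sqrtD_ne_zero]
      ext <;> simp [sqrtD, gamma]
      field_simp
    have h2 := congrArg P.toV hrel
    rw [map_add, map_zsmul, map_zsmul, hgu, ← Int.cast_smul_eq_zsmul ℝ n,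
      ← Int.cast_smul_eq_zsmul ℝ (d : ℤ)] at h2
    have h3 : P.toV u₂ = (1 / d : ℝ) • (((d : ℤ) : ℝ) • P.toV u₂) := by
      rw [smul_smul]; push_cast; rw [one_div_mul_cancel hd0, one_smul]
    rw [h1, combo_eigenParts, h3, ← h2]
    simp only [F, LinearMap.map_smul_of_tower, sqrtEnd_sqrtEnd]
    push_cast
    match_scalars
    · field_simp
    · field_simp
  have hortho : ∀ v w : P.V, ∀ i j : Fin 2, i ≠ j →
      imForm P.H (P.eigenParts v i) (P.eigenParts w j) = 0 := by
    intro v w i j hij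
    rw [imForm_apply, P.H_eq_zero_of_eigen hij (fun k => P.act_eigenParts hD v k i)
      (fun k => P.act_eigenParts hD w k j)]
    rfl
  have hsa : ∀ v w : P.V, imForm P.H (P.sqrtEnd v) w = imForm P.H v (P.sqrtEnd w) := fun v w =>
    congrArg Complex.im (P.actHom_selfAdjoint _ v w)
  have hEe : imForm P.H (P.toV u₁) (P.toV e) = 0 := by
    rw [hcoe, hcoe, ← hE, hu₁e]; simp
  have hESe : imForm P.H (P.toV u₁) (P.sqrtEnd (P.toV e)) = 2 * d := by
    have h1 : imForm P.H (P.toV u₁) (P.toV (g e)) = d := by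
      rw [hcoe, hcoe, ← hE, hu₁g]; simp
    rw [hge, Submodule.coe_add, Submodule.coe_smul_of_tower, Submodule.coe_smul_of_tower, map_add,
      map_smul, map_smul, hEe] at h1
    simp at h1
    linarith
  -- `E(F, e) = 2` and `E(F, √D e) = 0` determine the pairings of the eigencomponents
  have hfe0 : ∀ i, imForm P.H (P.eigenParts F i) (P.eigenParts (P.toV e) i) = 1 := by
    have h1 : imForm P.H F (P.toV e) = 2 := by
      simp only [F, Submodule.coe_smul_of_tower, map_smul, LinearMap.smul_apply, hsa, hESe, smul_eq_mul]
      field_simp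
    have h2 : imForm P.H F (P.sqrtEnd (P.toV e)) = 0 := by
      simp only [F, Submodule.coe_smul_of_tower, map_smul, LinearMap.smul_apply, hsa,
        sqrtEnd_sqrtEnd, hEe]
      simp
    have h3 : F = P.eigenParts F 0 + P.eigenParts F 1 := by
      rw [← combo_one (D := D), combo_eigenParts]
      simp [QuadraticAlgebra.re_one, QuadraticAlgebra.im_one]
    have h4 : P.toV e = P.eigenParts (P.toV e) 0 + P.eigenParts (P.toV e) 1 := by
      rw [← combo_one (D := D), ce]
    have h5 : P.sqrtEnd (P.toV e) = Real.sqrt D • P.eigenParts (P.toV e) 0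
        - Real.sqrt D • P.eigenParts (P.toV e) 1 := by
      have : combo (sqrtD D) (P.eigenParts (P.toV e)) = P.sqrtEnd (P.toV e) := by
        rw [combo_eigenParts]; simp [sqrtD]
      rw [← this, combo, emb_zero_sqrtD, emb_one_sqrtD]
      module
    have o1 := hortho F (P.toV e) 0 1 (by decide)
    have o2 := hortho F (P.toV e) 1 0 (by decide)
    rw [h3] at h1 h2
    rw [h4] at h1
    rw [h5] at h2
    simp only [Submodule.coe_add, Submodule.coe_sub, Submodule.coe_smul_of_tower, map_add, map_sub,
      map_smul, LinearMap.add_apply, smul_eq_mul] at h1 h2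
    simp only [o1, o2] at h1 h2
    have h6 : imForm P.H (P.eigenParts F 0) (P.eigenParts (P.toV e) 0) =
        imForm P.H (P.eigenParts F 1) (P.eigenParts (P.toV e) 1) := by
      apply mul_left_cancel₀ hs
      linarith
    intro i
    fin_cases i
    · simp only [Fin.zero_eta]; linarith
    · simp only [Fin.mk_one]; linarith
  refine ⟨n, hn, P.eigenParts (P.toV e), P.eigenParts F,
    ⟨hortho _ _ 0 1 (by decide), hortho _ _ 0 1 (by decide), fun i j => ?_,
      fun k i => P.act_eigenParts hD _ k i, fun k i => P.act_eigenParts hD _ k i⟩, fun v => ?_⟩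
  · rcases eq_or_ne i j with rfl | hij
    · rw [hfe0, if_pos rfl]
    · rw [hortho _ _ i j hij, if_neg hij]
  have hcombo : ∀ s t s' t' : ℤ, P.toV (s • e + t • g e + (s' • u₁ + t' • u₂)) =
      combo ((s : K D) + (t : K D) * gamma D) (P.eigenParts (P.toV e)) +
      combo ((sqrtD D)⁻¹ * ((d : K D) * (s' : K D) + (gamma D + (n : K D)) * (t' : K D))) (P.eigenParts F) := by
    intro s t s' t'
    have h1 : (s : K D) + t * gamma D = s • (1 : K D) + t • gamma D := by
      rw [zsmul_eq_mul, zsmul_eq_mul, mul_one]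
    have h2 : (sqrtD D)⁻¹ * ((d : K D) * (s' : K D) + (gamma D + (n : K D)) * (t' : K D)) =
        s' • ((sqrtD D)⁻¹ * (d : K D)) + t' • ((sqrtD D)⁻¹ * (gamma D + (n : K D))) := by
      rw [zsmul_eq_mul, zsmul_eq_mul]; ring
    rw [h1, h2]
    simp only [combo_add, combo_zsmul, ce, cge, cu₁, cu₂, map_add, map_zsmul]
  constructor
  · intro hv
    obtain ⟨s, t, s', t', hst⟩ := hspan ⟨v, hv, v.2⟩
    refine ⟨((s : K D) + (t : K D) * gamma D, (sqrtD D)⁻¹ * ((d : K D) * (s' : K D) + (gamma D + (n : K D)) * (t' : K D))),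
      ⟨(mem_order_iff hD).2 ⟨s, t, rfl⟩, ?_⟩, ?_⟩
    · rw [mul_inv_cancel_left₀ sqrtD_ne_zero]
      refine mem_idealLattice.2 ⟨⟨(d : K D) * (s' : K D) + (gamma D + (n : K D)) * (t' : K D), ?_⟩, ⟨s', t', rfl⟩, rfl⟩
      exact add_mem (mul_mem (natCast_mem _ d) (intCast_mem _ s'))
        (mul_mem (add_mem (gamma_mem_order D) (intCast_mem _ n)) (intCast_mem _ t'))
    · rw [← hcombo, ← hst]
      rfl
  · rintro ⟨⟨x, y⟩, ⟨hx, hy⟩, rfl⟩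
    obtain ⟨s, t, hst⟩ := (mem_order_iff hD).1 hx
    obtain ⟨k, ⟨s', t', hk⟩, hk2⟩ := mem_idealLattice.1 hy
    have hy' : y = (sqrtD D)⁻¹ * ((d : K D) * (s' : K D) + (gamma D + (n : K D)) * (t' : K D)) := by
      have : (d : K D) * (s' : K D) + (gamma D + (n : K D)) * (t' : K D) = sqrtD D * y := by rw [← hk2, hk]; simp
      rw [this, inv_mul_cancel_left₀ sqrtD_ne_zero]
    simp only at hst
    simp only [hst, hy', ← hcombo]
    exact (s • e + t • g e + (s' • u₁ + t' • u₂)).2.1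

end

/-! ### Real symplectic isomorphisms -/

section
variable {D d : ℕ} (P Q R : RMThreefold D d)

/-- A real linear isomorphism that respects lattices, polarization forms, subsurfaces and real
multiplications, but not necessarily the complex structures. -/
structure IsSymplecticIsom (τ : C3 ≃ₗ[ℝ] C3) : Prop where
  mem_Λ : ∀ v, τ v ∈ Q.Λ ↔ v ∈ P.Λ
  form : ∀ v w, imForm Q.H (τ v) (τ w) = imForm P.H v w
  mem_V : ∀ v, τ v ∈ Q.V ↔ v ∈ P.V
  act : ∀ (k : order D) (v : P.V) (w : Q.V), τ v = w → τ (P.actHom k v) = Q.actHom k w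

variable {P Q R}

lemma IsIsom.isSymplecticIsom {F : C3 ≃ₗ[ℂ] C3} (h : IsIsom P Q F) :
    IsSymplecticIsom P Q (F.restrictScalars ℝ) where
  mem_Λ := h.1
  form v w := congrArg Complex.im (h.2.1 v w)
  mem_V := h.2.2.1
  act := h.2.2.2

/-- The restriction of a symplectic isomorphism to the tangent spaces of the subsurfaces. -/
def onV {τ : C3 ≃ₗ[ℝ] C3} (h : IsSymplecticIsom P Q τ) : P.V ≃ₗ[ℝ] Q.V :=
  LinearEquiv.ofSubmodules τ (P.V.restrictScalars ℝ) (Q.V.restrictScalars ℝ) (by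
    ext w
    constructor
    · rintro ⟨v, hv, rfl⟩
      exact (h.mem_V v).2 hv
    · intro hw
      exact ⟨τ.symm w, (h.mem_V _).1 (by rwa [τ.apply_symm_apply]), τ.apply_symm_apply w⟩)

lemma coe_onV {τ : C3 ≃ₗ[ℝ] C3} (h : IsSymplecticIsom P Q τ) (v : P.V) :
    (onV h v : C3) = τ v := rfl

lemma IsSymplecticIsom.map_frame {τ : C3 ≃ₗ[ℝ] C3} (h : IsSymplecticIsom P Q τ)
    {e f : Fin 2 → P.V} (hm : P.IsRMFrame e f) :
    Q.IsRMFrame (fun i => onV h (e i)) (fun i => onV h (f i)) := by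
  have hact : ∀ (v : P.V) (r : ℝ) (k : order D), P.actHom k v = r • v →
      Q.actHom k (onV h v) = r • onV h v := by
    intro v r k hk
    have h1 := h.act k v (onV h v) rfl
    rw [hk] at h1
    rw [← map_smul]
    exact Subtype.ext h1.symm
  exact
    { ee := by rw [coe_onV, coe_onV, h.form, hm.ee]
      ff := by rw [coe_onV, coe_onV, h.form, hm.ff]
      fe := fun i j => by rw [coe_onV, coe_onV, h.form, hm.fe]
      act_e := fun k i => hact _ _ _ (hm.act_e k i)
      act_f := fun k i => hact _ _ _ (hm.act_f k i) }

lemma IsSymplecticIsom.map_surfaceMarking {τ : C3 ≃ₗ[ℝ] C3} (h : IsSymplecticIsom P Q τ)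
    {𝔞 : Ideal (order D)} {e f : Fin 2 → P.V} (hm : P.IsSurfaceMarking 𝔞 e f) :
    Q.IsSurfaceMarking 𝔞 (fun i => onV h (e i)) (fun i => onV h (f i)) where
  frame := h.map_frame hm.frame
  lattice v := by
    obtain ⟨v, rfl⟩ := (onV h).surjective v
    rw [coe_onV, h.mem_Λ, hm.lattice]
    simp only [← map_combo (onV h), ← map_add, (onV h).injective.eq_iff]

/-- Equal sums of eigenvectors of the real multiplication have equal summands. -/
lemma eigen_split [Fact (¬ IsSquare D)] {A A' : Fin 2 → P.V}
    (hA : ∀ k i, P.actHom k (A i) = emb D i k • A i)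
    (hA' : ∀ k i, P.actHom k (A' i) = emb D i k • A' i) (h : A 0 + A 1 = A' 0 + A' 1) : A = A' := by
  have h1 := congrArg (P.actHom ⟨sqrtD D, sqrtD_mem_order D⟩) h
  have hs := (sqrt_D_pos (D := D)).ne'
  simp only [map_add, hA, hA', emb_zero_sqrtD, emb_one_sqrtD] at h1
  have h2 : Real.sqrt D • (A 0 - A 1) = Real.sqrt D • (A' 0 - A' 1) := by
    linear_combination (norm := module) h1
  have h3 := smul_right_injective _ hs h2
  have h4 : (2 : ℝ) • A 0 = (2 : ℝ) • A' 0 := by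
    linear_combination (norm := module) h + h3
  have h5 := smul_right_injective _ (two_ne_zero (α := ℝ)) h4
  rw [h5] at h
  funext i
  fin_cases i
  · exact h5
  · exact add_left_cancel h

/-- Comparison of the components in two frames. -/
lemma IsRMFrame.split [Fact (¬ IsSquare D)] {e f e' f' : Fin 2 → P.V} (h : P.IsRMFrame e f)
    (h' : P.IsRMFrame e' f') {x y x' y' : K D}
    (heq : combo x e + combo y f = combo x' e' + combo y' f') (i : Fin 2) :
    emb D i x • e i + emb D i y • f i = emb D i x' • e' i + emb D i y' • f' i := by
  refine congrFun (eigen_split (A := fun i => emb D i x • e i + emb D i y • f i)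
    (A' := fun i => emb D i x' • e' i + emb D i y' • f' i) (fun k i => ?_) (fun k i => ?_) ?_) i
  · simp only [map_add, LinearMap.map_smul_of_tower, h.act_e, h.act_f]; module
  · simp only [map_add, LinearMap.map_smul_of_tower, h'.act_e, h'.act_f]; module
  · simp only [combo] at heq
    linear_combination (norm := module) heq

/-- The trace pairing on `K²` is nondegenerate, so coordinates in `K²` are unique. -/
lemma IsRMFrame.coords_injective [Fact (¬ IsSquare D)] {e f : Fin 2 → P.V} (h : P.IsRMFrame e f)
    {x y x' y' : K D} (heq : combo x e + combo y f = combo x' e + combo y' f) :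
    x = x' ∧ y = y' := by
  have h1 := h.split h heq 0
  have hee := P.isPolarization.self_im (e 0)
  have hff := P.isPolarization.self_im (f 0)
  have hfe := h.fe 0 0
  have hef := P.isPolarization.alt (e 0) (f 0)
  rw [if_pos rfl] at hfe
  rw [← imForm_apply] at hee hff
  have h2 := congrArg (fun v : P.V => imForm P.H v (e 0)) h1
  have h3 := congrArg (fun v : P.V => imForm P.H v (f 0)) h1
  simp only [Submodule.coe_add, Submodule.coe_smul_of_tower, map_add, map_smul,
    LinearMap.add_apply, LinearMap.smul_apply, smul_eq_mul, hee, hff, hfe, hef] at h2 h3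
  constructor <;> apply emb_injective (D := D) 0 <;> linarith

end

/-! ### The type of a subsurface -/

section
variable {D d : ℕ} [Fact (¬ IsSquare D)] {P : RMThreefold D d}

lemma tracePairing_eq (p q : K D × K D) : tracePairing p q =
    emb D 0 (q.1 * p.2 - p.1 * q.2) + emb D 1 (q.1 * p.2 - p.1 * q.2) := by
  rw [tracePairing, map_add]; rfl

omit [Fact (¬ IsSquare D)] in
lemma toC_eq_emb (x : K D) : toC x = ((emb D 0 x : ℝ) : ℂ) := rfl

/-- The point of `ℍ²` is given by `fᵢ = zᵢ eᵢ`. -/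
theorem IsSurfaceMarking.isOfType {𝔞 : Ideal (order D)} {e f : Fin 2 → P.V}
    (h : P.IsSurfaceMarking 𝔞 e f) : P.IsOfType 𝔞 := by
  obtain ⟨z, hz, -⟩ := h.frame.exists_uniformize
  let b := basisOfLinearIndependentOfCardEqFinrank h.frame.linearIndependent_e
    (by rw [P.finrank_V, Fintype.card_fin])
  have hb : ∀ i, b i = e i := fun i => by simp [b]
  have hFe : ∀ i, b.equivFun (e i) = Pi.single i 1 := by
    intro i
    ext j
    rw [← hb, Module.Basis.equivFun_self]
    simp [Pi.single_apply, eq_comm]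
  have hF : ∀ p : K D × K D, b.equivFun (combo p.1 e + combo p.2 f) = phi (z 0) (z 1) p := by
    intro p
    simp only [combo, hz, P.real_smul_eq, map_add, map_smul, hFe]
    funext j
    fin_cases j <;> simp [phi, toC_eq_emb, emb_zero_star]
  refine ⟨z 0, z 1, b.equivFun, fun v => ?_, fun p hp q hq v w hv hw => ?_, fun k v => ?_⟩
  · rw [h.lattice]
    constructor
    · rintro ⟨p, hp, rfl⟩
      exact ⟨p, hp, (hF p).symm⟩
    · rintro ⟨p, hp, hpv⟩
      exact ⟨p, hp, b.equivFun.injective (by rw [hF, hpv])⟩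
  · rw [← hF] at hv hw
    rw [b.equivFun.injective hv, b.equivFun.injective hw, ← imForm_apply, h.frame.imForm_combo,
      tracePairing_eq]
  · obtain ⟨c, rfl⟩ := h.frame.exists_coords v
    change b.equivFun (P.actHom k _) = _
    simp only [map_add, map_smul, h.frame.act_e, P.real_smul_eq, hFe]
    funext j
    fin_cases j <;> simp [toC_eq_emb, emb_zero_star, mul_comm]

/-- The frame is the preimage of the vectors `eᵢ`, `zᵢ eᵢ` of `ℂ²`. The trace pairing is known on
the lattice only; a nonzero integer in `𝔞` gives enough lattice vectors to extend it to the frame.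
-/
theorem IsOfType.exists_isSurfaceMarking {𝔞 : Ideal (order D)} {n : ℤ} (hn : n ≠ 0)
    (hn𝔞 : (n : order D) ∈ 𝔞) (h : P.IsOfType 𝔞) : ∃ e f, P.IsSurfaceMarking 𝔞 e f := by
  obtain ⟨z₁, z₂, F, hΛ, hE, hρ⟩ := h
  let z : Fin 2 → ℂ := ![z₁, z₂]
  let e : Fin 2 → P.V := fun i => F.symm (Pi.single i 1)
  let f : Fin 2 → P.V := fun i => z i • e i
  have hF : ∀ p : K D × K D, F (combo p.1 e + combo p.2 f) = phi z₁ z₂ p := by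
    intro p
    simp only [combo, f, e, P.real_smul_eq, map_add, map_smul, F.apply_symm_apply]
    funext j
    fin_cases j <;> simp [phi, toC_eq_emb, emb_zero_star, z]
  have act_e : ∀ k i, P.actHom k (e i) = emb D i k • e i := by
    intro k i
    apply F.injective
    rw [P.real_smul_eq, map_smul]
    refine (hρ k (e i)).trans ?_
    simp only [e, F.apply_symm_apply]
    funext j
    fin_cases i <;> fin_cases j <;> simp [toC_eq_emb, emb_zero_star]
  have act_f : ∀ k i, P.actHom k (f i) = emb D i k • f i := by
    intro k i
    simp only [f, map_smul, act_e, P.real_smul_eq, smul_smul, mul_comm]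
  have hee := P.H_eq_zero_of_eigen (i := 0) (j := 1) (by decide) (fun k => act_e k 0)
    (fun k => act_e k 1)
  have hff := P.H_eq_zero_of_eigen (i := 0) (j := 1) (by decide) (fun k => act_f k 0)
    (fun k => act_f k 1)
  have hfe : ∀ i j, i ≠ j → P.H (f i) (e j) = 0 := fun i j hij =>
    P.H_eq_zero_of_eigen hij (fun k => act_f k i) (fun k => act_e k j)
  -- the values of the form on the pairs `(n / √D) f`, `x e` determine its values on the frame
  have key : ∀ x ∈ order D, emb D 0 (x * ((sqrtD D)⁻¹ * n)) * imForm P.H (f 0) (e 0) +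
      emb D 1 (x * ((sqrtD D)⁻¹ * n)) * imForm P.H (f 1) (e 1) =
      emb D 0 (x * ((sqrtD D)⁻¹ * n)) + emb D 1 (x * ((sqrtD D)⁻¹ * n)) := by
    intro x hx
    have hp : ((0 : K D), (sqrtD D)⁻¹ * (n : K D)) ∈ pairLattice 𝔞 := by
      refine ⟨zero_mem _, ?_⟩
      rw [mul_inv_cancel_left₀ sqrtD_ne_zero]
      exact mem_idealLattice.2 ⟨_, hn𝔞, by simp⟩
    have hq : (x, (0 : K D)) ∈ pairLattice 𝔞 := ⟨hx, by rw [mul_zero]; exact zero_mem _⟩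
    have h1 := hE _ hp _ hq _ _ (hF _) (hF _)
    rw [tracePairing_eq, ← imForm_apply] at h1
    simp only [combo_zero, zero_add, add_zero, mul_zero, sub_zero] at h1
    rw [← h1]
    have h01 := hfe 0 1 (by decide)
    have h10 := hfe 1 0 (by decide)
    simp only [combo, Submodule.coe_add, Submodule.coe_smul_of_tower, map_add, map_smul,
      LinearMap.add_apply, LinearMap.smul_apply, smul_eq_mul, map_mul]
    simp only [imForm_apply, h01, h10, Complex.zero_im]
    ring
  have hs := (sqrt_D_pos (D := D)).ne'
  have hnR : (n : ℝ) ≠ 0 := by exact_mod_cast hn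
  have k1 := key 1 (one_mem _)
  have k2 := key (sqrtD D) (sqrtD_mem_order D)
  rw [one_mul, map_mul, map_mul, map_inv₀, map_inv₀, map_intCast, map_intCast, emb_zero_sqrtD,
    emb_one_sqrtD] at k1
  rw [mul_inv_cancel_left₀ sqrtD_ne_zero, map_intCast, map_intCast] at k2
  field_simp at k1 k2
  refine ⟨e, f, ⟨by rw [imForm_apply, hee]; rfl, by rw [imForm_apply, hff]; rfl, fun i j => ?_,
    act_e, act_f⟩, fun v => ?_⟩
  · rcases eq_or_ne i j with rfl | hij
    · rw [if_pos rfl]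
      fin_cases i <;> simp only [Fin.zero_eta, Fin.mk_one] <;> linarith
    · rw [if_neg hij, imForm_apply, hfe i j hij]; rfl
  · rw [hΛ]
    constructor
    · rintro ⟨p, hp, hpv⟩
      exact ⟨p, hp, F.injective (by rw [hF, hpv])⟩
    · rintro ⟨p, hp, rfl⟩
      exact ⟨p, hp, (hF p).symm⟩

/-- An element `y` of `(1/√D) 𝔟` is the determinant of the coordinates of `y f'` and `e'` in the
first decomposition, and so lies in `(1/√D) 𝔞`. -/
lemma IsSurfaceMarking.le {𝔞 𝔟 : Ideal (order D)} {e f e' f' : Fin 2 → P.V}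
    (h : P.IsSurfaceMarking 𝔞 e f) (h' : P.IsSurfaceMarking 𝔟 e' f') :
    idealLattice 𝔟 ≤ idealLattice 𝔞 := by
  intro x hx
  obtain ⟨y, hy⟩ : ∃ y, sqrtD D * y = x := ⟨_, mul_inv_cancel_left₀ sqrtD_ne_zero x⟩
  obtain ⟨⟨a, b⟩, ⟨ha, hb⟩, hab⟩ := (h.lattice _).1 ((h'.lattice (combo y f')).2
    ⟨(0, y), ⟨zero_mem _, by rwa [hy]⟩, by simp [combo_zero]⟩)
  obtain ⟨⟨a', b'⟩, ⟨ha', hb'⟩, hab'⟩ := (h.lattice _).1 ((h'.lattice (combo (1 : K D) e')).2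
    ⟨(1, 0), ⟨one_mem (order D), by rw [mul_zero]; exact zero_mem _⟩, by simp [combo_zero]⟩)
  simp only at ha hb hab ha' hb' hab'
  have s1 := h'.frame.split h.frame (x := 0) (y := y) (by rw [combo_zero, zero_add, hab]) 0
  have s2 := h'.frame.split h.frame (x := 1) (y := 0) (by rw [combo_zero, add_zero, hab']) 0
  simp only [map_zero, zero_smul, zero_add, map_one, one_smul, add_zero] at s1 s2
  have hee := P.isPolarization.self_im (e 0)
  have hff := P.isPolarization.self_im (f 0)
  have hfe := h.frame.fe 0 0
  have hef := P.isPolarization.alt (e 0) (f 0)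
  rw [if_pos rfl] at hfe
  rw [← imForm_apply] at hee hff
  have h1 := h'.frame.fe 0 0
  have h2 : imForm P.H ((emb D 0 y • f' 0 : P.V) : C3) (e' 0) = emb D 0 y := by
    simp [h1]
  rw [s1, s2] at h2
  simp only [Submodule.coe_add, Submodule.coe_smul_of_tower, map_add, map_smul,
    LinearMap.add_apply, LinearMap.smul_apply, smul_eq_mul, hee, hff, hfe, hef] at h2
  have h3 : y = b * a' - a * b' := by
    apply emb_injective (D := D) 0
    rw [map_sub, map_mul, map_mul]
    linarith
  rw [← hy, h3, show sqrtD D * (b * a' - a * b') = a' * (sqrtD D * b) - a * (sqrtD D * b') by ring]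
  exact sub_mem (mul_mem_idealLattice ha' hb) (mul_mem_idealLattice ha hb')

/-- The ideal attached to a subsurface is unique. -/
theorem IsSurfaceMarking.ideal_eq {𝔞 𝔟 : Ideal (order D)} {e f e' f' : Fin 2 → P.V}
    (h : P.IsSurfaceMarking 𝔞 e f) (h' : P.IsSurfaceMarking 𝔟 e' f') : 𝔞 = 𝔟 :=
  idealLattice_injective D (le_antisymm (h'.le h) (h.le h'))

end

/-! ### Coordinates with respect to a frame -/

section
variable {D d : ℕ} [Fact (¬ IsSquare D)] {P : RMThreefold D d}

omit [Fact (¬ IsSquare D)] in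
lemma map_vec {M N F : Type*} [AddCommGroup M] [Module ℝ M] [AddCommGroup N] [Module ℝ N]
    [FunLike F M N] [LinearMapClass F ℝ M N] (φ : F) (e f : Fin 2 → M) (u w : M) (x y : K D)
    (p q : ℝ) : φ (vec e f u w x y p q) =
      vec (fun i => φ (e i)) (fun i => φ (f i)) (φ u) (φ w) x y p q := by
  simp only [vec, map_add, map_combo, map_smul]

omit [Fact (¬ IsSquare D)] in
lemma coe_combo (x : K D) (e : Fin 2 → P.V) : ((combo x e : P.V) : C3) = combo x (coeV e) :=
  map_combo (P.V.subtype.restrictScalars ℝ) x e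

omit [Fact (¬ IsSquare D)] in
lemma vec_eq (e f : Fin 2 → P.V) (u w : C3) (x y : K D) (p q : ℝ) :
    vec (coeV e) (coeV f) u w x y p q = ((combo x e + combo y f : P.V) : C3) + (p • w + q • u) := by
  rw [vec, Submodule.coe_add, coe_combo, coe_combo]

omit [Fact (¬ IsSquare D)] in
lemma vec_zero_zero (e f : Fin 2 → P.V) (u w : C3) (x y : K D) :
    vec (coeV e) (coeV f) u w x y 0 0 = ((combo x e + combo y f : P.V) : C3) := by
  rw [vec_eq]; simp

/-- A vector orthogonal to a frame of the subsurface for `Im H` is orthogonal for `H`. -/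
lemma IsRMFrame.H_e_eq_zero {e f : Fin 2 → P.V} (h : P.IsRMFrame e f) {t : C3}
    (h1 : ∀ i, imForm P.H (e i) t = 0) (h2 : ∀ i, imForm P.H (f i) t = 0) (i : Fin 2) :
    P.H (e i) t = 0 := by
  obtain ⟨z, hz, -⟩ := h.exists_uniformize
  have h4 := h1 i
  have h5 := h2 i
  rw [imForm_apply] at h4
  rw [hz, imForm_apply, Submodule.coe_smul, map_smul, LinearMap.smul_apply, smul_eq_mul,
    Complex.mul_im, h4, mul_zero, zero_add] at h5
  exact Complex.ext ((mul_eq_zero.1 h5).resolve_left (z i).im_pos.ne') h4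

namespace IsFrame
variable {e f : Fin 2 → P.V} {u w : C3} (h : P.IsFrame e f u w)
include h

lemma imForm_vec (x y x' y' : K D) (p q p' q' : ℝ) :
    imForm P.H (vec (coeV e) (coeV f) u w x y p q) (vec (coeV e) (coeV f) u w x' y' p' q') =
      emb D 0 (x' * y - x * y') + emb D 1 (x' * y - x * y') + d * (p * q' - q * p') := by
  have h0 := P.isPolarization.alt
  have huu := P.isPolarization.self_im u
  have hww := P.isPolarization.self_im w
  rw [← imForm_apply] at huu hww
  have hV : ∀ (x y : K D) (t : C3), (∀ i, imForm P.H (e i) t = 0) → (∀ i, imForm P.H (f i) t = 0) →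
      imForm P.H (combo x e + combo y f : P.V) t = 0 := by
    intro x y t h1 h2
    simp only [combo, Submodule.coe_add, Submodule.coe_smul_of_tower, map_add, map_smul,
      LinearMap.add_apply, LinearMap.smul_apply, smul_eq_mul, h1, h2, mul_zero, add_zero]
  have a1 := hV x y u h.eu h.fu
  have a2 := hV x y w h.ew h.fw
  have b1 := h0 u (combo x' e + combo y' f : P.V)
  have b2 := h0 w (combo x' e + combo y' f : P.V)
  rw [hV x' y' u h.eu h.fu, neg_zero] at b1
  rw [hV x' y' w h.ew h.fw, neg_zero] at b2
  rw [vec_eq, vec_eq]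
  simp only [map_add, map_smul, LinearMap.add_apply, LinearMap.smul_apply, smul_eq_mul,
    h.frame.imForm_combo] at a1 a2 b1 b2 ⊢
  rw [← h.frame.imForm_combo x y x' y']
  simp only [Submodule.coe_add, map_add, LinearMap.add_apply] at a1 a2 b1 b2 ⊢
  rw [huu, hww, h0 u w, h.wu]
  linear_combination p' * a2 + q' * a1 + p * b2 + q * b1

lemma coords_injective (hd : 0 < d) {x y x' y' : K D} {p q p' q' : ℝ}
    (heq : vec (coeV e) (coeV f) u w x y p q = vec (coeV e) (coeV f) u w x' y' p' q') :
    x = x' ∧ y = y' ∧ p = p' ∧ q = q' := by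
  have hd' : (d : ℝ) ≠ 0 := by exact_mod_cast hd.ne'
  have h1 := congrArg (fun v => imForm P.H v (vec (coeV e) (coeV f) u w (0 : K D) 0 1 0)) heq
  have h2 := congrArg (fun v => imForm P.H v (vec (coeV e) (coeV f) u w (0 : K D) 0 0 1)) heq
  simp only [h.imForm_vec] at h1 h2
  simp [hd'] at h1 h2
  subst h1 h2
  have h3 := add_right_cancel (heq : _ + _ = _ + _)
  rw [← coe_combo, ← coe_combo, ← coe_combo, ← coe_combo, ← Submodule.coe_add,
    ← Submodule.coe_add] at h3
  obtain ⟨h4, h5⟩ := h.frame.coords_injective (Subtype.ext h3)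
  exact ⟨h4, h5, rfl, rfl⟩

lemma vec_mem_V (hd : 0 < d) {x y : K D} {p q : ℝ}
    (hv : vec (coeV e) (coeV f) u w x y p q ∈ P.V) : p = 0 ∧ q = 0 := by
  have hd' : (d : ℝ) ≠ 0 := by exact_mod_cast hd.ne'
  have hV : ∀ v : P.V, ∀ t : C3, (∀ i, imForm P.H (e i) t = 0) → (∀ i, imForm P.H (f i) t = 0) →
      imForm P.H v t = 0 := by
    intro v t h1 h2
    have h3 := h.frame.H_e_eq_zero h1 h2
    obtain ⟨c, rfl⟩ := h.frame.exists_coords v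
    simp [imForm_apply, h3]
  have h1 := hV ⟨_, hv⟩ u h.eu h.fu
  have h2 := hV ⟨_, hv⟩ w h.ew h.fw
  have h3 := h.imForm_vec x y 0 0 p q 0 1
  have h4 := h.imForm_vec x y 0 0 p q 1 0
  have h5 : vec (coeV e) (coeV f) u w (0 : K D) 0 0 1 = u := by simp [vec, combo_zero]
  have h6 : vec (coeV e) (coeV f) u w (0 : K D) 0 1 0 = w := by simp [vec, combo_zero]
  rw [h5, h1] at h3
  rw [h6, h2] at h4
  simp [hd'] at h3 h4
  exact ⟨h3, h4⟩

end IsFrame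

/-! ### Symplectic bases -/

omit [Fact (¬ IsSquare D)]

/-- The family `(λ₁, …, λ_g, μ₁, …, μ_g)` is symplectic of type `(t₁, …, t_g)` for `E`. -/
def IsSymplecticFamily {g : ℕ} (E : C3 →ₗ[ℝ] C3 →ₗ[ℝ] ℝ) (c : Fin g ⊕ Fin g → C3)
    (t : Fin g → ℝ) : Prop :=
  ∀ i j, E (c (Sum.inl i)) (c (Sum.inl j)) = 0 ∧ E (c (Sum.inr i)) (c (Sum.inr j)) = 0 ∧
    E (c (Sum.inl i)) (c (Sum.inr j)) = if i = j then t i else 0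

/-- The coordinates with respect to a symplectic family are values of the form. -/
lemma IsSymplecticFamily.sum {g : ℕ} {E : C3 →ₗ[ℝ] C3 →ₗ[ℝ] ℝ} (halt : ∀ v w, E v w = - E w v)
    {c : Fin g ⊕ Fin g → C3} {t : Fin g → ℝ} (h : IsSymplecticFamily E c t)
    (r : Fin g ⊕ Fin g → ℝ) (j : Fin g) :
    E (∑ i, r i • c i) (c (Sum.inr j)) = r (Sum.inl j) * t j ∧
      E (∑ i, r i • c i) (c (Sum.inl j)) = - (r (Sum.inr j) * t j) := by
  have hμl : ∀ i j, E (c (Sum.inr i)) (c (Sum.inl j)) = if i = j then - t j else 0 := by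
    intro i j
    rw [halt, (h j i).2.2]
    by_cases hij : i = j
    · simp [hij]
    · simp [hij, Ne.symm hij]
  rw [Fintype.sum_sum_type]
  simp only [map_add, LinearMap.add_apply, map_sum, LinearMap.sum_apply, map_smul,
    LinearMap.smul_apply, smul_eq_mul, (h _ _).1, (h _ _).2.1, (h _ _).2.2, hμl]
  simp

lemma IsSymplecticFamily.linearIndependent {g : ℕ} {E : C3 →ₗ[ℝ] C3 →ₗ[ℝ] ℝ}
    (halt : ∀ v w, E v w = - E w v) {c : Fin g ⊕ Fin g → C3} {t : Fin g → ℝ} (ht : ∀ i, t i ≠ 0)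
    (h : IsSymplecticFamily E c t) : LinearIndependent ℝ c := by
  rw [Fintype.linearIndependent_iff]
  intro r hr i
  have h1 := h.sum halt r
  rw [hr] at h1
  simp only [map_zero, LinearMap.zero_apply] at h1
  rcases i with j | j
  · exact (mul_eq_zero.1 (h1 j).1.symm).resolve_right (ht j)
  · exact (mul_eq_zero.1 (neg_eq_zero.1 (h1 j).2.symm)).resolve_right (ht j)

lemma IsSymplecticFamily.span_eq_top {E : C3 →ₗ[ℝ] C3 →ₗ[ℝ] ℝ}
    (halt : ∀ v w, E v w = - E w v) {c : Fin 3 ⊕ Fin 3 → C3} {t : Fin 3 → ℝ} (ht : ∀ i, t i ≠ 0)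
    (h : IsSymplecticFamily E c t) : Submodule.span ℝ (Set.range c) = ⊤ :=
  (h.linearIndependent halt ht).span_eq_top_of_card_eq_finrank' (by
    rw [← Module.finrank_mul_finrank ℝ ℂ C3, Complex.finrank_real_complex]; simp)

/-- A symplectic family spanning the lattice is a basis of it, since the form detects coordinates.
-/
lemma IsSymplecticFamily.hasType {g : ℕ} {Λ : Submodule ℤ C3} {H : SesqForm}
    (halt : ∀ v w, imForm H v w = - imForm H w v) {c : Fin g ⊕ Fin g → C3} {t : Fin g → ℕ}
    (ht : ∀ i, t i ≠ 0) (h : IsSymplecticFamily (imForm H) c (fun i => t i))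
    (hΛ : Λ = Submodule.span ℤ (Set.range c)) : HasType Λ H t := by
  subst hΛ
  have hli : LinearIndependent ℤ c :=
    (h.linearIndependent halt (fun i => by exact_mod_cast ht i)).restrict_scalars
      (fun a b hab => by simpa using hab)
  refine ⟨Module.Basis.span hli, fun i j => ?_⟩
  simp only [Module.Basis.span_apply]
  exact h i j

/-- A symplectic family of six vectors of the lattice generates it. -/
lemma span_eq_of_symplectic (c : Fin 6 → C3) (hc : ∀ j, c j ∈ P.Λ)
    (hs : IsSymplecticFamily (imForm P.H) (c ∘ finSumFinEquiv (m := 3) (n := 3)) (fun _ => 1)) :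
    P.Λ = Submodule.span ℤ (Set.range c) := by
  have hrange : Set.range (c ∘ finSumFinEquiv (m := 3) (n := 3)) = Set.range c :=
    EquivLike.range_comp c _
  have hE := hs.sum P.isPolarization.alt
  have hspan := hs.span_eq_top P.isPolarization.alt (fun _ => one_ne_zero)
  apply le_antisymm
  · intro v hv
    have hv' : v ∈ Submodule.span ℝ (Set.range (c ∘ finSumFinEquiv (m := 3) (n := 3))) := by
      rw [hspan]; trivial
    obtain ⟨r, rfl⟩ := (Submodule.mem_span_range_iff_exists_fun ℝ).1 hv'
    have hr : ∀ i, ∃ n : ℤ, r i = n := by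
      rintro (j | j)
      · obtain ⟨n, hn⟩ := P.isPolarization.integral _ hv _ (hc (finSumFinEquiv (m := 3) (n := 3) (Sum.inr j)))
        refine ⟨n, ?_⟩
        rw [← hn, ← imForm_apply]
        exact ((hE r j).1.trans (mul_one _)).symm
      · obtain ⟨n, hn⟩ := P.isPolarization.integral _ hv _ (hc (finSumFinEquiv (m := 3) (n := 3) (Sum.inl j)))
        refine ⟨-n, ?_⟩
        have h1 := (hE r j).2
        rw [mul_one] at h1
        rw [← imForm_apply] at hn
        push_cast
        linarith [hn.symm.trans h1]
    choose n hn using hr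
    refine sum_mem fun i _ => ?_
    rw [hn, Int.cast_smul_eq_zsmul]
    exact Submodule.smul_mem _ _ (Submodule.subset_span ⟨_, rfl⟩)
  · rw [Submodule.span_le]
    rintro _ ⟨j, rfl⟩
    exact hc j

/-- The columns of the period matrix form a symplectic family. -/
lemma frameCol_symplectic [Fact (¬ IsSquare D)] (hd : 0 < d) {H : SesqForm} {e f : Fin 2 → C3}
    {u w : C3}
    (h : ∀ (x y x' y' : K D) (p q p' q' : ℝ),
      imForm H (vec e f u w x y p q) (vec e f u w x' y' p' q') =
        emb D 0 (x' * y - x * y') + emb D 1 (x' * y - x * y') + d * (p * q' - q * p'))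
    {η₁ η₂ : K D} (hη : η₁ * star η₂ - star η₁ * η₂ = - sqrtD D) :
    IsSymplecticFamily (imForm H) (frameCol d η₁ η₂ e f u w ∘ finSumFinEquiv (m := 3) (n := 3))
      (fun _ => 1) := by
  intro i j
  have hd' : (d : ℝ) ≠ 0 := by exact_mod_cast hd.ne'
  have hs := (sqrt_D_pos (D := D)).ne'
  have h1 := congrArg (emb D 0) hη
  simp only [map_sub, map_mul, map_neg, emb_zero_star, emb_zero_sqrtD] at h1
  simp only [Function.comp_apply, finSumFinEquiv_apply_left, finSumFinEquiv_apply_right, frameCol,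
    h, map_sub, map_mul]
  fin_cases i <;> fin_cases j <;>
    simp [emb_zero_star, emb_one_star, emb_zero_sqrtD, emb_one_sqrtD] <;> field_simp <;>
    linarith

variable [Fact (¬ IsSquare D)]

/-! ### Markings -/

lemma sum_zsmul_frameCol (η₁ η₂ : K D) (e f : Fin 2 → C3) (u w : C3) (n : Fin 6 → ℤ) :
    ∑ i, n i • frameCol d η₁ η₂ e f u w i =
      vec e f u w ((n 0 : K D) * η₁ + (n 1 : K D) * η₂ + (n 5 : K D) * (η₂ / (d : K D)))
        ((n 3 : K D) * (star η₂ / sqrtD D) - (n 4 : K D) * (star η₁ / sqrtD D))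
        (-(n 5 : ℝ) * (1 / d)) (n 2 + n 4 * (1 / d)) := by
  simp only [Fin.sum_univ_six, frameCol, vec, ← Int.cast_smul_eq_zsmul ℝ]
  simp [combo]
  module

/-- The lattice generated by the columns of the period matrix, in terms of coordinates. -/
lemma mem_span_frameCol_iff (hd : 0 < d) {𝔞 : Ideal (order D)} {η₁ η₂ : K D}
    (hη : IsSmartBasis d 𝔞 η₁ η₂) {e f : Fin 2 → C3} {u w : C3} (v : C3) :
    v ∈ Submodule.span ℤ (Set.range (frameCol d η₁ η₂ e f u w)) ↔
      ∃ (x y : K D) (m n : ℤ), v = vec e f u w x y (m / d) (n / d) ∧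
        x + (m : K D) * η₂ / (d : K D) ∈ orderLattice D ∧
        sqrtD D * y + (n : K D) * star η₁ ∈ idealLattice 𝔞 := by
  have hdR : (d : ℝ) ≠ 0 := by exact_mod_cast hd.ne'
  have hdK : (d : K D) ≠ 0 := by
    have := intCast_injective_K (D := D).ne (show (d : ℤ) ≠ 0 by exact_mod_cast hd.ne')
    simpa using this
  have hs := sqrtD_ne_zero (D := D)
  rw [Submodule.mem_span_range_iff_exists_fun]
  simp only [sum_zsmul_frameCol]
  constructor
  · rintro ⟨n, rfl⟩
    refine ⟨(n 0 : K D) * η₁ + (n 1 : K D) * η₂ + (n 5 : K D) * (η₂ / (d : K D)),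
      (n 3 : K D) * (star η₂ / sqrtD D) - (n 4 : K D) * (star η₁ / sqrtD D),
      - n 5, d * n 2 + n 4, ?_, ?_, ?_⟩
    · congr 1
      · push_cast; ring
      · push_cast; field_simp
    · rw [← hη.1.2, Submodule.mem_span_pair]
      refine ⟨n 0, n 1, ?_⟩
      push_cast
      rw [zsmul_eq_mul, zsmul_eq_mul]
      ring
    · rw [← hη.2.2.2, Submodule.mem_span_pair]
      refine ⟨n 3, n 2, ?_⟩
      push_cast
      rw [zsmul_eq_mul, zsmul_eq_mul]
      field_simp
      ring
  · rintro ⟨x, y, m, k, rfl, hx, hy⟩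
    rw [← hη.1.2, Submodule.mem_span_pair] at hx
    rw [← hη.2.2.2, Submodule.mem_span_pair] at hy
    obtain ⟨a, b, hab⟩ := hx
    obtain ⟨a', b', hab'⟩ := hy
    rw [zsmul_eq_mul, zsmul_eq_mul] at hab hab'
    refine ⟨![a, b, b', a', k - d * b', -m], ?_⟩
    congr 1
    · simp
      linear_combination hab
    · simp
      field_simp
      linear_combination hab'
    · simp
      field_simp
    · simp
      field_simp
      ring

/-- The lattice in terms of coordinates with respect to a marking. -/
lemma IsMarking.mem_iff (hd : 0 < d) {𝔞 : Ideal (order D)} {η₁ η₂ : K D}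
    (hη : IsSmartBasis d 𝔞 η₁ η₂) {e f : Fin 2 → P.V} {u w : C3} (h : P.IsMarking η₁ η₂ e f u w)
    (x y : K D) (p q : ℝ) : vec (coeV e) (coeV f) u w x y p q ∈ P.Λ ↔
      ∃ m n : ℤ, p = m / d ∧ q = n / d ∧ x + (m : K D) * η₂ / (d : K D) ∈ orderLattice D ∧
        sqrtD D * y + (n : K D) * star η₁ ∈ idealLattice 𝔞 := by
  rw [h.lattice, mem_span_frameCol_iff hd hη]
  constructor
  · rintro ⟨x', y', m, n, heq, hx, hy⟩
    obtain ⟨rfl, rfl, rfl, rfl⟩ := h.frame.coords_injective hd heq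
    exact ⟨m, n, rfl, rfl, hx, hy⟩
  · rintro ⟨m, n, rfl, rfl, hx, hy⟩
    exact ⟨x, y, m, n, rfl, hx, hy⟩

/-- A marking restricts to a marking of the subsurface. -/
lemma IsMarking.isSurfaceMarking (hd : 0 < d) {𝔞 : Ideal (order D)} {η₁ η₂ : K D}
    (hη : IsSmartBasis d 𝔞 η₁ η₂) {e f : Fin 2 → P.V} {u w : C3} (h : P.IsMarking η₁ η₂ e f u w) :
    P.IsSurfaceMarking 𝔞 e f where
  frame := h.frame.frame
  lattice v := by
    have hdR : (d : ℝ) ≠ 0 := by exact_mod_cast hd.ne'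
    have h1 := h.mem_iff hd hη
    constructor
    · intro hv
      obtain ⟨x, y, p, q, hxy⟩ : ∃ (x y : K D) (p q : ℝ), vec (coeV e) (coeV f) u w x y p q = v := by
        rw [h.lattice, mem_span_frameCol_iff hd hη] at hv
        obtain ⟨x, y, m, n, hv, -⟩ := hv
        exact ⟨x, y, _, _, hv.symm⟩
      have hvV := v.2
      have hvΛ := hv
      rw [← hxy] at hvV hvΛ
      obtain ⟨rfl, rfl⟩ := h.frame.vec_mem_V hd hvV
      obtain ⟨m, k, hm, hk, hx, hy⟩ := (h1 x y 0 0).1 hvΛ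
      obtain rfl : m = 0 := by
        rw [eq_comm, div_eq_zero_iff] at hm
        exact_mod_cast hm.resolve_right hdR
      obtain rfl : k = 0 := by
        rw [eq_comm, div_eq_zero_iff] at hk
        exact_mod_cast hk.resolve_right hdR
      refine ⟨(x, y), ⟨by simpa using hx, by simpa using hy⟩, ?_⟩
      rw [vec_zero_zero] at hxy
      exact Subtype.ext hxy.symm
    · rintro ⟨⟨x, y⟩, ⟨hx, hy⟩, rfl⟩
      rw [← vec_zero_zero e f u w]
      exact (h1 x y 0 0).2 ⟨0, 0, by simp, by simp, by simpa using hx, by simpa using hy⟩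

end

/-! ### Unimodularity -/

section
variable {D d : ℕ} {P : RMThreefold D d}

/-- The form of a principal polarization is unimodular. -/
lemma exists_unimodular (P : RMThreefold D d) : ∃ E : P.Λ →ₗ[ℤ] P.Λ →ₗ[ℤ] ℤ,
    (∀ v w : P.Λ, (E v w : ℝ) = imForm P.H v w) ∧
    (∀ v w, E v w = - E w v) ∧
    ∀ φ : P.Λ →ₗ[ℤ] ℤ, ∃ m, ∀ v, E v m = φ v := by
  obtain ⟨E, hE⟩ := exists_intForm P.Λ P.isPolarization.integral
  obtain ⟨b, hb⟩ := P.principal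
  refine ⟨E, hE, fun v w => ?_, fun φ => ?_⟩
  · apply Int.cast_injective (α := ℝ)
    push_cast
    rw [hE, hE, P.isPolarization.alt]
  · have h1 : ∀ i j, E (b (Sum.inl i)) (b (Sum.inl j)) = 0 ∧ E (b (Sum.inr i)) (b (Sum.inr j)) = 0 ∧
        E (b (Sum.inl i)) (b (Sum.inr j)) = (if i = j then 1 else 0) ∧
        E (b (Sum.inr i)) (b (Sum.inl j)) = if i = j then -1 else 0 := by
      intro i j
      obtain ⟨h1, h2, h3⟩ := hb i j
      obtain ⟨-, -, h4⟩ := hb j i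
      refine ⟨?_, ?_, ?_, ?_⟩ <;> apply Int.cast_injective (α := ℝ) <;> rw [hE]
      · rw [imForm_apply, h1]; simp
      · rw [imForm_apply, h2]; simp
      · rw [imForm_apply, h3]; simp
      · rw [P.isPolarization.alt, imForm_apply, h4]
        by_cases hij : i = j
        · simp [hij]
        · simp [hij, Ne.symm hij]
    refine ⟨∑ i, (φ (b (Sum.inl i)) • b (Sum.inr i) - φ (b (Sum.inr i)) • b (Sum.inl i)), ?_⟩
    intro v
    suffices h : E.flip (∑ i, (φ (b (Sum.inl i)) • b (Sum.inr i) - φ (b (Sum.inr i)) •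
        b (Sum.inl i))) = φ from LinearMap.congr_fun h v
    refine b.ext fun i => ?_
    rw [LinearMap.flip_apply]
    simp only [map_sum, map_sub, map_smul, smul_eq_mul]
    rcases i with i | i
    · simp [h1]
    · simp [h1]

/-- An element of a unimodular lattice is a multiple of an element with a partner. -/
lemma exists_eq_smul_of_unimodular {L : Type*} [AddCommGroup L] (E : L →ₗ[ℤ] L →ₗ[ℤ] ℤ)
    (hnd : ∀ v, (∀ w, E v w = 0) → v = 0) (halt : ∀ v w, E v w = - E w v)
    (hu : ∀ φ : L →ₗ[ℤ] ℤ, ∃ m, ∀ v, E v m = φ v) (v : L) :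
    ∃ (q : ℤ) (v' : L), v = q • v' ∧ (v = 0 ∨ ∃ m, E v' m = 1) := by
  by_cases hv : v = 0
  · exact ⟨1, v, by rw [one_smul], Or.inl hv⟩
  obtain ⟨q, hq⟩ := Submodule.IsPrincipal.principal (LinearMap.range (E v))
  have hmem : ∀ w, ∃ a : ℤ, a * q = E v w := by
    intro w
    have : E v w ∈ Submodule.span ℤ {q} := hq ▸ LinearMap.mem_range_self _ w
    obtain ⟨a, ha⟩ := Submodule.mem_span_singleton.1 this
    exact ⟨a, ha⟩
  have hq0 : q ≠ 0 := by
    rintro rfl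
    exact hv (hnd v fun w => by obtain ⟨a, ha⟩ := hmem w; rw [← ha, mul_zero])
  choose φ hφ using hmem
  obtain ⟨m, hm⟩ := hu
    { toFun := φ
      map_add' := fun w w' => mul_right_cancel₀ hq0 (by rw [add_mul, hφ, hφ, hφ, map_add])
      map_smul' := fun n w => mul_right_cancel₀ hq0 (by
        rw [hφ, map_smul, smul_eq_mul, smul_eq_mul, eq_intCast, Int.cast_id, mul_assoc, hφ]) }
  have hm' : ∀ w, E w m * q = E v w := fun w => by rw [hm]; exact hφ w
  have hv' : v = q • (-m) := by
    rw [← sub_eq_zero]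
    refine hnd _ fun w => ?_
    rw [map_sub, LinearMap.sub_apply, ← hm' w, map_smul, LinearMap.smul_apply, halt (-m) w, map_neg,
      smul_eq_mul]
    ring
  refine ⟨q, -m, hv', Or.inr ?_⟩
  have : q ∈ LinearMap.range (E v) := by rw [hq]; exact Submodule.mem_span_singleton_self q
  obtain ⟨w, hw⟩ := this
  refine ⟨w, mul_left_cancel₀ hq0 ?_⟩
  have h2 : E v w = q * E (-m) w := by
    nth_rewrite 1 [hv']
    rw [map_smul, LinearMap.smul_apply, smul_eq_mul]
  rw [mul_one, ← h2, hw]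

end

/-! ### Extending markings of the subsurface -/

section
variable {D d : ℕ} [Fact (¬ IsSquare D)] {P : RMThreefold D d}

/-- The lattice of `S` as a submodule of the lattice of `A`. -/
abbrev subLattice (P : RMThreefold D d) : Submodule ℤ P.Λ :=
  (P.V.restrictScalars ℤ).comap P.Λ.subtype

omit [Fact (¬ IsSquare D)] in
lemma mem_subLattice_of_smul {n : ℤ} (hn : n ≠ 0) {v : P.Λ} (hv : n • v ∈ P.subLattice) :
    v ∈ P.subLattice := by
  have h1 : ((n : ℂ)) • (v : C3) ∈ P.V := by
    rw [Int.cast_smul_eq_zsmul]; exact hv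
  have h2 : (v : C3) ∈ P.V := (Submodule.smul_mem_iff _ (Int.cast_ne_zero.2 hn)).1 h1
  exact h2

/-- The numerical part of extending a marking of the subsurface: `λ₁, λ₂, μ₁, ν` generate the
sublattice `N` of type `(1, d)` in the unimodular lattice `L`. -/
lemma exists_symplectic_extension {L : Type*} [AddCommGroup L] [Module.Free ℤ L] [Module.Finite ℤ L]
    (E : L →ₗ[ℤ] L →ₗ[ℤ] ℤ)
    (hnd : ∀ v, (∀ w, E v w = 0) → v = 0) (halt : ∀ v w, E v w = - E w v)
    (hu : ∀ φ : L →ₗ[ℤ] ℤ, ∃ m, ∀ v, E v m = φ v) (N : Submodule ℤ L) (hN : N ≠ ⊤)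
    (hpure : ∀ (n : ℤ), n ≠ 0 → ∀ v : L, n • v ∈ N → v ∈ N) {d : ℤ} (hd : 0 < d)
    (l₁ l₂ m₁ ν : L) (hl₁ : l₁ ∈ N) (hl₂ : l₂ ∈ N) (hm₁ : m₁ ∈ N) (hν : ν ∈ N)
    (hspan : ∀ v ∈ N, ∃ a b a' b' : ℤ, v = a • l₁ + b • l₂ + a' • m₁ + b' • ν)
    (hll : E l₁ l₂ = 0) (hlm : E l₁ m₁ = 1) (hln : E l₁ ν = 0) (hl₂m : E l₂ m₁ = 0)
    (hl₂n : E l₂ ν = d) (hmn : E m₁ ν = 0) :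
    ∃ l₃ m₂ m₃ : L, d • m₂ - ν = l₃ ∧ (∀ v ∈ N, E v l₃ = 0) ∧ (∀ v ∈ N, E v (l₂ - d • m₃) = 0) ∧
      E (l₂ - d • m₃) l₃ = d := by
  have hself : ∀ v, E v v = 0 := fun v => by have := halt v v; omega
  -- a first choice of `m₂`, from the functional `E(·, ν) / d` on `N`
  have hdiv : ∀ v : N, ∃ k : ℤ, E v ν = d * k := by
    intro v
    obtain ⟨a, b, a', b', hv⟩ := hspan v v.2
    refine ⟨b, ?_⟩
    rw [hv]
    simp [hln, hl₂n, hmn, hself, mul_comm]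
  choose φ hφ using hdiv
  obtain ⟨ψ, hψ⟩ := exists_extension N (fun n v hn hv => hpure n hn v hv)
    { toFun := φ
      map_add' := fun w w' => mul_left_cancel₀ hd.ne' (by
        rw [mul_add, ← hφ, ← hφ, ← hφ, Submodule.coe_add, map_add, LinearMap.add_apply])
      map_smul' := fun n w => mul_left_cancel₀ hd.ne' (by
        rw [← hφ, Submodule.coe_smul, map_smul, LinearMap.smul_apply, smul_eq_mul, smul_eq_mul,
          eq_intCast, Int.cast_id, mul_left_comm, ← hφ]) }
  obtain ⟨m, hm⟩ := hu ψ
  have hmN : ∀ v ∈ N, E v (d • m - ν) = 0 := by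
    intro v hv
    rw [map_sub, map_smul, smul_eq_mul, hm, hψ ⟨v, hv⟩]
    change d * φ ⟨v, hv⟩ - _ = 0
    rw [← hφ]
    simp
  -- the projection of `d L` to the orthogonal complement of `N`
  have hproj : ∀ v, ∃ l ∈ N, ∀ x ∈ N, E x (d • v - l) = 0 := by
    intro v
    refine ⟨(d * E l₁ v) • m₁ + E l₂ v • ν - (d * E m₁ v) • l₁ - E ν v • l₂, ?_, ?_⟩
    · exact sub_mem (sub_mem (add_mem (N.smul_mem _ hm₁) (N.smul_mem _ hν)) (N.smul_mem _ hl₁))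
        (N.smul_mem _ hl₂)
    · intro x hx
      obtain ⟨a, b, a', b', rfl⟩ := hspan x hx
      simp only [map_add, map_sub, map_smul, LinearMap.add_apply, LinearMap.smul_apply, smul_eq_mul,
        hself, hll, hlm, hln, hl₂m, hl₂n, hmn, halt l₂ l₁, halt m₁ l₁, halt ν l₁, halt m₁ l₂,
        halt ν l₂, halt ν m₁]
      ring
  -- one may arrange `d m₂ ≠ ν`
  obtain ⟨m, hmN, hm0⟩ : ∃ m, (∀ v ∈ N, E v (d • m - ν) = 0) ∧ d • m - ν ≠ 0 := by
    by_cases h0 : d • m - ν = 0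
    · obtain ⟨v, hv⟩ : ∃ v, v ∉ N := by
        by_contra! hall
        exact hN (eq_top_iff.2 fun v _ => hall v)
      obtain ⟨l, hl, hlx⟩ := hproj v
      refine ⟨m + (d • v - l), fun x hx => ?_, fun h1 => hv (hpure d hd.ne' v ?_)⟩
      · rw [smul_add, add_sub_right_comm, h0, zero_add, map_smul, hlx x hx, smul_zero]
      · rw [smul_add, add_sub_right_comm, h0, zero_add] at h1
        have h2 : d • (d • v - l) ∈ N := by rw [h1]; exact N.zero_mem
        have h3 := N.add_mem (hpure d hd.ne' _ h2) hl
        rwa [sub_add_cancel] at h3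
    · exact ⟨m, hmN, h0⟩
  -- modify `m₂` so that `l₃ = d m₂ - ν` has a partner
  obtain ⟨q, v', hq, h1⟩ := exists_eq_smul_of_unimodular E hnd halt hu (d • m - ν)
  obtain ⟨t, ht⟩ := h1.resolve_left hm0
  have hq0 : q ≠ 0 := by rintro rfl; rw [zero_smul] at hq; exact hm0 hq
  have hv'N : ∀ x ∈ N, E x v' = 0 := by
    intro x hx
    have := hmN x hx
    rw [hq, map_smul, smul_eq_mul] at this
    exact (mul_eq_zero.1 this).resolve_left hq0
  obtain ⟨l, hl, hlx⟩ := hproj t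
  set ε := d • t - l with hε
  have hv'ε : E v' ε = d := by
    rw [hε, map_sub, map_smul, ht, halt v' l, hv'N l hl]; simp
  set m₂ := m + ε with hm₂
  set l₃ := d • m₂ - ν with hl₃
  have hl₃' : l₃ = q • v' + d • ε := by rw [hl₃, hm₂, ← hq]; module
  have hl₃N : ∀ x ∈ N, E x l₃ = 0 := by
    intro x hx
    rw [hl₃', map_add, map_smul, map_smul, hv'N x hx, hlx x hx]; simp
  obtain ⟨r, w, hr, h2⟩ := exists_eq_smul_of_unimodular E hnd halt hu l₃
  -- `l₃` is primitive: a prime dividing it divides `E(v', l₃) = d²`, hence `d`, hence `ν`, although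
  -- `E(l₂, ν) = d`
  have hprim : ∀ p : ℤ, Prime p → ∀ κ, l₃ ≠ p • κ := by
    intro p hp κ hκ
    have h3 : E v' l₃ = d * d := by
      rw [hl₃', map_add, map_smul, map_smul, hself, hv'ε]; simp
    have hpd : p ∣ d := by
      have : p ∣ d * d := ⟨E v' κ, by rw [← h3, hκ, map_smul, smul_eq_mul]⟩
      exact (hp.dvd_or_dvd this).elim id id
    obtain ⟨c, rfl⟩ := hpd
    have h4 : ν = p • (c • m₂ - κ) := by
      have : ν = (p * c) • m₂ - l₃ := by rw [hl₃]; abel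
      rw [this, hκ, smul_sub, smul_smul]
    have h5 : c • m₂ - κ ∈ N := hpure p hp.ne_zero _ (h4 ▸ hν)
    obtain ⟨a, b, a', b', hab⟩ := hspan _ h5
    have h6 : E l₂ ν = p * (b' * (p * c)) := by
      rw [h4, map_smul, hab]
      simp [hself, hl₂m, hl₂n, halt l₂ l₁, hll]
    rw [hl₂n] at h6
    have hc : c ≠ 0 := by rintro rfl; simp at hd
    have h7 : p * b' = 1 := by
      have h8 : (p * c) * (p * b') = (p * c) * 1 := by linear_combination -h6
      exact mul_left_cancel₀ hd.ne' h8
    exact hp.not_isUnit (IsUnit.of_mul_eq_one _ h7)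
  obtain ⟨m', hm'⟩ : ∃ m', E l₃ m' = 1 := by
    have hl₃0 : l₃ ≠ 0 := fun h => hprim 2 Int.prime_two 0 (by rw [h, smul_zero])
    obtain ⟨s, hs⟩ := h2.resolve_left hl₃0
    have hru : IsUnit r := by
      by_contra hru
      have hr0 : r ≠ 0 := by rintro rfl; rw [zero_smul] at hr; exact hl₃0 hr
      obtain ⟨p, hp, c, rfl⟩ := WfDvdMonoid.exists_irreducible_factor hru hr0
      exact hprim p hp.prime (c • w) (by rw [hr, smul_smul])
    refine ⟨r • s, ?_⟩
    rw [hr, map_smul, map_smul, LinearMap.smul_apply, hs]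
    rcases Int.isUnit_iff.1 hru with rfl | rfl <;> simp
  -- project the partner of `l₃` off the span of `l₁, m₁` and `l₂, m₂`
  have hNm₂ : ∀ x ∈ N, d * E x m₂ = E x ν := by
    intro x hx
    have := hl₃N x hx
    rw [hl₃, map_sub, map_smul, smul_eq_mul] at this
    linarith
  have e1 : E l₁ m₂ = 0 := mul_left_cancel₀ hd.ne' (by rw [hNm₂ _ hl₁, hln, mul_zero])
  have e2 : E l₂ m₂ = 1 := mul_left_cancel₀ hd.ne' (by rw [hNm₂ _ hl₂, hl₂n, mul_one])
  have e3 : E m₁ m₂ = 0 := mul_left_cancel₀ hd.ne' (by rw [hNm₂ _ hm₁, hmn, mul_zero])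
  have e4 : E ν m₂ = 0 := mul_left_cancel₀ hd.ne' (by rw [hNm₂ _ hν, hself, mul_zero])
  have e5 : E l₃ m₂ = 0 := by
    rw [hl₃, map_sub, map_smul, LinearMap.sub_apply, LinearMap.smul_apply, hself, e4]; simp
  set m₃ := m' - E l₁ m' • m₁ + E m₁ m' • l₁ - E l₂ m' • m₂ + E m₂ m' • l₂ with hm₃
  have f0 : ∀ x ∈ N, E l₃ x = 0 := fun x hx => by rw [halt, hl₃N x hx, neg_zero]
  have f1 : E l₁ m₃ = 0 := by
    simp [hm₃, hself, hlm, e1, hll]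
  have f2 : E l₂ m₃ = 0 := by
    simp [hm₃, hself, hl₂m, e2, halt l₂ l₁, hll]
  have f3 : E m₁ m₃ = 0 := by
    simp [hm₃, hself, e3, halt m₁ l₁, hlm, halt m₁ l₂, hl₂m]
  have f4 : E m₂ m₃ = 0 := by
    simp [hm₃, hself, halt m₂ m₁, e3, halt m₂ l₁, e1, halt m₂ l₂, e2]
  have f5 : E l₃ m₃ = 1 := by
    simp [hm₃, f0 _ hl₁, f0 _ hl₂, f0 _ hm₁, e5, hm']
  have f6 : E ν m₃ = -1 := by
    have : E l₃ m₃ = d * E m₂ m₃ - E ν m₃ := by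
      rw [hl₃, map_sub, map_smul, LinearMap.sub_apply, LinearMap.smul_apply, smul_eq_mul]
    rw [f4, f5] at this
    linarith
  refine ⟨l₃, m₂, m₃, rfl, hl₃N, fun x hx => ?_, ?_⟩
  · obtain ⟨a, b, a', b', rfl⟩ := hspan x hx
    simp only [map_add, map_sub, map_smul, LinearMap.add_apply, LinearMap.smul_apply, smul_eq_mul,
      f1, f2, f3, f6, hself, hll, halt m₁ l₂, hl₂m, halt ν l₂, hl₂n]
    ring
  · have h1 : E (l₂ - d • m₃) l₃ = E l₂ l₃ - d * E m₃ l₃ := by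
      rw [LinearMap.map_sub₂, map_smul, LinearMap.smul_apply, smul_eq_mul]
    rw [h1, hl₃N _ hl₂, halt m₃, f5]
    ring

/-- A marking of the subsurface extends to a marking of the threefold. -/
theorem IsSurfaceMarking.exists_isMarking (hd : 0 < d) {𝔞 : Ideal (order D)} {η₁ η₂ : K D}
    (hη : IsSmartBasis d 𝔞 η₁ η₂) {e f : Fin 2 → P.V} (h : P.IsSurfaceMarking 𝔞 e f) :
    ∃ u w, P.IsMarking η₁ η₂ e f u w := by
  have hdR : (d : ℝ) ≠ 0 := by exact_mod_cast hd.ne'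
  have hs0 := sqrtD_ne_zero (D := D)
  have hs := (sqrt_D_pos (D := D)).ne'
  have hη' := congrArg (emb D 0) hη.2.1
  simp only [map_sub, map_mul, map_neg, emb_zero_star, emb_zero_sqrtD] at hη'
  obtain ⟨E, hE, halt, hu⟩ := P.exists_unimodular
  -- the form on `Λ` is nondegenerate, as `Λ` spans `ℂ³` over `ℝ`
  have hspanΛ : ∀ v : C3, (∀ w : P.Λ, imForm P.H v w = 0) → v = 0 := by
    intro v hv
    apply P.isPolarization.eq_zero_of_forall
    intro w
    have hw : w ∈ Submodule.span ℝ (P.Λ : Set C3) := by rw [P.span_Λ]; trivial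
    induction hw using Submodule.span_induction with
    | mem x hx => exact hv ⟨x, hx⟩
    | zero => simp
    | add x y _ _ hx hy => rw [map_add, hx, hy, add_zero]
    | smul r x _ hx => rw [map_smul, hx, smul_zero]
  have hnd : ∀ v, (∀ w, E v w = 0) → v = 0 := by
    intro v hv
    apply Subtype.ext
    apply hspanΛ
    intro w
    rw [← hE, hv]; simp
  obtain ⟨b, -⟩ := P.principal
  have : Module.Finite ℤ P.Λ := Module.Finite.of_basis b
  have : Module.Free ℤ P.Λ := Module.Free.of_basis b
  have memO : ∀ m n : ℤ, (m : K D) * η₁ + (n : K D) * η₂ ∈ orderLattice D := by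
    intro m n
    rw [← hη.1.2, Submodule.mem_span_pair]
    exact ⟨m, n, by rw [zsmul_eq_mul, zsmul_eq_mul]⟩
  have mem𝔞 : ∀ m n : ℤ, (m : K D) * star η₂ + (n : K D) * ((d : K D) * star η₁) ∈ idealLattice 𝔞 := by
    intro m n
    rw [← hη.2.2.2, Submodule.mem_span_pair]
    exact ⟨m, n, by rw [zsmul_eq_mul, zsmul_eq_mul]⟩
  have hΛ : ∀ p ∈ pairLattice 𝔞, ((combo p.1 e + combo p.2 f : P.V) : C3) ∈ P.Λ := fun p hp =>
    (h.lattice _).2 ⟨p, hp, rfl⟩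
  -- the symplectic basis of type `(1, d)` of the lattice of `S` given by the smart basis
  have hl₁ := hΛ (η₁, 0) ⟨by simpa using memO 1 0, by rw [mul_zero]; exact zero_mem _⟩
  have hl₂ := hΛ (η₂, 0) ⟨by simpa using memO 0 1, by rw [mul_zero]; exact zero_mem _⟩
  have hm₁ := hΛ (0, star η₂ / sqrtD D) ⟨zero_mem _, by
    rw [mul_div_cancel₀ _ hs0]; simpa using mem𝔞 1 0⟩
  have hν := hΛ (0, -((d : K D) * star η₁ / sqrtD D)) ⟨zero_mem _, by
    rw [mul_neg, mul_div_cancel₀ _ hs0]; simpa using mem𝔞 0 (-1)⟩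
  have hform : ∀ (x y x' y' : K D) (hv hw) (n : ℤ),
      emb D 0 (x' * y - x * y') + emb D 1 (x' * y - x * y') = n →
      E ⟨((combo x e + combo y f : P.V) : C3), hv⟩ ⟨((combo x' e + combo y' f : P.V) : C3), hw⟩
        = n := by
    intro x y x' y' hv hw n hn
    apply Int.cast_injective (α := ℝ)
    rw [hE, h.frame.imForm_combo, hn]
  have hN : P.subLattice ≠ ⊤ := by
    intro htop
    have h1 : P.V = ⊤ := by
      have h2 : (P.V.restrictScalars ℝ) = ⊤ := by
        rw [eq_top_iff, ← P.span_Λ, Submodule.span_le]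
        intro v hv
        have : (⟨v, hv⟩ : P.Λ) ∈ P.subLattice := by rw [htop]; trivial
        exact this
      rw [eq_top_iff]
      intro v _
      have : v ∈ P.V.restrictScalars ℝ := by rw [h2]; trivial
      exact this
    have h2 := P.finrank_V
    rw [h1, finrank_top, Module.finrank_fin_fun] at h2
    norm_num at h2
  -- `u` and `w` are `d μ₂ - ν` and `λ₂ - d μ₃`, which are orthogonal to `S`
  obtain ⟨l₃, m₂, m₃, rfl, h3N, hwN, hw3⟩ := exists_symplectic_extension E hnd halt hu P.subLattice hN
    (fun n hn v hv => mem_subLattice_of_smul hn hv) (d := d) (by exact_mod_cast hd)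
    ⟨_, hl₁⟩ ⟨_, hl₂⟩ ⟨_, hm₁⟩ ⟨_, hν⟩ (combo η₁ e + combo (0 : K D) f : P.V).2
    (combo η₂ e + combo (0 : K D) f : P.V).2 (combo (0 : K D) e + combo (star η₂ / sqrtD D) f : P.V).2
    (combo (0 : K D) e + combo (-((d : K D) * star η₁ / sqrtD D)) f : P.V).2
    (fun v hv => by
      obtain ⟨⟨x, y⟩, ⟨hx, hy⟩, hxy⟩ := (h.lattice ⟨v, hv⟩).1 v.2
      simp only at hx hy hxy
      rw [← hη.1.2, Submodule.mem_span_pair] at hx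
      rw [← hη.2.2.2, Submodule.mem_span_pair] at hy
      obtain ⟨a, b, rfl⟩ := hx
      obtain ⟨a', b', hab⟩ := hy
      refine ⟨a, b, a', -b', Subtype.ext ?_⟩
      have hy : y = a' • (star η₂ / sqrtD D) + (-b') • (-((d : K D) * star η₁ / sqrtD D)) := by
        rw [zsmul_eq_mul, zsmul_eq_mul]
        rw [zsmul_eq_mul, zsmul_eq_mul] at hab
        field_simp
        push_cast
        linear_combination -hab
      have h1 := congrArg (fun v : P.V => (v : C3)) hxy
      simp only at h1
      rw [h1, hy]
      simp only [combo_add, combo_zsmul, combo_zero, Submodule.coe_add, Submodule.coe_smul_of_tower,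
        add_zero, zero_add]
      abel)
    (hform _ _ _ _ _ _ _ (by simp)) (hform _ _ _ _ _ _ _ (by
      simp [emb_zero_star, emb_one_star, emb_zero_sqrtD, emb_one_sqrtD]
      field_simp
      linarith))
    (hform _ _ _ _ _ _ _ (by
      simp [emb_zero_star, emb_one_star, emb_zero_sqrtD, emb_one_sqrtD]
      field_simp
      ring))
    (hform _ _ _ _ _ _ _ (by
      simp [emb_zero_star, emb_one_star, emb_zero_sqrtD, emb_one_sqrtD]
      field_simp
      ring))
    (hform _ _ _ _ _ _ _ (by
      simp [emb_zero_star, emb_one_star, emb_zero_sqrtD, emb_one_sqrtD]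
      field_simp
      linarith))
    (hform _ _ _ _ _ _ _ (by simp))
  set u : P.Λ := (d : ℤ) • m₂ - ⟨_, hν⟩ with hudef
  set w : P.Λ := ⟨_, hl₂⟩ - (d : ℤ) • m₃ with hwdef
  -- orthogonality to the lattice of `S` implies orthogonality to the tangent space
  have horth : ∀ t : P.Λ, (∀ v ∈ P.subLattice, E v t = 0) → ∀ v : P.V, imForm P.H v t = 0 := by
    intro t ht v
    have hv : (v : C3) ∈ P.V.restrictScalars ℝ := v.2
    rw [← P.span_V] at hv
    generalize (v : C3) = x at hv ⊢
    induction hv using Submodule.span_induction with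
    | mem x hx => rw [← hE ⟨x, hx.1⟩, ht ⟨x, hx.1⟩ hx.2]; simp
    | zero => simp
    | add x y _ _ hx hy => rw [map_add, LinearMap.add_apply, hx, hy, add_zero]
    | smul r x _ hx => rw [map_smul, LinearMap.smul_apply, hx, smul_zero]
  have hF : P.IsFrame e f (u : C3) (w : C3) :=
    { frame := h.frame
      eu := fun i => horth u h3N (e i)
      ew := fun i => horth w hwN (e i)
      fu := fun i => horth u h3N (f i)
      fw := fun i => horth w hwN (f i)
      wu := by rw [← hE, hw3]; simp }
  refine ⟨u, w, hF, span_eq_of_symplectic _ (fun j => ?_) (frameCol_symplectic hd hF.imForm_vec hη.2.1)⟩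
  have hu' : (u : C3) = (d : ℝ) • (m₂ : C3) -
      combo (-((d : K D) * star η₁ / sqrtD D)) (coeV f) := by
    rw [hudef, Submodule.coe_sub, Submodule.coe_smul, ← Int.cast_smul_eq_zsmul ℝ]
    simp only [combo_zero, zero_add, coe_combo]
    simp
  have hw' : (w : C3) = combo η₂ (coeV e) - (d : ℝ) • (m₃ : C3) := by
    rw [hwdef, Submodule.coe_sub, Submodule.coe_smul, ← Int.cast_smul_eq_zsmul ℝ]
    simp only [combo_zero, add_zero, coe_combo]
    simp
  fin_cases j
  · have := hl₁
    rw [← vec_zero_zero e f u w] at this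
    exact this
  · have := hl₂
    rw [← vec_zero_zero e f u w] at this
    exact this
  · have : frameCol d η₁ η₂ (coeV e) (coeV f) u w 2 = u := by
      simp [frameCol, vec, combo_zero]
    change frameCol d η₁ η₂ (coeV e) (coeV f) u w 2 ∈ _
    rw [this]
    exact u.2
  · have := hm₁
    rw [← vec_zero_zero e f u w] at this
    exact this
  · have : frameCol d η₁ η₂ (coeV e) (coeV f) u w 4 = m₂ := by
      simp only [frameCol, vec, hu']
      simp [combo, smul_sub, smul_add, smul_smul, hdR]
      match_scalars <;> field_simp <;> ring
    change frameCol d η₁ η₂ (coeV e) (coeV f) u w 4 ∈ _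
    rw [this]
    exact m₂.2
  · have : frameCol d η₁ η₂ (coeV e) (coeV f) u w 5 = m₃ := by
      simp only [frameCol, vec, hw']
      simp [combo, smul_sub, smul_add, smul_smul, hdR]
      match_scalars <;> field_simp <;> ring
    change frameCol d η₁ η₂ (coeV e) (coeV f) u w 5 ∈ _
    rw [this]
    exact m₃.2

end
end RMThreefold

/-- The ideal `ℤ d + ℤ (γ + n)` has a smart basis with `η₁ = 1`. -/
lemma exists_isSmartBasis {D d : ℕ} [Fact (¬ IsSquare D)] (hD : D % 4 = 0 ∨ D % 4 = 1) (hd : 0 < d)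
    {𝔞 : Ideal (order D)} (h𝔞 : 𝔞 ∈ primitiveIdeals D d) : ∃ η₁ η₂, IsSmartBasis d 𝔞 η₁ η₂ := by
  obtain ⟨n, h, rfl⟩ := exists_eq_idealOf hD hd h𝔞
  have hli : ∀ s t : ℤ, (s : K D) + (t : K D) * gamma D = 0 → s = 0 ∧ t = 0 := by
    intro s t hst
    refine order_coords_inj (D := D) (a' := 0) (b' := 0) ?_
    rw [hst]; simp
  refine ⟨1, gamma D - (D : K D) - (n : K D), ⟨?_, ?_⟩, ?_, ?_, ?_⟩
  · rw [LinearIndependent.pair_iff]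
    intro s t hst
    rw [zsmul_eq_mul, zsmul_eq_mul] at hst
    obtain ⟨h1, rfl⟩ := hli (s - t * (D + n)) t (by push_cast; linear_combination hst)
    exact ⟨by linarith, rfl⟩
  · ext x
    rw [Submodule.mem_span_pair, mem_orderLattice, mem_order_iff hD]
    constructor
    · rintro ⟨a, b, rfl⟩
      refine ⟨a - b * (D + n), b, ?_⟩
      rw [zsmul_eq_mul, zsmul_eq_mul]
      push_cast; ring
    · rintro ⟨a, b, rfl⟩
      refine ⟨a + b * (D + n), b, ?_⟩
      rw [zsmul_eq_mul, zsmul_eq_mul]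
      push_cast; ring
  · rw [star_sub, star_sub, star_gamma, star_intCast, star_natCast', star_one, sqrtD_eq]
    ring
  · rw [LinearIndependent.pair_iff]
    intro s t hst
    rw [zsmul_eq_mul, zsmul_eq_mul, star_sub, star_sub, star_gamma, star_intCast, star_natCast',
      star_one] at hst
    obtain ⟨h1, h2⟩ := hli (t * d - s * n) (-s) (by push_cast; linear_combination hst)
    obtain rfl : s = 0 := by linarith
    refine ⟨rfl, ?_⟩
    have h3 : t * (d : ℤ) = 0 := by linarith
    exact (mul_eq_zero.1 h3).resolve_right (by exact_mod_cast hd.ne')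
  · ext x
    rw [Submodule.mem_span_pair, mem_idealLattice, star_sub, star_sub, star_gamma, star_intCast,
      star_natCast', star_one]
    constructor
    · rintro ⟨a, b, rfl⟩
      refine ⟨⟨(d : K D) * (b : K D) + (gamma D + (n : K D)) * ((-a : ℤ) : K D), ?_⟩,
        (mem_idealOf hD h).2 ⟨b, -a, by push_cast; rfl⟩, ?_⟩
      · exact add_mem (mul_mem (natCast_mem _ d) (intCast_mem _ b))
          (mul_mem (add_mem (gamma_mem_order D) (intCast_mem _ n)) (intCast_mem _ (-a)))
      · rw [zsmul_eq_mul, zsmul_eq_mul]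
        push_cast; ring
    · rintro ⟨y, hy, rfl⟩
      obtain ⟨a, b, hab⟩ := (mem_idealOf hD h).1 hy
      refine ⟨-b, a, ?_⟩
      rw [hab, zsmul_eq_mul, zsmul_eq_mul]
      push_cast; ring

namespace RMThreefold

/-! ### Periods of markings -/

section
variable {D d : ℕ} [Fact (¬ IsSquare D)] {P Q : RMThreefold D d}

/-- The frame is given by `z` in the sense that `f₀ = z₁ e₀`, `f₁ = z₂ e₁`, `w = z₃ u`. -/
def HasPeriod (e f : Fin 2 → P.V) (u w : C3) (z : H3) : Prop :=
  f 0 = (z.1 : ℂ) • e 0 ∧ f 1 = (z.2.1 : ℂ) • e 1 ∧ w = (z.2.2 : ℂ) • u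

namespace IsFrame
variable {e f : Fin 2 → P.V} {u w : C3} (h : P.IsFrame e f u w)
include h

omit [Fact (¬ IsSquare D)] in
lemma u_ne_zero (hd : 0 < d) : u ≠ 0 := by
  rintro rfl
  have := h.wu
  rw [map_zero] at this
  exact hd.ne' (by exact_mod_cast this.symm)

/-- The complex basis of the tangent space attached to a frame. -/
def basis (hd : 0 < d) : Module.Basis (Fin 3) ℂ C3 :=
  basisOfLinearIndependentOfCardEqFinrank (b := ![(e 0 : C3), e 1, u])
    (P.isPolarization.linearIndependent _
      (by
        intro i
        fin_cases i
        · exact h.frame.e_ne_zero 0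
        · exact h.frame.e_ne_zero 1
        · exact h.u_ne_zero hd)
      (by
        have h1 := h.frame.H_e_eq_zero h.eu h.fu
        have h2 : ∀ i, P.H u (e i) = 0 := fun i => by rw [P.isPolarization.hermitian, h1, map_zero]
        have h3 := h.frame.H_e (i := 0) (j := 1) (by decide)
        have h4 := h.frame.H_e (i := 1) (j := 0) (by decide)
        intro i j hij
        fin_cases i <;> fin_cases j <;> simp [h1, h2, h3, h4] at hij ⊢))
    (by simp)

lemma basis_apply (hd : 0 < d) (i : Fin 3) : h.basis hd i = (![(e 0 : C3), e 1, u] : Fin 3 → C3) i := by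
  simp [basis]

lemma exists_basis_coords (hd : 0 < d) (v : C3) : ∃ c : Fin 3 → ℂ,
    v = c 0 • (e 0 : C3) + c 1 • (e 1 : C3) + c 2 • u := by
  refine ⟨(h.basis hd).repr v, ?_⟩
  conv_lhs => rw [← (h.basis hd).sum_repr v]
  rw [Fin.sum_univ_three, basis_apply, basis_apply, basis_apply]
  rfl

/-- A frame diagonalizes `H`: the lines spanned by `e 0`, `e 1` and `u` are orthogonal. -/
lemma H_coords (c c' : Fin 3 → ℂ) :
    P.H (c 0 • (e 0 : C3) + c 1 • (e 1 : C3) + c 2 • u)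
      (c' 0 • (e 0 : C3) + c' 1 • (e 1 : C3) + c' 2 • u) =
    c 0 * (starRingEnd ℂ) (c' 0) * P.H (e 0) (e 0) + c 1 * (starRingEnd ℂ) (c' 1) * P.H (e 1) (e 1) +
      c 2 * (starRingEnd ℂ) (c' 2) * P.H u u := by
  have h1 := h.frame.H_e_eq_zero h.eu h.fu
  have h2 : ∀ i, P.H u (e i) = 0 := fun i => by rw [P.isPolarization.hermitian, h1, map_zero]
  have h3 := h.frame.H_e (i := 0) (j := 1) (by decide)
  have h4 := h.frame.H_e (i := 1) (j := 0) (by decide)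
  simp [h1, h2, h3, h4, map_smulₛₗ]
  ring

/-- The vector `w` is a multiple of `u` because both lie in the orthogonal complement of the tangent
space of `S`, which is a line. -/
lemma exists_period (hd : 0 < d) : ∃ z : H3, HasPeriod e f u w z := by
  obtain ⟨z, hz, -⟩ := h.frame.exists_uniformize
  have hwe := h.frame.H_e_eq_zero h.ew h.fw
  have hwe' : ∀ i, P.H w (e i) = 0 := fun i => by rw [P.isPolarization.hermitian, hwe, map_zero]
  obtain ⟨c, hc⟩ := h.exists_basis_coords hd w
  have hne : ∀ i, P.H (e i) (e i) ≠ 0 := by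
    intro i h0
    have := P.isPolarization.pos _ (h.frame.e_ne_zero i)
    rw [h0] at this
    simp at this
  have h0 := h.H_coords c ![1, 0, 0]
  have h1 := h.H_coords c ![0, 1, 0]
  rw [← hc] at h0 h1
  simp [hwe', hne] at h0 h1
  have hw : w = c 2 • u := by rw [hc, h0, h1]; simp
  have hpos := P.isPolarization.pos u (h.u_ne_zero hd)
  have hwu := h.wu
  rw [hw, imForm_apply, map_smul, LinearMap.smul_apply, smul_eq_mul, Complex.mul_im,
    P.isPolarization.self_im, mul_zero, zero_add] at hwu
  have hdR : (0 : ℝ) < d := by exact_mod_cast hd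
  have him : 0 < (c 2).im := by
    by_contra hneg
    have : (c 2).im * (P.H u u).re ≤ 0 := mul_nonpos_of_nonpos_of_nonneg (not_lt.1 hneg) hpos.le
    linarith
  exact ⟨(z 0, z 1, ⟨c 2, him⟩), hz 0, hz 1, hw⟩

end IsFrame

omit [Fact (¬ IsSquare D)] in
/-- The values of the form on a frame with period `z`. -/
lemma HasPeriod.H_self {e f : Fin 2 → P.V} {u w : C3} {z : H3} (hz : HasPeriod e f u w z)
    (h : P.IsFrame e f u w) : P.H (e 0) (e 0) = ((1 / z.1.im : ℝ) : ℂ) ∧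
      P.H (e 1) (e 1) = ((1 / z.2.1.im : ℝ) : ℂ) ∧ P.H u u = ((d / z.2.2.im : ℝ) : ℂ) := by
  have key : ∀ (v : C3) (τ : UpperHalfPlane) (r : ℝ), imForm P.H ((τ : ℂ) • v) v = r →
      P.H v v = ((r / τ.im : ℝ) : ℂ) := by
    intro v τ r hr
    have him := P.isPolarization.self_im v
    rw [imForm_apply, map_smul, LinearMap.smul_apply, smul_eq_mul, Complex.mul_im, him, mul_zero,
      zero_add] at hr
    apply Complex.ext
    · rw [Complex.ofReal_re, eq_div_iff τ.im_pos.ne', mul_comm]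
      exact hr
    · rw [him, Complex.ofReal_im]
  obtain ⟨h0, h1, h2⟩ := hz
  refine ⟨key _ _ _ ?_, key _ _ _ ?_, key _ _ _ ?_⟩
  · rw [← Submodule.coe_smul, ← h0, h.frame.fe, if_pos rfl]
  · rw [← Submodule.coe_smul, ← h1, h.frame.fe, if_pos rfl]
  · rw [← h2, h.wu]

omit [Fact (¬ IsSquare D)] in
lemma HasPeriod.unique (hd : 0 < d) {e f : Fin 2 → P.V} {u w : C3} {z z' : H3}
    (hz : HasPeriod e f u w z) (hz' : HasPeriod e f u w z') (h : P.IsFrame e f u w) : z = z' := by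
  have key : ∀ (v : C3) (a b : UpperHalfPlane), v ≠ 0 → (a : ℂ) • v = (b : ℂ) • v → a = b := by
    intro v a b hv hab
    exact UpperHalfPlane.ext (smul_left_injective ℂ hv hab)
  obtain ⟨h0, h1, h2⟩ := hz
  obtain ⟨h0', h1', h2'⟩ := hz'
  refine Prod.ext (key _ _ _ (h.frame.e_ne_zero 0) ?_)
    (Prod.ext (key _ _ _ (h.frame.e_ne_zero 1) ?_) (key _ _ _ (h.u_ne_zero hd) ?_))
  · rw [← Submodule.coe_smul, ← Submodule.coe_smul, ← h0, ← h0']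
  · rw [← Submodule.coe_smul, ← Submodule.coe_smul, ← h1, ← h1']
  · rw [← h2, ← h2']

/-- Threefolds with markings of the same period are isomorphic. -/
theorem exists_isIsom_of_period (hd : 0 < d) {η₁ η₂ : K D} {e f : Fin 2 → P.V} {u w : C3}
    {e' f' : Fin 2 → Q.V} {u' w' : C3} {z : H3} (hP : P.IsMarking η₁ η₂ e f u w)
    (hQ : Q.IsMarking η₁ η₂ e' f' u' w') (hzP : HasPeriod e f u w z)
    (hzQ : HasPeriod e' f' u' w' z) : ∃ F : C3 ≃ₗ[ℂ] C3, IsIsom P Q F := by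
  let F : C3 ≃ₗ[ℂ] C3 := (hP.frame.basis hd).equiv (hQ.frame.basis hd) (Equiv.refl _)
  have hF : ∀ i, F (hP.frame.basis hd i) = hQ.frame.basis hd i := fun i => by
    simp [F, Module.Basis.equiv_apply]
  have hF0 : F (e 0) = e' 0 := by simpa [IsFrame.basis_apply] using hF 0
  have hF1 : F (e 1) = e' 1 := by simpa [IsFrame.basis_apply] using hF 1
  have hF2 : F u = u' := by simpa [IsFrame.basis_apply] using hF 2
  have hFc : ∀ c : Fin 3 → ℂ, F (c 0 • (e 0 : C3) + c 1 • (e 1 : C3) + c 2 • u) =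
      c 0 • (e' 0 : C3) + c 1 • (e' 1 : C3) + c 2 • u' := by
    intro c
    simp only [map_add, map_smul, hF0, hF1, hF2]
  obtain ⟨p0, p1, p2⟩ := hzP.H_self hP.frame
  obtain ⟨q0, q1, q2⟩ := hzQ.H_self hQ.frame
  have hV : ∀ v : P.V, ∃ c : Fin 2 → ℂ, v = c 0 • e 0 + c 1 • e 1 ∧
      F v = ((c 0 • e' 0 + c 1 • e' 1 : Q.V) : C3) := by
    intro v
    obtain ⟨c, rfl⟩ := hP.frame.frame.exists_coords v
    refine ⟨c, rfl, ?_⟩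
    simp only [Submodule.coe_add, Submodule.coe_smul, map_add, map_smul, hF0, hF1]
  refine ⟨F, fun v => ?_, fun v v' => ?_, fun v => ?_, fun k v v' hv => ?_⟩
  · have hcol : ∀ j, F (frameCol d η₁ η₂ (coeV e) (coeV f) u w j) =
        frameCol d η₁ η₂ (coeV e') (coeV f') u' w' j := by
      intro j
      have hf : ∀ i, F (coeV f i) = coeV f' i := by
        intro i
        fin_cases i
        · change F (f 0) = f' 0
          rw [hzP.1, hzQ.1, Submodule.coe_smul, Submodule.coe_smul, map_smul, hF0]
        · change F (f 1) = f' 1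
          rw [hzP.2.1, hzQ.2.1, Submodule.coe_smul, Submodule.coe_smul, map_smul, hF1]
      have he : ∀ i, F (coeV e i) = coeV e' i := by
        intro i
        fin_cases i
        · exact hF0
        · exact hF1
      have hw : F w = w' := by rw [hzP.2.2, hzQ.2.2, map_smul, hF2]
      change (F.restrictScalars ℝ) _ = _
      rw [frameCol, map_vec]
      change vec (fun i => F (coeV e i)) (fun i => F (coeV f i)) (F u) (F w) _ _ _ _ = _
      simp only [he, hf, hF2, hw]
      rfl
    have hΛ : Q.Λ = P.Λ.map (F.restrictScalars ℤ : C3 →ₗ[ℤ] C3) := by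
      rw [hP.lattice, hQ.lattice, Submodule.map_span, ← Set.range_comp]
      congr 2
      funext j
      exact (hcol j).symm
    rw [hΛ]
    exact ⟨fun ⟨x, hx, hxv⟩ => F.injective hxv ▸ hx, fun hv => ⟨v, hv, rfl⟩⟩
  · obtain ⟨c, rfl⟩ := hP.frame.exists_basis_coords hd v
    obtain ⟨c', rfl⟩ := hP.frame.exists_basis_coords hd v'
    rw [hFc, hFc, hQ.frame.H_coords, hP.frame.H_coords, p0, p1, p2, q0, q1, q2]
  · constructor
    · intro hv
      obtain ⟨c, hc⟩ := hQ.frame.frame.exists_coords ⟨F v, hv⟩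
      have h1 : F v = F ((c 0 • e 0 + c 1 • e 1 : P.V) : C3) := by
        simp only [Submodule.coe_add, Submodule.coe_smul, map_add, map_smul, hF0, hF1]
        exact congrArg Subtype.val hc
      rw [F.injective h1]
      exact (c 0 • e 0 + c 1 • e 1 : P.V).2
    · intro hv
      obtain ⟨c, -, hc⟩ := hV ⟨v, hv⟩
      rw [hc]
      exact Subtype.mem _
  · obtain ⟨c, hcv, hc⟩ := hV v
    have h1 : v' = c 0 • e' 0 + c 1 • e' 1 := Subtype.ext (by rw [← hv, hc])
    rw [act_eq, act_eq, h1, hcv]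
    simp only [map_add, map_smul, hP.frame.frame.act_e, hQ.frame.frame.act_e, P.real_smul_eq,
      Q.real_smul_eq, Submodule.coe_add, Submodule.coe_smul, hF0, hF1]

/-- A marking depends on the lattice, the form, the tangent space of `S` and the action of `𝒪_D`,
but not on the complex structure. -/
lemma IsSymplecticIsom.map_marking {τ : C3 ≃ₗ[ℝ] C3} (h : IsSymplecticIsom P Q τ)
    {η₁ η₂ : K D} {e f : Fin 2 → P.V} {u w : C3} (hm : P.IsMarking η₁ η₂ e f u w) :
    Q.IsMarking η₁ η₂ (fun i => onV h (e i)) (fun i => onV h (f i)) (τ u) (τ w) where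
  frame :=
    { frame := h.map_frame hm.frame.frame
      eu := fun i => by rw [coe_onV, h.form, hm.frame.eu]
      ew := fun i => by rw [coe_onV, h.form, hm.frame.ew]
      fu := fun i => by rw [coe_onV, h.form, hm.frame.fu]
      fw := fun i => by rw [coe_onV, h.form, hm.frame.fw]
      wu := by rw [h.form, hm.frame.wu] }
  lattice := by
    have hΛ : Q.Λ = P.Λ.map (τ.restrictScalars ℤ : C3 →ₗ[ℤ] C3) := by
      ext v
      constructor
      · intro hv
        exact ⟨τ.symm v, (h.mem_Λ _).1 (by rwa [τ.apply_symm_apply]), τ.apply_symm_apply v⟩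
      · rintro ⟨x, hx, rfl⟩
        exact (h.mem_Λ x).2 hx
    rw [hΛ, hm.lattice, Submodule.map_span, ← Set.range_comp]
    congr 2
    funext j
    change τ _ = _
    rw [frameCol, map_vec]
    rfl

omit [Fact (¬ IsSquare D)] in
lemma HasPeriod.map_isom {F : C3 ≃ₗ[ℂ] C3} (h : IsIsom P Q F) {e f : Fin 2 → P.V} {u w : C3}
    {z : H3} (hz : HasPeriod e f u w z) :
    HasPeriod (fun i => onV h.isSymplecticIsom (e i)) (fun i => onV h.isSymplecticIsom (f i))
      (F u) (F w) z := by
  refine ⟨Subtype.ext ?_, Subtype.ext ?_, ?_⟩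
  · exact (congrArg (fun v : P.V => F v) hz.1).trans (map_smul F _ _)
  · exact (congrArg (fun v : P.V => F v) hz.2.1).trans (map_smul F _ _)
  · rw [hz.2.2]
    exact map_smul F _ _

end
end RMThreefold

open RMThreefold

/-! ### The threefolds `A_z` -/

section
variable {D d : ℕ}

/-- The first two standard basis vectors. -/
def stdE : Fin 2 → C3 := ![![1, 0, 0], ![0, 1, 0]]

/-- The vectors `z₁ e₀`, `z₂ e₁`. -/
def stdF (z : H3) : Fin 2 → C3 := ![![(z.1 : ℂ), 0, 0], ![0, (z.2.1 : ℂ), 0]]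

/-- The third standard basis vector. -/
def stdU : C3 := ![0, 0, 1]

/-- `z₃` times the third standard basis vector. -/
def stdW (z : H3) : C3 := ![0, 0, (z.2.2 : ℂ)]

lemma vec_std (z : H3) (x y : K D) (p q : ℝ) : vec stdE (stdF z) stdU (stdW z) x y p q =
    ![(emb D 0 x : ℂ) + (emb D 0 y : ℂ) * z.1, (emb D 1 x : ℂ) + (emb D 1 y : ℂ) * z.2.1,
      (p : ℂ) * z.2.2 + q] := by
  funext i
  fin_cases i <;> simp [vec, combo, stdE, stdF, stdU, stdW]

/-- The polarization form of `A_z`. -/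
def stdForm (d : ℕ) (z : H3) : SesqForm :=
  LinearMap.mk₂'ₛₗ (RingHom.id ℂ) (starRingEnd ℂ)
    (fun v w => v 0 * (starRingEnd ℂ) (w 0) * ((1 / z.1.im : ℝ) : ℂ) +
      v 1 * (starRingEnd ℂ) (w 1) * ((1 / z.2.1.im : ℝ) : ℂ) +
      v 2 * (starRingEnd ℂ) (w 2) * ((d / z.2.2.im : ℝ) : ℂ))
    (fun v v' w => by simp only [Pi.add_apply]; ring)
    (fun c v w => by simp only [Pi.smul_apply, smul_eq_mul, RingHom.id_apply]; ring)
    (fun v w w' => by simp only [Pi.add_apply, map_add]; ring)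
    (fun c v w => by simp only [Pi.smul_apply, smul_eq_mul, map_mul]; ring)

lemma stdForm_apply (z : H3) (v w : C3) : stdForm d z v w =
    v 0 * (starRingEnd ℂ) (w 0) * ((1 / z.1.im : ℝ) : ℂ) +
      v 1 * (starRingEnd ℂ) (w 1) * ((1 / z.2.1.im : ℝ) : ℂ) +
      v 2 * (starRingEnd ℂ) (w 2) * ((d / z.2.2.im : ℝ) : ℂ) := rfl

lemma stdForm_hermitian (z : H3) (v w : C3) : stdForm d z w v = (starRingEnd ℂ) (stdForm d z v w) := by
  simp only [stdForm_apply, map_add, map_mul, Complex.conj_conj, Complex.conj_ofReal]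
  ring

lemma stdForm_pos (hd : 0 < d) (z : H3) {v : C3} (hv : v ≠ 0) : 0 < (stdForm d z v v).re := by
  have h0 := z.1.im_pos
  have h1 := z.2.1.im_pos
  have h2 := z.2.2.im_pos
  have hdR : (0 : ℝ) < d := by exact_mod_cast hd
  have h3 : (stdForm d z v v).re = Complex.normSq (v 0) * (1 / z.1.im) +
      Complex.normSq (v 1) * (1 / z.2.1.im) + Complex.normSq (v 2) * (d / z.2.2.im) := by
    rw [stdForm_apply, Complex.mul_conj, Complex.mul_conj, Complex.mul_conj, ← Complex.ofReal_mul,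
      ← Complex.ofReal_mul, ← Complex.ofReal_mul, ← Complex.ofReal_add, ← Complex.ofReal_add,
      Complex.ofReal_re]
  rw [h3]
  have a0 := mul_nonneg (Complex.normSq_nonneg (v 0)) (one_div_pos.2 h0).le
  have a1 := mul_nonneg (Complex.normSq_nonneg (v 1)) (one_div_pos.2 h1).le
  have a2 := mul_nonneg (Complex.normSq_nonneg (v 2)) (div_pos hdR h2).le
  by_contra hneg
  have b0 : Complex.normSq (v 0) * (1 / z.1.im) = 0 := by linarith
  have b1 : Complex.normSq (v 1) * (1 / z.2.1.im) = 0 := by linarith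
  have b2 : Complex.normSq (v 2) * (d / z.2.2.im) = 0 := by linarith
  apply hv
  funext i
  fin_cases i
  · exact Complex.normSq_eq_zero.1 ((mul_eq_zero.1 b0).resolve_right (one_div_pos.2 h0).ne')
  · exact Complex.normSq_eq_zero.1 ((mul_eq_zero.1 b1).resolve_right (one_div_pos.2 h1).ne')
  · exact Complex.normSq_eq_zero.1 ((mul_eq_zero.1 b2).resolve_right (div_pos hdR h2).ne')

lemma stdForm_alt (z : H3) (v w : C3) : imForm (stdForm d z) v w = - imForm (stdForm d z) w v := by
  rw [imForm_apply, imForm_apply, stdForm_hermitian z v w, Complex.conj_im, neg_neg]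

/-- On the frame of `A_z`, the form does not depend on `z`. -/
lemma stdForm_vec (z : H3) (x y x' y' : K D) (p q p' q' : ℝ) :
    imForm (stdForm d z) (vec stdE (stdF z) stdU (stdW z) x y p q)
      (vec stdE (stdF z) stdU (stdW z) x' y' p' q') =
      emb D 0 (x' * y - x * y') + emb D 1 (x' * y - x * y') + d * (p * q' - q * p') := by
  have key : ∀ (a b a' b' c : ℝ) (τ : UpperHalfPlane),
      (((a : ℂ) + b * τ) * (starRingEnd ℂ) ((a' : ℂ) + b' * τ) * ((c / τ.im : ℝ) : ℂ)).im =
        c * (a' * b - a * b') := by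
    intro a b a' b' c τ
    have := τ.im_pos.ne'
    simp only [Complex.mul_im, Complex.mul_re, Complex.ofReal_im, Complex.ofReal_re, map_add, map_mul,
      Complex.conj_ofReal, Complex.add_re, Complex.add_im, Complex.conj_re, Complex.conj_im,
      UpperHalfPlane.coe_re, UpperHalfPlane.coe_im]
    field_simp
    ring
  rw [imForm_apply, stdForm_apply, vec_std, vec_std]
  simp only [Matrix.cons_val, Complex.add_im]
  rw [key, key, add_comm ((p : ℂ) * _), add_comm ((p' : ℂ) * _), key]
  simp only [map_sub, map_mul]
  ring

/-- The tangent space `ℂ² × {0}` of the surface `S_z`. -/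
def stdV : Submodule ℂ C3 := LinearMap.ker (LinearMap.proj (R := ℂ) (φ := fun _ : Fin 3 => ℂ) 2)

lemma mem_stdV {v : C3} : v ∈ stdV ↔ v 2 = 0 := LinearMap.mem_ker

lemma finrank_stdV : Module.finrank ℂ stdV = 2 := by
  have h := LinearMap.finrank_range_add_finrank_ker
    (LinearMap.proj (R := ℂ) (φ := fun _ : Fin 3 => ℂ) 2)
  have h1 : LinearMap.range (LinearMap.proj (R := ℂ) (φ := fun _ : Fin 3 => ℂ) 2) = ⊤ :=
    LinearMap.range_eq_top.2 (Function.surjective_eval 2)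
  rw [h1, finrank_top, Module.finrank_self, Module.finrank_fin_fun] at h
  change Module.finrank ℂ stdV = 2
  have : 1 + Module.finrank ℂ stdV = 3 := h
  omega

/-- The action `k ↦ diag (k, k^σ)` on `ℂ² × {0}`. -/
def stdAct (D : ℕ) : K D →+* Module.End ℂ stdV where
  toFun y :=
    { toFun := fun v => ⟨![(emb D 0 y : ℂ) * (v : C3) 0, (emb D 1 y : ℂ) * (v : C3) 1, 0], by
        simp [mem_stdV]⟩
      map_add' := fun v w => by
        apply Subtype.ext; funext i
        fin_cases i <;> simp [mul_add]
      map_smul' := fun c v => by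
        apply Subtype.ext; funext i
        fin_cases i <;> simp [mul_left_comm] }
  map_one' := by
    refine LinearMap.ext fun v => Subtype.ext (funext fun i => ?_)
    have := mem_stdV.1 v.2
    fin_cases i <;> simp [this]
  map_zero' := by
    refine LinearMap.ext fun v => Subtype.ext (funext fun i => ?_)
    fin_cases i <;> simp
  map_add' x y := by
    refine LinearMap.ext fun v => Subtype.ext (funext fun i => ?_)
    fin_cases i <;> simp [add_mul]
  map_mul' x y := by
    refine LinearMap.ext fun v => Subtype.ext (funext fun i => ?_)
    fin_cases i <;> simp [mul_assoc]

lemma stdAct_apply (y : K D) (v : stdV) : (stdAct D y v : C3) =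
    ![(emb D 0 y : ℂ) * (v : C3) 0, (emb D 1 y : ℂ) * (v : C3) 1, 0] := rfl

variable [Fact (¬ IsSquare D)]

lemma periodMatrix_col (η₁ η₂ : K D) (z : H3) (j : Fin 6) :
    (fun i => periodMatrix d η₁ η₂ z i j) =
      frameCol d η₁ η₂ stdE (stdF z) stdU (stdW z) j := by
  funext i
  rw [frameCol, vec_std]
  fin_cases j <;> fin_cases i <;>
    simp [periodMatrix, toC, emb_zero, emb_one, star_sqrtD, div_eq_mul_inv,
      -mul_eq_mul_right_iff, -mul_eq_mul_left_iff] <;> ring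

/-- The lattice of `A_z`. -/
def stdLattice (d : ℕ) (η₁ η₂ : K D) (z : H3) : Submodule ℤ C3 :=
  Submodule.span ℤ (Set.range (frameCol d η₁ η₂ stdE (stdF z) stdU (stdW z)))

lemma std_im_eq_zero {τ : UpperHalfPlane} {a b : ℝ} (h : (a : ℂ) * τ + b = 0) : a = 0 ∧ b = 0 := by
  have h1 := congrArg Complex.im h
  have h2 := congrArg Complex.re h
  simp only [Complex.add_im, Complex.add_re, Complex.mul_im, Complex.mul_re, Complex.ofReal_im,
    Complex.ofReal_re, Complex.zero_im, Complex.zero_re, zero_mul, add_zero, sub_zero,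
    UpperHalfPlane.coe_im, UpperHalfPlane.coe_re] at h1 h2
  obtain rfl := (mul_eq_zero.1 h1).resolve_right τ.im_pos.ne'
  exact ⟨rfl, by linarith⟩

/-- The lattice of the surface `S_z`. -/
lemma mem_stdLattice_stdV (hd : 0 < d) {𝔞 : Ideal (order D)} {η₁ η₂ : K D}
    (hη : IsSmartBasis d 𝔞 η₁ η₂) {z : H3} {v : C3} :
    v ∈ stdLattice d η₁ η₂ z ∧ v ∈ stdV ↔ ∃ x y : K D, v = vec stdE (stdF z) stdU (stdW z) x y 0 0 ∧
      x ∈ orderLattice D ∧ sqrtD D * y ∈ idealLattice 𝔞 := by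
  have hdR : (d : ℝ) ≠ 0 := by exact_mod_cast hd.ne'
  rw [stdLattice, mem_span_frameCol_iff hd hη, mem_stdV]
  constructor
  · rintro ⟨⟨x, y, m, n, rfl, hx, hy⟩, h2⟩
    rw [vec_std] at h2
    obtain ⟨hm, hn⟩ := std_im_eq_zero (τ := z.2.2) (a := m / d) (b := n / d)
      (by push_cast; simpa using h2)
    rw [div_eq_zero_iff, or_iff_left hdR] at hm hn
    obtain rfl : m = 0 := by exact_mod_cast hm
    obtain rfl : n = 0 := by exact_mod_cast hn
    exact ⟨x, y, by simp, by simpa using hx, by simpa using hy⟩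
  · rintro ⟨x, y, rfl, hx, hy⟩
    refine ⟨⟨x, y, 0, 0, by simp, by simpa using hx, by simpa using hy⟩, ?_⟩
    rw [vec_std]; simp

omit [Fact (¬ IsSquare D)] in
lemma stdAct_vec (k x y : K D) {z : H3} (v : stdV)
    (hv : (v : C3) = vec stdE (stdF z) stdU (stdW z) x y 0 0) :
    (stdAct D k v : C3) = vec stdE (stdF z) stdU (stdW z) (k * x) (k * y) 0 0 := by
  rw [stdAct_apply, hv, vec_std, vec_std]
  funext i
  fin_cases i <;> simp <;> ring

/-- A symplectic basis of the lattice of `S_z`. -/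
def stdSurfaceBasis (d : ℕ) (η₁ η₂ : K D) (z : H3) : Fin 2 ⊕ Fin 2 → C3 :=
  Sum.elim (fun i => vec stdE (stdF z) stdU (stdW z) ((![η₁, η₂] : Fin 2 → K D) i) 0 0 0)
    (fun i => vec stdE (stdF z) stdU (stdW z) 0
      ((![star η₂ / sqrtD D, -((d : K D) * (star η₁ / sqrtD D))] : Fin 2 → K D) i) 0 0)

lemma stdSurfaceBasis_symplectic (d : ℕ) {η₁ η₂ : K D}
    (hη : η₁ * star η₂ - star η₁ * η₂ = - sqrtD D) (z : H3) :
    IsSymplecticFamily (imForm (stdForm d z)) (stdSurfaceBasis d η₁ η₂ z)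
      (fun i => ((![1, d] i : ℕ) : ℝ)) := by
  intro i j
  have hs := (sqrt_D_pos (D := D)).ne'
  have h1 := congrArg (emb D 0) hη
  simp only [map_sub, map_mul, map_neg, emb_zero_star, emb_zero_sqrtD] at h1
  simp only [stdSurfaceBasis, Sum.elim_inl, Sum.elim_inr, stdForm_vec, map_sub, map_mul]
  fin_cases i <;> fin_cases j <;>
    simp [emb_zero_star, emb_one_star, emb_zero_sqrtD, emb_one_sqrtD] <;> field_simp <;>
    first | linarith | linear_combination (d : ℝ) * h1 | linear_combination -(d : ℝ) * h1

lemma stdSurfaceBasis_span (hd : 0 < d) {𝔞 : Ideal (order D)} {η₁ η₂ : K D}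
    (hη : IsSmartBasis d 𝔞 η₁ η₂) (z : H3) :
    stdLattice d η₁ η₂ z ⊓ stdV.restrictScalars ℤ =
      Submodule.span ℤ (Set.range (stdSurfaceBasis d η₁ η₂ z)) := by
  have hs := sqrtD_ne_zero (D := D)
  ext v
  rw [Submodule.mem_span_range_iff_exists_fun]
  refine (mem_stdLattice_stdV hd hη).trans ?_
  have hsum : ∀ c : Fin 2 ⊕ Fin 2 → ℤ, ∑ i, c i • stdSurfaceBasis d η₁ η₂ z i =
      vec stdE (stdF z) stdU (stdW z) (c (Sum.inl 0) • η₁ + c (Sum.inl 1) • η₂)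
        (c (Sum.inr 0) • (star η₂ / sqrtD D) +
          c (Sum.inr 1) • -((d : K D) * (star η₁ / sqrtD D))) 0 0 := by
    intro c
    simp only [Fintype.sum_sum_type, Fin.sum_univ_two, stdSurfaceBasis, Sum.elim_inl, Sum.elim_inr,
      vec, combo_add, combo_zsmul, combo_zero, zero_smul, add_zero, zero_add, Matrix.cons_val_zero,
      Matrix.cons_val_one]
  simp only [hsum]
  constructor
  · rintro ⟨x, y, rfl, hx, hy⟩
    rw [← hη.1.2, Submodule.mem_span_pair] at hx
    rw [← hη.2.2.2, Submodule.mem_span_pair] at hy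
    obtain ⟨a, b, rfl⟩ := hx
    obtain ⟨a', b', hab'⟩ := hy
    refine ⟨Sum.elim ![a, b] ![a', -b'], ?_⟩
    congr 1
    simp only [Sum.elim_inr, Matrix.cons_val_zero, Matrix.cons_val_one]
    rw [zsmul_eq_mul, zsmul_eq_mul] at hab' ⊢
    field_simp
    push_cast
    linear_combination hab'
  · rintro ⟨c, rfl⟩
    refine ⟨_, _, rfl, ?_, ?_⟩
    · rw [← hη.1.2, Submodule.mem_span_pair]
      exact ⟨_, _, rfl⟩
    · rw [← hη.2.2.2, Submodule.mem_span_pair]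
      refine ⟨c (Sum.inr 0), - c (Sum.inr 1), ?_⟩
      simp only [zsmul_eq_mul]
      field_simp
      push_cast
      ring

lemma std_coords_iff {z : H3} {x y x' y' : K D} {p q p' q' : ℝ} :
    vec stdE (stdF z) stdU (stdW z) x y p q = vec stdE (stdF z) stdU (stdW z) x' y' p' q' ↔
    x = x' ∧ y = y' ∧ p = p' ∧ q = q' := by
  refine ⟨fun h => ?_, by rintro ⟨rfl, rfl, rfl, rfl⟩; rfl⟩
  rw [vec_std, vec_std] at h
  have h0 := congrFun h 0
  have h2 := congrFun h 2
  simp only [Matrix.cons_val] at h0 h2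
  obtain ⟨h3, h4⟩ := std_im_eq_zero (τ := z.1) (a := emb D 0 y - emb D 0 y')
    (b := emb D 0 x - emb D 0 x') (by push_cast; linear_combination h0)
  obtain ⟨h5, h6⟩ := std_im_eq_zero (τ := z.2.2) (a := p - p') (b := q - q')
    (by push_cast; linear_combination h2)
  exact ⟨emb_injective 0 (sub_eq_zero.1 h4), emb_injective 0 (sub_eq_zero.1 h3), sub_eq_zero.1 h5,
    sub_eq_zero.1 h6⟩

lemma exists_natCast_mul_mem_order (y : K D) : ∃ N : ℕ, N ≠ 0 ∧ (N : K D) * y ∈ order D := by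
  refine ⟨y.re.den * y.im.den, mul_ne_zero y.re.den_nz y.im.den_nz, ?_⟩
  have h : ((y.re.den * y.im.den : ℕ) : K D) * y = ((y.re.num * y.im.den : ℤ) : K D) +
      ((y.im.num * y.re.den : ℤ) : K D) * sqrtD D := by
    have h1 := Rat.mul_den_eq_num y.re
    have h2 := Rat.mul_den_eq_num y.im
    ext
    · simp [sqrtD]
      linear_combination (y.im.den : ℚ) * h1
    · simp [sqrtD]
      linear_combination (y.re.den : ℚ) * h2
  rw [h]
  exact add_mem (intCast_mem _ _) (mul_mem (intCast_mem _ _) (sqrtD_mem_order D))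

omit [Fact (¬ IsSquare D)] in
lemma _root_.RMModuli.RMThreefold.IsSymplecticFamily.integral {g : ℕ}
    {E : C3 →ₗ[ℝ] C3 →ₗ[ℝ] ℝ} (halt : ∀ v w, E v w = - E w v) {c : Fin g ⊕ Fin g → C3} {t : Fin g → ℤ}
    (h : IsSymplecticFamily E c (fun i => t i)) (i j : Fin g ⊕ Fin g) :
    ∃ n : ℤ, E (c i) (c j) = n := by
  rcases i with i | i <;> rcases j with j | j
  · exact ⟨0, by rw [(h i j).1]; simp⟩
  · exact ⟨if i = j then t i else 0, by rw [(h i j).2.2]; split_ifs <;> simp⟩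
  · exact ⟨-if j = i then t j else 0, by rw [halt, (h j i).2.2]; split_ifs <;> simp⟩
  · exact ⟨0, by rw [(h i j).2.1]; simp⟩

omit [Fact (¬ IsSquare D)] in
lemma integral_of_span {ι : Type*} {H : SesqForm} {c : ι → C3}
    (h : ∀ i j, ∃ n : ℤ, imForm H (c i) (c j) = n) :
    ∀ v ∈ Submodule.span ℤ (Set.range c), ∀ w ∈ Submodule.span ℤ (Set.range c),
      ∃ n : ℤ, (H v w).im = n := by
  intro v hv w hw
  induction hv using Submodule.span_induction with
  | mem x hx =>
    obtain ⟨i, rfl⟩ := hx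
    induction hw using Submodule.span_induction with
    | mem y hy => obtain ⟨j, rfl⟩ := hy; exact h i j
    | zero => exact ⟨0, by simp⟩
    | add y y' _ _ hy hy' =>
      obtain ⟨n, hn⟩ := hy
      obtain ⟨n', hn'⟩ := hy'
      exact ⟨n + n', by rw [map_add, Complex.add_im, hn, hn']; push_cast; rfl⟩
    | smul a y _ hy =>
      obtain ⟨n, hn⟩ := hy
      exact ⟨a * n, by
        rw [← imForm_apply, map_zsmul, imForm_apply, hn, zsmul_eq_mul]; push_cast; rfl⟩
  | zero => exact ⟨0, by simp⟩
  | add y y' _ _ hy hy' =>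
    obtain ⟨n, hn⟩ := hy
    obtain ⟨n', hn'⟩ := hy'
    exact ⟨n + n', by rw [map_add, LinearMap.add_apply, Complex.add_im, hn, hn']; push_cast; rfl⟩
  | smul a y _ hy =>
    obtain ⟨n, hn⟩ := hy
    exact ⟨a * n, by
      rw [← imForm_apply, map_zsmul, LinearMap.smul_apply, imForm_apply, hn, zsmul_eq_mul]
      push_cast; rfl⟩

/-- The vectors of the lattice of `S_z` coming from `𝒪_D` and `(1/√D) 𝔞` span `ℂ²` over `ℝ`. -/
lemma stdV_span (hd : 0 < d) {𝔞 : Ideal (order D)} {η₁ η₂ : K D}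
    (hη : IsSmartBasis d 𝔞 η₁ η₂) (z : H3) :
    Submodule.span ℝ ((stdLattice d η₁ η₂ z : Set C3) ∩ stdV) = stdV.restrictScalars ℝ := by
  apply le_antisymm
  · rw [Submodule.span_le]
    rintro v ⟨-, hv⟩
    exact hv
  have hli := (stdSurfaceBasis_symplectic d hη.2.1 z).linearIndependent (stdForm_alt z) (fun i => by
    fin_cases i
    · simp
    · simpa using hd.ne')
  have hmem : ∀ i, stdSurfaceBasis d η₁ η₂ z i ∈ (stdLattice d η₁ η₂ z : Set C3) ∩ stdV := by
    intro i
    have : stdSurfaceBasis d η₁ η₂ z i ∈ stdLattice d η₁ η₂ z ⊓ stdV.restrictScalars ℤ := by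
      rw [stdSurfaceBasis_span hd hη]
      exact Submodule.subset_span ⟨i, rfl⟩
    exact this
  have h1 : Submodule.span ℝ (Set.range (stdSurfaceBasis d η₁ η₂ z)) = stdV.restrictScalars ℝ := by
    apply Submodule.eq_of_le_of_finrank_eq
    · rw [Submodule.span_le]
      rintro _ ⟨i, rfl⟩
      exact (hmem i).2
    · rw [finrank_span_eq_card hli]
      change _ = Module.finrank ℝ stdV
      rw [← Module.finrank_mul_finrank ℝ ℂ stdV, Complex.finrank_real_complex, finrank_stdV]
      simp
  rw [← h1]
  apply Submodule.span_mono
  rintro _ ⟨i, rfl⟩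
  exact hmem i

/-- The quadruple `(A_z, H_z, S_z, ρ_z)`. -/
def stdThreefold (hd : 0 < d) {𝔞 : Ideal (order D)} {η₁ η₂ : K D} (hη : IsSmartBasis d 𝔞 η₁ η₂)
    (z : H3) : RMThreefold D d where
  Λ := stdLattice d η₁ η₂ z
  discrete := by
    have hsym := frameCol_symplectic hd (H := stdForm d z) (stdForm_vec z) hη.2.1
    have hli := hsym.linearIndependent (stdForm_alt z) (fun _ => one_ne_zero)
    have hspan := hsym.span_eq_top (stdForm_alt z) (fun _ => one_ne_zero)
    rw [stdLattice, ← EquivLike.range_comp _ (finSumFinEquiv (m := 3) (n := 3)),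
      ← Module.Basis.coe_mk hli hspan.ge]
    infer_instance
  span_Λ := by
    have hsym := frameCol_symplectic hd (H := stdForm d z) (stdForm_vec z) hη.2.1
    have hspan := hsym.span_eq_top (stdForm_alt z) (fun _ => one_ne_zero)
    rw [EquivLike.range_comp _ (finSumFinEquiv (m := 3) (n := 3))] at hspan
    rw [eq_top_iff, ← hspan]
    exact Submodule.span_mono Submodule.subset_span
  H := stdForm d z
  isPolarization :=
    { hermitian := stdForm_hermitian z
      pos := fun v hv => stdForm_pos hd z hv
      integral := by
        have hsym := frameCol_symplectic hd (H := stdForm d z) (stdForm_vec z) hη.2.1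
        refine integral_of_span fun i j => ?_
        have h1 := IsSymplecticFamily.integral (stdForm_alt z)
          (t := fun _ => 1) (by simpa using hsym) ((finSumFinEquiv (m := 3) (n := 3)).symm i)
          ((finSumFinEquiv (m := 3) (n := 3)).symm j)
        simpa using h1 }
  principal := by
    have hsym := frameCol_symplectic hd (H := stdForm d z) (stdForm_vec z) hη.2.1
    refine IsSymplecticFamily.hasType (stdForm_alt z) (fun _ => one_ne_zero)
      (c := frameCol d η₁ η₂ stdE (stdF z) stdU (stdW z) ∘ finSumFinEquiv (m := 3) (n := 3))
      (by simpa using hsym) ?_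
    rw [EquivLike.range_comp _ (finSumFinEquiv (m := 3) (n := 3))]
    rfl
  V := stdV
  finrank_V := finrank_stdV
  span_V := stdV_span hd hη z
  type_S := by
    refine IsSymplecticFamily.hasType (stdForm_alt z) (fun i => ?_)
      (stdSurfaceBasis_symplectic d hη.2.1 z) (stdSurfaceBasis_span hd hη z)
    fin_cases i
    · exact one_ne_zero
    · exact hd.ne'
  ρ := ((stdAct D).comp (order D).subtype).codRestrict _ (fun k v hv => by
    obtain ⟨x, y, hxy, hx, hy⟩ := (mem_stdLattice_stdV hd hη).1 ⟨hv, v.2⟩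
    refine ((mem_stdLattice_stdV hd hη).2 ⟨k * x, k * y, stdAct_vec _ _ _ v hxy, ?_, ?_⟩).1
    · exact (order D).mul_mem k.2 hx
    · rw [mul_left_comm]
      exact mul_mem_idealLattice k.2 hy)
  injective_ρ := by
    have : Nontrivial stdV := Module.nontrivial_of_finrank_pos (R := ℂ) (by
      rw [finrank_stdV]; norm_num)
    intro k k' hk
    exact Subtype.ext ((stdAct D).injective (congrArg Subtype.val hk))
  selfAdjoint k v w := by
    change stdForm d z (stdAct D k v : C3) w = stdForm d z v (stdAct D k w : C3)
    rw [stdForm_apply, stdForm_apply, stdAct_apply, stdAct_apply]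
    simp
    ring
  proper := by
    rintro R hR - ⟨ρ', -, hρ'⟩
    apply hR.not_ge
    intro y hy
    -- an extension of `ρ` must be given by `stdAct`; evaluation at the lattice vector `(1, 1, 0)`
    -- then shows `y ∈ 𝒪_D`
    obtain ⟨N, hN, hNy⟩ := exists_natCast_mul_mem_order y
    have h1 : (N : R) * ⟨y, hy⟩ = Subring.inclusion hR.le ⟨_, hNy⟩ := rfl
    have h2 := congrArg ρ' h1
    rw [hρ', map_mul, map_natCast] at h2
    have hact : ∀ v : stdV, ((ρ' ⟨y, hy⟩ : endRing _ _) : Module.End ℂ stdV) v = stdAct D y v := by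
      intro v
      have h3 := LinearMap.congr_fun (congrArg Subtype.val h2) v
      change ((N : ℕ) : Module.End ℂ stdV) (((ρ' ⟨y, hy⟩ : endRing _ _) : Module.End ℂ stdV) v)
        = stdAct D ((N : K D) * y) v at h3
      rw [map_mul, map_natCast, Module.End.mul_apply, Module.End.natCast_apply,
        Module.End.natCast_apply] at h3
      exact smul_right_injective _ hN h3
    obtain ⟨h3, h4⟩ := (mem_stdLattice_stdV hd hη (z := z)
      (v := vec stdE (stdF z) stdU (stdW z) (1 : K D) 0 0 0)).2
      ⟨1, 0, rfl, one_mem (order D), by rw [mul_zero]; exact zero_mem _⟩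
    have h5 := (ρ' ⟨y, hy⟩).2 ⟨_, h4⟩ h3
    rw [hact] at h5
    obtain ⟨x', y', h6, hx', -⟩ := (mem_stdLattice_stdV hd hη).1 ⟨h5, Subtype.mem _⟩
    rw [stdAct_vec y 1 0 ⟨_, h4⟩ rfl, mul_one] at h6
    rw [(std_coords_iff.1 h6).1]
    exact hx'

end

/-! ### The marking of `A_z` -/

section
variable {D d : ℕ} [Fact (¬ IsSquare D)]

lemma stdThreefold_isMarking (hd : 0 < d) {𝔞 : Ideal (order D)} {η₁ η₂ : K D}
    (hη : IsSmartBasis d 𝔞 η₁ η₂) (z : H3) : ∃ e f : Fin 2 → (stdThreefold hd hη z).V,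
      (stdThreefold hd hη z).IsMarking η₁ η₂ e f stdU (stdW z) ∧ HasPeriod e f stdU (stdW z) z := by
  let P := stdThreefold hd hη z
  have he : ∀ i, stdE i ∈ stdV := by intro i; fin_cases i <;> simp [mem_stdV, stdE]
  have hf : ∀ i, stdF z i ∈ stdV := by intro i; fin_cases i <;> simp [mem_stdV, stdF]
  let e : Fin 2 → P.V := fun i => ⟨stdE i, he i⟩
  let f : Fin 2 → P.V := fun i => ⟨stdF z i, hf i⟩
  have hH : P.H = stdForm d z := rfl
  have h0 := z.1.im_pos.ne'
  have h1 := z.2.1.im_pos.ne'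
  have h2 := z.2.2.im_pos.ne'
  have hact : ∀ (k : order D) (v : P.V) (i : Fin 2),
      (∀ j, (v : C3) j ≠ 0 → j = Fin.castSucc i) → P.actHom k v = emb D i k • v := by
    intro k v i hv
    apply Subtype.ext
    refine (stdAct_apply (k : K D) v).trans ?_
    rw [Submodule.coe_smul_of_tower]
    funext j
    by_cases hj : (v : C3) j = 0
    · fin_cases j <;> simp at hj ⊢ <;> simp [hj]
    · obtain rfl := hv j hj
      fin_cases i <;> simp
  refine ⟨e, f, ⟨⟨⟨?_, ?_, fun i j => ?_, fun k i => hact k _ i ?_, fun k i => hact k _ i ?_⟩,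
    fun i => ?_, fun i => ?_, fun i => ?_, fun i => ?_, ?_⟩, rfl⟩, ?_, ?_, ?_⟩
  · rw [hH, imForm_apply, stdForm_apply]; simp [e, stdE]
  · rw [hH, imForm_apply, stdForm_apply]; simp [f, stdF]
  · rw [hH, imForm_apply, stdForm_apply]
    fin_cases i <;> fin_cases j <;> simp [e, f, stdE, stdF, h0, h1]
  · intro j; fin_cases i <;> fin_cases j <;> simp [e, stdE]
  · intro j; fin_cases i <;> fin_cases j <;> simp [f, stdF]
  · rw [hH, imForm_apply, stdForm_apply]; fin_cases i <;> simp [e, stdE, stdU]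
  · rw [hH, imForm_apply, stdForm_apply]; fin_cases i <;> simp [e, stdE, stdW]
  · rw [hH, imForm_apply, stdForm_apply]; fin_cases i <;> simp [f, stdF, stdU]
  · rw [hH, imForm_apply, stdForm_apply]; fin_cases i <;> simp [f, stdF, stdW]
  · rw [hH, imForm_apply, stdForm_apply]; simp [stdU, stdW]; field_simp
  · apply Subtype.ext; funext j; fin_cases j <;> simp [e, f, stdE, stdF]
  · apply Subtype.ext; funext j; fin_cases j <;> simp [e, f, stdE, stdF]
  · funext j; fin_cases j <;> simp [stdU, stdW]

lemma stdThreefold_isPeriodModel (hd : 0 < d) {𝔞 : Ideal (order D)} {η₁ η₂ : K D}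
    (hη : IsSmartBasis d 𝔞 η₁ η₂) (z : H3) : IsPeriodModel η₁ η₂ z (stdThreefold hd hη z) := by
  have hsym := frameCol_symplectic hd (H := stdForm d z) (stdForm_vec z) hη.2.1
  have hcol : frameCol d η₁ η₂ stdE (stdF z) stdU (stdW z) =
      fun j i => periodMatrix d η₁ η₂ z i j := funext fun j => (periodMatrix_col η₁ η₂ z j).symm
  refine ⟨?_, fun i j => ?_, fun v => mem_stdV, fun k v => rfl⟩
  · change stdLattice d η₁ η₂ z = _
    rw [stdLattice, hcol]
  · have h := hsym i j
    rw [hcol] at h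
    exact h

end

namespace RMThreefold
/-! ### The action of `SL₂(K) × SL₂(ℤ)` on frames -/

section
variable {D d : ℕ} [Fact (¬ IsSquare D)] {P : RMThreefold D d}

/-- The vectors `a fᵢ + b eᵢ`, for the first row `(a, b)` of the first component. -/
def actF (g : BigGroup D) (e f : Fin 2 → P.V) : Fin 2 → P.V := fun i =>
  emb D i (g.1 0 0) • f i + emb D i (g.1 0 1) • e i

/-- The vectors `a fᵢ + b eᵢ`, for the second row `(a, b)` of the first component. -/
def actE (g : BigGroup D) (e f : Fin 2 → P.V) : Fin 2 → P.V := fun i =>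
  emb D i (g.1 1 0) • f i + emb D i (g.1 1 1) • e i

/-- The vector `a w + b u`, for the first row `(a, b)` of the second component. -/
def actW (g : BigGroup D) (u w : C3) : C3 := ((g.2 0 0 : ℤ) : ℝ) • w + ((g.2 0 1 : ℤ) : ℝ) • u

/-- The vector `a w + b u`, for the second row `(a, b)` of the second component. -/
def actU (g : BigGroup D) (u w : C3) : C3 := ((g.2 1 0 : ℤ) : ℝ) • w + ((g.2 1 1 : ℤ) : ℝ) • u

omit [Fact (¬ IsSquare D)] in
lemma det_fst (g : BigGroup D) : g.1 0 0 * g.1 1 1 - g.1 0 1 * g.1 1 0 = 1 := by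
  rw [← Matrix.det_fin_two]; exact g.1.2

omit [Fact (¬ IsSquare D)] in
lemma det_snd (g : BigGroup D) : g.2 0 0 * g.2 1 1 - g.2 0 1 * g.2 1 0 = 1 := by
  rw [← Matrix.det_fin_two]; exact g.2.2

/-- The group acts on frames by its matrices and on coordinates by their transposes. -/
lemma vec_act (g : BigGroup D) (e f : Fin 2 → P.V) (u w : C3) (x y : K D) (p q : ℝ) :
    vec (coeV (actE g e f)) (coeV (actF g e f)) (actU g u w) (actW g u w) x y p q =
      vec (coeV e) (coeV f) u w (x * g.1 1 1 + y * g.1 0 1) (x * g.1 1 0 + y * g.1 0 0)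
        (p * (g.2 0 0 : ℤ) + q * (g.2 1 0 : ℤ)) (p * (g.2 0 1 : ℤ) + q * (g.2 1 1 : ℤ)) := by
  simp only [vec, combo, coeV, actE, actF, actU, actW, Submodule.coe_add,
    Submodule.coe_smul_of_tower, map_add, map_mul]
  module

lemma actE_mul (g h : BigGroup D) (e f : Fin 2 → P.V) :
    actE (g * h) e f = actE g (actE h e f) (actF h e f) := by
  funext i
  simp only [actE, actF, Prod.fst_mul, Matrix.SpecialLinearGroup.coe_mul, Matrix.mul_apply,
    Fin.sum_univ_two, map_add, map_mul]
  module

lemma actF_mul (g h : BigGroup D) (e f : Fin 2 → P.V) :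
    actF (g * h) e f = actF g (actE h e f) (actF h e f) := by
  funext i
  simp only [actE, actF, Prod.fst_mul, Matrix.SpecialLinearGroup.coe_mul, Matrix.mul_apply,
    Fin.sum_univ_two, map_add, map_mul]
  module

omit [Fact (¬ IsSquare D)] in
lemma actU_mul (g h : BigGroup D) (u w : C3) :
    actU (g * h) u w = actU g (actU h u w) (actW h u w) := by
  simp only [actU, actW, Prod.snd_mul, Matrix.SpecialLinearGroup.coe_mul, Matrix.mul_apply,
    Fin.sum_univ_two, Int.cast_add, Int.cast_mul]
  module

omit [Fact (¬ IsSquare D)] in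
lemma actW_mul (g h : BigGroup D) (u w : C3) :
    actW (g * h) u w = actW g (actU h u w) (actW h u w) := by
  simp only [actU, actW, Prod.snd_mul, Matrix.SpecialLinearGroup.coe_mul, Matrix.mul_apply,
    Fin.sum_univ_two, Int.cast_add, Int.cast_mul]
  module

omit [Fact (¬ IsSquare D)] in
lemma actE_one (e f : Fin 2 → P.V) : actE 1 e f = e := by
  funext i; simp [actE]

omit [Fact (¬ IsSquare D)] in
lemma actF_one (e f : Fin 2 → P.V) : actF 1 e f = f := by
  funext i; simp [actF]

omit [Fact (¬ IsSquare D)] in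
lemma actU_one (u w : C3) : actU (1 : BigGroup D) u w = u := by simp [actU]

omit [Fact (¬ IsSquare D)] in
lemma actW_one (u w : C3) : actW (1 : BigGroup D) u w = w := by simp [actW]

omit [Fact (¬ IsSquare D)] in
lemma IsRMFrame.imForm_ef {e f : Fin 2 → P.V} (h : P.IsRMFrame e f) (i j : Fin 2) :
    imForm P.H (e i) (f j) = if i = j then -1 else 0 := by
  rw [P.isPolarization.alt, h.fe]
  by_cases hij : i = j
  · simp [hij]
  · simp [hij, Ne.symm hij]

omit [Fact (¬ IsSquare D)] in
lemma IsRMFrame.imForm_ee {e f : Fin 2 → P.V} (h : P.IsRMFrame e f) (i j : Fin 2) :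
    imForm P.H (e i) (e j) = 0 := by
  have h1 := h.ee
  have h2 := P.isPolarization.alt (e 1) (e 0)
  have h3 := fun i => P.isPolarization.self_im (e i)
  simp only [← imForm_apply] at h3
  fin_cases i <;> fin_cases j <;> simp [h1, h2, h3]

omit [Fact (¬ IsSquare D)] in
lemma IsRMFrame.imForm_ff {e f : Fin 2 → P.V} (h : P.IsRMFrame e f) (i j : Fin 2) :
    imForm P.H (f i) (f j) = 0 := by
  have h1 := h.ff
  have h2 := P.isPolarization.alt (f 1) (f 0)
  have h3 := fun i => P.isPolarization.self_im (f i)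
  simp only [← imForm_apply] at h3
  fin_cases i <;> fin_cases j <;> simp [h1, h2, h3]

/-- Both matrices have determinant one, so the pairings between the vectors of the frame do not
change. -/
lemma IsFrame.act {e f : Fin 2 → P.V} {u w : C3} (h : P.IsFrame e f u w) (g : BigGroup D) :
    P.IsFrame (actE g e f) (actF g e f) (actU g u w) (actW g u w) := by
  have hee := h.frame.imForm_ee
  have hff := h.frame.imForm_ff
  have hef := h.frame.imForm_ef
  have hfe := h.frame.fe
  have hdet := fun i => congrArg (emb D i) (det_fst g)
  simp only [map_sub, map_mul, map_one] at hdet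
  have hdet' : ((g.2 0 0 * g.2 1 1 - g.2 0 1 * g.2 1 0 : ℤ) : ℝ) = 1 := by rw [det_snd]; simp
  push_cast at hdet'
  have huu := P.isPolarization.self_im u
  have hww := P.isPolarization.self_im w
  have huw := P.isPolarization.alt u w
  rw [← imForm_apply] at huu hww
  constructor
  · constructor
    · simp [actE, hee, hff, hef, hfe]
    · simp [actF, hee, hff, hef, hfe]
    · intro i j
      by_cases hij : i = j
      · subst hij
        simp only [actE, actF, Submodule.coe_add, Submodule.coe_smul_of_tower, map_add, map_smul,
          LinearMap.add_apply, LinearMap.smul_apply, smul_eq_mul, hee, hff, hef, hfe, if_true]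
        linear_combination hdet i
      · simp [actE, actF, hee, hff, hef, hfe, hij]
    · intro k i
      simp only [actE, map_add, LinearMap.map_smul_of_tower, h.frame.act_e, h.frame.act_f]
      module
    · intro k i
      simp only [actF, map_add, LinearMap.map_smul_of_tower, h.frame.act_e, h.frame.act_f]
      module
  · intro i; simp [actE, actU, h.eu, h.ew, h.fu, h.fw]
  · intro i; simp [actE, actW, h.eu, h.ew, h.fu, h.fw]
  · intro i; simp [actF, actU, h.eu, h.ew, h.fu, h.fw]
  · intro i; simp [actF, actW, h.eu, h.ew, h.fu, h.fw]
  · simp only [actU, actW, map_add, map_smul, LinearMap.add_apply, LinearMap.smul_apply, smul_eq_mul,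
      huu, hww, huw, h.wu]
    linear_combination (d : ℝ) * hdet'

/-- The action on frames induces the action on periods. -/
lemma HasPeriod.act (hd : 0 < d) {e f : Fin 2 → P.V} {u w : C3} {z : H3}
    (hz : HasPeriod e f u w z) (h : P.IsFrame e f u w) (g : BigGroup D) :
    HasPeriod (actE g e f) (actF g e f) (actU g u w) (actW g u w) (g • z) := by
  have h' := h.act g
  obtain ⟨h0, h1, h2⟩ := hz
  have hE : ∀ i (τ : UpperHalfPlane), f i = (τ : ℂ) • e i →
      actE g e f i = ((emb D i (g.1 1 0) : ℂ) * τ + emb D i (g.1 1 1)) • e i ∧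
      actF g e f i = ((emb D i (g.1 0 0) : ℂ) * τ + emb D i (g.1 0 1)) • e i := by
    intro i τ hτ
    simp only [actE, actF, hτ, P.real_smul_eq]
    constructor <;> module
  have key : ∀ i (τ τ' : UpperHalfPlane), f i = (τ : ℂ) • e i → (τ' : ℂ) =
      ((emb D i (g.1 0 0) : ℂ) * τ + emb D i (g.1 0 1)) /
        ((emb D i (g.1 1 0) : ℂ) * τ + emb D i (g.1 1 1)) →
      actF g e f i = (τ' : ℂ) • actE g e f i := by
    intro i τ τ' hτ hτ'
    obtain ⟨a1, a2⟩ := hE i τ hτ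
    have hne : (emb D i (g.1 1 0) : ℂ) * τ + emb D i (g.1 1 1) ≠ 0 := by
      intro h0
      apply h'.frame.e_ne_zero i
      rw [a1, h0, zero_smul]; rfl
    rw [a1, a2, smul_smul, hτ', div_mul_cancel₀ _ hne]
  refine ⟨key 0 z.1 _ h0 ?_, key 1 z.2.1 _ h1 ?_, ?_⟩
  · exact UpperHalfPlane.coe_specialLinearGroup_apply _ _
  · exact UpperHalfPlane.coe_specialLinearGroup_apply _ _
  · have a1 : actU g u w = (((g.2 1 0 : ℤ) : ℂ) * z.2.2 + ((g.2 1 1 : ℤ) : ℂ)) • u := by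
      rw [actU, h2, ← Complex.coe_smul, ← Complex.coe_smul]
      push_cast
      module
    have a2 : actW g u w = (((g.2 0 0 : ℤ) : ℂ) * z.2.2 + ((g.2 0 1 : ℤ) : ℂ)) • u := by
      rw [actW, h2, ← Complex.coe_smul, ← Complex.coe_smul]
      push_cast
      module
    have hne : ((g.2 1 0 : ℤ) : ℂ) * z.2.2 + ((g.2 1 1 : ℤ) : ℂ) ≠ 0 := by
      intro h0
      apply h'.u_ne_zero hd
      rw [a1, h0, zero_smul]
    have a3 : ((g • z).2.2 : ℂ) = (((g.2 0 0 : ℤ) : ℂ) * z.2.2 + ((g.2 0 1 : ℤ) : ℂ)) /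
        (((g.2 1 0 : ℤ) : ℂ) * z.2.2 + ((g.2 1 1 : ℤ) : ℂ)) := by
      refine (UpperHalfPlane.coe_specialLinearGroup_apply g.2 z.2.2).trans ?_
      simp
    rw [a1, a2, smul_smul, a3, div_mul_cancel₀ _ hne]

/-- Two markings of the same threefold differ by an element of `SL₂(K) × SL₂(ℤ)`. -/
theorem IsMarking.exists_act (hd : 0 < d) {𝔞 : Ideal (order D)} {η₁ η₂ : K D}
    (hη : IsSmartBasis d 𝔞 η₁ η₂) {e f e' f' : Fin 2 → P.V} {u w u' w' : C3}
    (h : P.IsMarking η₁ η₂ e f u w) (h' : P.IsMarking η₁ η₂ e' f' u' w') :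
    ∃ g : BigGroup D, e' = actE g e f ∧ f' = actF g e f ∧ u' = actU g u w ∧ w' = actW g u w := by
  have hs := sqrtD_ne_zero (D := D)
  have hdR : (d : ℝ) ≠ 0 := by exact_mod_cast hd.ne'
  have hsm := h.isSurfaceMarking hd hη
  have hsm' := h'.isSurfaceMarking hd hη
  -- the part on the subsurface: the second row `(y, x)` is read off from `e'`, and the first one from `y₀ f'`, because `f'` itself
  -- need not lie in the lattice
  obtain ⟨⟨x, y⟩, -, hxy⟩ := (hsm.lattice _).1 ((hsm'.lattice (combo (1 : K D) e')).2
    ⟨(1, 0), ⟨one_mem (order D), by rw [mul_zero]; exact zero_mem _⟩, by simp [combo_zero]⟩)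
  have hη₂ : star η₂ ≠ 0 := by
    intro h0
    exact hη.2.2.1.ne_zero 0 (by simpa using h0)
  obtain ⟨y₀, hy₀⟩ : ∃ y₀, sqrtD D * y₀ = star η₂ := ⟨_, mul_inv_cancel_left₀ hs (star η₂)⟩
  have hy₀0 : y₀ ≠ 0 := by rintro rfl; rw [mul_zero] at hy₀; exact hη₂ hy₀.symm
  -- `y₀ = η₂^σ / √D` is a nonzero element of `(1/√D) 𝔞`
  obtain ⟨⟨a, b⟩, -, hab⟩ := (hsm.lattice _).1 ((hsm'.lattice (combo y₀ f')).2
    ⟨(0, y₀), ⟨zero_mem _, by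
      rw [hy₀, ← hη.2.2.2]; exact Submodule.subset_span (Set.mem_insert _ _)⟩, by simp [combo_zero]⟩)
  simp only at hxy hab
  have he' : ∀ i, e' i = emb D i y • f i + emb D i x • e i := by
    intro i
    have := h'.frame.frame.split h.frame.frame (x := 1) (y := 0)
      (by rw [combo_zero, add_zero, hxy]) i
    rw [map_one, map_zero, one_smul, zero_smul, add_zero] at this
    rw [this, add_comm]
  have hf' : ∀ i, f' i = emb D i (b / y₀) • f i + emb D i (a / y₀) • e i := by
    intro i
    have h1 := h'.frame.frame.split h.frame.frame (x := 0) (y := y₀)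
      (by rw [combo_zero, zero_add, hab]) i
    rw [map_zero, zero_smul, zero_add] at h1
    have h2 : emb D i y₀ ≠ 0 := (map_ne_zero _).2 hy₀0
    rw [map_div₀, map_div₀, div_eq_inv_mul, div_eq_inv_mul, ← smul_smul, ← smul_smul, ← smul_add,
      add_comm (emb D i b • _), ← h1, smul_smul, inv_mul_cancel₀ h2, one_smul]
  have hdetA : (b / y₀) * x - (a / y₀) * y = 1 := by
    apply emb_injective (D := D) 0
    have h1 := h'.frame.frame.fe 0 0
    rw [he', hf', if_pos rfl] at h1
    simp only [Submodule.coe_add, Submodule.coe_smul_of_tower, map_add, map_smul,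
      LinearMap.add_apply, LinearMap.smul_apply, smul_eq_mul, h.frame.frame.imForm_ee,
      h.frame.frame.imForm_ff, h.frame.frame.imForm_ef, h.frame.frame.fe, if_true] at h1
    rw [map_sub, map_mul, map_mul, map_one]
    linear_combination h1
  -- the part on the orthogonal complement
  have hcomp : ∀ t ∈ P.Λ, (∀ i, imForm P.H (e' i) t = 0) → (∀ i, imForm P.H (f' i) t = 0) →
      ∃ m n : ℤ, t = (m : ℝ) • w + (n : ℝ) • u := by
    intro t ht h1 h2
    have hV : ∀ v : P.V, imForm P.H v t = 0 := by
      intro v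
      have h3 := h'.frame.frame.H_e_eq_zero h1 h2
      obtain ⟨c, rfl⟩ := h'.frame.frame.exists_coords v
      simp [imForm_apply, h3]
    have ht' := ht
    rw [h.lattice, mem_span_frameCol_iff hd hη] at ht'
    obtain ⟨x, y, m, n, rfl, hx, hy⟩ := ht'
    have k1 := hV (e 0)
    have k2 := hV (f 0)
    simp only [vec_eq, combo, map_add, map_smul, Submodule.coe_add, Submodule.coe_smul_of_tower,
      h.frame.frame.imForm_ee, h.frame.frame.imForm_ff, h.frame.frame.imForm_ef, h.frame.frame.fe,
      h.frame.eu, h.frame.ew, h.frame.fu, h.frame.fw] at k1 k2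
    simp at k1 k2
    subst k1 k2
    obtain ⟨a, b, hab⟩ := Submodule.mem_span_pair.1 (hη.1.2 ▸ hx)
    obtain ⟨a', b', hab'⟩ := Submodule.mem_span_pair.1 (hη.2.2.2 ▸ hy)
    have hdK : (d : K D) ≠ 0 := natCast_ne_zero_K hd
    have q1 := LinearIndependent.pair_iff.1 hη.1.1 (d * a) (d * b - m) (by
      rw [zsmul_eq_mul, zsmul_eq_mul] at hab ⊢
      push_cast
      field_simp at hab
      linear_combination hab)
    have q2 := LinearIndependent.pair_iff.1 hη.2.2.1 (d * a') (d * b' - n) (by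
      rw [zsmul_eq_mul, zsmul_eq_mul] at hab' ⊢
      push_cast
      linear_combination (d : K D) * hab')
    refine ⟨b, b', ?_⟩
    have m1 : (m : ℝ) / d = b := by
      rw [div_eq_iff hdR]
      have : (d : ℤ) * b = m := by linarith [q1.2]
      rw [← this]; push_cast; ring
    have n1 : (n : ℝ) / d = b' := by
      rw [div_eq_iff hdR]
      have : (d : ℤ) * b' = n := by linarith [q2.2]
      rw [← this]; push_cast; ring
    rw [m1, n1]
    simp [vec, combo_zero]
  have hu'Λ : u' ∈ P.Λ := by
    have : u' = vec (coeV e') (coeV f') u' w' (0 : K D) 0 0 1 := by simp [vec, combo_zero]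
    rw [this]
    refine (h'.mem_iff hd hη _ _ _ _).2 ⟨0, d, by simp, by simp [hdR], by simp, ?_⟩
    rw [mul_zero, zero_add, ← hη.2.2.2]
    exact Submodule.subset_span (Set.mem_insert_of_mem _ (by simp))
  have hw'Λ : w' ∈ P.Λ := by
    have hdK : (d : K D) ≠ 0 := natCast_ne_zero_K hd
    have : w' = vec (coeV e') (coeV f') u' w' (0 : K D) 0 1 0 := by simp [vec, combo_zero]
    rw [this]
    refine (h'.mem_iff hd hη _ _ _ _).2 ⟨d, 0, by simp [hdR], by simp, ?_, by simp⟩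
    rw [zero_add, Int.cast_natCast, mul_div_cancel_left₀ _ hdK, ← hη.1.2]
    exact Submodule.subset_span (Set.mem_insert_of_mem _ (by simp))
  obtain ⟨c, e₀, hu'⟩ := hcomp u' hu'Λ h'.frame.eu h'.frame.fu
  obtain ⟨a₀, b₀, hw'⟩ := hcomp w' hw'Λ h'.frame.ew h'.frame.fw
  have hdetB : a₀ * e₀ - b₀ * c = 1 := by
    have h1 := h'.frame.wu
    have huu := P.isPolarization.self_im u
    have hww := P.isPolarization.self_im w
    rw [← imForm_apply] at huu hww
    rw [hu', hw'] at h1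
    simp only [map_add, map_smul, LinearMap.add_apply, LinearMap.smul_apply, smul_eq_mul, huu, hww,
      P.isPolarization.alt u w, h.frame.wu] at h1
    have h2 : (d : ℝ) * ((a₀ * e₀ - b₀ * c : ℤ) : ℝ) = d * ((1 : ℤ) : ℝ) := by
      push_cast; linear_combination h1
    exact_mod_cast mul_left_cancel₀ hdR h2
  refine ⟨(⟨!![b / y₀, a / y₀; y, x], by rw [Matrix.det_fin_two_of, hdetA]⟩,
    ⟨!![a₀, b₀; c, e₀], by rw [Matrix.det_fin_two_of, hdetB]⟩), ?_, ?_, ?_, ?_⟩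
  · funext i; simp [actE, he']
  · funext i; simp [actF, hf']
  · simp [actU, hu']
  · simp [actW, hw']

end
end RMThreefold

/-! ### The group `Γ` -/

section
variable {D d : ℕ} [Fact (¬ IsSquare D)]

lemma mem_smul_lattice_iff {c : K D} (hc : c ≠ 0) {L : Submodule ℤ (K D)} {x : K D} :
    x ∈ c • L ↔ c⁻¹ * x ∈ L := by
  rw [Submodule.mem_smul_pointwise_iff_exists]
  constructor
  · rintro ⟨y, hy, rfl⟩
    rwa [smul_eq_mul, inv_mul_cancel_left₀ hc]
  · intro h
    exact ⟨_, h, by rw [smul_eq_mul, mul_inv_cancel_left₀ hc]⟩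

lemma IsSmartBasis.ne_zero {𝔞 : Ideal (order D)} {η₁ η₂ : K D} (hη : IsSmartBasis d 𝔞 η₁ η₂) :
    η₁ ≠ 0 ∧ η₂ ≠ 0 :=
  ⟨fun h => hη.1.1.ne_zero 0 (by simpa using h), fun h => hη.1.1.ne_zero 1 (by simpa using h)⟩

/-- The defining conditions of `Γ`, written out entry by entry. -/
lemma mem_gammaSet_iff (hd : 0 < d) {𝔞 : Ideal (order D)} {η₁ η₂ : K D}
    (hη : IsSmartBasis d 𝔞 η₁ η₂) {g : BigGroup D} : g ∈ gammaSet d 𝔞 η₁ η₂ ↔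
    (g.1 0 0 ∈ orderLattice D ∧ (∀ y, sqrtD D * y ∈ idealLattice 𝔞 → g.1 0 1 * y ∈ orderLattice D) ∧
      sqrtD D * g.1 1 0 ∈ idealLattice 𝔞 ∧ g.1 1 1 ∈ orderLattice D) ∧
    η₂ / (d : K D) * (g.1 0 0 - (g.2 1 1 : K D)) ∈ orderLattice D ∧
    star η₁ / sqrtD D * g.1 0 1 - (g.2 1 0 : K D) * η₂ / (d : K D) ∈ orderLattice D ∧
    sqrtD D * η₂ / (d : K D) * g.1 1 0 - (g.2 0 1 : K D) * star η₁ ∈ idealLattice 𝔞 ∧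
    star η₁ * (g.1 1 1 - (g.2 0 0 : K D)) ∈ idealLattice 𝔞 := by
  have hs := sqrtD_ne_zero (D := D)
  have hdK := natCast_ne_zero_K (D := D) hd
  obtain ⟨h1, h2⟩ := hη.ne_zero
  have h1' : star η₁ ≠ 0 := by rwa [ne_eq, star_eq_zero]
  set τ : K D := sqrtD D / d * (η₂ / star η₁) with hτ
  have hτ0 : τ ≠ 0 := by rw [hτ]; positivity
  have hinv : (matS d η₁ η₂)⁻¹ = !![0, 1; τ⁻¹, 0] := by
    apply Matrix.inv_eq_right_inv
    rw [matS, ← hτ, Matrix.mul_fin_two, Matrix.one_fin_two]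
    simp [hτ0]
  have hT : matS d η₁ η₂ * (g.2 : Matrix (Fin 2) (Fin 2) ℤ).map (Int.cast : ℤ → K D) *
      (matS d η₁ η₂)⁻¹ = !![(g.2 1 1 : K D), τ * (g.2 1 0 : K D); (g.2 0 1 : K D) * τ⁻¹,
        (g.2 0 0 : K D)] := by
    have hB : (g.2 : Matrix (Fin 2) (Fin 2) ℤ).map (Int.cast : ℤ → K D) =
        !![(g.2 0 0 : K D), (g.2 0 1 : K D); (g.2 1 0 : K D), (g.2 1 1 : K D)] :=
      Matrix.eta_fin_two _
    have h3 : τ * (g.2 1 1 : K D) * τ⁻¹ = (g.2 1 1 : K D) := by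
      rw [mul_comm τ, mul_inv_cancel_right₀ hτ0]
    rw [hinv, matS, ← hτ, hB, Matrix.mul_fin_two, Matrix.mul_fin_two]
    simp [h3]
  rw [gammaSet, Set.mem_ofPred_eq, hT]
  simp only [slLattice, matM, Set.mem_ofPred_eq]
  refine and_congr (and_congr Iff.rfl (and_congr ?_ (and_congr ?_ Iff.rfl)))
    (and_congr ?_ (and_congr ?_ (and_congr ?_ ?_)))
  · refine forall_congr' fun y => ?_
    rw [mem_smul_lattice_iff (inv_ne_zero hs), inv_inv]
  · rw [mem_smul_lattice_iff (inv_ne_zero hs), inv_inv]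
  · rw [mem_smul_lattice_iff (div_ne_zero hdK h2), inv_div]
    rfl
  · rw [mem_smul_lattice_iff (div_ne_zero hs h1'), inv_div]
    refine iff_of_eq (congrArg (· ∈ orderLattice D) ?_)
    simp [hτ]
    field_simp
  · rw [mem_smul_lattice_iff (div_ne_zero hdK (mul_ne_zero hs h2)), inv_div]
    refine iff_of_eq (congrArg (· ∈ idealLattice 𝔞) ?_)
    simp [hτ]
    field_simp
  · rw [mem_smul_lattice_iff (one_div_ne_zero h1'), one_div, inv_inv]
    rfl

omit [Fact (¬ IsSquare D)] in
lemma coe_inv_fst (g : BigGroup D) : g⁻¹.1 0 0 = g.1 1 1 ∧ g⁻¹.1 0 1 = - g.1 0 1 ∧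
    g⁻¹.1 1 0 = - g.1 1 0 ∧ g⁻¹.1 1 1 = g.1 0 0 := by
  simp [Matrix.SpecialLinearGroup.coe_inv, Matrix.adjugate_fin_two]

omit [Fact (¬ IsSquare D)] in
lemma coe_inv_snd (g : BigGroup D) : g⁻¹.2 0 0 = g.2 1 1 ∧ g⁻¹.2 0 1 = - g.2 0 1 ∧
    g⁻¹.2 1 0 = - g.2 1 0 ∧ g⁻¹.2 1 1 = g.2 0 0 := by
  simp [Matrix.SpecialLinearGroup.coe_inv, Matrix.adjugate_fin_two]

namespace RMThreefold
variable {P : RMThreefold D d}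

/-- The integrality conditions satisfied by an element that takes a marking to a marking. -/
lemma IsMarking.integrality_of_act (hd : 0 < d) {𝔞 : Ideal (order D)} {η₁ η₂ : K D}
    (hη : IsSmartBasis d 𝔞 η₁ η₂) {e f : Fin 2 → P.V} {u w : C3} (h : P.IsMarking η₁ η₂ e f u w)
    {g : BigGroup D}
    (h' : P.IsMarking η₁ η₂ (actE g e f) (actF g e f) (actU g u w) (actW g u w)) :
    (∀ y, sqrtD D * y ∈ idealLattice 𝔞 → g.1 0 1 * y ∈ orderLattice D) ∧
    sqrtD D * g.1 1 0 ∈ idealLattice 𝔞 ∧ g.1 1 1 ∈ orderLattice D ∧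
    star η₁ * (g.1 0 0 - (g.2 1 1 : K D)) ∈ idealLattice 𝔞 ∧
    star η₁ / sqrtD D * g.1 0 1 - (g.2 1 0 : K D) * η₂ / (d : K D) ∈ orderLattice D ∧
    sqrtD D * η₂ / (d : K D) * g.1 1 0 - (g.2 0 1 : K D) * star η₁ ∈ idealLattice 𝔞 ∧
    η₂ / (d : K D) * (g.1 1 1 - (g.2 0 0 : K D)) ∈ orderLattice D := by
  have hs := sqrtD_ne_zero (D := D)
  have hdK := natCast_ne_zero_K (D := D) hd
  have hdR : (d : ℝ) ≠ 0 := by exact_mod_cast hd.ne'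
  have key : ∀ (x y : K D) (m n m' n' : ℤ),
      m' = m * g.2 0 0 + n * g.2 1 0 → n' = m * g.2 0 1 + n * g.2 1 1 →
      x + (m : K D) * η₂ / (d : K D) ∈ orderLattice D →
      sqrtD D * y + (n : K D) * star η₁ ∈ idealLattice 𝔞 →
      (x * g.1 1 1 + y * g.1 0 1) + (m' : K D) * η₂ / (d : K D) ∈ orderLattice D ∧
      sqrtD D * (x * g.1 1 0 + y * g.1 0 0) + (n' : K D) * star η₁ ∈ idealLattice 𝔞 := by
    intro x y m n m' n' hm' hn' hx hy
    have h1 := (h'.mem_iff hd hη x y (m / d) (n / d)).2 ⟨m, n, rfl, rfl, hx, hy⟩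
    rw [vec_act, h.mem_iff hd hη] at h1
    obtain ⟨m₁, n₁, e1, e2, h2, h3⟩ := h1
    have e3 : m₁ = m' := by
      rw [hm']
      field_simp at e1
      exact_mod_cast e1.symm
    have e4 : n₁ = n' := by
      rw [hn']
      field_simp at e2
      exact_mod_cast e2.symm
    rw [← e3, ← e4]
    exact ⟨h2, h3⟩
  have k1 := key 1 0 0 0 0 0 (by ring) (by ring) (by simp; exact one_mem (order D)) (by simp)
  have k4 := key 0 (-(star η₁ / sqrtD D)) 0 1 _ _ rfl rfl (by simp) (by
    have : sqrtD D * -(star η₁ / sqrtD D) + ((1 : ℤ) : K D) * star η₁ = 0 := by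
      push_cast; field_simp; ring
    rw [this]; exact zero_mem _)
  have k5 := key (η₂ / (d : K D)) 0 (-1) 0 _ _ rfl rfl (by
    have : η₂ / (d : K D) + ((-1 : ℤ) : K D) * η₂ / (d : K D) = 0 := by
      push_cast; field_simp; ring
    rw [this]; exact zero_mem _) (by simp)
  refine ⟨fun y hy => ?_, ?_, ?_, ?_, ?_, ?_, ?_⟩
  · have := (key 0 y 0 0 0 0 (by ring) (by ring) (by simp) (by simpa using hy)).1
    simpa [mul_comm] using this
  · simpa using k1.2
  · simpa using k1.1
  · have := neg_mem k4.2
    convert this using 1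
    push_cast
    field_simp
    ring
  · have := neg_mem k4.1
    convert this using 1
    push_cast
    field_simp
    ring
  · have := k5.2
    convert this using 1
    push_cast
    field_simp
    ring
  · have := k5.1
    convert this using 1
    push_cast
    field_simp
    ring

/-- An element that takes a marking to a marking belongs to `Γ`. -/
lemma IsMarking.mem_gammaSet (hd : 0 < d) {𝔞 : Ideal (order D)} {η₁ η₂ : K D}
    (hη : IsSmartBasis d 𝔞 η₁ η₂) {e f : Fin 2 → P.V} {u w : C3} (h : P.IsMarking η₁ η₂ e f u w)
    {g : BigGroup D}
    (h' : P.IsMarking η₁ η₂ (actE g e f) (actF g e f) (actU g u w) (actW g u w)) :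
    g ∈ gammaSet d 𝔞 η₁ η₂ := by
  obtain ⟨a1, a2, a3, -, a5, a6, -⟩ := h.integrality_of_act hd hη h'
  -- the remaining conditions hold because the inverse of `g` takes a marking to a marking as well
  have h'' : P.IsMarking η₁ η₂ (actE g⁻¹ (actE g e f) (actF g e f))
      (actF g⁻¹ (actE g e f) (actF g e f)) (actU g⁻¹ (actU g u w) (actW g u w))
      (actW g⁻¹ (actU g u w) (actW g u w)) := by
    rw [← actE_mul, ← actF_mul, ← actU_mul, ← actW_mul, inv_mul_cancel, actE_one, actF_one, actU_one,
      actW_one]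
    exact h
  obtain ⟨-, -, b3, b4, -, -, b7⟩ := h'.integrality_of_act hd hη h''
  obtain ⟨c1, -, -, c4⟩ := coe_inv_fst g
  obtain ⟨d1, -, -, d4⟩ := coe_inv_snd g
  rw [c4] at b3
  rw [c1, d4] at b4
  rw [c4, d1] at b7
  exact (mem_gammaSet_iff hd hη).2 ⟨⟨b3, a1, a2, a3⟩, b7, a5, a6, b4⟩

/-- The inverses of the elements of `Γ` take markings to markings. -/
lemma IsMarking.act_inv (hd : 0 < d) {𝔞 : Ideal (order D)} {η₁ η₂ : K D}
    (hη : IsSmartBasis d 𝔞 η₁ η₂) {e f : Fin 2 → P.V} {u w : C3} (h : P.IsMarking η₁ η₂ e f u w)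
    {g : BigGroup D} (hg : g ∈ gammaSet d 𝔞 η₁ η₂) :
    P.IsMarking η₁ η₂ (actE g⁻¹ e f) (actF g⁻¹ e f) (actU g⁻¹ u w) (actW g⁻¹ u w) := by
  have hs := sqrtD_ne_zero (D := D)
  have hdK := natCast_ne_zero_K (D := D) hd
  have hdR : (d : ℝ) ≠ 0 := by exact_mod_cast hd.ne'
  obtain ⟨⟨a1, a2, a3, a4⟩, a5, a6, a7, a8⟩ := (mem_gammaSet_iff hd hη).1 hg
  obtain ⟨c1, c2, c3, c4⟩ := coe_inv_fst g
  obtain ⟨d1, d2, d3, d4⟩ := coe_inv_snd g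
  have hη₁ : η₁ ∈ orderLattice D := by
    rw [← hη.1.2]; exact Submodule.subset_span (Set.mem_insert _ _)
  have hη₂ : η₂ ∈ orderLattice D := by
    rw [← hη.1.2]; exact Submodule.subset_span (Set.mem_insert_of_mem _ (by simp))
  have hη₂' : star η₂ ∈ idealLattice 𝔞 := by
    rw [← hη.2.2.2]; exact Submodule.subset_span (Set.mem_insert _ _)
  have hη₁' : (d : K D) * star η₁ ∈ idealLattice 𝔞 := by
    rw [← hη.2.2.2]; exact Submodule.subset_span (Set.mem_insert_of_mem _ (by simp))
  have hfr := h.frame.act g⁻¹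
  refine ⟨hfr, span_eq_of_symplectic _ (fun j => ?_)
    (frameCol_symplectic hd hfr.imForm_vec hη.2.1)⟩
  have hmem : ∀ (x y : K D) (p q : ℝ) (m n : ℤ),
      p * (g.2 1 1 : ℤ) - q * (g.2 1 0 : ℤ) = m / d →
      - p * (g.2 0 1 : ℤ) + q * (g.2 0 0 : ℤ) = n / d →
      x * g.1 0 0 - y * g.1 0 1 + (m : K D) * η₂ / (d : K D) ∈ orderLattice D →
      sqrtD D * (- x * g.1 1 0 + y * g.1 1 1) + (n : K D) * star η₁ ∈ idealLattice 𝔞 →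
      vec (coeV (actE g⁻¹ e f)) (coeV (actF g⁻¹ e f)) (actU g⁻¹ u w) (actW g⁻¹ u w) x y p q ∈ P.Λ := by
    intro x y p q m n e1 e2 h1 h2
    rw [vec_act, h.mem_iff hd hη, c1, c2, c3, c4, d1, d2, d3, d4]
    refine ⟨m, n, ?_, ?_, ?_, ?_⟩
    · rw [← e1]; push_cast; ring
    · rw [← e2]; push_cast; ring
    · convert h1 using 1; ring
    · convert h2 using 1; ring
  fin_cases j
  · refine hmem η₁ 0 0 0 0 0 (by simp) (by simp) ?_ ?_
    · have : η₁ * g.1 0 0 ∈ orderLattice D := (order D).mul_mem hη₁ a1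
      simpa using this
    · have := neg_mem (mul_mem_idealLattice hη₁ a3)
      convert this using 1
      simp; ring
  · refine hmem η₂ 0 0 0 0 0 (by simp) (by simp) ?_ ?_
    · have : η₂ * g.1 0 0 ∈ orderLattice D := (order D).mul_mem hη₂ a1
      simpa using this
    · have := neg_mem (mul_mem_idealLattice hη₂ a3)
      convert this using 1
      simp; ring
  · refine hmem 0 0 0 1 (-(d * g.2 1 0)) (d * g.2 0 0) (by push_cast; field_simp; ring)
      (by push_cast; field_simp; ring) ?_ ?_
    · have := (orderLattice D).smul_mem (-g.2 1 0) hη₂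
      convert this using 1
      rw [zsmul_eq_mul]
      push_cast
      field_simp
      ring
    · have := (idealLattice 𝔞).smul_mem (g.2 0 0) hη₁'
      convert this using 1
      rw [zsmul_eq_mul]
      push_cast
      ring
  · refine hmem 0 (star η₂ / sqrtD D) 0 0 0 0 (by simp) (by simp) ?_ ?_
    · have := neg_mem (a2 (star η₂ / sqrtD D) (by rwa [mul_div_cancel₀ _ hs]))
      convert this using 1
      simp; ring
    · have := mul_mem_idealLattice a4 hη₂'
      convert this using 1
      push_cast
      field_simp
      ring
  · refine hmem 0 (-(star η₁ / sqrtD D)) 0 (1 / d) (- g.2 1 0) (g.2 0 0)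
      (by push_cast; ring) (by ring) ?_ ?_
    · convert a6 using 1
      push_cast
      field_simp
      ring
    · have := neg_mem a8
      convert this using 1
      field_simp
      ring
  · refine hmem (η₂ / (d : K D)) 0 (-(1 / d)) 0 (- g.2 1 1) (g.2 0 1)
      (by push_cast; ring) (by ring) ?_ ?_
    · convert a5 using 1
      push_cast
      field_simp
      ring
    · have := neg_mem a7
      convert this using 1
      field_simp
      ring

end RMThreefold

/-- `Γ` is a group: it consists of the elements that take markings of a threefold to markings. -/
def gammaGroup (hd : 0 < d) {𝔞 : Ideal (order D)} {η₁ η₂ : K D} (hη : IsSmartBasis d 𝔞 η₁ η₂) :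
    Subgroup (BigGroup D) :=
  have hex : ∃ (P : RMThreefold D d) (e f : Fin 2 → P.V) (u w : C3), P.IsMarking η₁ η₂ e f u w := by
    obtain ⟨e, f, h, -⟩ := stdThreefold_isMarking hd hη
      (UpperHalfPlane.I, UpperHalfPlane.I, UpperHalfPlane.I)
    exact ⟨_, e, f, _, _, h⟩
  have hinv : ∀ {g : BigGroup D}, g ∈ gammaSet d 𝔞 η₁ η₂ → g⁻¹ ∈ gammaSet d 𝔞 η₁ η₂ := fun {g} hg => by
    obtain ⟨P, e, f, u, w, h⟩ := hex
    exact h.mem_gammaSet hd hη (h.act_inv hd hη hg)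
  { carrier := gammaSet d 𝔞 η₁ η₂
    inv_mem' := hinv
    one_mem' := by
      obtain ⟨P, e, f, u, w, h⟩ := hex
      refine h.mem_gammaSet hd hη ?_
      rwa [actE_one, actF_one, actU_one, actW_one]
    mul_mem' := fun {g g'} hg hg' => by
      obtain ⟨P, e, f, u, w, h⟩ := hex
      have h1 := h.act_inv hd hη hg
      have h2 := h1.act_inv hd hη hg'
      rw [← actE_mul, ← actF_mul, ← actU_mul, ← actW_mul, ← mul_inv_rev] at h2
      have h3 := hinv (h.mem_gammaSet hd hη h2)
      rwa [inv_inv] at h3 }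

/-- The elements of `Γ` take markings to markings. -/
lemma RMThreefold.IsMarking.act (hd : 0 < d) {P : RMThreefold D d} {𝔞 : Ideal (order D)} {η₁ η₂ : K D}
    (hη : IsSmartBasis d 𝔞 η₁ η₂) {e f : Fin 2 → P.V} {u w : C3} (h : P.IsMarking η₁ η₂ e f u w)
    {g : BigGroup D} (hg : g ∈ gammaGroup hd hη) :
    P.IsMarking η₁ η₂ (actE g e f) (actF g e f) (actU g u w) (actW g u w) := by
  have := h.act_inv hd hη ((gammaGroup hd hη).inv_mem hg)
  rwa [inv_inv] at this

/-- The points of the moduli space with the marking type of `𝔞` correspond to the orbits of `Γ`: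
two marked threefolds are isomorphic if and only if their periods lie in the same orbit. -/
theorem equiv_iff_of_period (hd : 0 < d) {𝔞 : Ideal (order D)} {η₁ η₂ : K D}
    (hη : IsSmartBasis d 𝔞 η₁ η₂) {P Q : RMThreefold D d} {e f : Fin 2 → P.V} {u w : C3}
    {e' f' : Fin 2 → Q.V} {u' w' : C3} {z z' : H3} (hP : P.IsMarking η₁ η₂ e f u w)
    (hQ : Q.IsMarking η₁ η₂ e' f' u' w') (hzP : HasPeriod e f u w z)
    (hzQ : HasPeriod e' f' u' w' z') :
    cls P = cls Q ↔ ∃ g ∈ gammaGroup hd hη, g • z = z' := by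
  constructor
  · intro h
    obtain ⟨F, hF⟩ : ∃ F, IsIsom P Q F := Quotient.exact h
    have hm := hF.isSymplecticIsom.map_marking hP
    have hz := hzP.map_isom hF
    obtain ⟨g, rfl, rfl, rfl, rfl⟩ := hm.exists_act hd hη hQ
    exact ⟨g, hm.mem_gammaSet hd hη hQ, (hz.act hd hm.frame g).unique hd hzQ hQ.frame⟩
  · rintro ⟨g, hg, rfl⟩
    exact Quotient.sound (exists_isIsom_of_period hd (hP.act hd hη hg) hQ (hzP.act hd hP.frame g) hzQ)

end

/-! ### Holomorphic families -/

section
variable {D d n : ℕ}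

/-- A real linear map between spans of lattice vectors is determined by the lattice vectors. -/
lemma RMThreefold.map_mem_V {P Q : RMThreefold D d} (τ : C3 →ₗ[ℝ] C3)
    (h : ∀ v ∈ P.Λ, v ∈ P.V → τ v ∈ Q.V) {v : C3} (hv : v ∈ P.V) : τ v ∈ Q.V := by
  have hv' : v ∈ P.V.restrictScalars ℝ := hv
  rw [← P.span_V] at hv'
  have h1 : Submodule.span ℝ ((P.Λ : Set C3) ∩ P.V) ≤ (Q.V.restrictScalars ℝ).comap τ := by
    rw [Submodule.span_le]
    rintro x ⟨hx, hx'⟩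
    exact h x hx hx'
  exact h1 hv'

/-- The lattice bases of a holomorphic family are real bases. -/
lemma linearIndependent_real_of_span {P : RMThreefold D d} {b : Fin 6 → C3}
    (h : Submodule.span ℤ (Set.range b) = P.Λ) : ∃ B : Module.Basis (Fin 6) ℝ C3, ⇑B = b := by
  have hspan : Submodule.span ℝ (Set.range b) = ⊤ := by
    rw [eq_top_iff, ← P.span_Λ, Submodule.span_le, ← h]
    intro v hv
    exact Submodule.span_le_restrictScalars ℤ ℝ _ hv
  exact ⟨basisOfTopLeSpanOfCardEqFinrank b hspan.ge (by
    rw [← Module.finrank_mul_finrank ℝ ℂ C3, Complex.finrank_real_complex]; simp), by simp⟩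

/-- Parallel transport in a holomorphic family. -/
theorem IsHolFamily.exists_transport {T : Set (Fin n → ℂ)} {P : (Fin n → ℂ) → RMThreefold D d}
    (hP : IsHolFamily T P) {s : Fin n → ℂ} (hs : s ∈ T) :
    ∃ τ : (Fin n → ℂ) → C3 ≃ₗ[ℝ] C3, (∀ t ∈ T, IsSymplecticIsom (P s) (P t) (τ t)) ∧
      ∀ v, DifferentiableOn ℂ (fun t => τ t v) T := by
  classical
  obtain ⟨b, hb, hΛ, hconst⟩ := hP
  have hB : ∀ t, ∃ B : Module.Basis (Fin 6) ℝ C3, t ∈ T → ∀ i, B i = b i t := by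
    intro t
    by_cases ht : t ∈ T
    · obtain ⟨B, hB⟩ := linearIndependent_real_of_span (hΛ t ht).2
      exact ⟨B, fun _ i => congrFun hB i⟩
    · obtain ⟨B, hB⟩ := linearIndependent_real_of_span (hΛ s hs).2
      exact ⟨B, fun h => absurd h ht⟩
  choose B hB using hB
  let τ : (Fin n → ℂ) → C3 ≃ₗ[ℝ] C3 := fun t => (B s).equiv (B t) (Equiv.refl _)
  have hτ : ∀ t ∈ T, ∀ i, τ t (b i s) = b i t := by
    intro t ht i
    rw [← hB s hs, ← hB t ht]
    simp [τ, Module.Basis.equiv_apply]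
  have hτsum : ∀ t ∈ T, ∀ c : Fin 6 → ℤ, τ t (∑ i, c i • b i s) = ∑ i, c i • b i t := by
    intro t ht c
    simp only [map_sum, map_zsmul, hτ t ht]
  have hlat : ∀ t ∈ T, ∀ v, v ∈ (P t).Λ ↔ ∃ c : Fin 6 → ℤ, ∑ i, c i • b i t = v := by
    intro t ht v
    rw [← (hΛ t ht).2, Submodule.mem_span_range_iff_exists_fun]
  have hVto : ∀ t ∈ T, ∀ v ∈ (P s).V, τ t v ∈ (P t).V := by
    intro t ht v hv
    refine map_mem_V (τ t : C3 →ₗ[ℝ] C3) (fun x hx hxV => ?_) hv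
    obtain ⟨c, rfl⟩ := (hlat s hs x).1 hx
    change τ t _ ∈ _
    rw [hτsum t ht]
    exact ((hconst s hs t ht).2.1 c).1 hxV
  have hVfrom : ∀ t ∈ T, ∀ v ∈ (P t).V, (τ t).symm v ∈ (P s).V := by
    intro t ht v hv
    refine map_mem_V ((τ t).symm : C3 →ₗ[ℝ] C3) (fun x hx hxV => ?_) hv
    obtain ⟨c, rfl⟩ := (hlat t ht x).1 hx
    change (τ t).symm _ ∈ _
    rw [← hτsum t ht, LinearEquiv.symm_apply_apply]
    exact ((hconst s hs t ht).2.1 c).2 hxV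
  refine ⟨τ, fun t ht => ⟨fun v => ?_, fun v w => ?_, fun v => ?_, fun k v w hw => ?_⟩, fun v => ?_⟩
  · rw [hlat t ht, hlat s hs]
    refine exists_congr fun c => ?_
    rw [← hτsum t ht, (τ t).injective.eq_iff]
  · have h1 : (imForm (P t).H).compl₁₂ (τ t : C3 →ₗ[ℝ] C3) (τ t : C3 →ₗ[ℝ] C3) = imForm (P s).H := by
      refine (B s).ext fun i => (B s).ext fun j => ?_
      rw [LinearMap.compl₁₂_apply]
      change imForm (P t).H (τ t (B s i)) (τ t (B s j)) = _
      rw [hB s hs, hB s hs, hτ t ht, hτ t ht]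
      exact ((hconst s hs t ht).1 i j).symm
    exact LinearMap.congr_fun (LinearMap.congr_fun h1 v) w
  · refine ⟨fun hv => ?_, hVto t ht v⟩
    have := hVfrom t ht _ hv
    rwa [LinearEquiv.symm_apply_apply] at this
  · obtain rfl : (⟨τ t v, hVto t ht v v.2⟩ : (P t).V) = w := Subtype.ext hw
    let τV : (P s).V →ₗ[ℝ] (P t).V :=
      { toFun := fun v => ⟨τ t v, hVto t ht v v.2⟩
        map_add' := fun v w => Subtype.ext (map_add (τ t) _ _)
        map_smul' := fun r v => Subtype.ext (map_smul (τ t) _ _) }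
    let L : (P s).V →ₗ[ℝ] C3 :=
      (τ t : C3 →ₗ[ℝ] C3) ∘ₗ ((P s).V.subtype.restrictScalars ℝ) ∘ₗ
        (((P s).actHom k).restrictScalars ℝ) -
      ((P t).V.subtype.restrictScalars ℝ) ∘ₗ (((P t).actHom k).restrictScalars ℝ) ∘ₗ τV
    have hL : Submodule.span ℝ (((P s).Λ : Set C3) ∩ (P s).V) ≤
        (LinearMap.ker L).map ((P s).V.subtype.restrictScalars ℝ) := by
      rw [Submodule.span_le]
      rintro x ⟨hx, hxV⟩
      refine ⟨⟨x, hxV⟩, ?_, rfl⟩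
      obtain ⟨c, hc⟩ := (hlat s hs x).1 hx
      obtain ⟨c', hc'⟩ := (hlat s hs _).1 ((P s).actHom_mem k ⟨x, hxV⟩ hx)
      subst hc
      have h1 := ((hconst s hs t ht).2.2 c c' hxV (((hconst s hs t ht).2.1 c).1 hxV) k).1 hc'.symm
      change L _ = 0
      change τ t ((P s).actHom k ⟨_, hxV⟩ : C3) - ((P t).actHom k ⟨τ t _, _⟩ : C3) = 0
      rw [sub_eq_zero, ← hc', hτsum t ht, ← h1, act_eq]
      congr 2
      exact Subtype.ext (hτsum t ht c).symm
    rw [(P s).span_V] at hL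
    obtain ⟨v', hv', hvv⟩ := hL v.2
    obtain rfl : v' = v := Subtype.ext hvv
    exact sub_eq_zero.1 hv'
  · have h1 : ∀ t ∈ T, τ t v = ∑ i, ((B s).repr v i : ℂ) • b i t := by
      intro t ht
      conv_lhs => rw [← (B s).sum_repr v]
      rw [map_sum]
      refine Finset.sum_congr rfl fun i _ => ?_
      rw [map_smul, hB s hs, hτ t ht, Complex.coe_smul]
    refine DifferentiableOn.congr ?_ h1
    exact DifferentiableOn.fun_sum fun i _ => (hb i).fun_const_smul _

/-- Quotients of proportional holomorphic vectors are holomorphic. -/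
lemma differentiableOn_quotient {T : Set (Fin n → ℂ)} {v w : (Fin n → ℂ) → C3}
    {ζ : (Fin n → ℂ) → ℂ} (hv : DifferentiableOn ℂ v T) (hw : DifferentiableOn ℂ w T)
    (h0 : ∀ t ∈ T, v t ≠ 0) (h : ∀ t ∈ T, w t = ζ t • v t) : DifferentiableOn ℂ ζ T := by
  intro t ht
  obtain ⟨k, hk⟩ : ∃ k, v t k ≠ 0 := by
    by_contra! hall
    exact h0 t ht (funext hall)
  have hvk : DifferentiableWithinAt ℂ (fun t => v t k) T t := (differentiableOn_pi.1 hv k) t ht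
  have hwk : DifferentiableWithinAt ℂ (fun t => w t k) T t := (differentiableOn_pi.1 hw k) t ht
  have hev : ∀ᶠ x in nhdsWithin t T, v x k ≠ 0 := hvk.continuousWithinAt.eventually_ne hk
  have key : ∀ x ∈ T, v x k ≠ 0 → ζ x = w x k / v x k := by
    intro x hx hx0
    rw [h x hx, Pi.smul_apply, smul_eq_mul, mul_div_cancel_right₀ _ hx0]
  have hdiv : DifferentiableWithinAt ℂ (fun t => w t k / v t k) T t := by
    simp only [div_eq_mul_inv]
    exact hwk.fun_mul (hvk.fun_inv hk)
  refine hdiv.congr_of_eventuallyEq ?_ (key t ht hk)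
  filter_upwards [hev, self_mem_nhdsWithin] with x hx hxT
  exact key x hxT hx

/-- The coordinates of a point of `ℍ³`. -/
def ofH3 (z : H3) : Fin 3 → ℂ := ![(z.1 : ℂ), (z.2.1 : ℂ), (z.2.2 : ℂ)]

lemma ofH3_im (z : H3) (i : Fin 3) : 0 < (ofH3 z i).im := by
  fin_cases i
  · exact z.1.im_pos
  · exact z.2.1.im_pos
  · exact z.2.2.im_pos

lemma toH3_ofH3 (z : H3) : toH3 (ofH3 z) = z := by
  simp [toH3, ofH3, UpperHalfPlane.ofComplex_apply]

/-- `ℍ³` as an open subset of `ℂ³`. -/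
def upperSet : Set (Fin 3 → ℂ) := {w | ∀ i, 0 < (w i).im}

lemma isOpen_upperSet : IsOpen upperSet := by
  rw [upperSet, Set.ofPred_forall]
  exact isOpen_iInter_of_finite fun i =>
    isOpen_lt continuous_const (Complex.continuous_im.comp (continuous_apply i))

lemma ofH3_toH3 {w : Fin 3 → ℂ} (hw : w ∈ upperSet) : ofH3 (toH3 w) = w := by
  funext i
  fin_cases i <;> simp [toH3, ofH3, UpperHalfPlane.ofComplex_apply_of_im_pos (hw _)]

lemma continuous_ofH3 : Continuous ofH3 := by
  refine continuous_pi fun i => ?_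
  fin_cases i
  · exact UpperHalfPlane.continuous_coe.comp continuous_fst
  · exact UpperHalfPlane.continuous_coe.comp (continuous_fst.comp continuous_snd)
  · exact UpperHalfPlane.continuous_coe.comp (continuous_snd.comp continuous_snd)

variable [Fact (¬ IsSquare D)]

/-- The periods of a holomorphic family of marked threefolds are holomorphic. -/
theorem IsHolFamily.exists_period (hd : 0 < d) {T : Set (Fin n → ℂ)}
    {P : (Fin n → ℂ) → RMThreefold D d} (hP : IsHolFamily T P) {s : Fin n → ℂ} (hs : s ∈ T)
    {η₁ η₂ : K D} {e f : Fin 2 → (P s).V} {u w : C3} (hm : (P s).IsMarking η₁ η₂ e f u w) :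
    ∃ ζ : (Fin n → ℂ) → H3, DifferentiableOn ℂ (fun t => ofH3 (ζ t)) T ∧
      ∀ t ∈ T, ∃ (e' f' : Fin 2 → (P t).V) (u' w' : C3), (P t).IsMarking η₁ η₂ e' f' u' w' ∧
        HasPeriod e' f' u' w' (ζ t) := by
  classical
  obtain ⟨τ, hτ, hdiff⟩ := hP.exists_transport hs
  have hmt := fun t ht => (hτ t ht).map_marking hm
  have hex : ∀ t, ∃ z : H3, ∀ ht : t ∈ T,
      HasPeriod (fun i => onV (hτ t ht) (e i)) (fun i => onV (hτ t ht) (f i)) (τ t u) (τ t w) z := by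
    intro t
    by_cases ht : t ∈ T
    · obtain ⟨z, hz⟩ := (hmt t ht).frame.exists_period hd
      exact ⟨z, fun _ => hz⟩
    · exact ⟨(UpperHalfPlane.I, UpperHalfPlane.I, UpperHalfPlane.I), fun h => absurd h ht⟩
  choose ζ hζ using hex
  refine ⟨ζ, ?_, fun t ht => ⟨_, _, _, _, hmt t ht, hζ t ht⟩⟩
  refine differentiableOn_pi.2 fun i => ?_
  fin_cases i
  · refine differentiableOn_quotient (hdiff (e 0)) (hdiff (f 0))
      (fun t ht => (hmt t ht).frame.frame.e_ne_zero 0) fun t ht => ?_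
    exact congrArg Subtype.val (hζ t ht).1
  · refine differentiableOn_quotient (hdiff (e 1)) (hdiff (f 1))
      (fun t ht => (hmt t ht).frame.frame.e_ne_zero 1) fun t ht => ?_
    exact congrArg Subtype.val (hζ t ht).2.1
  · exact differentiableOn_quotient (hdiff u) (hdiff w)
      (fun t ht => (hmt t ht).frame.u_ne_zero hd) fun t ht => (hζ t ht).2.2

omit [Fact (¬ IsSquare D)] in
lemma vec_mem_stdV_iff {z : H3} {x y : K D} {p q : ℝ} :
    vec stdE (stdF z) stdU (stdW z) x y p q ∈ stdV ↔ p = 0 ∧ q = 0 := by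
  rw [mem_stdV, vec_std]
  constructor
  · intro h
    exact std_im_eq_zero (by simpa using h)
  · rintro ⟨rfl, rfl⟩
    simp

/-- The threefolds `A_z` form a holomorphic family over `ℍ³`. -/
theorem isHolFamily_std (hd : 0 < d) {𝔞 : Ideal (order D)} {η₁ η₂ : K D}
    (hη : IsSmartBasis d 𝔞 η₁ η₂) :
    IsHolFamily upperSet (fun w => stdThreefold hd hη (toH3 w)) := by
  refine ⟨fun j w => frameCol d η₁ η₂ stdE (stdF (toH3 w)) stdU (stdW (toH3 w)) j, fun j => ?_,
    fun w hw => ⟨?_, rfl⟩, fun s hs t ht => ⟨fun i j => ?_, fun c => ?_, fun c c' h1 h2 k => ?_⟩⟩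
  · have h1 : ∀ w ∈ upperSet, frameCol d η₁ η₂ stdE (stdF (toH3 w)) stdU (stdW (toH3 w)) j =
        frameCol d η₁ η₂ stdE ![![w 0, 0, 0], ![0, w 1, 0]] stdU ![0, 0, w 2] j := by
      intro w hw
      have h2 := ofH3_toH3 hw
      have e0 : ((toH3 w).1 : ℂ) = w 0 := congrFun h2 0
      have e1 : ((toH3 w).2.1 : ℂ) = w 1 := congrFun h2 1
      have e2 : ((toH3 w).2.2 : ℂ) = w 2 := congrFun h2 2
      rw [stdF, stdW, e0, e1, e2]
    refine DifferentiableOn.congr ?_ h1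
    refine differentiableOn_pi.2 fun i => ?_
    have hw : ∀ i, DifferentiableOn ℂ (fun w : Fin 3 → ℂ => w i) upperSet := fun i =>
      (differentiable_apply i).differentiableOn
    fin_cases i
    · simp [frameCol, vec, combo, stdE, stdU]
      fun_prop
    · simp [frameCol, vec, combo, stdE, stdU]
      fun_prop
    · simp [frameCol, vec, combo, stdE, stdU]
      fun_prop
  · have hsym := frameCol_symplectic hd (H := stdForm d (toH3 w)) (stdForm_vec (toH3 w)) hη.2.1
    have hli := (hsym.linearIndependent (stdForm_alt (toH3 w)) (fun _ => one_ne_zero)).comp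
      (finSumFinEquiv (m := 3) (n := 3)).symm (Equiv.injective _)
    have hli' : LinearIndependent ℝ (frameCol d η₁ η₂ stdE (stdF (toH3 w)) stdU (stdW (toH3 w))) := by
      convert hli using 1
      funext j
      simp
    exact hli'.restrict_scalars (fun a b hab => by simpa using hab)
  · change imForm (stdForm d _) _ _ = imForm (stdForm d _) _ _
    simp only [frameCol, stdForm_vec]
  · change _ ∈ stdV ↔ _ ∈ stdV
    rw [sum_zsmul_frameCol, sum_zsmul_frameCol, vec_mem_stdV_iff, vec_mem_stdV_iff]
  · have key : ∀ (w : H3) (h : ∑ i, c i • frameCol d η₁ η₂ stdE (stdF w) stdU (stdW w) i ∈ stdV),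
        (stdAct D k ⟨_, h⟩ : C3) = ∑ i, c' i • frameCol d η₁ η₂ stdE (stdF w) stdU (stdW w) i ↔
        ((k : K D) * ((c 0 : K D) * η₁ + (c 1 : K D) * η₂ + (c 5 : K D) * (η₂ / (d : K D))) =
            (c' 0 : K D) * η₁ + (c' 1 : K D) * η₂ + (c' 5 : K D) * (η₂ / (d : K D)) ∧
          (k : K D) * ((c 3 : K D) * (star η₂ / sqrtD D) - (c 4 : K D) * (star η₁ / sqrtD D)) =
            (c' 3 : K D) * (star η₂ / sqrtD D) - (c' 4 : K D) * (star η₁ / sqrtD D) ∧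
          0 = -(c' 5 : ℝ) * (1 / d) ∧ 0 = (c' 2 : ℝ) + c' 4 * (1 / d)) := by
      intro w h
      have h3 := h
      rw [sum_zsmul_frameCol] at h3
      obtain ⟨h4, h5⟩ := vec_mem_stdV_iff.1 h3
      rw [stdAct_vec (k : K D) _ _ ⟨_, h⟩ (by
        rw [← h4.trans rfl]
        exact (sum_zsmul_frameCol _ _ _ _ _ _ _).trans (by rw [h4, h5])), sum_zsmul_frameCol,
        std_coords_iff]
    exact (key (toH3 s) h1).trans (key (toH3 t) h2).symm

end

/-! ### The biholomorphic map onto the locus of type `𝔞` -/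

section
variable {D d n : ℕ} [Fact (¬ IsSquare D)] {𝔞 : Ideal (order D)} {η₁ η₂ : K D}

lemma natCast_mem_of_mem_primitiveIdeals (hD : D % 4 = 0 ∨ D % 4 = 1) (hd : 0 < d)
    (h𝔞 : 𝔞 ∈ primitiveIdeals D d) : ((d : ℤ) : order D) ∈ 𝔞 := by
  obtain ⟨n, h, rfl⟩ := exists_eq_idealOf hD hd h𝔞
  exact (mem_idealOf hD h).2 ⟨1, 0, by simp⟩

lemma cls_mem_component_iff (hd : 0 < d) (hd𝔞 : ((d : ℤ) : order D) ∈ 𝔞) {P : RMThreefold D d} :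
    cls P ∈ component d 𝔞 ↔ ∃ e f, P.IsSurfaceMarking 𝔞 e f := by
  constructor
  · rintro ⟨Q, hQ, hty⟩
    obtain ⟨F, hF⟩ : ∃ F, IsIsom Q P F := Quotient.exact hQ
    obtain ⟨e, f, h⟩ := hty.exists_isSurfaceMarking (by exact_mod_cast hd.ne') hd𝔞
    exact ⟨_, _, hF.isSymplecticIsom.map_surfaceMarking h⟩
  · rintro ⟨e, f, h⟩
    exact ⟨P, rfl, h.isOfType⟩

lemma cls_stdThreefold_mem_component (hd : 0 < d) (hη : IsSmartBasis d 𝔞 η₁ η₂) (z : H3) :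
    cls (stdThreefold hd hη z) ∈ component d 𝔞 := by
  obtain ⟨e, f, h, -⟩ := stdThreefold_isMarking hd hη z
  exact ⟨_, rfl, (h.isSurfaceMarking hd hη).isOfType⟩

/-- The classifying map of a holomorphic family of threefolds of type `𝔞` lifts to a holomorphic
map to `ℍ³`. It suffices that one member of the family is of type `𝔞`. -/
theorem IsHolFamily.exists_lift (hd : 0 < d) (hd𝔞 : ((d : ℤ) : order D) ∈ 𝔞)
    (hη : IsSmartBasis d 𝔞 η₁ η₂) {T : Set (Fin n → ℂ)} {P : (Fin n → ℂ) → RMThreefold D d}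
    (hP : IsHolFamily T P) {s : Fin n → ℂ} (hs : s ∈ T) (hcls : cls (P s) ∈ component d 𝔞) :
    ∃ ζ : (Fin n → ℂ) → H3, DifferentiableOn ℂ (fun t => ofH3 (ζ t)) T ∧
      ∀ t ∈ T, cls (P t) = cls (stdThreefold hd hη (ζ t)) := by
  obtain ⟨e, f, h⟩ := (cls_mem_component_iff hd hd𝔞).1 hcls
  obtain ⟨u, w, hm⟩ := h.exists_isMarking hd hη
  obtain ⟨ζ, hζ, hper⟩ := hP.exists_period hd hs hm
  refine ⟨ζ, hζ, fun t ht => ?_⟩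
  obtain ⟨e', f', u', w', hm', hp'⟩ := hper t ht
  obtain ⟨e'', f'', hm'', hp''⟩ := stdThreefold_isMarking hd hη (ζ t)
  exact Quotient.sound (exists_isIsom_of_period hd hm' hm'' hp' hp'')

/-- A threefold of type `𝔞` has a marking, and is then `A_z` for the period `z` of the marking. -/
lemma exists_cls_eq_stdThreefold (hd : 0 < d) (hd𝔞 : ((d : ℤ) : order D) ∈ 𝔞)
    (hη : IsSmartBasis d 𝔞 η₁ η₂) {x : ModuliSpace D d} (hx : x ∈ component d 𝔞) :
    ∃ z, x = cls (stdThreefold hd hη z) := by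
  obtain ⟨P, rfl⟩ := Quotient.exists_rep x
  obtain ⟨e, f, h⟩ := (cls_mem_component_iff hd hd𝔞).1 hx
  obtain ⟨u, w, hm⟩ := h.exists_isMarking hd hη
  obtain ⟨z, hz⟩ := hm.frame.exists_period hd
  obtain ⟨e'', f'', hm'', hp''⟩ := stdThreefold_isMarking hd hη z
  exact ⟨z, Quotient.sound (exists_isIsom_of_period hd hm hm'' hz hp'')⟩

/-- The type is constant in holomorphic families: the locus of type `𝔞` is open and closed. -/
theorem isClopen_component (hd : 0 < d) (hd𝔞 : ((d : ℤ) : order D) ∈ 𝔞)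
    (hη : IsSmartBasis d 𝔞 η₁ η₂) : IsClopen (component d 𝔞) := by
  have key : ∀ (n : ℕ) (T : Set (Fin n → ℂ)) (P : (Fin n → ℂ) → RMThreefold D d),
      IsHolFamily T P → (∀ t ∈ T, cls (P t) ∈ component d 𝔞) ∨
        ∀ t ∈ T, cls (P t) ∉ component d 𝔞 := by
    intro n T P hP
    by_contra! h
    obtain ⟨⟨t, ht, ht'⟩, s, hs, hs'⟩ := h
    obtain ⟨ζ, -, hζ⟩ := hP.exists_lift hd hd𝔞 hη hs hs'
    exact ht' (hζ t ht ▸ cls_stdThreefold_mem_component hd hη (ζ t))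
  refine ⟨⟨?_⟩, ?_⟩
  · intro n T P hT hP
    rcases key n T P hP with h | h
    · convert isOpen_empty using 1
      ext t
      simpa using h t
    · convert hT using 1
      ext t
      simpa using h t
  · intro n T P hT hP
    rcases key n T P hP with h | h
    · convert hT using 1
      ext t
      simpa using h t
    · convert isOpen_empty using 1
      ext t
      simpa using h t

/-- `ofH3` is a homeomorphism onto its image; in this form: a map to `ℍ³` is continuous if its
coordinates are. -/
lemma continuousOn_of_ofH3 {T : Set (Fin n → ℂ)} {ζ : (Fin n → ℂ) → H3}
    (h : ContinuousOn (fun t => ofH3 (ζ t)) T) : ContinuousOn ζ T := by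
  have hi := fun i => continuousOn_pi.1 h i
  refine ContinuousOn.prodMk ?_ (ContinuousOn.prodMk ?_ ?_)
  · exact UpperHalfPlane.isEmbedding_coe.continuousOn_iff.2 (hi 0)
  · exact UpperHalfPlane.isEmbedding_coe.continuousOn_iff.2 (hi 1)
  · exact UpperHalfPlane.isEmbedding_coe.continuousOn_iff.2 (hi 2)

/-- The map `[z] ↦ [A_z]`. -/
def moduliMap (hd : 0 < d) (hη : IsSmartBasis d 𝔞 η₁ η₂) :
    HilbertVariety (gammaGroup hd hη) → component d 𝔞 :=
  Quotient.lift (fun z => ⟨cls (stdThreefold hd hη z), cls_stdThreefold_mem_component hd hη z⟩) <| by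
    intro z z' h
    obtain ⟨g, hg⟩ := MulAction.orbitRel_apply.1 h
    apply Subtype.ext
    obtain ⟨e, f, hm, hp⟩ := stdThreefold_isMarking hd hη z
    obtain ⟨e', f', hm', hp'⟩ := stdThreefold_isMarking hd hη z'
    exact ((equiv_iff_of_period hd hη hm' hm hp' hp).2 ⟨g, g.2, hg⟩).symm

lemma moduliMap_orbitCls (hd : 0 < d) (hη : IsSmartBasis d 𝔞 η₁ η₂) (z : H3) :
    (moduliMap hd hη (orbitCls _ z) : ModuliSpace D d) = cls (stdThreefold hd hη z) := rfl

lemma moduliMap_bijective (hd : 0 < d) (hd𝔞 : ((d : ℤ) : order D) ∈ 𝔞)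
    (hη : IsSmartBasis d 𝔞 η₁ η₂) : Function.Bijective (moduliMap hd hη) := by
  constructor
  · intro q q' h
    obtain ⟨z, rfl⟩ := Quotient.exists_rep q
    obtain ⟨z', rfl⟩ := Quotient.exists_rep q'
    obtain ⟨e, f, hm, hp⟩ := stdThreefold_isMarking hd hη z
    obtain ⟨e', f', hm', hp'⟩ := stdThreefold_isMarking hd hη z'
    obtain ⟨g, hg, hgz⟩ := (equiv_iff_of_period hd hη hm' hm hp' hp).1 (congrArg Subtype.val h).symm
    exact Quotient.sound (MulAction.orbitRel_apply.2 ⟨⟨g, hg⟩, hgz⟩)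
  · rintro ⟨x, hx⟩
    obtain ⟨z, rfl⟩ := exists_cls_eq_stdThreefold hd hd𝔞 hη hx
    exact ⟨orbitCls _ z, rfl⟩

lemma continuous_cls_stdThreefold (hd : 0 < d) (hη : IsSmartBasis d 𝔞 η₁ η₂) :
    Continuous fun z => cls (stdThreefold hd hη z) := by
  refine ⟨fun U hU => ?_⟩
  have h := (hU 3 upperSet _ isOpen_upperSet (isHolFamily_std hd hη)).preimage continuous_ofH3
  convert h using 1
  ext z
  simp only [Set.mem_preimage, Set.mem_ofPred_eq, toH3_ofH3]
  exact ⟨fun h => ⟨ofH3_im z, h⟩, fun h => h.2⟩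

/-- A set of classes is open if its preimages in all families are. As a family passing through the
locus of type `𝔞` lifts to `ℍ³`, such a preimage is that of a saturated open subset of `ℍ³` under a
continuous map. -/
lemma isOpenMap_moduliMap (hd : 0 < d) (hd𝔞 : ((d : ℤ) : order D) ∈ 𝔞)
    (hη : IsSmartBasis d 𝔞 η₁ η₂) : IsOpenMap (moduliMap hd hη) := by
  intro U hU
  refine ⟨Subtype.val '' (moduliMap hd hη '' U), fun n T P hT hP => ?_, by
    rw [Set.preimage_image_eq _ Subtype.val_injective]⟩
  rw [isOpen_iff_mem_nhds]
  rintro s ⟨hs, x, ⟨q, hq, rfl⟩, hx⟩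
  obtain ⟨ζ, hζ, hcls⟩ := hP.exists_lift hd hd𝔞 hη hs (hx ▸ (moduliMap hd hη q).2)
  have hcont : ContinuousOn (fun t => orbitCls (gammaGroup hd hη) (ζ t)) T :=
    continuous_quotient_mk'.comp_continuousOn (continuousOn_of_ofH3 hζ.continuousOn)
  have hsq : orbitCls (gammaGroup hd hη) (ζ s) = q :=
    (moduliMap_bijective hd hd𝔞 hη).1 (Subtype.ext ((hcls s hs).symm.trans hx.symm))
  have h1 := (hcont.isOpen_inter_preimage hT hU).mem_nhds ⟨hs, by
    rw [Set.mem_preimage, hsq]; exact hq⟩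
  filter_upwards [h1] with t ht
  exact ⟨ht.1, _, ⟨_, ht.2, rfl⟩, (hcls t ht.1).symm⟩

/-- The homeomorphism `[z] ↦ [A_z]` of `Γ \ ℍ³` onto the locus of type `𝔞`. -/
def moduliHomeomorph (hd : 0 < d) (hd𝔞 : ((d : ℤ) : order D) ∈ 𝔞)
    (hη : IsSmartBasis d 𝔞 η₁ η₂) : HilbertVariety (gammaGroup hd hη) ≃ₜ component d 𝔞 :=
  (Equiv.ofBijective _ (moduliMap_bijective hd hd𝔞 hη)).toHomeomorphOfContinuousOpen
    (Continuous.quotient_lift (Continuous.subtype_mk (continuous_cls_stdThreefold hd hη) _) _)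
    (isOpenMap_moduliMap hd hd𝔞 hη)

/-- A function on an open part of the locus of type `𝔞` is holomorphic if and only if its pull-back
to `ℍ³` is: `z ↦ A_z` is a holomorphic family, and every other one factors through it. -/
theorem holOn_iff (hd : 0 < d) (hd𝔞 : ((d : ℤ) : order D) ∈ 𝔞)
    (hη : IsSmartBasis d 𝔞 η₁ η₂) {U : Set (ModuliSpace D d)} (hU : U ⊆ component d 𝔞)
    (f : ModuliSpace D d → ℂ) :
    HolOn f U ↔ HilbertHolOn (gammaGroup hd hη) (fun q => f (moduliMap hd hη q))
      {q | (moduliMap hd hη q : ModuliSpace D d) ∈ U} := by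
  constructor
  · intro h
    exact h 3 upperSet _ isOpen_upperSet (isHolFamily_std hd hη)
  · intro h n T P hT hP
    by_cases hne : ∃ s ∈ T, cls (P s) ∈ U
    · obtain ⟨s, hs, hsU⟩ := hne
      obtain ⟨ζ, hζ, hcls⟩ := hP.exists_lift hd hd𝔞 hη hs (hU hsU)
      have h1 := DifferentiableOn.comp (f := fun t => ofH3 (ζ t)) h
        (hζ.mono (s := {t | t ∈ T ∧ cls (P t) ∈ U}) fun t ht => ht.1) (fun t ht => by
          refine ⟨ofH3_im _, ?_⟩
          change cls (stdThreefold hd hη (toH3 (ofH3 (ζ t)))) ∈ U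
          rw [toH3_ofH3, ← hcls t ht.1]
          exact ht.2)
      refine h1.congr fun t ht => ?_
      change _ = f (cls (stdThreefold hd hη (toH3 (ofH3 (ζ t)))))
      rw [toH3_ofH3, ← hcls t ht.1]
    · convert differentiableOn_empty
      ext t
      simpa using fun ht => (not_exists.1 hne t) ∘ And.intro ht

end

/-! ### Irreducible components -/

section
variable {D d : ℕ}

lemma HolOn.mono {f : ModuliSpace D d → ℂ} {U V : Set (ModuliSpace D d)} (h : HolOn f U)
    (hVU : V ⊆ U) : HolOn f V :=
  fun n T P hT hP => (h n T P hT hP).mono fun _ ht => ⟨ht.1, hVU ht.2⟩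

lemma IsAnalyticSubset.inter_isClopen {Z X : Set (ModuliSpace D d)} (hZ : IsAnalyticSubset Z)
    (hX : IsClopen X) : IsAnalyticSubset (Z ∩ X) := by
  intro x
  by_cases hx : x ∈ X
  · obtain ⟨U, hU, hxU, m, f, hf, h⟩ := hZ x
    refine ⟨U ∩ X, hU.inter hX.isOpen, ⟨hxU, hx⟩, m, f, fun i => (hf i).mono Set.inter_subset_left,
      fun y hy => ?_⟩
    rw [← h y hy.1]
    exact ⟨fun h => h.1, fun h => ⟨h, hy.2⟩⟩
  · refine ⟨Xᶜ, hX.compl.isOpen, hx, 1, fun _ _ => 1, fun _ n T P _ _ => differentiableOn_const _,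
      fun y hy => ?_⟩
    simpa using fun _ => hy

lemma isAnalyticSubset_univ : IsAnalyticSubset (Set.univ : Set (ModuliSpace D d)) := fun _ =>
  ⟨Set.univ, isOpen_univ, trivial, 0, Fin.elim0, fun i => i.elim0, fun _ _ => by simp⟩

lemma isAnalyticSubset_of_isClopen {X : Set (ModuliSpace D d)} (hX : IsClopen X) :
    IsAnalyticSubset X := by
  simpa using isAnalyticSubset_univ.inter_isClopen hX

lemma IsIrreducibleAnalytic.subset_of_isClopen {Z X : Set (ModuliSpace D d)}
    (hZ : IsIrreducibleAnalytic Z) (hX : IsClopen X) (h : (Z ∩ X).Nonempty) : Z ⊆ X := by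
  rcases hZ.2.2 _ _ (hZ.1.inter_isClopen hX) (hZ.1.inter_isClopen hX.compl)
    (Set.inter_union_compl Z X).symm with h1 | h1
  · rw [h1]
    exact Set.inter_subset_right
  · obtain ⟨x, hxZ, hxX⟩ := h
    rw [h1] at hxZ
    exact absurd hxX hxZ.2

/-- Subsets `Y` of `ℂⁿ` that are, near the points of `W`, common zero loci of holomorphic
functions. -/
def IsLocallyZeroLocus {n : ℕ} (Y W : Set (Fin n → ℂ)) : Prop :=
  ∀ a ∈ W, ∃ U : Set (Fin n → ℂ), IsOpen U ∧ a ∈ U ∧ ∃ (m : ℕ) (f : Fin m → (Fin n → ℂ) → ℂ),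
    (∀ i, DifferentiableOn ℂ (f i) U) ∧ ∀ y ∈ U, y ∈ Y ↔ ∀ i, f i y = 0

/-- Identity theorem: an analytic subset of a convex open set that contains a neighbourhood of a
point is everything. The proof restricts to complex lines. -/
lemma IsLocallyZeroLocus.subset {n : ℕ} {Y W : Set (Fin n → ℂ)} (hY : IsLocallyZeroLocus Y W)
    (hW : Convex ℝ W) {a : Fin n → ℂ} (ha : a ∈ W) (hYa : Y ∈ nhds a) : W ⊆ Y := by
  intro b hb
  let γ : ℂ → (Fin n → ℂ) := fun s => a + s • (b - a)
  have hγ : Differentiable ℂ γ := by fun_prop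
  let A : Set ℂ := {s | ∀ᶠ t in nhds s, γ t ∈ Y}
  have hA : IsOpen A := isOpen_setOfPred_eventually_nhds
  have hconv : Convex ℝ (γ ⁻¹' W) := by
    intro s hs t ht p q hp hq hpq
    have h1 := hW hs ht hp hq hpq
    have h2 : p • γ s + q • γ t = γ (p • s + q • t) := by
      obtain rfl : p = 1 - q := by linarith
      funext i
      simp [γ]
      ring
    rwa [h2] at h1
  have h0 : γ 0 = a := by simp [γ]
  have h1 : γ 1 = b := by simp [γ]
  have hsub : γ ⁻¹' W ⊆ A := by
    refine hconv.isPreconnected.subset_of_closure_inter_subset hA ⟨0, ?_, ?_⟩ ?_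
    · rwa [Set.mem_preimage, h0]
    · exact hγ.continuous.continuousAt.preimage_mem_nhds (by rwa [h0])
    · rintro s ⟨hs, hsW⟩
      have hfreq : ∃ᶠ t in nhdsWithin s {s}ᶜ, γ t ∈ Y := by
        have h2 := closure_minimal ((dense_compl_singleton s).open_subset_closure_inter hA)
          isClosed_closure hs
        rw [mem_closure_iff_frequently] at h2
        rw [frequently_nhdsWithin_iff]
        exact h2.mono fun t ht => ⟨ht.1.self_of_nhds, ht.2⟩
      obtain ⟨U, hU, hsU, m, f, hf, h⟩ := hY _ hsW
      have hUn : γ ⁻¹' U ∈ nhds s := (hU.preimage hγ.continuous).mem_nhds hsU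
      have hz : ∀ i, ∀ᶠ t in nhds s, f i (γ t) = 0 := by
        intro i
        have han : AnalyticAt ℂ (fun t => f i (γ t)) s :=
          ((hf i).comp hγ.differentiableOn (Set.mapsTo_preimage γ U)).analyticAt hUn
        refine han.frequently_zero_iff_eventually_zero.1 ?_
        refine (hfreq.and_eventually (mem_nhdsWithin_of_mem_nhds hUn)).mono fun t ht => ?_
        exact (h _ ht.2).1 ht.1 i
      filter_upwards [Filter.eventually_all.2 hz, hUn] with t ht htU
      exact (h _ htU).2 ht
  rw [← h1]
  exact (hsub (show γ 1 ∈ W by rwa [h1])).self_of_nhds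

lemma convex_upperSet : Convex ℝ upperSet := by
  have h : upperSet = ⋂ i : Fin 3, (fun w : Fin 3 → ℂ => (w i).im) ⁻¹' Set.Ioi 0 := by
    ext w
    simp [upperSet]
  rw [h]
  exact convex_iInter fun i => (convex_Ioi 0).is_linear_preimage
    (Complex.imLm.comp (LinearMap.proj (R := ℝ) (φ := fun _ : Fin 3 => ℂ) i)).isLinear

variable [Fact (¬ IsSquare D)] {𝔞 : Ideal (order D)} {η₁ η₂ : K D}

lemma IsAnalyticSubset.isLocallyZeroLocus {Z : Set (ModuliSpace D d)} (hZ : IsAnalyticSubset Z)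
    (hd : 0 < d) (hη : IsSmartBasis d 𝔞 η₁ η₂) :
    IsLocallyZeroLocus {w | cls (stdThreefold hd hη (toH3 w)) ∈ Z} upperSet := by
  intro a ha
  obtain ⟨U, hU, haU, m, f, hf, h⟩ := hZ (cls (stdThreefold hd hη (toH3 a)))
  exact ⟨_, hU 3 upperSet _ isOpen_upperSet (isHolFamily_std hd hη), ⟨ha, haU⟩, m,
    fun i w => f i (cls (stdThreefold hd hη (toH3 w))),
    fun i => hf i 3 upperSet _ isOpen_upperSet (isHolFamily_std hd hη), fun y hy => h _ hy.2⟩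

/-- The locus of type `𝔞` is irreducible, being the image of `ℍ³`. -/
theorem isIrreducibleAnalytic_component (hd : 0 < d) (hd𝔞 : ((d : ℤ) : order D) ∈ 𝔞)
    (hη : IsSmartBasis d 𝔞 η₁ η₂) : IsIrreducibleAnalytic (component d 𝔞) := by
  refine ⟨isAnalyticSubset_of_isClopen (isClopen_component hd hd𝔞 hη),
    ⟨_, cls_stdThreefold_mem_component hd hη (UpperHalfPlane.I, UpperHalfPlane.I, UpperHalfPlane.I)⟩,
    fun Z₁ Z₂ h₁ h₂ h => ?_⟩
  by_cases hall : ∀ w ∈ upperSet, cls (stdThreefold hd hη (toH3 w)) ∈ Z₁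
  · left
    refine (h ▸ Set.subset_union_left : Z₁ ⊆ _).antisymm' fun x hx => ?_
    obtain ⟨z, rfl⟩ := exists_cls_eq_stdThreefold hd hd𝔞 hη hx
    have := hall _ (ofH3_im z)
    rwa [toH3_ofH3] at this
  · right
    push Not at hall
    obtain ⟨a, ha, haZ⟩ := hall
    obtain ⟨U, hU, haU, m, f, hf, hfz⟩ := h₁.isLocallyZeroLocus hd hη a ha
    obtain ⟨i, hi⟩ : ∃ i, f i a ≠ 0 := by
      by_contra! h0
      exact haZ ((hfz a haU).2 h0)
    have hev : ∀ᶠ w in nhds a, w ∈ {w | cls (stdThreefold hd hη (toH3 w)) ∈ Z₂} := by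
      have hcont := ((hf i).continuousOn.continuousAt (hU.mem_nhds haU)).eventually_ne hi
      filter_upwards [hcont, hU.mem_nhds haU] with w hw hwU
      have h3 : cls (stdThreefold hd hη (toH3 w)) ∈ Z₁ ∪ Z₂ :=
        h ▸ cls_stdThreefold_mem_component hd hη _
      exact h3.resolve_left fun h4 => hw ((hfz w hwU).1 h4 i)
    have hsub := (h₂.isLocallyZeroLocus hd hη).subset convex_upperSet ha hev
    refine (h ▸ Set.subset_union_right : Z₂ ⊆ _).antisymm' fun x hx => ?_
    obtain ⟨z, rfl⟩ := exists_cls_eq_stdThreefold hd hd𝔞 hη hx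
    have := hsub (ofH3_im z)
    rwa [Set.mem_ofPred_eq, toH3_ofH3] at this

/-- The ideal is determined by the lattice of `S`. -/
lemma component_disjoint (hd : 0 < d) {𝔟 : Ideal (order D)} (h𝔞 : ((d : ℤ) : order D) ∈ 𝔞)
    (h𝔟 : ((d : ℤ) : order D) ∈ 𝔟) {x : ModuliSpace D d} (hx : x ∈ component d 𝔞)
    (hx' : x ∈ component d 𝔟) : 𝔞 = 𝔟 := by
  obtain ⟨P, rfl⟩ := Quotient.exists_rep x
  obtain ⟨e, f, h⟩ := (cls_mem_component_iff hd h𝔞).1 hx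
  obtain ⟨e', f', h'⟩ := (cls_mem_component_iff hd h𝔟).1 hx'
  exact h.ideal_eq h'

/-- The structure theorem for the lattice of `S` yields an ideal for every class. -/
lemma exists_mem_component (hD : D % 4 = 0 ∨ D % 4 = 1) (hd : 0 < d) (x : ModuliSpace D d) :
    ∃ 𝔞 ∈ primitiveIdeals D d, x ∈ component d 𝔞 := by
  obtain ⟨P, rfl⟩ := Quotient.exists_rep x
  obtain ⟨n, h, e, f, hm⟩ := P.exists_isSurfaceMarking hD hd
  exact ⟨_, idealOf_mem_primitiveIdeals hD d n h, P, rfl, hm.isOfType⟩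

/-- The loci are irreducible, clopen and pairwise disjoint, and they cover the moduli space; an
irreducible set meeting a clopen one is contained in it, so that they are the maximal irreducible
sets. -/
theorem bijOn_component (hD : D % 4 = 0 ∨ D % 4 = 1) (hd : 0 < d) :
    Set.BijOn (fun 𝔞 => component d 𝔞) (primitiveIdeals D d) (irreducibleComponents D d) := by
  have hirr : ∀ 𝔞 ∈ primitiveIdeals D d,
      IsIrreducibleAnalytic (component d 𝔞) ∧ IsClopen (component d 𝔞) := by
    intro 𝔞 h𝔞
    obtain ⟨η₁, η₂, hη⟩ := exists_isSmartBasis hD hd h𝔞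
    have hd𝔞 := natCast_mem_of_mem_primitiveIdeals hD hd h𝔞
    exact ⟨isIrreducibleAnalytic_component hd hd𝔞 hη, isClopen_component hd hd𝔞 hη⟩
  refine ⟨fun 𝔞 h𝔞 => ⟨(hirr 𝔞 h𝔞).1, fun Z hZ hle => ?_⟩, fun 𝔞 h𝔞 𝔟 h𝔟 h => ?_, fun Z hZ => ?_⟩
  · obtain ⟨x, hx⟩ := (hirr 𝔞 h𝔞).1.2.1
    exact hZ.subset_of_isClopen (hirr 𝔞 h𝔞).2 ⟨x, hle hx, hx⟩
  · obtain ⟨x, hx⟩ := (hirr 𝔞 h𝔞).1.2.1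
    exact component_disjoint hd (natCast_mem_of_mem_primitiveIdeals hD hd h𝔞)
      (natCast_mem_of_mem_primitiveIdeals hD hd h𝔟) hx ((show component d 𝔞 = component d 𝔟 from h) ▸ hx)
  · obtain ⟨x, hx⟩ := hZ.prop.2.1
    obtain ⟨𝔞, h𝔞, hx𝔞⟩ := exists_mem_component hD hd x
    exact ⟨𝔞, h𝔞, (hZ.eq_of_subset (hirr 𝔞 h𝔞).1
      (hZ.prop.subset_of_isClopen (hirr 𝔞 h𝔞).2 ⟨x, hx, hx𝔞⟩)).symm⟩

/-- Every class belongs to a primitive ideal of norm `d`, and conversely such an ideal has a smart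
basis, which defines threefolds `A_z`. -/
theorem nonempty_moduliSpace_iff (hD : D % 4 = 0 ∨ D % 4 = 1) (hd : 0 < d)
    (hcop : Nat.Coprime d (conductor D)) :
    Nonempty (ModuliSpace D d) ↔ PrimeFactorCondition D d := by
  rw [← primitiveIdeals_nonempty_iff hD hd hcop]
  constructor
  · rintro ⟨x⟩
    obtain ⟨𝔞, h𝔞, -⟩ := exists_mem_component hD hd x
    exact ⟨𝔞, h𝔞⟩
  · rintro ⟨𝔞, h𝔞⟩
    obtain ⟨η₁, η₂, hη⟩ := exists_isSmartBasis hD hd h𝔞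
    exact ⟨cls (stdThreefold hd hη (UpperHalfPlane.I, UpperHalfPlane.I, UpperHalfPlane.I))⟩

end

end RMModuli

end

theorem mainTheorem1 (D d : ℕ) [Fact (¬ IsSquare D)] (hD : D % 4 = 0 ∨ D % 4 = 1)
    (hd : 0 < d) (hcop : Nat.Coprime d (RMModuli.conductor D)) :
    (Nonempty (RMModuli.ModuliSpace D d) ↔ RMModuli.PrimeFactorCondition D d) ∧
    (RMModuli.PrimeFactorCondition D d →
      -- the loci of type `𝔞` are the irreducible components, one for each primitive ideal of norm `d`
      Set.BijOn (fun 𝔞 => RMModuli.component d 𝔞) (RMModuli.primitiveIdeals D d)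
        (RMModuli.irreducibleComponents D d) ∧
      (RMModuli.irreducibleComponents D d).ncard = 2 ^ RMModuli.numSplit D d ∧
      (RMModuli.primitiveIdeals D d).PairwiseDisjoint (fun 𝔞 => RMModuli.component d 𝔞) ∧
      (⋃ 𝔞 ∈ RMModuli.primitiveIdeals D d, RMModuli.component d 𝔞) = Set.univ ∧
      ∀ 𝔞 ∈ RMModuli.primitiveIdeals D d,
        (∃ η₁ η₂ : RMModuli.K D, RMModuli.IsSmartBasis d 𝔞 η₁ η₂) ∧
        ∀ η₁ η₂ : RMModuli.K D, RMModuli.IsSmartBasis d 𝔞 η₁ η₂ →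
          ∃ Γ : Subgroup (RMModuli.BigGroup D),
            (Γ : Set (RMModuli.BigGroup D)) = RMModuli.gammaSet d 𝔞 η₁ η₂ ∧
            ∃ P : RMModuli.H3 → RMModuli.RMThreefold D d,
              (∀ z, RMModuli.IsPeriodModel η₁ η₂ z (P z)) ∧
              -- the biholomorphic map `[z] ↦ [P z]`
              ∃ Φ : RMModuli.HilbertVariety Γ ≃ₜ RMModuli.component d 𝔞,
                (∀ z, (Φ (RMModuli.orbitCls Γ z) : RMModuli.ModuliSpace D d)
                  = RMModuli.cls (P z)) ∧
                ∀ U : Set (RMModuli.ModuliSpace D d), IsOpen U → U ⊆ RMModuli.component d 𝔞 →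
                  ∀ f : RMModuli.ModuliSpace D d → ℂ,
                    RMModuli.HolOn f U ↔
                      RMModuli.HilbertHolOn Γ (fun q => f (Φ q))
                        {q | (Φ q : RMModuli.ModuliSpace D d) ∈ U}) := by
  refine ⟨RMModuli.nonempty_moduliSpace_iff hD hd hcop, fun hpfc => ?_⟩
  have hbij := RMModuli.bijOn_component (D := D) hD hd
  have hmem := fun 𝔞 h𝔞 => RMModuli.natCast_mem_of_mem_primitiveIdeals (𝔞 := 𝔞) hD hd h𝔞
  refine ⟨hbij, ?_, fun 𝔞 h𝔞 𝔟 h𝔟 hne => ?_, ?_, fun 𝔞 h𝔞 =>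
    ⟨RMModuli.exists_isSmartBasis hD hd h𝔞, fun η₁ η₂ hη => ?_⟩⟩
  · rw [← hbij.image_eq, Set.InjOn.ncard_image hbij.injOn,
      RMModuli.ncard_primitiveIdeals_eq hD hd hcop hpfc]
  · exact Set.disjoint_left.2 fun x hx hx' =>
      hne (RMModuli.component_disjoint hd (hmem 𝔞 h𝔞) (hmem 𝔟 h𝔟) hx hx')
  · refine Set.eq_univ_of_forall fun x => ?_
    simpa using RMModuli.exists_mem_component hD hd x
  · exact ⟨RMModuli.gammaGroup hd hη, rfl, RMModuli.stdThreefold hd hη,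
      RMModuli.stdThreefold_isPeriodModel hd hη, RMModuli.moduliHomeomorph hd (hmem 𝔞 h𝔞) hη,
      RMModuli.moduliMap_orbitCls hd hη,
      fun U _ hU f => RMModuli.holOn_iff hd (hmem 𝔞 h𝔞) hη hU f⟩
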